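/- Let $N\ge 2$ be an integer, $\hbar>0$, $\beta\in[0,1]$, $\kappa\ge 0$, and let $V:\mathbb R^3\to[0,\infty)$ be smooth, compactly supported and spherically symmetric. Put $V_N(x)=N^{3\beta}V(N^\beta x)$, $V_c(x)=1/|x|$, $b_0=\int V$. Let $$H=-\frac{\hbar^2}{2}\sum_{j=1}^N\Delta_{x_j}+\frac1N\sum_{j<k}V_N(x_j-x_k)+\frac{\kappa}{N}\sum_{j<k}V_c(x_j-x_k)$$ on $L^2(\mathbb R^{3N})$, and let $T_0>0$. Let $\psi\in C([0,T_0];H^2(\mathbb R^{3N}))\cap C^1([0,T_0];L^2(\mathbb R^{3N}))$ be a solution of $i\hbar\partial_t\psi=H\psi$ that is symmetric under permutations of the particles and satisfies $\|\psi\|_{L^2}=1$. Write $X_N=(x_1,\dots,x_N)$, and let $$\rho_N^{(1)}(t,x_1)=\int|\psi(t,X_N)|^2dx_2\cdots dx_N,\qquad \rho_N^{(2)}(t,x_1,x_2)=\int|\psi(t,X_N)|^2dx_3\cdots dx_N$$ be its one- and two-particle densities. Let $s\in\mathbb N$, $s>\frac92$, and let $(\rho,u)$, with $\rho\in C([0,T_0];H^{s-1}(\mathbb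 R^3))$, $u=(u^1,u^2,u^3)\in C([0,T_0];H^{s}(\mathbb R^3))$, $\rho\ge0$, $\int\rho(t,x)\,dx=1$, be a solution (continuous representatives) of the Euler–Poisson system $$\partial_t\rho+\operatorname{div}(\rho u)=0,\qquad \partial_tu+(u\cdot\nabla)u+b_0\nabla\rho+\kappa\nabla(V_c*\rho)=0 .$$ Define the modulated energy $\mathcal M=\mathcal M_K+\mathcal F_\delta+\kappa\mathcal F_c$, where $$\mathcal M_K(t)=\int_{\mathbb R^{3N}}|(-i\hbar\nabla_{x_1}-u(t,x_1))\psi(t,X_N)|^2dX_N,$$ $$\mathcal F_\delta(t)=\frac{N-1}{N}\iint V_N(x_1-x_2)\rho_N^{(2)}(t,x_1,x_2)dx_1dx_2+b_0\int\rho(t,x)^2dx-2b_0\int\rho(t,x)\rho_N^{(1)}(t,x)dx,$$ $$\mathcal F_c(t)=\iint V_c(x_1-x_2)\Big[\frac{N-1}{N}\rho_N^{(2)}(t,x_1,x_2)+\rho(t,x_1)\rho(t,x_2)-2\rho(t,x_1)\rho_N^{(1)}(t,x_2)\Big]dx_1dx_2 .$$ Then all integrals above and below converge absolutely, $\mathcal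 M$ is differentiable on $[0,T_0]$ (one-sidedly at the end points), and for every $t\in[0,T_0]$, with $\partial_j=\partial_{x_1^j}$, $$\begin{aligned}\frac{d}{dt}\mathcal M(t)=&-\sum_{j,k=1}^3\int_{\mathbb R^{3N}}(\partial_ju^k+\partial_ku^j)(t,x_1)\,(-i\hbar\partial_j\psi-u^j\psi)\,\overline{(-i\hbar\partial_k\psi-u^k\psi)}\,dX_N\\&+\frac{\hbar^2}{2}\int_{\mathbb R^3}\Delta(\operatorname{div}u)(t,x)\,\rho_N^{(1)}(t,x)\,dx+\widetilde{\mathcal F}_\delta(t)+\kappa\widetilde{\mathcal F}_c(t),\end{aligned}$$ where $$\widetilde{\mathcal F}_\delta(t)=\frac{N-1}{N}\iint(u(t,x_1)-u(t,x_2))\cdot\nabla V_N(x_1-x_2)\,\rho_N^{(2)}(t,x_1,x_2)\,dx_1dx_2-b_0\int\operatorname{div}u\,\rho\,\big[\rho-2\rho_N^{(1)}\big](t,x)\,dx,$$ $$\widetilde{\mathcal F}_c(t)=\iint(u(t,x_1)-u(t,x_2))\cdot\nabla V_c(x_1-x_2)\Big[\frac{N-1}{N}\rho_N^{(2)}(t,x_1,x_2)+\rho(t,x_1)\rho(t,x_2)-2\rho(t,x_1)\rho_N^{(1)}(t,x_2)\Big]dx_1dx_2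 .$$ -/

import Mathlib

open MeasureTheory Set
open scoped SchwartzMap LineDeriv ContDiff ENNReal

noncomputable section

namespace QuantumEuler

/-- Physical space `ℝ³` with its Euclidean norm. -/
abbrev E3 : Type := EuclideanSpace ℝ (Fin 3)

/-- The `k`-th standard unit vector of `ℝ³`. -/
def unitVec (k : Fin 3) : E3 := EuclideanSpace.single k (1 : ℝ)

/-- Configurations `X_N = (x_1, …, x_N)` of `N` particles, that is `ℝ^{3N}` with Lebesgue measure.
Particles are numbered from `0`, so `X 0` and `X 1` are the `x_1` and `x_2` of the usual notation. -/
abbrev Config (N : ℕ) : Type := Fin N → E3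

/-- The unit vector of `ℝ^{3N}` in the direction of the coordinate `x_j^k`. -/
def particleDir {N : ℕ} (j : Fin N) (k : Fin 3) : Config N := Pi.single j (unitVec k)

/-! ### Sobolev spaces of integer order -/

section Sobolev

variable {E : Type*} [NormedAddCommGroup E] [NormedSpace ℝ E] [FiniteDimensional ℝ E]
  [MeasureSpace E] [BorelSpace E] [(volume : Measure E).IsAddHaarMeasure]

/-- `g ∈ L²` is the distributional derivative of `f ∈ L²` in the direction `v`. -/
def IsWeakDeriv (v : E) (f g : Lp ℂ 2 (volume : Measure E)) : Prop :=
  ∂_{v} (f : 𝓢'(E, ℂ)) = (g : 𝓢'(E, ℂ))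

open Classical in
/-- The distributional derivative of `f ∈ L²` in the direction `v`, as an element of `L²`
(it is unique when it exists; the value is `0` when the derivative is not in `L²`). -/
def weakDeriv (v : E) (f : Lp ℂ 2 (volume : Measure E)) : Lp ℂ 2 (volume : Measure E) :=
  if h : ∃ g : Lp ℂ 2 (volume : Measure E), IsWeakDeriv v f g then h.choose else 0

/-- `f ∈ C(I; H^m)`: all distributional derivatives of `f(t)` of order at most `m` are in `L²` and
depend continuously on `t ∈ I` in the norm of `L²`. -/
def ContinuousInSobolev (I : Set ℝ) : ℕ → (ℝ → Lp ℂ 2 (volume : Measure E)) → Prop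
  | 0, f => ContinuousOn f I
  | m + 1, f => ContinuousOn f I ∧ ∀ v : E, ∃ g : ℝ → Lp ℂ 2 (volume : Measure E),
      (∀ t ∈ I, IsWeakDeriv v (f t) (g t)) ∧ ContinuousInSobolev I m g

/-- `f ∈ C(I; H^m)` for a family `f(t)` of real functions. -/
def RealContinuousInSobolev (I : Set ℝ) (m : ℕ) (f : ℝ → E → ℝ) : Prop :=
  ∃ F : ℝ → Lp ℂ 2 (volume : Measure E),
    (∀ t ∈ I, ∀ᵐ x, F t x = (f t x : ℂ)) ∧ ContinuousInSobolev I m F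

end Sobolev

/-! ### Classical differential operators on `ℝ³` -/

/-- The partial derivative `∂_k f (x)`. -/
def pderiv (k : Fin 3) (f : E3 → ℝ) (x : E3) : ℝ := fderiv ℝ f x (unitVec k)

/-- The divergence `div w (x)`. -/
def divergence (w : E3 → E3) (x : E3) : ℝ := ∑ k, pderiv k (fun y => w y k) x

/-- The Laplacian `Δ f (x)`. -/
def laplace (f : E3 → ℝ) (x : E3) : ℝ := ∑ k, pderiv k (pderiv k f) x

/-- `v · ∇ f (x)`. -/
def dotGrad (v : E3) (f : E3 → ℝ) (x : E3) : ℝ := ∑ k, v k * pderiv k f x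

/-! ### Potentials -/

/-- The Coulomb potential `V_c(x) = 1 / |x|`. -/
def coulomb (x : E3) : ℝ := 1 / ‖x‖

/-- The `δ`-type potential `V_N(x) = N^{3β} V(N^β x)`. -/
def scaledPotential (N : ℕ) (β : ℝ) (V : E3 → ℝ) (x : E3) : ℝ :=
  (N : ℝ) ^ (3 * β) * V ((N : ℝ) ^ β • x)

/-- Smooth, compactly supported, spherically symmetric, nonnegative interaction profiles. -/
structure IsProfile (V : E3 → ℝ) : Prop where
  smooth : ContDiff ℝ ∞ V
  compactSupport : HasCompactSupport V
  radial : ∀ x y, ‖x‖ = ‖y‖ → V x = V y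
  nonneg : ∀ x, 0 ≤ V x

/-- The coupling constant `b₀ = ∫ V`. -/
def coupling (V : E3 → ℝ) : ℝ := ∫ x, V x

/-- The convolution `V_c * ρ`. -/
def coulombConv (ρ : E3 → ℝ) (x : E3) : ℝ := ∫ y, coulomb (x - y) * ρ y

/-! ### The `N`-body dynamics -/

/-- `L²(ℝ^{3N}; ℂ)`. -/
abbrev WaveFn (N : ℕ) : Type := Lp ℂ 2 (volume : Measure (Config N))

/-- The `N`-body Hamiltonian applied to `ψ ∈ H²(ℝ^{3N})`:
`-(ħ²/2) ∑_j Δ_{x_j} ψ + N⁻¹ ∑_{j<k} V_N(x_j - x_k) ψ + κ N⁻¹ ∑_{j<k} V_c(x_j - x_k) ψ`. -/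
def hamiltonian {N : ℕ} (ħ κ β : ℝ) (V : E3 → ℝ) (ψ : WaveFn N) (X : Config N) : ℂ :=
  (∑ j : Fin N, -((ħ ^ 2 / 2 : ℝ) : ℂ) *
      ∑ k : Fin 3, weakDeriv (particleDir j k) (weakDeriv (particleDir j k) ψ) X)
    + ((1 / N * ∑ j : Fin N, ∑ k ∈ Finset.Ioi j, scaledPotential N β V (X j - X k) : ℝ) : ℂ) * ψ X
    + ((κ / N * ∑ j : Fin N, ∑ k ∈ Finset.Ioi j, coulomb (X j - X k) : ℝ) : ℂ) * ψ X

/-- `ψ` is a normalized bosonic strong solution of `iħ ∂_t ψ = H ψ` on `[0, T]`: it lies in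
`C([0,T]; H²)`, is symmetric in the particles, and the equation holds with the time derivative
taken in `L²`. -/
structure IsNBodySolution {N : ℕ} (ħ κ β : ℝ) (V : E3 → ℝ) (T : ℝ) (ψ : ℝ → WaveFn N) :
    Prop where
  regular : ContinuousInSobolev (Icc 0 T) 2 ψ
  symmetric : ∀ t ∈ Icc 0 T, ∀ σ : Equiv.Perm (Fin N), ∀ᵐ X, ψ t (fun i => X (σ i)) = ψ t X
  normalized : ‖ψ 0‖ = 1
  evolution : ∀ t ∈ Icc 0 T, ∃ φ : WaveFn N, HasDerivWithinAt ψ φ (Icc 0 T) t ∧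
    ∀ᵐ X, Complex.I * ħ * φ X = hamiltonian ħ κ β V (ψ t) X

/-- The one-particle density `ρ_N^{(1)}(x_1) = ∫ |ψ(x_1, x_2, …, x_N)|² dx_2 ⋯ dx_N`, the diagonal
of the one-particle marginal of `ψ`. -/
def density1 {n : ℕ} (ψ : WaveFn (n + 2)) (x : E3) : ℝ :=
  ∫ Y : Config (n + 1), ‖ψ (Fin.cons (α := fun _ => E3) x Y)‖ ^ 2

/-- The two-particle density `ρ_N^{(2)}(x_1, x_2) = ∫ |ψ(x_1, x_2, …, x_N)|² dx_3 ⋯ dx_N`, the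
diagonal of the two-particle marginal of `ψ`. -/
def density2 {n : ℕ} (ψ : WaveFn (n + 2)) (x y : E3) : ℝ :=
  ∫ Z : Config n, ‖ψ (Fin.cons (α := fun _ => E3) x (Fin.cons (α := fun _ => E3) y Z))‖ ^ 2

/-! ### The Euler–Poisson system -/

/-- `(ρ, u)` solves the Euler–Poisson system with pressure `b₀ ρ² / 2`,
`∂_t ρ + div (ρ u) = 0`, `∂_t u + (u · ∇) u + b₀ ∇ρ + κ ∇(V_c * ρ) = 0`,
on `[0, T]`, with `ρ ∈ C([0,T]; H^{s-1})`, `u ∈ C([0,T]; H^s)`, `ρ ≥ 0` and `∫ ρ = 1`. The functions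
`ρ(t)`, `u(t)` are the continuous representatives of their classes. -/
structure IsEulerPoissonSolution (κ b₀ : ℝ) (s : ℕ) (T : ℝ) (ρ : ℝ → E3 → ℝ)
    (u : ℝ → E3 → E3) : Prop where
  regular_density : RealContinuousInSobolev (Icc 0 T) (s - 1) ρ
  regular_velocity : ∀ k : Fin 3, RealContinuousInSobolev (Icc 0 T) s (fun t x => u t x k)
  continuous_density : ∀ t ∈ Icc 0 T, Continuous (ρ t)
  continuous_velocity : ∀ t ∈ Icc 0 T, Continuous (u t)
  nonneg : ∀ t ∈ Icc 0 T, ∀ x, 0 ≤ ρ t x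
  mass : ∀ t ∈ Icc 0 T, ∫ x, ρ t x = 1
  continuity_equation : ∀ t ∈ Icc 0 T, ∀ x,
    HasDerivWithinAt (fun τ => ρ τ x) (-divergence (fun y => ρ t y • u t y) x) (Icc 0 T) t
  velocity_equation : ∀ t ∈ Icc 0 T, ∀ x, ∀ k : Fin 3,
    HasDerivWithinAt (fun τ => u τ x k)
      (-(dotGrad (u t x) (fun y => u t y k) x + b₀ * pderiv k (ρ t) x
        + κ * pderiv k (coulombConv (ρ t)) x)) (Icc 0 T) t

/-! ### The modulated energy -/

section Energy

variable {n : ℕ}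

/-- The component `(-iħ ∂_{x_1^k} - u^k(x_1)) ψ`. -/
def modMomentum (ħ : ℝ) (u : E3 → E3) (ψ : WaveFn (n + 2)) (k : Fin 3) (X : Config (n + 2)) : ℂ :=
  -Complex.I * ħ * weakDeriv (particleDir 0 k) ψ X - (u (X 0) k : ℂ) * ψ X

/-- `|(-iħ ∇_{x_1} - u(x_1)) ψ|²`. -/
def kineticIntegrand (ħ : ℝ) (u : E3 → E3) (ψ : WaveFn (n + 2)) (X : Config (n + 2)) : ℝ :=
  ∑ k, ‖modMomentum ħ u ψ k X‖ ^ 2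

/-- The factor `(N - 1) / N` with `N = n + 2`. -/
def pairFactor (n : ℕ) : ℝ := (((n + 2 : ℕ) : ℝ) - 1) / ((n + 2 : ℕ) : ℝ)

/-- `(N-1)/N ρ_N^{(2)}(x_1,x_2) + ρ(x_1) ρ(x_2) - 2 ρ(x_1) ρ_N^{(1)}(x_2)`. -/
def correlationBracket (ρ : E3 → ℝ) (ψ : WaveFn (n + 2)) (p : E3 × E3) : ℝ :=
  pairFactor n * density2 ψ p.1 p.2 + ρ p.1 * ρ p.2 - 2 * (ρ p.1 * density1 ψ p.2)

/-- `V_N(x_1 - x_2) ρ_N^{(2)}(x_1, x_2)`. -/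
def deltaIntegrand (β : ℝ) (V : E3 → ℝ) (ψ : WaveFn (n + 2)) (p : E3 × E3) : ℝ :=
  scaledPotential (n + 2) β V (p.1 - p.2) * density2 ψ p.1 p.2

/-- The integrand of the Coulomb part of the modulated energy. -/
def coulombIntegrand (ρ : E3 → ℝ) (ψ : WaveFn (n + 2)) (p : E3 × E3) : ℝ :=
  coulomb (p.1 - p.2) * correlationBracket ρ ψ p

/-- The kinetic part of the modulated energy. -/
def kineticEnergy (ħ : ℝ) (u : E3 → E3) (ψ : WaveFn (n + 2)) : ℝ :=
  ∫ X, kineticIntegrand ħ u ψ X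

/-- The `δ`-type potential part `F_δ` of the modulated energy. -/
def deltaEnergy (β : ℝ) (V : E3 → ℝ) (ρ : E3 → ℝ) (ψ : WaveFn (n + 2)) : ℝ :=
  pairFactor n * (∫ p, deltaIntegrand β V ψ p)
    + coupling V * (∫ x, ρ x * ρ x)
    - 2 * coupling V * ∫ x, ρ x * density1 ψ x

/-- The Coulomb potential part `F_c` of the modulated energy. -/
def coulombEnergy (ρ : E3 → ℝ) (ψ : WaveFn (n + 2)) : ℝ :=
  ∫ p, coulombIntegrand ρ ψ p

/-- The modulated energy of the state `ψ` relative to the fluid state `(ρ, u)`. -/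
def modulatedEnergy (ħ κ β : ℝ) (V : E3 → ℝ) (ρ : E3 → ℝ) (u : E3 → E3)
    (ψ : WaveFn (n + 2)) : ℝ :=
  kineticEnergy ħ u ψ + deltaEnergy β V ρ ψ + κ * coulombEnergy ρ ψ

/-- Every integral in the modulated energy converges absolutely. -/
structure EnergyConverges (ħ β : ℝ) (V : E3 → ℝ) (ρ : E3 → ℝ) (u : E3 → E3)
    (ψ : WaveFn (n + 2)) : Prop where
  kinetic : Integrable (kineticIntegrand ħ u ψ)
  delta : Integrable (deltaIntegrand β V ψ)
  square : Integrable (fun x => ρ x * ρ x)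
  cross : Integrable (fun x => ρ x * density1 ψ x)
  coulomb : Integrable (coulombIntegrand ρ ψ)

/-! ### The rate of change of the modulated energy -/

/-- `(∂_j u^k + ∂_k u^j)(x_1) (-iħ∂_jψ - u^jψ) conj(-iħ∂_kψ - u^kψ)`, with `∂_j = ∂_{x_1^j}`. -/
def strainIntegrand (ħ : ℝ) (u : E3 → E3) (ψ : WaveFn (n + 2)) (j k : Fin 3)
    (X : Config (n + 2)) : ℂ :=
  ((pderiv j (fun y => u y k) (X 0) + pderiv k (fun y => u y j) (X 0) : ℝ) : ℂ)
    * modMomentum ħ u ψ j X * (starRingEnd ℂ) (modMomentum ħ u ψ k X)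

/-- `(u(x_1) - u(x_2)) · ∇V_N(x_1 - x_2) ρ_N^{(2)}(x_1, x_2)`. -/
def deltaRateIntegrand (β : ℝ) (V : E3 → ℝ) (u : E3 → E3) (ψ : WaveFn (n + 2))
    (p : E3 × E3) : ℝ :=
  dotGrad (u p.1 - u p.2) (scaledPotential (n + 2) β V) (p.1 - p.2) * density2 ψ p.1 p.2

/-- `div u(x) ρ(x) [ρ(x) - 2 ρ_N^{(1)}(x)]`. -/
def deltaFluidRateIntegrand (ρ : E3 → ℝ) (u : E3 → E3) (ψ : WaveFn (n + 2)) (x : E3) : ℝ :=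
  divergence u x * ρ x * (ρ x - 2 * density1 ψ x)

/-- The `δ`-type potential contribution to the rate. -/
def deltaRate (β : ℝ) (V : E3 → ℝ) (ρ : E3 → ℝ) (u : E3 → E3) (ψ : WaveFn (n + 2)) : ℝ :=
  pairFactor n * (∫ p, deltaRateIntegrand β V u ψ p)
    - coupling V * ∫ x, deltaFluidRateIntegrand ρ u ψ x

/-- `(u(x_1) - u(x_2)) · ∇V_c(x_1 - x_2)` times the correlation bracket. -/
def coulombRateIntegrand (ρ : E3 → ℝ) (u : E3 → E3) (ψ : WaveFn (n + 2)) (p : E3 × E3) : ℝ :=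
  dotGrad (u p.1 - u p.2) coulomb (p.1 - p.2) * correlationBracket ρ ψ p

/-- The Coulomb potential contribution to the rate. -/
def coulombRate (ρ : E3 → ℝ) (u : E3 → E3) (ψ : WaveFn (n + 2)) : ℝ :=
  ∫ p, coulombRateIntegrand ρ u ψ p

/-- Every integral in the expression for the rate converges absolutely. -/
structure RateConverges (ħ β : ℝ) (V : E3 → ℝ) (ρ : E3 → ℝ) (u : E3 → E3)
    (ψ : WaveFn (n + 2)) : Prop where
  strain : ∀ j k, Integrable (strainIntegrand ħ u ψ j k)
  quantum : Integrable (fun x => laplace (divergence u) x * density1 ψ x)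
  delta : Integrable (deltaRateIntegrand β V u ψ)
  deltaFluid : Integrable (deltaFluidRateIntegrand ρ u ψ)
  coulomb : Integrable (coulombRateIntegrand ρ u ψ)

end Energy

end QuantumEuler

end

open QuantumEuler

open Filter Topology

namespace QuantumEuler
set_option linter.unusedSectionVars false

/-! Write `N = n + 2`, let `∇` act on the first particle, put `J = Im(conj ψ ∇ψ)`, and let functions
of position be evaluated at `x_1`. Expanding `|(-iħ∇ - u)ψ|²` turns the modulated energy into
(`modulatedEnergy_eq`) `(2/N)⟨ψ, Hψ⟩ - 2ħ∫u·J + ∫|u|²|ψ|² + b₀∫ρ² - 2b₀∫ρ|ψ|² + κ∫(V_c*ρ)ρ -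
2κ∫(V_c*ρ)|ψ|²`. The first term arises because, by symmetry, all particles have the same kinetic
energy and all pairs the same interaction energy; it is conserved.

The other terms are differentiated one by one. The expectation of `f(x_1)` changes at the rate
`ħ∫∇f·J + ∫∂_t f|ψ|²`, since real potentials commute with multiplications. The momentum `∫u·J` is
the quadratic form of the antisymmetric operator `A = u·∇ + ½ div u` (`antiOp`). Its commutator with
the Laplacian gives the stress tensor and `Δ div u`; its commutator with the potentials gives the
pair forces (`IsH2.im_inner_antiOp_evolution`). The fluid terms follow from the Euler–Poisson
system. On adding up, the terms in which `∇ρ` or `∇V_c*ρ` meets `J` cancel, and so do those with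
`u·∇ρ`. The terms with `∂_j u^k` complete the square to the strain form, and the rest is the two
potential rates, after the pair forces have been symmetrized.

The analysis rests on four devices. Since `∂_t ψ` is only in `L²`, no product rule is applied to `ψ`
and its derivatives. Instead a symmetric form is polarized, `B(ψ_τ,ψ_τ) - B(ψ_t,ψ_t) = Re B(ψ_τ+ψ_t,
ψ_τ-ψ_t)`, which needs only the continuity of `ψ` in `H¹` or `H²`. The Coulomb singularity is
handled by `hardy`: `ψ/|x_1-x_2|` is in `L²`, so potentials and forces are limits of their
regularizations. The Sobolev embedding `H² ⊂ C_b` (`exists_sobolev_const`) makes the needed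
derivatives of `ρ` and `u` bounded and uniformly continuous in time. Finally `ρ` is differentiable
in time both uniformly and in `L¹`, and convolution with a kernel of singularity at most `|y|⁻²`
maps `L¹ ∩ L^∞` boundedly to `L^∞`, so `V_c*ρ` is differentiable in time. -/

/-- Square integrable complex functions. -/
abbrev L2 (α : Type*) [MeasureSpace α] : Type _ := Lp ℂ 2 (volume : Measure α)

/-! ### Multiplication operators on `L²`. -/

section Multiplication

variable {α : Type*} [MeasureSpace α]

lemma norm_sq_eq_integral (f : L2 α) : ‖f‖ ^ 2 = ∫ x, ‖f x‖ ^ 2 := by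
  have h := congrArg Complex.re (L2.inner_def (𝕜 := ℂ) f f)
  rw [inner_self_eq_norm_sq_to_K] at h
  have h2 : (∫ a, inner ℂ (f a) (f a)) = ((∫ a, ‖f a‖ ^ 2 : ℝ) : ℂ) := by
    rw [← integral_complex_ofReal]
    congr 1
    ext a
    rw [inner_self_eq_norm_sq_to_K]
    simp
  rw [h2] at h
  simpa [← Complex.ofReal_pow] using h

lemma integrable_norm_sq (f : L2 α) : Integrable (fun x => ‖f x‖ ^ 2) :=
  (memLp_two_iff_integrable_sq_norm (Lp.aestronglyMeasurable f)).1 (Lp.memLp f)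

/-- Measurable bounded real functions. -/
structure IsBddMeas {α : Type*} [MeasurableSpace α] (a : α → ℝ) : Prop where
  meas : Measurable a
  bdd : ∃ C, ∀ x, |a x| ≤ C

/-- The product `a f` belongs to `L²`. -/
def MulMem (a : α → ℝ) (f : L2 α) : Prop := MemLp (fun x => (a x : ℂ) * f x) 2

open Classical in
/-- Multiplication of an element of `L²` by a real function (`0` when the product is not in
`L²`). -/
noncomputable def mulL (a : α → ℝ) (f : L2 α) : L2 α :=
  if h : MulMem a f then MemLp.toLp _ h else 0

lemma coeFn_mulL {a : α → ℝ} {f : L2 α} (h : MulMem a f) :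
    ∀ᵐ x, mulL a f x = (a x : ℂ) * f x := by
  rw [mulL, dif_pos h]
  exact MemLp.coeFn_toLp _

lemma mulMem_of_le {a b : α → ℝ} {f : L2 α} (ha : Measurable a)
    (hab : ∀ᵐ x, |a x| ≤ |b x|) (h : MulMem b f) : MulMem a f := by
  refine MemLp.of_le h ?_ ?_
  · exact (Complex.measurable_ofReal.comp ha).aestronglyMeasurable.mul (Lp.aestronglyMeasurable f)
  · filter_upwards [hab] with x hx
    simp only [norm_mul, Complex.norm_real, Real.norm_eq_abs]
    gcongr

lemma mulMem_const (c : ℝ) (f : L2 α) : MulMem (fun _ => c) f :=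
  (Lp.memLp f).const_mul (c : ℂ)

lemma IsBddMeas.mulMem {a : α → ℝ} (ha : IsBddMeas a) (f : L2 α) : MulMem a f := by
  obtain ⟨C, hC⟩ := ha.bdd
  refine mulMem_of_le ha.meas (Eventually.of_forall fun x => ?_) (mulMem_const C f)
  exact (hC x).trans (le_abs_self C)

lemma mulMem_iff_integrable {a : α → ℝ} (ha : Measurable a) (f : L2 α) :
    MulMem a f ↔ Integrable (fun x => a x ^ 2 * ‖f x‖ ^ 2) := by
  rw [MulMem, memLp_two_iff_integrable_sq_norm]
  · simp only [norm_mul, Complex.norm_real, Real.norm_eq_abs, mul_pow, sq_abs]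
  · exact (Complex.measurable_ofReal.comp ha).aestronglyMeasurable.mul (Lp.aestronglyMeasurable f)

lemma MulMem.add {a : α → ℝ} {f g : L2 α} (hf : MulMem a f) (hg : MulMem a g) :
    MulMem a (f + g) := by
  refine MemLp.ae_eq ?_ (MemLp.add hf hg)
  filter_upwards [Lp.coeFn_add f g] with x hx
  rw [hx]
  simp only [Pi.add_apply, mul_add]

lemma MulMem.sub {a : α → ℝ} {f g : L2 α} (hf : MulMem a f) (hg : MulMem a g) :
    MulMem a (f - g) := by
  refine MemLp.ae_eq ?_ (MemLp.sub hf hg)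
  filter_upwards [Lp.coeFn_sub f g] with x hx
  rw [hx]
  simp only [Pi.sub_apply, mul_sub]

lemma mulL_add {a : α → ℝ} {f g : L2 α} (hf : MulMem a f) (hg : MulMem a g) :
    mulL a (f + g) = mulL a f + mulL a g := by
  apply Lp.ext
  filter_upwards [Lp.coeFn_add f g, Lp.coeFn_add (mulL a f) (mulL a g), coeFn_mulL hf,
    coeFn_mulL hg, coeFn_mulL (hf.add hg)] with x h1 h2 h3 h4 h5
  rw [h5, h2, Pi.add_apply, h3, h4, h1, Pi.add_apply, mul_add]

lemma mulL_sub {a : α → ℝ} {f g : L2 α} (hf : MulMem a f) (hg : MulMem a g) :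
    mulL a (f - g) = mulL a f - mulL a g := by
  apply Lp.ext
  filter_upwards [Lp.coeFn_sub f g, Lp.coeFn_sub (mulL a f) (mulL a g), coeFn_mulL hf,
    coeFn_mulL hg, coeFn_mulL (hf.sub hg)] with x h1 h2 h3 h4 h5
  rw [h5, h2, Pi.sub_apply, h3, h4, h1, Pi.sub_apply, mul_sub]

lemma mulL_sub_left {a b : α → ℝ} {f : L2 α} (ha : MulMem a f) (hb : MulMem b f) :
    mulL (fun x => a x - b x) f = mulL a f - mulL b f := by
  have hab : MulMem (fun x => a x - b x) f := by
    refine MemLp.ae_eq (Eventually.of_forall fun x => ?_) (MemLp.sub ha hb)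
    simp [sub_mul]
  apply Lp.ext
  filter_upwards [Lp.coeFn_sub (mulL a f) (mulL b f), coeFn_mulL ha,
    coeFn_mulL hb, coeFn_mulL hab] with x h2 h3 h4 h5
  rw [h5, h2, Pi.sub_apply, h3, h4]
  push_cast
  ring

lemma mulL_mulL {a b : α → ℝ} {f : L2 α} (hb : MulMem b f) (hab : MulMem (fun x => a x * b x) f) :
    mulL a (mulL b f) = mulL (fun x => a x * b x) f := by
  have h : MulMem a (mulL b f) := by
    refine MemLp.ae_eq ?_ hab
    filter_upwards [coeFn_mulL hb] with x hx
    rw [hx]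
    push_cast
    ring
  apply Lp.ext
  filter_upwards [coeFn_mulL hb, coeFn_mulL h, coeFn_mulL hab] with x h1 h2 h3
  rw [h2, h3, h1]
  push_cast
  ring

lemma inner_mulL {a : α → ℝ} {f g : L2 α} (hg : MulMem a g) :
    inner ℂ f (mulL a g) = ∫ x, (a x : ℂ) * ((starRingEnd ℂ) (f x) * g x) := by
  rw [L2.inner_def]
  refine integral_congr_ae ?_
  filter_upwards [coeFn_mulL hg] with x hx
  rw [hx]
  simp only [RCLike.inner_apply]
  ring

lemma inner_mulL_comm {a : α → ℝ} {f g : L2 α} (hf : MulMem a f) (hg : MulMem a g) :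
    inner ℂ (mulL a f) g = inner ℂ f (mulL a g) := by
  rw [L2.inner_def, L2.inner_def]
  refine integral_congr_ae ?_
  filter_upwards [coeFn_mulL hf, coeFn_mulL hg] with x hx hy
  rw [hx, hy]
  simp only [RCLike.inner_apply, map_mul, Complex.conj_ofReal]
  ring

lemma integrable_inner_mulL {a : α → ℝ} {f g : L2 α} (hg : MulMem a g) :
    Integrable (fun x => (a x : ℂ) * ((starRingEnd ℂ) (f x) * g x)) := by
  have := L2.integrable_inner (𝕜 := ℂ) f (mulL a g)
  refine this.congr ?_
  filter_upwards [coeFn_mulL hg] with x hx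
  rw [hx]
  simp only [RCLike.inner_apply]
  ring

lemma inner_mulL_self {a : α → ℝ} {f : L2 α} (hf : MulMem a f) :
    inner ℂ f (mulL a f) = ((∫ x, a x * ‖f x‖ ^ 2 : ℝ) : ℂ) := by
  rw [inner_mulL hf, ← integral_complex_ofReal]
  congr 1
  ext x
  rw [← Complex.normSq_eq_conj_mul_self, Complex.normSq_eq_norm_sq]
  push_cast
  ring

lemma integrable_mul_norm_sq {a : α → ℝ} {f : L2 α} (hf : MulMem a f) :
    Integrable (fun x => a x * ‖f x‖ ^ 2) := by
  refine (integrable_inner_mulL (f := f) hf).re.congr (Eventually.of_forall fun x => ?_)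
  simp only [← Complex.normSq_eq_conj_mul_self, Complex.normSq_eq_norm_sq]
  norm_cast

lemma norm_mulL_le {a : α → ℝ} (ha : Measurable a) {C : ℝ} (hC : ∀ x, |a x| ≤ C) (f : L2 α) :
    ‖mulL a f‖ ≤ C * ‖f‖ := by
  refine Lp.norm_le_mul_norm_of_ae_le_mul ?_
  filter_upwards [coeFn_mulL (IsBddMeas.mulMem ⟨ha, C, hC⟩ f)] with x hx
  rw [hx, norm_mul, Complex.norm_real, Real.norm_eq_abs]
  gcongr
  exact hC x

/-- Dominated convergence for multiplication operators. -/
lemma tendsto_mulL_of_dominated {ι : Type*} {l : Filter ι} [l.IsCountablyGenerated]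
    {a : ι → α → ℝ} {a₀ b : α → ℝ} {f : L2 α} (hb : MulMem b f) (ha₀ : Measurable a₀)
    (ha : ∀ᶠ i in l, Measurable (a i) ∧ ∀ᵐ x, |a i x| ≤ b x) (h₀ : ∀ᵐ x, |a₀ x| ≤ b x)
    (hlim : ∀ᵐ x, Tendsto (fun i => a i x) l (𝓝 (a₀ x))) :
    Tendsto (fun i => mulL (a i) f) l (𝓝 (mulL a₀ f)) := by
  rw [tendsto_iff_norm_sub_tendsto_zero]
  have hM0 : MulMem a₀ f := mulMem_of_le ha₀
    (by filter_upwards [h₀] with x hx; exact hx.trans (le_abs_self _)) hb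
  have hbi : Integrable (fun x => (2 * b x) ^ 2 * ‖f x‖ ^ 2) := by
    have h1 := (memLp_two_iff_integrable_sq_norm hb.1).1 hb
    refine (h1.const_mul 4).congr (Eventually.of_forall fun x => ?_)
    simp only [norm_mul, Complex.norm_real, Real.norm_eq_abs, mul_pow, sq_abs]
    ring
  -- The squared distance is `∫ (a_i - a₀)²|f|²`, with integrable majorant `(2b)²|f|²` because `b f
  -- ∈ L²`. The functions `a_i` and `b` may be unbounded; this is used for the Coulomb potential.
  have key : Tendsto (fun i => ∫ x, (a i x - a₀ x) ^ 2 * ‖f x‖ ^ 2) l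
      (𝓝 (∫ _ : α, (0 : ℝ))) := by
    refine tendsto_integral_filter_of_dominated_convergence _ ?_ ?_ hbi ?_
    · filter_upwards [ha] with i hi
      exact ((hi.1.sub ha₀).pow_const 2).aestronglyMeasurable.mul
        ((Lp.aestronglyMeasurable f).norm.pow 2)
    · filter_upwards [ha] with i hi
      filter_upwards [hi.2, h₀] with x h1 h2
      rw [Real.norm_eq_abs, abs_mul, abs_pow, abs_pow, abs_norm]
      gcongr
      calc |a i x - a₀ x| ≤ |a i x| + |a₀ x| := abs_sub _ _
        _ ≤ 2 * b x := by linarith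
    · filter_upwards [hlim] with x hx
      have h3 : Tendsto (fun i => a i x - a₀ x) l (𝓝 0) := by
        simpa using hx.sub_const (a₀ x)
      simpa using (h3.pow 2).mul_const (‖f x‖ ^ 2)
  rw [integral_zero] at key
  have h4 : Tendsto (fun i => ‖mulL (a i) f - mulL a₀ f‖ ^ 2) l (𝓝 0) := by
    refine key.congr' ?_
    filter_upwards [ha] with i hi
    have hMi : MulMem (a i) f := mulMem_of_le hi.1
      (by filter_upwards [hi.2] with x hx; exact hx.trans (le_abs_self _)) hb
    rw [norm_sq_eq_integral]
    refine integral_congr_ae ?_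
    filter_upwards [Lp.coeFn_sub (mulL (a i) f) (mulL a₀ f), coeFn_mulL hMi, coeFn_mulL hM0]
      with x h1 h2 h3
    rw [h1, Pi.sub_apply, h2, h3, ← sub_mul, norm_mul, mul_pow, ← Complex.ofReal_sub,
      Complex.norm_real, Real.norm_eq_abs, sq_abs]
  have h5 := h4.sqrt
  simpa using h5

/-- Joint continuity of multiplication under bounded pointwise convergence. -/
lemma tendsto_mulL {ι : Type*} {l : Filter ι} [l.IsCountablyGenerated]
    {a : ι → α → ℝ} {a₀ : α → ℝ} {f : ι → L2 α} {f₀ : L2 α} {C : ℝ} (ha₀ : Measurable a₀)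
    (ha : ∀ᶠ i in l, Measurable (a i) ∧ ∀ x, |a i x| ≤ C) (h₀ : ∀ x, |a₀ x| ≤ C)
    (hlim : ∀ x, Tendsto (fun i => a i x) l (𝓝 (a₀ x))) (hf : Tendsto f l (𝓝 f₀)) :
    Tendsto (fun i => mulL (a i) (f i)) l (𝓝 (mulL a₀ f₀)) := by
  have h1 : Tendsto (fun i => mulL (a i) f₀) l (𝓝 (mulL a₀ f₀)) := by
    refine tendsto_mulL_of_dominated (mulMem_const C f₀) ha₀ ?_ (Eventually.of_forall h₀)
      (Eventually.of_forall hlim)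
    filter_upwards [ha] with i hi
    exact ⟨hi.1, Eventually.of_forall hi.2⟩
  -- The operators converge only strongly; the common bound `C` absorbs the motion of `f i`.
  have h2 : Tendsto (fun i => mulL (a i) (f i) - mulL (a i) f₀) l (𝓝 0) := by
    rw [tendsto_iff_norm_sub_tendsto_zero] at hf
    refine squeeze_zero_norm' ?_ (by simpa using hf.const_mul C)
    filter_upwards [ha] with i hi
    have hb : IsBddMeas (a i) := ⟨hi.1, C, hi.2⟩
    rw [← mulL_sub (hb.mulMem _) (hb.mulMem _)]
    exact norm_mulL_le hi.1 hi.2 _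
  simpa using h2.add h1

end Multiplication

/-! ### Weak derivatives as strong derivatives along translations. -/

section Translation

variable {E : Type*} [NormedAddCommGroup E] [NormedSpace ℝ E] [FiniteDimensional ℝ E]
  [MeasureSpace E] [BorelSpace E] [(volume : Measure E).IsAddHaarMeasure]

/-- Translation of square integrable functions. -/
noncomputable def translate (v : E) : (L2 E) →ₗᵢ[ℂ] (L2 E) :=
  Lp.compMeasurePreservingₗᵢ ℂ (fun x => x + v) (measurePreserving_add_right volume v)

lemma coeFn_translate (v : E) (f : L2 E) : ∀ᵐ x, translate v f x = f (x + v) :=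
  Lp.coeFn_compMeasurePreserving f (measurePreserving_add_right volume v)

lemma translate_zero (f : L2 E) : translate 0 f = f := by
  apply Lp.ext
  filter_upwards [coeFn_translate 0 f] with x hx
  rw [hx, add_zero]

lemma ae_add_right (v : E) {p : E → Prop} (h : ∀ᵐ x, p x) : ∀ᵐ x, p (x + v) :=
  (measurePreserving_add_right volume v).quasiMeasurePreserving.ae h

lemma continuous_translate (v : E) (f : L2 E) :
    Continuous (fun h : ℝ => translate (h • v) f) := by
  have : Continuous (fun h : ℝ => (ContinuousMap.mk (fun x : E => x + h • v) : C(E, E))) := by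
    refine ContinuousMap.continuous_of_continuous_uncurry _ ?_
    simp only [Function.uncurry_def, ContinuousMap.coe_mk]
    fun_prop
  exact Continuous.compMeasurePreservingLp (μ := volume) (ν := volume) (f := fun _ => f)
    continuous_const this (fun h => measurePreserving_add_right volume (h • v)) (by norm_num)

/-- Translation is isometric with inverse `translate (-v)`. Every integration by parts on wave
functions is the derivative of this identity. -/
lemma inner_translate (v : E) (f g : L2 E) :
    inner ℂ (translate v f) g = inner ℂ f (translate (-v) g) := by
  have h : translate v (translate (-v) g) = g := by
    apply Lp.ext
    filter_upwards [coeFn_translate v (translate (-v) g), ae_add_right v (coeFn_translate (-v) g)]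
      with x h1 h2
    rw [h1, h2, add_neg_cancel_right]
  conv_lhs => rw [← h]
  exact (translate v).inner_map_map _ _

/-- `g` is the derivative of `f` in the direction `v` in the norm of `L²`. -/
def HasL2Deriv (v : E) (f g : L2 E) : Prop :=
  HasDerivAt (fun h : ℝ => translate (h • v) f) g 0

/-- Moving the translation onto the test function makes the pairing a convolution of `f` with the
smooth function `φ(-·)`, and the hypothesis is applied to a translate of `φ`. Local integrability
suffices, so the lemma serves elements of `L²` as well as continuous representatives. -/
lemma hasDerivAt_pairing {f g : E → ℂ} (hf : LocallyIntegrable f) (v : E)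
    (hfg : ∀ φ : E → ℝ, ContDiff ℝ ∞ φ → HasCompactSupport φ →
      ∫ x, (fderiv ℝ φ x v) • f x = -∫ x, φ x • g x)
    {φ : E → ℝ} (hφ : ContDiff ℝ ∞ φ) (hc : HasCompactSupport φ) (h : ℝ) :
    HasDerivAt (fun h : ℝ => ∫ x, φ x • f (x + h • v)) (∫ x, φ x • g (x + h • v)) h := by
  set φ' : E → ℝ := fun y => φ (-y) with hφ'
  have hφ's : ContDiff ℝ ∞ φ' := hφ.comp contDiff_neg
  have hc' : HasCompactSupport φ' := hc.comp_homeomorph (Homeomorph.neg E)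
  set L : ℂ →L[ℝ] ℝ →L[ℝ] ℂ := (ContinuousLinearMap.lsmul ℝ ℝ).flip with hL
  have hD := hc'.hasFDerivAt_convolution_right L hf (hφ's.of_le (by simp)) (h • v)
    (μ := volume)
  have hshift : ∀ (F : E → ℂ) (h : ℝ),
      ∫ x, φ x • F (x + h • v) = ∫ x, φ (x - h • v) • F x := by
    intro F h
    rw [← integral_add_right_eq_self (fun x => φ (x - h • v) • F x) (h • v)]
    simp
  have hline : HasDerivAt (fun h : ℝ => h • v) v h := by
    simpa using (hasDerivAt_id h).smul_const v
  have h1 := hD.comp_hasDerivAt h hline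
  have e1 : (fun h : ℝ => ∫ x, φ x • f (x + h • v)) = (convolution f φ' L volume) ∘ (· • v) := by
    ext h
    rw [hshift]
    simp only [Function.comp, convolution, hL, ContinuousLinearMap.flip_apply,
      ContinuousLinearMap.lsmul_apply, hφ', neg_sub]
  rw [e1]
  refine h1.congr_deriv ?_
  symm
  rw [convolution_precompR_apply L hf (hc'.fderiv (𝕜 := ℝ))
    (hφ's.continuous_fderiv (by simp)) (h • v) v]
  rw [hshift]
  have hsub : ContDiff ℝ ∞ (fun x : E => φ (x - h • v)) :=
    hφ.comp (contDiff_id.sub contDiff_const)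
  have hsubc : HasCompactSupport (fun x : E => φ (x - h • v)) := by
    simpa [sub_eq_add_neg, Function.comp_def] using hc.comp_homeomorph (Homeomorph.addRight (-(h • v)))
  have h2 := hfg _ hsub hsubc
  rw [← neg_eq_iff_eq_neg] at h2
  rw [← h2, ← integral_neg]
  simp only [convolution, hL, ContinuousLinearMap.flip_apply, ContinuousLinearMap.lsmul_apply]
  congr 1
  ext x
  have hd1 : fderiv ℝ φ' (h • v - x) v = -(fderiv ℝ φ (x - h • v) v) := by
    have : HasFDerivAt φ' ((fderiv ℝ φ (-(h • v - x))).comp (-(ContinuousLinearMap.id ℝ E)))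
        (h • v - x) :=
      ((hφ.differentiable (by simp)) _).hasFDerivAt.comp _ (hasFDerivAt_id _).neg
    rw [this.fderiv, neg_sub]
    simp
  have hd2 : fderiv ℝ (fun x : E => φ (x - h • v)) x v = fderiv ℝ φ (x - h • v) v := by
    rw [fderiv_comp_sub]
  rw [hd1, hd2, neg_smul]

lemma locallyIntegrable_L2 (f : L2 E) : LocallyIntegrable f :=
  (Lp.memLp f).locallyIntegrable (by norm_num)

/-- Real compactly supported test functions already separate `L²`, so the distributional equation is
evaluated only on their complexifications. -/
lemma IsWeakDeriv.integral_eq {v : E} {f g : L2 E} (h : IsWeakDeriv v f g)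
    {φ : E → ℝ} (hφ : ContDiff ℝ ∞ φ) (hc : HasCompactSupport φ) :
    ∫ x, (fderiv ℝ φ x v) • f x = -∫ x, φ x • g x := by
  have hg₁ : HasCompactSupport (Complex.ofRealCLM ∘ φ) := hc.comp_left rfl
  have hg₂ : ContDiff ℝ ∞ (Complex.ofRealCLM ∘ φ) := by fun_prop
  have h1 := congrArg (fun T : 𝓢'(E, ℂ) => T (hg₁.toSchwartzMap hg₂)) h
  simp only [TemperedDistribution.lineDerivOp_apply_apply, map_neg] at h1
  rw [Lp.toTemperedDistribution_apply, Lp.toTemperedDistribution_apply] at h1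
  have e1 : ∀ x, fderiv ℝ (Complex.ofRealCLM ∘ φ) x v = (fderiv ℝ φ x v : ℂ) := by
    intro x
    rw [(Complex.ofRealCLM.hasFDerivAt.comp x
      ((hφ.differentiable (by simp)) x).hasFDerivAt).fderiv]
    rfl
  have e2 : ⇑(hg₁.toSchwartzMap hg₂) = Complex.ofRealCLM ∘ φ := rfl
  simp only [SchwartzMap.lineDerivOp_apply_eq_fderiv, e2, e1] at h1
  rw [neg_eq_iff_eq_neg] at h1
  simpa [Complex.real_smul] using h1

/-- An element of `L²` is determined by its integrals against test functions. -/
lemma eq_of_integral_test_eq {f g : L2 E} (h : ∀ φ : E → ℝ, ContDiff ℝ ∞ φ → HasCompactSupport φ →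
    ∫ x, φ x • f x = ∫ x, φ x • g x) : f = g :=
  Lp.ext (ae_eq_of_integral_contDiff_smul_eq (locallyIntegrable_L2 f) (locallyIntegrable_L2 g) h)

lemma IsWeakDeriv.unique {v : E} {f g₁ g₂ : L2 E} (h₁ : IsWeakDeriv v f g₁)
    (h₂ : IsWeakDeriv v f g₂) : g₁ = g₂ := by
  refine eq_of_integral_test_eq fun φ hφ hc => ?_
  have e1 := h₁.integral_eq hφ hc
  rw [h₂.integral_eq hφ hc, neg_inj] at e1
  exact e1.symm

lemma IsWeakDeriv.weakDeriv_eq {v : E} {f g : L2 E} (h : IsWeakDeriv v f g) :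
    weakDeriv v f = g := by
  have hex : ∃ g : L2 E, IsWeakDeriv v f g := ⟨g, h⟩
  rw [weakDeriv, dif_pos hex]
  exact hex.choose_spec.unique h

/-- The integral against a test function as a continuous functional on `L²`. -/
lemma exists_testCLM {φ : E → ℝ} (hφ : ContDiff ℝ ∞ φ) (hc : HasCompactSupport φ) :
    ∃ T : (L2 E) →L[ℂ] ℂ, ∀ f : L2 E, T f = ∫ x, φ x • f x := by
  have hm : MemLp (fun x => (φ x : ℂ)) 2 (volume : Measure E) :=
    (Complex.continuous_ofReal.comp hφ.continuous).memLp_of_hasCompactSupport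
      (hc.comp_left (g := Complex.ofReal) rfl)
  refine ⟨innerSL ℂ (hm.toLp _), fun f => ?_⟩
  rw [innerSL_apply_apply, L2.inner_def]
  refine integral_congr_ae ?_
  filter_upwards [hm.coeFn_toLp] with x hx
  rw [hx]
  simp [mul_comm]

/-- The fundamental theorem of calculus along translations. -/
lemma IsWeakDeriv.translate_sub {v : E} {f g : L2 E} (hfg : IsWeakDeriv v f g) (h : ℝ) :
    translate (h • v) f - f = ∫ s in (0 : ℝ)..h, translate (s • v) g := by
  -- After pairing with a test function both sides are scalar, and `hasDerivAt_pairing` reduces the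
  -- claim to the ordinary fundamental theorem of calculus.
  refine eq_of_integral_test_eq fun φ hφ hc => ?_
  obtain ⟨T, hT⟩ := exists_testCLM hφ hc
  have hpair : ∀ (F : L2 E) (s : ℝ), T (translate (s • v) F) = ∫ x, φ x • F (x + s • v) := by
    intro F s
    rw [hT]
    refine integral_congr_ae ?_
    filter_upwards [coeFn_translate (s • v) F] with x hx
    rw [hx]
  rw [← hT, ← hT, map_sub, ← T.intervalIntegral_comp_comm
    ((continuous_translate v g).intervalIntegrable _ _)]
  have hder : ∀ s ∈ uIcc 0 h, HasDerivAt (fun s : ℝ => T (translate (s • v) f))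
      (T (translate (s • v) g)) s := by
    intro s _
    simp only [hpair]
    exact hasDerivAt_pairing (locallyIntegrable_L2 f) v (fun φ h1 h2 => hfg.integral_eq h1 h2)
      hφ hc s
  rw [intervalIntegral.integral_eq_sub_of_hasDerivAt hder
    ((T.continuous.comp (continuous_translate v g)).intervalIntegrable _ _)]
  simp [translate_zero]

/-- The difference quotient is the mean of the translates of `g` over `[0, h]`, and translation is
strongly continuous. With strong derivatives, the product rule and integration by parts become
limits of difference quotients and need no mollification. -/
lemma IsWeakDeriv.hasL2Deriv {v : E} {f g : L2 E} (hfg : IsWeakDeriv v f g) :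
    HasL2Deriv v f g := by
  have h1 : HasDerivAt (fun h : ℝ => ∫ s in (0 : ℝ)..h, translate (s • v) g)
      (translate ((0 : ℝ) • v) g) 0 :=
    intervalIntegral.integral_hasDerivAt_right
      ((continuous_translate v g).intervalIntegrable _ _)
      (continuous_translate v g).stronglyMeasurable.stronglyMeasurableAtFilter
      (continuous_translate v g).continuousAt
  rw [zero_smul, translate_zero] at h1
  have h2 : (fun h : ℝ => translate (h • v) f) =
      fun h => (∫ s in (0 : ℝ)..h, translate (s • v) g) + f := by
    ext1 h
    rw [← hfg.translate_sub h, sub_add_cancel]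
  unfold HasL2Deriv
  rw [h2]
  exact h1.add_const f

lemma HasL2Deriv.unique {v : E} {f g₁ g₂ : L2 E} (h₁ : HasL2Deriv v f g₁)
    (h₂ : HasL2Deriv v f g₂) : g₁ = g₂ := HasDerivAt.unique h₁ h₂

lemma HasL2Deriv.add {v : E} {f₁ f₂ g₁ g₂ : L2 E} (h₁ : HasL2Deriv v f₁ g₁)
    (h₂ : HasL2Deriv v f₂ g₂) : HasL2Deriv v (f₁ + f₂) (g₁ + g₂) := by
  unfold HasL2Deriv
  simp only [map_add]
  exact HasDerivAt.add h₁ h₂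

lemma HasL2Deriv.sub {v : E} {f₁ f₂ g₁ g₂ : L2 E} (h₁ : HasL2Deriv v f₁ g₁)
    (h₂ : HasL2Deriv v f₂ g₂) : HasL2Deriv v (f₁ - f₂) (g₁ - g₂) := by
  unfold HasL2Deriv
  simp only [map_sub]
  exact HasDerivAt.sub h₁ h₂

lemma HasL2Deriv.const_smul {v : E} {f g : L2 E} (c : ℂ) (h : HasL2Deriv v f g) :
    HasL2Deriv v (c • f) (c • g) := by
  unfold HasL2Deriv
  simp only [map_smul]
  exact HasDerivAt.const_smul c h

lemma HasL2Deriv.sum {ι : Type*} {s : Finset ι} {v : E} {f g : ι → L2 E}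
    (h : ∀ i ∈ s, HasL2Deriv v (f i) (g i)) :
    HasL2Deriv v (∑ i ∈ s, f i) (∑ i ∈ s, g i) := by
  unfold HasL2Deriv
  simp only [map_sum]
  exact HasDerivAt.fun_sum h

/-- Integration by parts. -/
lemma HasL2Deriv.inner_eq_neg {v : E} {f f' g g' : L2 E} (hf : HasL2Deriv v f f')
    (hg : HasL2Deriv v g g') : inner ℂ f' g = -inner ℂ f g' := by
  have h1 : HasDerivAt (fun h : ℝ => inner ℂ (translate (h • v) f) g) (inner ℂ f' g) 0 := by
    simpa using HasDerivAt.inner ℂ hf (hasDerivAt_const (0 : ℝ) g)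
  have h3 : HasDerivAt (fun h : ℝ => translate ((-h) • v) g) (-g') 0 := by
    have h4 : HasDerivAt (fun h : ℝ => translate (h • v) g) g' (-0) := by
      rw [neg_zero]; exact hg
    simpa [Function.comp_def] using h4.scomp (0 : ℝ) (hasDerivAt_neg (0 : ℝ))
  have h2 : HasDerivAt (fun h : ℝ => inner ℂ f (translate ((-h) • v) g)) (inner ℂ f (-g')) 0 := by
    simpa using HasDerivAt.inner ℂ (hasDerivAt_const (0 : ℝ) f) h3
  -- The two derivatives at `0` belong to one function, by `⟨τ_h f, g⟩ = ⟨f, τ_{-h} g⟩`.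
  have e : (fun h : ℝ => inner ℂ (translate (h • v) f) g) =
      fun h : ℝ => inner ℂ f (translate ((-h) • v) g) := by
    ext h
    rw [inner_translate, neg_smul]
  rw [e] at h1
  rw [h1.unique h2, inner_neg_right]

/-- A bounded function with bounded derivative along the direction `v`. -/
structure HasBddLineDeriv (v : E) (a a' : E → ℝ) : Prop where
  fn : IsBddMeas a
  deriv : IsBddMeas a'
  hasDeriv : ∀ x, HasDerivAt (fun h : ℝ => a (x + h • v)) (a' x) 0

lemma HasBddLineDeriv.hasDerivAt {v : E} {a a' : E → ℝ} (h : HasBddLineDeriv v a a') (x : E)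
    (s : ℝ) : HasDerivAt (fun h : ℝ => a (x + h • v)) (a' (x + s • v)) s := by
  have h1 : HasDerivAt (fun h : ℝ => a (x + s • v + h • v)) (a' (x + s • v)) (s - s) := by
    rw [sub_self]; exact h.hasDeriv _
  have h2 := h1.comp_sub_const s s
  refine h2.congr_of_eventuallyEq (Eventually.of_forall fun r => ?_)
  simp only
  congr 1
  rw [sub_smul]
  abel

lemma HasBddLineDeriv.abs_sub_le {v : E} {a a' : E → ℝ} (h : HasBddLineDeriv v a a') {C : ℝ}
    (hC : ∀ x, |a' x| ≤ C) (x : E) (s : ℝ) : |a (x + s • v) - a x| ≤ C * |s| := by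
  have := Convex.norm_image_sub_le_of_norm_hasDerivWithin_le (s := univ) (x := (0 : ℝ)) (y := s)
    (fun r _ => (h.hasDerivAt x r).hasDerivWithinAt) (fun r _ => hC _) convex_univ
    (mem_univ _) (mem_univ _)
  simpa using this

/-- The product rule. -/
lemma HasL2Deriv.mulL {v : E} {f f' : L2 E} (hf : HasL2Deriv v f f') {a a' : E → ℝ}
    (ha : HasBddLineDeriv v a a') :
    HasL2Deriv v (mulL a f) (mulL a' f + mulL a f') := by
  obtain ⟨C, hC⟩ := ha.fn.bdd
  obtain ⟨C', hC'⟩ := ha.deriv.bdd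
  unfold HasL2Deriv at hf ⊢
  rw [hasDerivAt_iff_tendsto_slope_zero] at hf ⊢
  simp only [zero_add, zero_smul, translate_zero] at hf ⊢
  have hmt : ∀ h : ℝ, Measurable (fun x => a (x + h • v)) := fun h =>
    ha.fn.meas.comp (measurable_add_const _)
  have hne : ∀ᶠ h : ℝ in 𝓝[≠] 0, h ≠ 0 := eventually_mem_nhdsWithin
  -- The difference quotient of `a f` is the quotient of `a` times `f` plus the translate of `a`
  -- times the quotient of `f`. Each factor coming from `a` converges pointwise with a uniform
  -- bound, so `a'` need not be continuous.
  have t1 : Tendsto (fun h : ℝ => QuantumEuler.mulL (fun x => a (x + h • v))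
      (h⁻¹ • (translate (h • v) f - f))) (𝓝[≠] 0) (𝓝 (QuantumEuler.mulL a f')) := by
    refine tendsto_mulL (C := C) ha.fn.meas (Eventually.of_forall fun h => ⟨hmt h, fun x => hC _⟩)
      hC (fun x => ?_) hf
    have := (ha.hasDeriv x).continuousAt.tendsto
    simp only [zero_smul, add_zero] at this
    exact this.mono_left nhdsWithin_le_nhds
  have t2 : Tendsto (fun h : ℝ => QuantumEuler.mulL (fun x => h⁻¹ * (a (x + h • v) - a x)) f)
      (𝓝[≠] 0) (𝓝 (QuantumEuler.mulL a' f)) := by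
    refine tendsto_mulL (C := C') ha.deriv.meas ?_ hC' (fun x => ?_) tendsto_const_nhds
    · filter_upwards [hne] with h hh
      refine ⟨((hmt h).sub ha.fn.meas).const_mul _, fun x => ?_⟩
      rw [abs_mul, abs_inv, inv_mul_le_iff₀ (abs_pos.2 hh), mul_comm]
      exact ha.abs_sub_le hC' x h
    · have := ha.hasDeriv x
      rw [hasDerivAt_iff_tendsto_slope_zero] at this
      simpa using this
  have t3 := t2.add t1
  refine t3.congr' ?_
  filter_upwards [hne] with h hh
  have hb1 : IsBddMeas (fun x => h⁻¹ * (a (x + h • v) - a x)) := by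
    refine ⟨((hmt h).sub ha.fn.meas).const_mul _, |h⁻¹| * (C + C), fun x => ?_⟩
    rw [abs_mul]
    gcongr
    exact (abs_sub _ _).trans (add_le_add (hC _) (hC _))
  have hb2 : IsBddMeas (fun x => a (x + h • v)) := ⟨hmt h, C, fun x => hC _⟩
  apply Lp.ext
  filter_upwards [Lp.coeFn_add (QuantumEuler.mulL (fun x => h⁻¹ * (a (x + h • v) - a x)) f)
      (QuantumEuler.mulL (fun x => a (x + h • v)) (h⁻¹ • (translate (h • v) f - f))),
    coeFn_mulL (hb1.mulMem f), coeFn_mulL (hb2.mulMem (h⁻¹ • (translate (h • v) f - f))),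
    Lp.coeFn_smul h⁻¹ (translate (h • v) f - f), Lp.coeFn_sub (translate (h • v) f) f,
    coeFn_translate (h • v) f, Lp.coeFn_smul h⁻¹ (translate (h • v) (QuantumEuler.mulL a f) -
      QuantumEuler.mulL a f),
    Lp.coeFn_sub (translate (h • v) (QuantumEuler.mulL a f)) (QuantumEuler.mulL a f),
    coeFn_translate (h • v) (QuantumEuler.mulL a f), coeFn_mulL (ha.fn.mulMem f),
    ae_add_right (h • v) (coeFn_mulL (ha.fn.mulMem f))] with x h1 h2 h3 h4 h5 h6 h7 h8 h9 h10 h11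
  rw [h1, Pi.add_apply, h2, h3, h4, Pi.smul_apply, h5, Pi.sub_apply, h6, h7, Pi.smul_apply, h8,
    Pi.sub_apply, h9, h10, h11, Complex.real_smul, Complex.real_smul]
  push_cast
  ring

end Translation

/-! ### The embedding of `H²(ℝ³)` into bounded continuous functions. -/

section SobolevEmbedding

open FourierTransform TemperedDistribution
open scoped Laplacian Real

/-- A tempered distribution whose Fourier transform is an `L¹` function is a continuous function. -/
lemma ae_eq_fourierInv {F : L2 E3} {v : Lp ℂ 1 (volume : Measure E3)}
    (h : 𝓕 (F : 𝓢'(E3, ℂ)) = (v : 𝓢'(E3, ℂ))) :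
    ∀ᵐ x, F x = Real.Lp.fourierTransformInv v x := by
  have h1 : (F : 𝓢'(E3, ℂ)) = 𝓕⁻ (v : 𝓢'(E3, ℂ)) := by
    rw [← h, FourierTransform.fourierInv_fourier_eq]
  refine ae_eq_of_integral_contDiff_smul_eq (locallyIntegrable_L2 F)
    (Real.Lp.fourierTransformInv v).continuous.locallyIntegrable fun φ hφ hc => ?_
  have hg₁ : HasCompactSupport (Complex.ofRealCLM ∘ φ) := hc.comp_left rfl
  have hg₂ : ContDiff ℝ ∞ (Complex.ofRealCLM ∘ φ) := by fun_prop
  set Φ : 𝓢(E3, ℂ) := hg₁.toSchwartzMap hg₂ with hΦ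
  have e2 : ∀ x, Φ x = (φ x : ℂ) := fun _ => rfl
  have h2 := congrArg (fun T : 𝓢'(E3, ℂ) => T Φ) h1
  simp only [TemperedDistribution.fourierInv_apply, Lp.toTemperedDistribution_apply, e2] at h2
  simp only [Complex.real_smul]
  simp only [smul_eq_mul] at h2
  rw [h2]
  -- By Fubini the inverse transform passes from the test function to `v`; the sign in `-innerₗ E3`
  -- makes the transform inverse.
  have h3 := VectorFourier.integral_fourierIntegral_smul_eq_flip (L := -innerₗ E3)
      (μ := volume) (ν := volume)
      Real.continuous_fourierChar (by simpa [Pi.neg_def] using (continuous_inner (𝕜 := ℝ) (E := E3)).neg) Φ.integrable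
      (L1.integrable_coeFn v)
  have e3 : (-innerₗ E3).flip = -innerₗ E3 := by
    ext x y
    simp [real_inner_comm]
  rw [e3] at h3
  simp only [smul_eq_mul] at h3
  rw [SchwartzMap.fourierInv_coe]
  simp only [Real.Lp.fourierTransformInv_apply]
  have e4 : ∀ f : E3 → ℂ, VectorFourier.fourierIntegral Real.fourierChar volume (-innerₗ E3) f =
      𝓕⁻ f := by
    intro f
    ext w
    simp [Real.fourierInv_eq, VectorFourier.fourierIntegral]
  rw [e4, e4] at h3
  exact h3

/-- The Sobolev embedding `H² ⊂ C_b` in three dimensions. -/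
lemma exists_sobolev_const : ∃ C : ℝ, 0 ≤ C ∧ ∀ (F : L2 E3) (H G : Fin 3 → L2 E3),
    (∀ k, IsWeakDeriv (unitVec k) F (H k)) → (∀ k, IsWeakDeriv (unitVec k) (H k) (G k)) →
    ∃ g : E3 → ℂ, Continuous g ∧ (∀ᵐ x, F x = g x) ∧ ∀ x, ‖g x‖ ≤ C * (‖F‖ + ∑ k, ‖G k‖) := by
  -- The weight `(1 + |ξ|²)⁻¹` is square integrable because `4 > 3`; the dimension enters here.
  have hw : MemLp (fun x : E3 => ((1 + ‖x‖ ^ 2) ^ (-1 : ℝ) : ℝ)) 2 := by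
    constructor
    · have : (fun x : E3 ↦ (1 + ‖x‖ ^ 2) ^ (-1 : ℝ)).HasTemperateGrowth := by
        fun_prop
      exact this.1.continuous.aestronglyMeasurable
    · rw [eLpNorm_lt_top_iff_lintegral_rpow_enorm_lt_top (by norm_num) (by norm_num)]
      suffices h : ∫⁻ a : E3, ENNReal.ofReal ‖(1 + ‖a‖ ^ 2) ^ (-(2 : ℝ))‖ < ⊤ from by
        norm_cast
        simp_rw [ofReal_norm] at h
        simp_rw [← enorm_pow]
        convert h
        norm_num [Real.rpow_neg_one]
      have hs : (Module.finrank ℝ E3 : ℝ) < 4 := by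
        rw [finrank_euclideanSpace_fin]; norm_num
      apply ((integrable_rpow_neg_one_add_norm_sq hs).congr _).lintegral_lt_top
      filter_upwards with x
      rw [Real.norm_eq_abs, abs_eq_self.mpr (by positivity)]
      congr
      norm_num
  have hwc : MemLp (fun x : E3 ↦ Complex.ofReal ((1 + ‖x‖ ^ 2) ^ (-1 : ℝ) : ℝ)) 2 := hw.ofReal
  have hg₁ : (fun x : E3 ↦ Complex.ofReal ((1 + ‖x‖ ^ 2) ^ (-1 : ℝ) : ℝ)).HasTemperateGrowth := by
    fun_prop
  have hg₂ : (fun x : E3 ↦ Complex.ofReal (‖x‖ ^ 2)).HasTemperateGrowth := by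
    fun_prop
  refine ⟨‖hwc.toLp‖, norm_nonneg _, fun F H G hH hG => ?_⟩
  -- The symbol of `Δ` is `-(2π|ξ|)²`. With this `c` the function `h = F - c ΔF` has Fourier
  -- transform `(1 + |ξ|²)` times that of `F`.
  set c : ℂ := ((((2 * π) ^ 2)⁻¹ : ℝ) : ℂ) with hc
  have hcn : ‖c‖ ≤ 1 := by
    rw [hc, Complex.norm_real, Real.norm_eq_abs, abs_of_nonneg (by positivity)]
    apply inv_le_one_of_one_le₀
    nlinarith [Real.pi_gt_three]
  set h : L2 E3 := F - c • ∑ k, G k with hh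
  have hlap : Δ (F : 𝓢'(E3, ℂ)) = ((∑ k, G k : L2 E3) : 𝓢'(E3, ℂ)) := by
    rw [TemperedDistribution.laplacian_eq_sum (EuclideanSpace.basisFun (Fin 3) ℝ),
      ← Lp.toTemperedDistributionCLM_apply (∑ k, G k), map_sum]
    refine Finset.sum_congr rfl fun k _ => ?_
    have e : (EuclideanSpace.basisFun (Fin 3) ℝ) k = unitVec k := by
      simp [unitVec]
    rw [e]
    have h1 : ∂_{unitVec k} (F : 𝓢'(E3, ℂ)) = (H k : 𝓢'(E3, ℂ)) := hH k
    have h2 : ∂_{unitVec k} (H k : 𝓢'(E3, ℂ)) = (G k : 𝓢'(E3, ℂ)) := hG k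
    rw [h1, h2]
    rfl
  have hfour : 𝓕 (h : 𝓢'(E3, ℂ)) = 𝓕 (F : 𝓢'(E3, ℂ)) +
      smulLeftCLM ℂ (fun x : E3 ↦ Complex.ofReal (‖x‖ ^ 2)) (𝓕 (F : 𝓢'(E3, ℂ))) := by
    have e1 : (h : 𝓢'(E3, ℂ)) = (F : 𝓢'(E3, ℂ)) - c • Δ (F : 𝓢'(E3, ℂ)) := by
      rw [hlap, ← Lp.toTemperedDistributionCLM_apply, hh, map_sub, map_smul]
      rfl
    have e2 : c • Δ (F : 𝓢'(E3, ℂ)) =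
        -TemperedDistribution.fourierMultiplierCLM ℂ (fun x : E3 ↦ Complex.ofReal (‖x‖ ^ 2))
          (F : 𝓢'(E3, ℂ)) := by
      rw [TemperedDistribution.laplacian_eq_fourierMultiplierCLM]
      ext u
      simp only [smul_apply, neg_apply]
      rw [hc, neg_smul, smul_neg, Complex.coe_smul, smul_smul,
        inv_mul_cancel₀ (by positivity), one_smul]
    rw [e1, e2, sub_neg_eq_add, FourierTransform.fourier_add,
      TemperedDistribution.fourierMultiplierCLM_apply, FourierTransform.fourier_fourierInv_eq]
  -- Hence the transform of `F` is a product of two `L²` functions, so it lies in `L¹`, and `F` is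
  -- its inverse transform, continuous and bounded by the `L¹` norm.
  have hv : 𝓕 (F : 𝓢'(E3, ℂ)) =
      ((hwc.toLp • 𝓕 h : Lp ℂ 1 (volume : Measure E3)) : 𝓢'(E3, ℂ)) := by
    rw [MeasureTheory.Lp.toTemperedDistribution_smul_eq hg₁ hwc,
      ← Lp.fourier_toTemperedDistribution_eq, hfour, map_add,
      smulLeftCLM_smulLeftCLM_apply hg₂ hg₁, ← add_apply,
      ← smulLeftCLM_add hg₁ (hg₂.mul hg₁)]
    have e : ((fun x : E3 ↦ Complex.ofReal ((1 + ‖x‖ ^ 2) ^ (-1 : ℝ) : ℝ)) +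
        (fun x : E3 ↦ Complex.ofReal (‖x‖ ^ 2)) *
          fun x : E3 ↦ Complex.ofReal ((1 + ‖x‖ ^ 2) ^ (-1 : ℝ) : ℝ)) = fun _ => 1 := by
      ext x
      simp only [Pi.add_apply, Pi.mul_apply]
      rw [← Complex.ofReal_mul, ← Complex.ofReal_add, ← Complex.ofReal_one, Complex.ofReal_inj,
        Real.rpow_neg_one]
      have : (1 + ‖x‖ ^ 2) ≠ 0 := by positivity
      field_simp
    rw [e, smulLeftCLM_const, one_smul]
  refine ⟨Real.Lp.fourierTransformInv (hwc.toLp • 𝓕 h : Lp ℂ 1 (volume : Measure E3)),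
    (Real.Lp.fourierTransformInv _).continuous, ae_eq_fourierInv hv, fun x => ?_⟩
  calc ‖Real.Lp.fourierTransformInv (hwc.toLp • 𝓕 h : Lp ℂ 1 (volume : Measure E3)) x‖
      ≤ ‖(hwc.toLp • 𝓕 h : Lp ℂ 1 (volume : Measure E3))‖ := by
        have h1 := Real.fourierInv_eq (hwc.toLp • 𝓕 h : Lp ℂ 1 (volume : Measure E3)) x
        rw [Real.Lp.fourierTransformInv_apply, h1, L1.norm_eq_integral_norm]
        refine (norm_integral_le_integral_norm _).trans (le_of_eq ?_)
        simp_rw [Circle.norm_smul]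
    _ ≤ ‖hwc.toLp‖ * ‖𝓕 h‖ := Lp.norm_smul_le _ _
    _ = ‖hwc.toLp‖ * ‖h‖ := by rw [Lp.norm_fourier_eq]
    _ ≤ ‖hwc.toLp‖ * (‖F‖ + ∑ k, ‖G k‖) := by
        gcongr
        calc ‖h‖ ≤ ‖F‖ + ‖c • ∑ k, G k‖ := norm_sub_le _ _
          _ ≤ ‖F‖ + 1 * ∑ k, ‖G k‖ := by
            rw [norm_smul]
            gcongr
            exact norm_sum_le _ _
          _ = _ := by rw [one_mul]

end SobolevEmbedding

/-! ### Classical regularity of Sobolev functions. -/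

section Regularity

/-- Sobolev functions are classically differentiable as soon as the weak derivatives are continuous
and bounded. -/
lemma hasFDerivAt_of_isWeakDeriv {F : L2 E3} {G : Fin 3 → L2 E3} {f : E3 → ℂ} {g : Fin 3 → E3 → ℂ}
    (hfc : Continuous f) (hF : ∀ᵐ x, F x = f x) (hFG : ∀ k, IsWeakDeriv (unitVec k) F (G k))
    (hgc : ∀ k, Continuous (g k)) (hG : ∀ k, ∀ᵐ x, G k x = g k x) {C : ℝ}
    (hC : ∀ k x, ‖g k x‖ ≤ C) (x : E3) :
    HasFDerivAt f (∑ k, (EuclideanSpace.proj k : E3 →L[ℝ] ℝ).smulRight (g k x)) x := by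
  have hsum : ∀ y : E3, y = ∑ k, y k • unitVec k := by
    intro y
    conv_lhs => rw [← (EuclideanSpace.basisFun (Fin 3) ℝ).sum_repr y]
    simp [unitVec]
  set gy : E3 → E3 → ℂ := fun y x => ∑ k, (y k : ℂ) * g k x with hgy
  have hgyc : ∀ y, Continuous (gy y) := fun y =>
    continuous_finsetSum _ fun k _ => continuous_const.mul (hgc k)
  have hint : ∀ (φ : E3 → ℝ), Continuous φ → HasCompactSupport φ → ∀ (q : E3 → ℂ), Continuous q →
      Integrable (fun x => φ x • q x) := fun φ h1 h2 q hq =>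
    (h1.smul hq).integrable_of_hasCompactSupport h2.smul_right
  have htest : ∀ y : E3, ∀ φ : E3 → ℝ, ContDiff ℝ ∞ φ → HasCompactSupport φ →
      ∫ x, (fderiv ℝ φ x y) • f x = -∫ x, φ x • gy y x := by
    intro y φ hφ hc
    have hd : ∀ k, ∫ x, (fderiv ℝ φ x (unitVec k)) • f x = -∫ x, φ x • g k x := by
      intro k
      have h1 := (hFG k).integral_eq hφ hc
      have e1 : ∫ x, (fderiv ℝ φ x (unitVec k)) • F x = ∫ x, (fderiv ℝ φ x (unitVec k)) • f x :=
        integral_congr_ae (by filter_upwards [hF] with x hx; rw [hx])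
      have e2 : ∫ x, φ x • G k x = ∫ x, φ x • g k x :=
        integral_congr_ae (by filter_upwards [hG k] with x hx; rw [hx])
      rwa [e1, e2] at h1
    have h2 : ∀ x, (fderiv ℝ φ x y) • f x =
        ∑ k, (y k : ℂ) * ((fderiv ℝ φ x (unitVec k)) • f x) := by
      intro x
      conv_lhs => rw [hsum y]
      rw [map_sum, Finset.sum_smul]
      refine Finset.sum_congr rfl fun k _ => ?_
      rw [map_smul, smul_eq_mul, Complex.real_smul, Complex.real_smul]
      push_cast
      ring
    have hdc : ∀ k, Integrable (fun x => (fderiv ℝ φ x (unitVec k)) • f x) := fun k =>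
      hint _ ((hφ.continuous_fderiv (by simp)).clm_apply continuous_const)
        (hc.fderiv_apply (𝕜 := ℝ) _) f hfc
    simp_rw [h2, hgy, Finset.smul_sum]
    rw [integral_finsetSum _ fun k _ => (hdc k).const_mul _, integral_finsetSum, ← Finset.sum_neg_distrib]
    · refine Finset.sum_congr rfl fun k _ => ?_
      rw [integral_const_mul, hd k, mul_neg, ← integral_const_mul]
      congr 2
      ext x
      simp only [Complex.real_smul]
      ring
    · intro k _
      exact hint φ hφ.continuous hc _ (continuous_const.mul (hgc k))
  have hgyb : ∀ y x, ‖gy y x‖ ≤ ∑ k, |y k| * C := by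
    intro y x
    refine (norm_sum_le _ _).trans (Finset.sum_le_sum fun k _ => ?_)
    rw [norm_mul, Complex.norm_real, Real.norm_eq_abs]
    gcongr
    exact hC k x
  have hcu : ∀ y : E3, Continuous (Function.uncurry fun (x : E3) (s : ℝ) => gy y (x + s • y)) := by
    intro y
    have := hgyc y
    simp only [Function.uncurry_def]
    fun_prop
  -- The identity is obtained almost everywhere by testing, and everywhere because both sides are
  -- continuous in `x`.
  have hftc : ∀ y x : E3, f (x + y) - f x = ∫ s in (0 : ℝ)..1, gy y (x + s • y) := by
    intro y
    have hRc : Continuous fun x => ∫ s in (0 : ℝ)..1, gy y (x + s • y) :=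
      intervalIntegral.continuous_parametric_intervalIntegral_of_continuous' (hcu y) 0 1
    have hLc : Continuous fun x => f (x + y) - f x :=
      (hfc.comp (continuous_id.add continuous_const)).sub hfc
    refine fun x => congrFun (Measure.eq_of_ae_eq (μ := (volume : Measure E3)) ?_ hLc hRc) x
    refine ae_eq_of_integral_contDiff_smul_eq hLc.locallyIntegrable hRc.locallyIntegrable
      fun φ hφ hc => ?_
    have hder : ∀ s ∈ uIcc (0 : ℝ) 1, HasDerivAt (fun s : ℝ => ∫ x, φ x • f (x + s • y))
        (∫ x, φ x • gy y (x + s • y)) s := fun s _ =>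
      hasDerivAt_pairing hfc.locallyIntegrable y (htest y) hφ hc s
    have hprod : Integrable (Function.uncurry fun (s : ℝ) (x : E3) => φ x • gy y (x + s • y))
        ((volume.restrict (Ioc (0 : ℝ) 1)).prod volume) := by
      have hφi : Integrable (fun p : ℝ × E3 => φ p.2)
          ((volume.restrict (Ioc (0 : ℝ) 1)).prod volume) :=
        (hφ.continuous.integrable_of_hasCompactSupport hc).comp_snd _
      refine (hφi.smul_of_top_left ?_ : Integrable (fun p : ℝ × E3 => φ p.2 • gy y (p.2 + p.1 • y)) _)
      refine memLp_top_of_bound ?_ (∑ k, |y k| * C) (Eventually.of_forall fun p => hgyb _ _)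
      exact ((hcu y).comp continuous_swap).aestronglyMeasurable
    have hci : IntervalIntegrable (fun s : ℝ => ∫ x, φ x • gy y (x + s • y)) volume 0 1 := by
      rw [intervalIntegrable_iff_integrableOn_Ioc_of_le zero_le_one]
      exact hprod.integral_prod_left
    have h3 := intervalIntegral.integral_eq_sub_of_hasDerivAt hder hci
    simp only [one_smul, zero_smul, add_zero] at h3
    have h4 : ∫ x, φ x • (f (x + y) - f x) = (∫ x, φ x • f (x + y)) - ∫ x, φ x • f x := by
      simp_rw [smul_sub]
      exact integral_sub (hint φ hφ.continuous hc _ (hfc.comp (continuous_id.add continuous_const)))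
        (hint φ hφ.continuous hc _ hfc)
    rw [h4, ← h3, intervalIntegral.integral_of_le zero_le_one, integral_integral_swap hprod]
    congr 1
    ext x
    rw [intervalIntegral.integral_of_le zero_le_one, integral_smul]
  rw [hasFDerivAt_iff_isLittleO_nhds_zero, Asymptotics.isLittleO_iff]
  intro ε hε
  -- The remainder at `y` is the mean of `gy y (x + s y) - gy y x`; each of the three components
  -- contributes at most `‖y‖ ε/3`.
  have hev : ∀ᶠ z in 𝓝 x, ∀ k, ‖g k z - g k x‖ ≤ ε / 3 := by
    rw [eventually_all]
    intro k
    have := (hgc k).tendsto x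
    rw [Metric.tendsto_nhds] at this
    filter_upwards [this (ε / 3) (by positivity)] with z hz
    rw [← dist_eq_norm]
    exact hz.le
  obtain ⟨δ, hδ, hball⟩ := Metric.eventually_nhds_iff.1 hev
  filter_upwards [Metric.ball_mem_nhds (0 : E3) hδ] with y hy
  rw [hftc y x]
  have e1 : (∑ k, (EuclideanSpace.proj k : E3 →L[ℝ] ℝ).smulRight (g k x)) y =
      ∫ s in (0 : ℝ)..1, gy y x := by
    simp [hgy]
  rw [e1, ← intervalIntegral.integral_sub
    ((Continuous.intervalIntegrable (by have := hgyc y; fun_prop) _ _)) (by simp)]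
  have h5 := intervalIntegral.norm_integral_le_of_norm_le_const (a := (0 : ℝ)) (b := 1)
    (f := fun s : ℝ => gy y (x + s • y) - gy y x) (C := ε * ‖y‖) ?_
  · simpa using h5
  intro s hs
  rw [uIoc_of_le zero_le_one] at hs
  have hdist : dist (x + s • y) x < δ := by
    rw [dist_eq_norm, add_sub_cancel_left, norm_smul, Real.norm_eq_abs, abs_of_pos hs.1]
    rw [mem_ball_zero_iff] at hy
    calc s * ‖y‖ ≤ 1 * ‖y‖ := by gcongr; exact hs.2
      _ < δ := by rwa [one_mul]
  rw [hgy]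
  simp only
  rw [← Finset.sum_sub_distrib]
  refine (norm_sum_le _ _).trans ?_
  calc ∑ k, ‖(y k : ℂ) * g k (x + s • y) - (y k : ℂ) * g k x‖ ≤ ∑ _k : Fin 3, ‖y‖ * (ε / 3) := by
        refine Finset.sum_le_sum fun k _ => ?_
        rw [← mul_sub, norm_mul, Complex.norm_real]
        gcongr
        · exact PiLp.norm_apply_le y k
        · exact hball hdist k
    _ = ε * ‖y‖ := by
        rw [Finset.sum_const, Finset.card_univ, Fintype.card_fin, nsmul_eq_mul]
        push_cast
        ring

/-- Families of continuous functions which are uniformly bounded and continuous in time for the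
supremum norm. -/
structure IsTame (I : Set ℝ) (f : ℝ → E3 → ℝ) : Prop where
  continuous : ∀ t ∈ I, Continuous (f t)
  bounded : ∃ C, ∀ t ∈ I, ∀ x, |f t x| ≤ C
  uniform : ∀ t ∈ I, TendstoUniformly f (f t) (𝓝[I] t)

lemma ContinuousInSobolev.continuousOn {I : Set ℝ} {m : ℕ} {F : ℝ → L2 E3}
    (h : ContinuousInSobolev I m F) : ContinuousOn F I := by
  cases m with
  | zero => exact h
  | succ m => exact h.1

/-- The second derivatives of a family in `C(I; H²)`. -/
lemma ContinuousInSobolev.exists_second {I : Set ℝ} {m : ℕ} {F : ℝ → L2 E3}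
    (h : ContinuousInSobolev I (m + 2) F) : ∃ H G : Fin 3 → ℝ → L2 E3,
      (∀ k, ∀ t ∈ I, IsWeakDeriv (unitVec k) (F t) (H k t)) ∧
      (∀ k, ∀ t ∈ I, IsWeakDeriv (unitVec k) (H k t) (G k t)) ∧ ∀ k, ContinuousOn (G k) I := by
  choose H hH hH' using fun k : Fin 3 => h.2 (unitVec k)
  choose G hG hG' using fun k : Fin 3 => (hH' k).2 (unitVec k)
  exact ⟨H, G, hH, hG, fun k => (hG' k).continuousOn⟩

lemma IsWeakDeriv.sub {v : E3} {f₁ f₂ g₁ g₂ : L2 E3} (h₁ : IsWeakDeriv v f₁ g₁)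
    (h₂ : IsWeakDeriv v f₂ g₂) : IsWeakDeriv v (f₁ - f₂) (g₁ - g₂) := by
  unfold IsWeakDeriv at *
  have e : ∀ a b : L2 E3, ((a - b : L2 E3) : 𝓢'(E3, ℂ)) = (a : 𝓢'(E3, ℂ)) - (b : 𝓢'(E3, ℂ)) :=
    fun a b => map_sub (Lp.toTemperedDistributionCLM ℂ volume 2) a b
  rw [e, e, ← h₁, ← h₂]
  ext φ
  simp

/-- The Sobolev estimate is applied to `F t`, with compactness of the time interval for the uniform
bound, and to the differences `F τ - F t` for the uniform continuity in time. -/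
lemma RealContinuousInSobolev.isTame {T : ℝ} {m : ℕ} {f : ℝ → E3 → ℝ}
    (h : RealContinuousInSobolev (Icc 0 T) (m + 2) f) (hc : ∀ t ∈ Icc 0 T, Continuous (f t)) :
    IsTame (Icc 0 T) f := by
  obtain ⟨F, hF, hS⟩ := h
  obtain ⟨H, G, hH, hG, hGc⟩ := hS.exists_second
  obtain ⟨C, hC0, hC⟩ := exists_sobolev_const
  refine ⟨hc, ?_, fun t ht => ?_⟩
  · have hcont : ContinuousOn (fun t => C * (‖F t‖ + ∑ k, ‖G k t‖)) (Icc 0 T) :=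
      continuousOn_const.mul (hS.continuousOn.norm.add
        (continuousOn_finsetSum _ fun k _ => (hGc k).norm))
    obtain ⟨B, hB⟩ := isCompact_Icc.bddAbove_image hcont
    refine ⟨B, fun t ht x => ?_⟩
    obtain ⟨g, hgc, hg, hgb⟩ := hC (F t) (fun k => H k t) (fun k => G k t) (fun k => hH k t ht)
      fun k => hG k t ht
    have e : (fun x => (f t x : ℂ)) = g := by
      refine Measure.eq_of_ae_eq (μ := (volume : Measure E3)) ?_
        (Complex.continuous_ofReal.comp (hc t ht)) hgc
      filter_upwards [hF t ht, hg] with x h1 h2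
      rw [← h1, h2]
    have h1 := hgb x
    rw [← e, Complex.norm_real, Real.norm_eq_abs] at h1
    exact h1.trans (hB ⟨t, ht, rfl⟩)
  · rw [Metric.tendstoUniformly_iff]
    intro ε hε
    have hlim : Tendsto (fun τ => C * (‖F τ - F t‖ + ∑ k, ‖G k τ - G k t‖)) (𝓝[Icc 0 T] t)
        (𝓝 (C * (‖F t - F t‖ + ∑ k, ‖G k t - G k t‖))) := by
      refine (Tendsto.add ?_ (tendsto_finsetSum _ fun k _ => ?_)).const_mul C
      · exact ((hS.continuousOn t ht).sub continuousWithinAt_const).norm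
      · exact ((hGc k t ht).sub continuousWithinAt_const).norm
    simp only [sub_self, norm_zero, Finset.sum_const_zero, add_zero, mul_zero] at hlim
    filter_upwards [hlim.eventually (gt_mem_nhds hε), self_mem_nhdsWithin] with τ h1 hτ x
    obtain ⟨g, hgc, hg, hgb⟩ := hC (F τ - F t) (fun k => H k τ - H k t) (fun k => G k τ - G k t)
      (fun k => (hH k τ hτ).sub (hH k t ht)) fun k => (hG k τ hτ).sub (hG k t ht)
    have e : (fun x => ((f τ x - f t x : ℝ) : ℂ)) = g := by
      refine Measure.eq_of_ae_eq (μ := (volume : Measure E3)) ?_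
        (Complex.continuous_ofReal.comp ((hc τ hτ).sub (hc t ht))) hgc
      filter_upwards [hF t ht, hF τ hτ, hg, Lp.coeFn_sub (F τ) (F t)] with x h1 h2 h3 h4
      rw [← h3, h4, Pi.sub_apply, h1, h2]
      push_cast
      ring
    have h2 := hgb x
    rw [← e, Complex.norm_real] at h2
    rw [dist_comm, Real.dist_eq, ← Real.norm_eq_abs]
    exact h2.trans_lt h1

/-- The third order of regularity puts the weak gradient itself into `H²`; its continuous bounded
representatives are then the classical derivatives. -/
lemma RealContinuousInSobolev.pderiv {T : ℝ} {m : ℕ} {f : ℝ → E3 → ℝ}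
    (h : RealContinuousInSobolev (Icc 0 T) (m + 3) f) (hc : ∀ t ∈ Icc 0 T, Continuous (f t)) :
    (∀ t ∈ Icc 0 T, Differentiable ℝ (f t)) ∧
    ∀ k, RealContinuousInSobolev (Icc 0 T) (m + 2) (fun t => pderiv k (f t)) ∧
      ∀ t ∈ Icc 0 T, Continuous (QuantumEuler.pderiv k (f t)) := by
  obtain ⟨F, hF, hS⟩ := h
  choose G hG hGS using fun k : Fin 3 => hS.2 (unitVec k)
  obtain ⟨C, hC0, hC⟩ := exists_sobolev_const
  have key : ∀ t ∈ Icc 0 T, Differentiable ℝ (f t) ∧ ∀ k,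
      (∀ᵐ x, G k t x = (QuantumEuler.pderiv k (f t) x : ℂ)) ∧
        Continuous (QuantumEuler.pderiv k (f t)) := by
    intro t ht
    have hg : ∀ k, ∃ g : E3 → ℂ, Continuous g ∧ (∀ᵐ x, G k t x = g x) ∧ ∃ B, ∀ x, ‖g x‖ ≤ B := by
      intro k
      obtain ⟨H', G', hH', hG', -⟩ := (hGS k).exists_second
      obtain ⟨g, h1, h2, h3⟩ := hC (G k t) (fun l => H' l t) (fun l => G' l t)
        (fun l => hH' l t ht) (fun l => hG' l t ht)
      exact ⟨g, h1, h2, _, h3⟩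
    choose g hgc hg B hB using hg
    have hD := fun x => hasFDerivAt_of_isWeakDeriv (Complex.continuous_ofReal.comp (hc t ht))
      (hF t ht) (fun k => hG k t ht) hgc hg (C := ∑ k, B k) (fun k x => (hB k x).trans
        (Finset.single_le_sum (f := B) (fun j _ => (norm_nonneg _).trans (hB j 0))
          (Finset.mem_univ k))) x
    have hDr : ∀ x, HasFDerivAt (f t) (Complex.reCLM.comp
        (∑ k, (EuclideanSpace.proj k : E3 →L[ℝ] ℝ).smulRight (g k x))) x := fun x =>
      Complex.reCLM.hasFDerivAt.comp x (hD x)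
    have hgp : ∀ k x, g k x = (QuantumEuler.pderiv k (f t) x : ℂ) := by
      intro k x
      have h1 := (Complex.ofRealCLM.hasFDerivAt.comp x (hDr x)).unique (hD x)
      have h2 := congrArg (fun L : E3 →L[ℝ] ℂ => L (unitVec k)) h1
      have h3 : (∑ j, (EuclideanSpace.proj j : E3 →L[ℝ] ℝ).smulRight (g j x)) (unitVec k) =
          g k x := by
        simp [unitVec]
      rw [h3] at h2
      rw [QuantumEuler.pderiv, (hDr x).fderiv, ← h2]
      rfl
    refine ⟨fun x => (hDr x).differentiableAt, fun k => ⟨?_, ?_⟩⟩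
    · filter_upwards [hg k] with x hx
      rw [hx, hgp]
    · have : QuantumEuler.pderiv k (f t) = fun x => (g k x).re := by
        ext x
        rw [hgp, Complex.ofReal_re]
      rw [this]
      exact Complex.continuous_re.comp (hgc k)
  exact ⟨fun t ht => (key t ht).1, fun k => ⟨⟨G k, fun t ht => ((key t ht).2 k).1, hGS k⟩,
    fun t ht => ((key t ht).2 k).2⟩⟩

lemma RealContinuousInSobolev.memLp {I : Set ℝ} {m : ℕ} {f : ℝ → E3 → ℝ}
    (h : RealContinuousInSobolev I m f) {t : ℝ} (ht : t ∈ I) : MemLp (f t) 2 := by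
  obtain ⟨F, hF, -⟩ := h
  refine MemLp.ae_eq ?_ (Lp.memLp (F t)).re
  filter_upwards [hF t ht] with x hx
  simp [hx]

/-- Continuity in time in the norm of `L²`. -/
lemma RealContinuousInSobolev.tendsto_integral_sq {I : Set ℝ} {m : ℕ} {f : ℝ → E3 → ℝ}
    (h : RealContinuousInSobolev I m f) {t : ℝ} (ht : t ∈ I) :
    Tendsto (fun τ => ∫ x, (f τ x - f t x) ^ 2) (𝓝[I] t) (𝓝 0) := by
  obtain ⟨F, hF, hS⟩ := h
  have h1 : Tendsto (fun τ => ‖F τ - F t‖ ^ 2) (𝓝[I] t) (𝓝 (‖F t - F t‖ ^ 2)) :=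
    ((hS.continuousOn t ht).sub continuousWithinAt_const).norm.pow 2
  rw [sub_self, norm_zero, zero_pow two_ne_zero] at h1
  refine h1.congr' ?_
  filter_upwards [self_mem_nhdsWithin] with τ hτ
  rw [norm_sq_eq_integral]
  refine integral_congr_ae ?_
  filter_upwards [hF t ht, hF τ hτ, Lp.coeFn_sub (F τ) (F t)] with x h1 h2 h3
  rw [h3, Pi.sub_apply, h1, h2, ← Complex.ofReal_sub, Complex.norm_real, Real.norm_eq_abs, sq_abs]

end Regularity

/-! ### Commutators of multiplications and first order operators with the Laplacian and with bounded
potentials. -/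

section Commutators

variable {n : ℕ}

/-- A function of the position of the first particle. -/
def lift0 (a : E3 → ℝ) (X : Config (n + 2)) : ℝ := a (X 0)

/-- Bounded differentiable functions with bounded partial derivatives. -/
structure IsC1b (a : E3 → ℝ) : Prop where
  diff : Differentiable ℝ a
  bdd : ∃ C, ∀ x, |a x| ≤ C
  dbdd : ∀ k, ∃ C, ∀ x, |pderiv k a x| ≤ C

lemma measurable_pderiv (k : Fin 3) (a : E3 → ℝ) : Measurable (pderiv k a) :=
  measurable_fderiv_apply_const ℝ a (unitVec k)

lemma IsC1b.isBddMeas {a : E3 → ℝ} (ha : IsC1b a) : IsBddMeas a :=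
  ⟨ha.diff.continuous.measurable, ha.bdd⟩

lemma IsC1b.isBddMeas_pderiv {a : E3 → ℝ} (ha : IsC1b a) (k : Fin 3) : IsBddMeas (pderiv k a) :=
  ⟨measurable_pderiv k a, ha.dbdd k⟩

lemma IsBddMeas.lift0 {a : E3 → ℝ} (ha : IsBddMeas a) :
    IsBddMeas (lift0 a : Config (n + 2) → ℝ) :=
  ⟨ha.meas.comp (measurable_pi_apply 0), ha.bdd.imp fun _ hC X => hC (X 0)⟩

lemma Differentiable.hasDerivAt_line {a : E3 → ℝ} (ha : Differentiable ℝ a) (k : Fin 3) (x : E3) :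
    HasDerivAt (fun h : ℝ => a (x + h • unitVec k)) (pderiv k a x) 0 := by
  have h2 : HasFDerivAt a (fderiv ℝ a x) (x + (0 : ℝ) • unitVec k) := by
    rw [zero_smul, add_zero]; exact (ha x).hasFDerivAt
  have h1 : HasDerivAt (fun h : ℝ => x + h • unitVec k) (unitVec k) 0 := by
    simpa using ((hasDerivAt_id (0 : ℝ)).smul_const (unitVec k)).const_add x
  exact h2.comp_hasDerivAt 0 h1

lemma IsC1b.hasBddLineDeriv_zero {a : E3 → ℝ} (ha : IsC1b a) (k : Fin 3) :
    HasBddLineDeriv (particleDir (0 : Fin (n + 2)) k) (QuantumEuler.lift0 a)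
      (QuantumEuler.lift0 (pderiv k a)) where
  fn := ha.isBddMeas.lift0
  deriv := (ha.isBddMeas_pderiv k).lift0
  hasDeriv X := by
    simpa [QuantumEuler.lift0, particleDir] using Differentiable.hasDerivAt_line ha.diff k (X 0)

lemma IsC1b.hasBddLineDeriv_of_ne {a : E3 → ℝ} (ha : IsC1b a) {j : Fin (n + 2)} (hj : j ≠ 0)
    (k : Fin 3) :
    HasBddLineDeriv (particleDir j k) (QuantumEuler.lift0 a) (fun _ => 0) where
  fn := ha.isBddMeas.lift0
  deriv := ⟨measurable_const, 0, by simp⟩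
  hasDeriv X := by
    simp only [QuantumEuler.lift0, particleDir, Pi.add_apply, Pi.smul_apply,
      Pi.single_eq_of_ne hj.symm, smul_zero, add_zero]
    exact hasDerivAt_const _ _

lemma mulL_zero {α : Type*} [MeasureSpace α] (f : L2 α) : mulL (fun _ => (0 : ℝ)) f = 0 := by
  apply Lp.ext
  filter_upwards [coeFn_mulL (mulMem_const 0 f), Lp.coeFn_zero ℂ 2 (volume : Measure α)] with x h1 h2
  rw [h1, h2]
  simp

lemma inner_mulL_self_im {α : Type*} [MeasureSpace α] {a : α → ℝ} {f : L2 α} (h : MulMem a f) :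
    (inner ℂ (mulL a f) f).im = 0 := by
  rw [inner_mulL_comm h h, inner_mulL_self h, Complex.ofReal_im]

/-- First and second derivatives of an element of `H²`. -/
structure IsH2 (ψ : WaveFn (n + 2)) (d : Fin (n + 2) → Fin 3 → WaveFn (n + 2))
    (d2 : Fin (n + 2) → Fin 3 → Fin (n + 2) → Fin 3 → WaveFn (n + 2)) : Prop where
  first : ∀ j k, HasL2Deriv (particleDir j k) ψ (d j k)
  second : ∀ j k i l, HasL2Deriv (particleDir j k) (d i l) (d2 j k i l)
  comm : ∀ j k i l, d2 j k i l = d2 i l j k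

variable {ψ : WaveFn (n + 2)} {d : Fin (n + 2) → Fin 3 → WaveFn (n + 2)}
  {d2 : Fin (n + 2) → Fin 3 → Fin (n + 2) → Fin 3 → WaveFn (n + 2)}

/-- One integration by parts produces `⟨a ∂ψ, ∂ψ⟩`, which is real, and the term in which the
derivative falls on `a`. -/
lemma IsH2.im_inner_zero (h : IsH2 ψ d d2) {a : E3 → ℝ} (ha : IsC1b a) (k : Fin 3) :
    (inner ℂ (mulL (lift0 a) ψ) (d2 0 k 0 k)).im =
      -(inner ℂ (mulL (lift0 (pderiv k a)) ψ) (d 0 k)).im := by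
  have h1 := ((h.first 0 k).mulL (ha.hasBddLineDeriv_zero k)).inner_eq_neg (h.second 0 k 0 k)
  rw [inner_add_left] at h1
  have h2 := congrArg Complex.im h1
  rw [Complex.add_im, inner_mulL_self_im (ha.isBddMeas.lift0.mulMem _), Complex.neg_im] at h2
  linarith

/-- Derivatives in the other particles do not see `a`, so only the real term is left. -/
lemma IsH2.im_inner_of_ne (h : IsH2 ψ d d2) {a : E3 → ℝ} (ha : IsC1b a) {j : Fin (n + 2)}
    (hj : j ≠ 0) (k : Fin 3) :
    (inner ℂ (mulL (lift0 a) ψ) (d2 j k j k)).im = 0 := by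
  have h1 := ((h.first j k).mulL (ha.hasBddLineDeriv_of_ne hj k)).inner_eq_neg (h.second j k j k)
  rw [inner_add_left, mulL_zero, inner_zero_left, zero_add] at h1
  have h2 := congrArg Complex.im h1
  rw [inner_mulL_self_im (ha.isBddMeas.lift0.mulMem _), Complex.neg_im] at h2
  linarith

/-- Smooth velocity fields, with the bounds on derivatives needed for commutators. -/
structure IsGoodField (w : Fin 3 → E3 → ℝ) : Prop where
  comp : ∀ k, IsC1b (w k)
  div : IsC1b (fun x => ∑ k, pderiv k (w k) x)
  ddiv : ∀ l, IsC1b (pderiv l (fun x => ∑ k, pderiv k (w k) x))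

/-- The divergence of a field given by its components. -/
noncomputable def fieldDiv (w : Fin 3 → E3 → ℝ) (x : E3) : ℝ := ∑ k, pderiv k (w k) x

/-- The antisymmetric first order operator `w · ∇ + ½ div w` in the first particle. -/
noncomputable def antiOp (w : Fin 3 → E3 → ℝ) (f : WaveFn (n + 2)) (fd : Fin 3 → WaveFn (n + 2)) :
    WaveFn (n + 2) :=
  ∑ k, mulL (lift0 (w k)) (fd k) + (1 / 2 : ℂ) • mulL (lift0 (fieldDiv w)) f

lemma mulL_finset_sum_left {α ι : Type*} [MeasureSpace α] (s : Finset ι) {a : ι → α → ℝ}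
    (ha : ∀ i, IsBddMeas (a i)) (f : L2 α) :
    ∑ i ∈ s, mulL (a i) f = mulL (fun x => ∑ i ∈ s, a i x) f := by
  classical
  induction s using Finset.induction_on with
  | empty => simp [mulL_zero]
  | insert i s hi ih =>
    have hb : IsBddMeas (fun x => ∑ i ∈ s, a i x) := by
      choose C hC using fun i => (ha i).bdd
      refine ⟨Finset.measurable_fun_sum _ fun i _ => (ha i).meas, ∑ i ∈ s, C i, fun x => ?_⟩
      exact (Finset.abs_sum_le_sum_abs _ _).trans (Finset.sum_le_sum fun i _ => hC i x)
    have hm : IsBddMeas (fun x => -∑ i ∈ s, a i x) :=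
      ⟨hb.meas.neg, hb.bdd.imp fun C hC x => by rw [abs_neg]; exact hC x⟩
    rw [Finset.sum_insert hi, ih]
    have e := mulL_sub_left ((ha i).mulMem f) (hm.mulMem f)
    have e2 := mulL_sub_left (mulMem_const 0 f) (hb.mulMem f)
    simp only [zero_sub, mulL_zero] at e2
    rw [e2] at e
    simp only [sub_neg_eq_add] at e
    rw [← e]
    congr 1
    ext x
    rw [Finset.sum_insert hi]

/-- The term `½ div w` is half of what integrating `w·∇` by parts leaves behind, and so balances the
two sides. Consequently `⟨f, A f⟩` is imaginary, and its imaginary part is the momentum of `f` along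
`w`. -/
lemma antiOp_antisymm {w : Fin 3 → E3 → ℝ} (hw : IsGoodField w) {f g : WaveFn (n + 2)}
    {fd gd : Fin 3 → WaveFn (n + 2)} (hf : ∀ k, HasL2Deriv (particleDir 0 k) f (fd k))
    (hg : ∀ k, HasL2Deriv (particleDir 0 k) g (gd k)) :
    inner ℂ (antiOp w f fd) g = -inner ℂ f (antiOp w g gd) := by
  have hdm : ∀ q : WaveFn (n + 2), MulMem (lift0 (fieldDiv w)) q := fun q =>
    hw.div.isBddMeas.lift0.mulMem q
  have h1 : ∀ k, inner ℂ (mulL (lift0 (w k)) (fd k)) g =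
      -inner ℂ f (mulL (lift0 (pderiv k (w k))) g) - inner ℂ f (mulL (lift0 (w k)) (gd k)) := by
    intro k
    rw [inner_mulL_comm ((hw.comp k).isBddMeas.lift0.mulMem _)
      ((hw.comp k).isBddMeas.lift0.mulMem _),
      (hf k).inner_eq_neg ((hg k).mulL ((hw.comp k).hasBddLineDeriv_zero k)), inner_add_right]
    ring
  have h2 : ∑ k, inner ℂ f (mulL (lift0 (pderiv k (w k))) g) =
      inner ℂ f (mulL (lift0 (fieldDiv w)) g) := by
    rw [← inner_sum, mulL_finset_sum_left _ fun k => ((hw.comp k).isBddMeas_pderiv k).lift0]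
    rfl
  rw [antiOp, antiOp, inner_add_left, inner_add_right, sum_inner, inner_sum, inner_smul_left,
    inner_smul_right, Finset.sum_congr rfl fun k _ => h1 k, Finset.sum_sub_distrib,
    Finset.sum_neg_distrib, h2, inner_mulL_comm (hdm _) (hdm _)]
  simp only [map_div₀, map_one, Complex.conj_ofNat]
  ring

lemma antiOp_re_self {w : Fin 3 → E3 → ℝ} (hw : IsGoodField w) {f : WaveFn (n + 2)}
    {fd : Fin 3 → WaveFn (n + 2)} (hf : ∀ k, HasL2Deriv (particleDir 0 k) f (fd k)) :
    (inner ℂ (antiOp w f fd) f).re = 0 := by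
  have h1 := congrArg Complex.re (antiOp_antisymm hw hf hf)
  rw [Complex.neg_re, ← inner_conj_symm, Complex.conj_re] at h1
  rw [← inner_conj_symm, Complex.conj_re]
  linarith

lemma antiOp_add {w : Fin 3 → E3 → ℝ} (hw : IsGoodField w) {f g : WaveFn (n + 2)}
    {fd gd : Fin 3 → WaveFn (n + 2)} :
    antiOp w (f + g) (fun k => fd k + gd k) = antiOp w f fd + antiOp w g gd := by
  have hdm : ∀ q : WaveFn (n + 2), MulMem (lift0 (fieldDiv w)) q := fun q =>
    hw.div.isBddMeas.lift0.mulMem q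
  have hm : ∀ k (q : WaveFn (n + 2)), MulMem (lift0 (w k)) q := fun k q =>
    (hw.comp k).isBddMeas.lift0.mulMem q
  simp only [antiOp, mulL_add (hm _ _) (hm _ _), mulL_add (hdm _) (hdm _), Finset.sum_add_distrib,
    smul_add]
  abel

/-- The derivative is `A ∂_l ψ + [∂_l, A] ψ`, arranged so that the first summand has no real part
when paired with `∂_l ψ`. Equality of mixed second derivatives is used. -/
lemma hasL2Deriv_antiOp_zero (h : IsH2 ψ d d2) {w : Fin 3 → E3 → ℝ} (hw : IsGoodField w)
    (l : Fin 3) :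
    HasL2Deriv (particleDir 0 l) (antiOp w ψ (d 0))
      (antiOp w (d 0 l) (fun k => d2 0 k 0 l) + (∑ k, mulL (lift0 (pderiv l (w k))) (d 0 k) +
        (1 / 2 : ℂ) • mulL (lift0 (pderiv l (fieldDiv w))) ψ)) := by
  have h1 := (HasL2Deriv.sum (s := Finset.univ) fun k _ =>
      (h.second 0 l 0 k).mulL ((hw.comp k).hasBddLineDeriv_zero l)).add
    (((h.first 0 l).mulL (hw.div.hasBddLineDeriv_zero l)).const_smul (1 / 2 : ℂ))
  have e : antiOp w (d 0 l) (fun k => d2 0 k 0 l) +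
      (∑ k, mulL (lift0 (pderiv l (w k))) (d 0 k) +
        (1 / 2 : ℂ) • mulL (lift0 (pderiv l (fieldDiv w))) ψ) =
      ∑ k, (mulL (lift0 (pderiv l (w k))) (d 0 k) + mulL (lift0 (w k)) (d2 0 l 0 k)) +
        (1 / 2 : ℂ) • (mulL (lift0 (pderiv l (fieldDiv w))) ψ +
          mulL (lift0 (fieldDiv w)) (d 0 l)) := by
    simp only [antiOp, Finset.sum_add_distrib, smul_add, h.comm 0 l]
    abel
  rw [e]
  exact h1

/-- The coefficients of `A` depend on `x_1` only, so there is no commutator. -/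
lemma hasL2Deriv_antiOp_of_ne (h : IsH2 ψ d d2) {w : Fin 3 → E3 → ℝ} (hw : IsGoodField w)
    {j : Fin (n + 2)} (hj : j ≠ 0) (l : Fin 3) :
    HasL2Deriv (particleDir j l) (antiOp w ψ (d 0))
      (antiOp w (d j l) (fun k => d2 0 k j l)) := by
  have h1 := (HasL2Deriv.sum (s := Finset.univ) fun k _ =>
      (h.second j l 0 k).mulL ((hw.comp k).hasBddLineDeriv_of_ne hj l)).add
    (((h.first j l).mulL (hw.div.hasBddLineDeriv_of_ne hj l)).const_smul (1 / 2 : ℂ))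
  simp only [mulL_zero, zero_add, h.comm j l] at h1
  exact h1

lemma re_inner_mulL_deriv {f f' : WaveFn (n + 2)} {b : E3 → ℝ} (hb : IsC1b b) (l : Fin 3)
    (hf : HasL2Deriv (particleDir 0 l) f f') :
    (inner ℂ (mulL (lift0 b) f) f').re = -(1 / 2) * ∫ X, pderiv l b (X 0) * ‖f X‖ ^ 2 := by
  have hm : ∀ q : WaveFn (n + 2), MulMem (lift0 b) q := fun q => hb.isBddMeas.lift0.mulMem q
  have hm' : MulMem (lift0 (pderiv l b)) f := (hb.isBddMeas_pderiv l).lift0.mulMem f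
  have h1 := congrArg Complex.re ((hf.mulL (hb.hasBddLineDeriv_zero l)).inner_eq_neg hf)
  rw [inner_add_left, Complex.add_re, Complex.neg_re, inner_mulL_comm hm' hm',
    inner_mulL_self hm', Complex.ofReal_re, inner_mulL_comm (hm f') (hm f),
    ← inner_conj_symm, Complex.conj_re] at h1
  have e : ∫ X, lift0 (pderiv l b) X * ‖f X‖ ^ 2 = ∫ X, pderiv l b (X 0) * ‖f X‖ ^ 2 := rfl
  rw [e] at h1
  linarith

/-- The commutator of `w · ∇ + ½ div w` with the second derivatives in the first particle. -/
lemma IsH2.re_inner_antiOp_zero (h : IsH2 ψ d d2) {w : Fin 3 → E3 → ℝ} (hw : IsGoodField w)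
    (l : Fin 3) :
    (inner ℂ (antiOp w ψ (d 0)) (d2 0 l 0 l)).re =
      -(∑ k, (inner ℂ (mulL (lift0 (pderiv l (w k))) (d 0 k)) (d 0 l)).re) +
        1 / 4 * ∫ X, pderiv l (pderiv l (fieldDiv w)) (X 0) * ‖ψ X‖ ^ 2 := by
  -- By parts, `⟨Aψ, ∂_l²ψ⟩ = -⟨∂_l Aψ, ∂_l ψ⟩`, and `⟨A ∂_l ψ, ∂_l ψ⟩` has zero real part by
  -- antisymmetry.
  have h1 := congrArg Complex.re
    ((hasL2Deriv_antiOp_zero h hw l).inner_eq_neg (h.second 0 l 0 l))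
  rw [inner_add_left, Complex.add_re, antiOp_re_self hw fun k => h.second 0 k 0 l, inner_add_left,
    Complex.add_re, sum_inner, Complex.re_sum, inner_smul_left, Complex.neg_re] at h1
  -- The coefficient `1/4` is the `½` in `A` times the `½` in `Re(conj ψ ∂_l ψ) = ½ ∂_l|ψ|²`.
  have h2 := re_inner_mulL_deriv (b := pderiv l (fieldDiv w)) (hw.ddiv l) l (h.first 0 l)
  have h3 : ((starRingEnd ℂ) (1 / 2 : ℂ) *
      inner ℂ (mulL (lift0 (pderiv l (fieldDiv w))) ψ) (d 0 l)).re =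
      1 / 2 * (inner ℂ (mulL (lift0 (pderiv l (fieldDiv w))) ψ) (d 0 l)).re := by
    have : (starRingEnd ℂ) (1 / 2 : ℂ) = ((1 / 2 : ℝ) : ℂ) := by simp [Complex.conj_ofNat]
    rw [this, Complex.re_ofReal_mul]
  rw [h3, h2] at h1
  linarith

/-- The kinetic energies of the other particles exert no force on the first one. -/
lemma IsH2.re_inner_antiOp_of_ne (h : IsH2 ψ d d2) {w : Fin 3 → E3 → ℝ} (hw : IsGoodField w)
    {j : Fin (n + 2)} (hj : j ≠ 0) (l : Fin 3) :
    (inner ℂ (antiOp w ψ (d 0)) (d2 j l j l)).re = 0 := by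
  have h1 := congrArg Complex.re
    ((hasL2Deriv_antiOp_of_ne h hw hj l).inner_eq_neg (h.second j l j l))
  rw [antiOp_re_self hw fun k => h.second 0 k j l, Complex.neg_re] at h1
  linarith

/-- The commutator of `w · ∇ + ½ div w` with a bounded differentiable potential. -/
lemma re_inner_antiOp_potential {w : Fin 3 → E3 → ℝ} (hw : IsGoodField w)
    {fd : Fin 3 → WaveFn (n + 2)} (hf : ∀ k, HasL2Deriv (particleDir 0 k) ψ (fd k))
    {U : Config (n + 2) → ℝ} {U' : Fin 3 → Config (n + 2) → ℝ}
    (hU : ∀ k, HasBddLineDeriv (particleDir 0 k) U (U' k)) :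
    2 * (inner ℂ (antiOp w ψ fd) (mulL U ψ)).re =
      -∑ k, ∫ X, w k (X 0) * U' k X * ‖ψ X‖ ^ 2 := by
  have hUm : ∀ q : WaveFn (n + 2), MulMem U q := fun q => (hU 0).fn.mulMem q
  have hwm : ∀ k (q : WaveFn (n + 2)), MulMem (lift0 (w k)) q := fun k q =>
    (hw.comp k).isBddMeas.lift0.mulMem q
  have hdm : ∀ q : WaveFn (n + 2), MulMem (lift0 (fieldDiv w)) q := fun q =>
    hw.div.isBddMeas.lift0.mulMem q
  have hb2 : ∀ k, IsBddMeas (fun X => lift0 (w k) X * U' k X) := by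
    intro k
    obtain ⟨A, hA⟩ := (hw.comp k).bdd
    obtain ⟨B, hB⟩ := (hU k).deriv.bdd
    refine ⟨((hw.comp k).isBddMeas.lift0.meas).mul (hU k).deriv.meas, A * B, fun X => ?_⟩
    rw [abs_mul]
    exact mul_le_mul (hA _) (hB _) (abs_nonneg _) ((abs_nonneg _).trans (hA (X 0)))
  -- Antisymmetry is applied to the pair `ψ`, `Uψ`. Since `A(Uψ) = U Aψ + (w·∇U)ψ`, moving `U`
  -- across the inner product leaves twice the real part on one side.
  have h1 := congrArg Complex.re (antiOp_antisymm hw hf fun k => (hf k).mulL (hU k))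
  have comm : ∀ (a : Config (n + 2) → ℝ) (_ : ∀ q : WaveFn (n + 2), MulMem a q)
      (q : WaveFn (n + 2)), inner ℂ ψ (mulL a (mulL U q)) = inner ℂ (mulL U ψ) (mulL a q) := by
    intro a ha q
    have : mulL a (mulL U q) = mulL U (mulL a q) := by
      apply Lp.ext
      filter_upwards [coeFn_mulL (ha (mulL U q)), coeFn_mulL (hUm (mulL a q)), coeFn_mulL (ha q),
        coeFn_mulL (hUm q)] with x h1 h2 h3 h4
      rw [h1, h2, h3, h4]
      ring
    rw [this, inner_mulL_comm (hUm _) (hUm _)]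
  have h2 : inner ℂ ψ (antiOp w (mulL U ψ) (fun k => mulL (U' k) ψ + mulL U (fd k))) =
      inner ℂ (mulL U ψ) (antiOp w ψ fd) +
        ∑ k, ((∫ X, w k (X 0) * U' k X * ‖ψ X‖ ^ 2 : ℝ) : ℂ) := by
    simp only [antiOp, mulL_add (hwm _ _) (hwm _ _), inner_add_right, inner_sum, inner_smul_right,
      Finset.sum_add_distrib, comm _ hdm, comm _ (hwm _)]
    rw [Finset.sum_congr rfl fun k _ => by
      rw [mulL_mulL ((hU k).deriv.mulMem ψ) ((hb2 k).mulMem ψ), inner_mulL_self ((hb2 k).mulMem ψ)]]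
    simp only [lift0]
    ring
  rw [h2, Complex.neg_re, Complex.add_re, ← inner_conj_symm (mulL U ψ), Complex.conj_re,
    ← Complex.ofReal_sum, Complex.ofReal_re] at h1
  linarith

end Commutators

/-! ### Time derivatives of expectations of multiplication operators. -/

section TimeDerivatives

variable {α : Type*} [MeasureSpace α]

lemma im_inner_mulL {a : α → ℝ} {f g : L2 α} (hg : MulMem a g) :
    (inner ℂ f (mulL a g)).im = ∫ x, a x * ((starRingEnd ℂ) (f x) * g x).im := by
  rw [inner_mulL hg]
  have := (integral_im (integrable_inner_mulL (f := f) hg))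
  simp only [RCLike.im_to_complex] at this
  rw [← this]
  simp only [Complex.im_ofReal_mul]

/-- The change of a quadratic expression due to the motion of the state. -/
lemma hasDerivWithinAt_quadratic_state {I : Set ℝ} {t : ℝ} {ψ : ℝ → L2 α} {φ : L2 α}
    (hψ : HasDerivWithinAt ψ φ I t) {f : ℝ → α → ℝ} {C : ℝ} (ht : t ∈ I)
    (hf : ∀ τ ∈ I, Measurable (f τ) ∧ ∀ x, |f τ x| ≤ C)
    (hlim : ∀ x, Tendsto (fun τ => f τ x) (𝓝[I] t) (𝓝 (f t x))) :
    HasDerivWithinAt (fun τ => (∫ x, f τ x * ‖ψ τ x‖ ^ 2) - ∫ x, f τ x * ‖ψ t x‖ ^ 2)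
      (2 * (inner ℂ (mulL (f t) (ψ t)) φ).re) I t := by
  have hm : ∀ τ ∈ I, ∀ q : L2 α, MulMem (f τ) q := fun τ hτ q =>
    IsBddMeas.mulMem ⟨(hf τ hτ).1, C, (hf τ hτ).2⟩ q
  have hle : 𝓝[I \ {t}] t ≤ 𝓝[I] t := nhdsWithin_mono _ sdiff_subset
  rw [hasDerivWithinAt_iff_tendsto_slope] at hψ ⊢
  have hc : Tendsto ψ (𝓝[I \ {t}] t) (𝓝 (ψ t)) := by
    have := (hasDerivWithinAt_iff_tendsto_slope.2 hψ).continuousWithinAt.tendsto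
    exact this.mono_left hle
  -- Polarization: the difference is `Re⟨f_τ(ψ_τ + ψ_t), ψ_τ - ψ_t⟩`. The left entry converges in
  -- `L²`, and the difference quotient on the right converges to `φ`.
  have h1 : Tendsto (fun τ => mulL (f τ) (ψ τ + ψ t)) (𝓝[I \ {t}] t)
      (𝓝 (mulL (f t) (ψ t + ψ t))) := by
    refine tendsto_mulL (C := C) (hf t ht).1 ?_ (hf t ht).2 (fun x => (hlim x).mono_left hle)
      (hc.add_const _)
    filter_upwards [self_mem_nhdsWithin] with τ hτ
    exact hf τ hτ.1
  have h2 := (Complex.continuous_re.tendsto _).comp (h1.inner (𝕜 := ℂ) hψ)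
  have e : (inner ℂ (mulL (f t) (ψ t + ψ t)) φ).re = 2 * (inner ℂ (mulL (f t) (ψ t)) φ).re := by
    rw [mulL_add (hm t ht _) (hm t ht _), inner_add_left, Complex.add_re, two_mul]
  rw [e] at h2
  refine h2.congr' ?_
  filter_upwards [self_mem_nhdsWithin] with τ hτ
  have hre : ∀ q : L2 α, ∫ x, f τ x * ‖q x‖ ^ 2 = (inner ℂ (mulL (f τ) q) q).re := fun q => by
    rw [inner_mulL_comm (hm τ hτ.1 _) (hm τ hτ.1 _), inner_mulL_self (hm τ hτ.1 _),
      Complex.ofReal_re]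
  simp only [Function.comp, slope_def_module, sub_self, sub_zero, smul_eq_mul]
  rw [hre, hre, inner_smul_right_eq_smul, mulL_add (hm τ hτ.1 _) (hm τ hτ.1 _)]
  have h3 : (inner ℂ (mulL (f τ) (ψ τ)) (ψ t)).re = (inner ℂ (mulL (f τ) (ψ t)) (ψ τ)).re := by
    rw [inner_mulL_comm (hm τ hτ.1 _) (hm τ hτ.1 _), ← inner_conj_symm, Complex.conj_re]
  rw [inner_add_left, inner_sub_right, inner_sub_right, Complex.real_smul, Complex.re_ofReal_mul]
  simp only [Complex.add_re, Complex.sub_re]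
  rw [h3]
  ring

/-- Differentiation under the integral sign with a uniformly Lipschitz factor. -/
lemma hasDerivWithinAt_integral_mul {I : Set ℝ} {t : ℝ} {f : ℝ → α → ℝ} {f' g : α → ℝ} {L : ℝ}
    (ht : t ∈ I) (hg : Integrable g) (hf : ∀ τ ∈ I, Measurable (f τ))
    (hfi : ∀ τ ∈ I, Integrable (fun x => f τ x * g x))
    (hlip : ∀ τ ∈ I, ∀ x, |f τ x - f t x| ≤ L * |τ - t|)
    (hder : ∀ x, HasDerivWithinAt (fun τ => f τ x) (f' x) I t) :
    HasDerivWithinAt (fun τ => ∫ x, f τ x * g x) (∫ x, f' x * g x) I t := by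
  rw [hasDerivWithinAt_iff_tendsto_slope]
  have h1 : Tendsto (fun τ => ∫ x, slope (fun τ => f τ x) t τ * g x) (𝓝[I \ {t}] t)
      (𝓝 (∫ x, f' x * g x)) := by
    refine tendsto_integral_filter_of_dominated_convergence (fun x => L * |g x|) ?_ ?_
      (hg.abs.const_mul L) ?_
    · filter_upwards [self_mem_nhdsWithin] with τ hτ
      simp only [slope_def_module, smul_eq_mul]
      exact (((hf τ hτ.1).sub (hf t ht)).const_mul _).aestronglyMeasurable.mul
        hg.aestronglyMeasurable
    · filter_upwards [self_mem_nhdsWithin] with τ hτ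
      refine Eventually.of_forall fun x => ?_
      have hne : 0 < |τ - t| := abs_pos.2 (sub_ne_zero.2 hτ.2)
      rw [Real.norm_eq_abs, abs_mul, slope_def_module, smul_eq_mul, abs_mul, abs_inv]
      gcongr
      rw [inv_mul_le_iff₀ hne, mul_comm]
      exact hlip τ hτ.1 x
    · refine Eventually.of_forall fun x => Tendsto.mul_const _ ?_
      exact hasDerivWithinAt_iff_tendsto_slope.1 (hder x)
  refine h1.congr' ?_
  filter_upwards [self_mem_nhdsWithin] with τ hτ
  simp only [slope_def_module, smul_eq_mul]
  rw [← integral_sub (hfi τ hτ.1) (hfi t ht), ← integral_const_mul]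
  congr 1
  ext x
  ring

lemma tendsto_of_lipschitz {I : Set ℝ} {t a : ℝ} {f : ℝ → ℝ} {L : ℝ} (ha : f t = a)
    (h : ∀ τ ∈ I, |f τ - f t| ≤ L * |τ - t|) : Tendsto f (𝓝[I] t) (𝓝 a) := by
  rw [← ha, tendsto_iff_norm_sub_tendsto_zero]
  have h1 : Tendsto (fun τ : ℝ => L * |τ - t|) (𝓝[I] t) (𝓝 (L * |t - t|)) := by
    have : Continuous fun τ : ℝ => L * |τ - t| := by fun_prop
    exact (this.tendsto t).mono_left nhdsWithin_le_nhds
  rw [sub_self, abs_zero, mul_zero] at h1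
  refine squeeze_zero' (Eventually.of_forall fun _ => norm_nonneg _) ?_ h1
  filter_upwards [self_mem_nhdsWithin] with τ hτ
  exact h τ hτ

/-- The derivative of the integral of a time dependent observable. -/
lemma hasDerivWithinAt_quadratic {I : Set ℝ} {t : ℝ} {ψ : ℝ → L2 α} {φ : L2 α}
    (hψ : HasDerivWithinAt ψ φ I t) {f : ℝ → α → ℝ} {f' : α → ℝ} {C L : ℝ} (ht : t ∈ I)
    (hf : ∀ τ ∈ I, Measurable (f τ) ∧ ∀ x, |f τ x| ≤ C)
    (hlip : ∀ τ ∈ I, ∀ x, |f τ x - f t x| ≤ L * |τ - t|)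
    (hder : ∀ x, HasDerivWithinAt (fun τ => f τ x) (f' x) I t) :
    HasDerivWithinAt (fun τ => ∫ x, f τ x * ‖ψ τ x‖ ^ 2)
      (2 * (inner ℂ (mulL (f t) (ψ t)) φ).re + ∫ x, f' x * ‖ψ t x‖ ^ 2) I t := by
  -- Subtract and add `∫ f_τ|ψ_t|²`. In the first difference only the state moves; in the second
  -- only the observable does.
  have h1 := hasDerivWithinAt_quadratic_state hψ ht hf
    fun x => tendsto_of_lipschitz rfl fun τ hτ => hlip τ hτ x
  have h2 := hasDerivWithinAt_integral_mul (g := fun x => ‖ψ t x‖ ^ 2) ht (integrable_norm_sq (ψ t))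
    (fun τ hτ => (hf τ hτ).1) (fun τ hτ => integrable_mul_norm_sq
      (IsBddMeas.mulMem ⟨(hf τ hτ).1, C, (hf τ hτ).2⟩ _)) hlip hder
  refine (h1.add h2).congr_of_eventuallyEq (Eventually.of_forall fun τ => ?_) ?_ <;>
  simp

end TimeDerivatives

/-! ### Time derivative of the momentum along a field. -/

section Momentum

variable {n : ℕ}

/-- The divergence term is real and drops out. The momentum thus becomes the form of an
antisymmetric operator, to which polarization applies. -/
lemma im_inner_antiOp {w : Fin 3 → E3 → ℝ} (hw : IsGoodField w) (f : WaveFn (n + 2))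
    (fd : Fin 3 → WaveFn (n + 2)) :
    (inner ℂ f (antiOp w f fd)).im =
      ∑ k, ∫ X, w k (X 0) * ((starRingEnd ℂ) (f X) * fd k X).im := by
  have hdm : MulMem (lift0 (fieldDiv w)) f := hw.div.isBddMeas.lift0.mulMem f
  rw [antiOp, inner_add_right, inner_sum, inner_smul_right, inner_mulL_self hdm, Complex.add_im,
    Complex.im_sum]
  have : ((1 / 2 : ℂ) * ((∫ X, lift0 (fieldDiv w) X * ‖f X‖ ^ 2 : ℝ) : ℂ)).im = 0 := by
    have e : (1 / 2 : ℂ) = ((1 / 2 : ℝ) : ℂ) := by simp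
    rw [e, ← Complex.ofReal_mul, Complex.ofReal_im]
  rw [this, add_zero]
  refine Finset.sum_congr rfl fun k _ => ?_
  rw [im_inner_mulL ((hw.comp k).isBddMeas.lift0.mulMem _)]
  rfl

lemma integrable_im_conj_mul {α : Type*} [MeasureSpace α] (f g : L2 α) :
    Integrable (fun x => ((starRingEnd ℂ) (f x) * g x).im) := by
  refine ((L2.integrable_inner (𝕜 := ℂ) f g).im).congr (Eventually.of_forall fun x => ?_)
  simp [RCLike.inner_apply, mul_comm]

/-- The derivative of the momentum of the state along a time dependent field. -/
lemma hasDerivWithinAt_momentum {I : Set ℝ} {t : ℝ} (ht : t ∈ I) {ψ : ℝ → WaveFn (n + 2)}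
    {d : ℝ → Fin 3 → WaveFn (n + 2)} {φ : WaveFn (n + 2)} (hψ : HasDerivWithinAt ψ φ I t)
    (hd : ∀ τ ∈ I, ∀ k, HasL2Deriv (particleDir 0 k) (ψ τ) (d τ k))
    (hdc : ∀ k, ContinuousWithinAt (fun τ => d τ k) I t)
    {w : ℝ → Fin 3 → E3 → ℝ} {w' : Fin 3 → E3 → ℝ} (hw : ∀ τ ∈ I, IsGoodField (w τ))
    {C L : ℝ} (hC : ∀ τ ∈ I, ∀ k x, |w τ k x| ≤ C) (hCd : ∀ τ ∈ I, ∀ x, |fieldDiv (w τ) x| ≤ C)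
    (hlip : ∀ τ ∈ I, ∀ k x, |w τ k x - w t k x| ≤ L * |τ - t|)
    (hdiv : ∀ x, Tendsto (fun τ => fieldDiv (w τ) x) (𝓝[I] t) (𝓝 (fieldDiv (w t) x)))
    (hder : ∀ k x, HasDerivWithinAt (fun τ => w τ k x) (w' k x) I t) :
    HasDerivWithinAt
      (fun τ => ∑ k, ∫ X, w τ k (X 0) * ((starRingEnd ℂ) (ψ τ X) * d τ k X).im)
      (-2 * (inner ℂ (antiOp (w t) (ψ t) (d t)) φ).im +
        ∑ k, ∫ X, w' k (X 0) * ((starRingEnd ℂ) (ψ t X) * d t k X).im) I t := by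
  have hle : 𝓝[I \ {t}] t ≤ 𝓝[I] t := nhdsWithin_mono _ sdiff_subset
  have h1 : HasDerivWithinAt (fun τ => (∑ k, ∫ X, w τ k (X 0) * ((starRingEnd ℂ) (ψ τ X) * d τ k X).im)
      - ∑ k, ∫ X, w τ k (X 0) * ((starRingEnd ℂ) (ψ t X) * d t k X).im)
      (-2 * (inner ℂ (antiOp (w t) (ψ t) (d t)) φ).im) I t := by
    rw [hasDerivWithinAt_iff_tendsto_slope] at hψ ⊢
    have hc : Tendsto ψ (𝓝[I \ {t}] t) (𝓝 (ψ t)) :=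
      ((hasDerivWithinAt_iff_tendsto_slope.2 hψ).continuousWithinAt.tendsto).mono_left hle
    -- Antisymmetry of `A` gives `Im⟨ψ_τ, Aψ_τ⟩ - Im⟨ψ_t, Aψ_t⟩ = -Im⟨A(ψ_τ + ψ_t), ψ_τ - ψ_t⟩`.
    -- Only continuity in time of the first derivatives of `ψ` is needed, never their
    -- differentiability.
    have h2 : Tendsto (fun τ => antiOp (w τ) (ψ τ + ψ t) (fun k => d τ k + d t k)) (𝓝[I \ {t}] t)
        (𝓝 (antiOp (w t) (ψ t + ψ t) (fun k => d t k + d t k))) := by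
      refine (tendsto_finsetSum _ fun k _ => ?_).add (Tendsto.const_smul ?_ _)
      · refine tendsto_mulL (C := C) ((hw t ht).comp k).isBddMeas.lift0.meas ?_
          (fun X => hC t ht k _) (fun X => ?_) (((hdc k).tendsto.mono_left hle).add_const _)
        · filter_upwards [self_mem_nhdsWithin] with τ hτ
          exact ⟨((hw τ hτ.1).comp k).isBddMeas.lift0.meas, fun X => hC τ hτ.1 k _⟩
        · exact (tendsto_of_lipschitz rfl fun τ hτ => hlip τ hτ k (X 0)).mono_left hle
      · refine tendsto_mulL (C := C) ((hw t ht).div).isBddMeas.lift0.meas ?_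
          (fun X => hCd t ht _) (fun X => (hdiv (X 0)).mono_left hle) (hc.add_const _)
        filter_upwards [self_mem_nhdsWithin] with τ hτ
        exact ⟨((hw τ hτ.1).div).isBddMeas.lift0.meas, fun X => hCd τ hτ.1 _⟩
    have h3 := ((Complex.continuous_im.tendsto _).comp (h2.inner (𝕜 := ℂ) hψ)).neg
    rw [antiOp_add (hw t ht), ← two_smul ℂ, inner_smul_left] at h3
    have e : -((starRingEnd ℂ) 2 * inner ℂ (antiOp (w t) (ψ t) (d t)) φ).im =
        -2 * (inner ℂ (antiOp (w t) (ψ t) (d t)) φ).im := by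
      simp
    have e' : (antiOp (w t) (ψ t) fun k => d t k) = antiOp (w t) (ψ t) (d t) := rfl
    rw [e', e] at h3
    refine h3.congr' ?_
    filter_upwards [self_mem_nhdsWithin] with τ hτ
    rw [slope_def_module]
    simp only [Function.comp, sub_self, sub_zero]
    rw [← im_inner_antiOp (hw τ hτ.1), ← im_inner_antiOp (hw τ hτ.1) (ψ t) (d t), slope_def_module,
      inner_smul_right_eq_smul, Complex.real_smul, Complex.im_ofReal_mul, antiOp_add (hw τ hτ.1)]
    have e3 := antiOp_antisymm (hw τ hτ.1) (hd τ hτ.1) (hd t ht)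
    have e4 : inner ℂ (antiOp (w τ) (ψ t) (d t)) (ψ τ) =
        -inner ℂ (ψ t) (antiOp (w τ) (ψ τ) (d τ)) := antiOp_antisymm (hw τ hτ.1) (hd t ht) (hd τ hτ.1)
    have e5 : (inner ℂ (ψ t) (antiOp (w τ) (ψ τ) (d τ))).im =
        -(inner ℂ (antiOp (w τ) (ψ τ) (d τ)) (ψ t)).im := by
      rw [← inner_conj_symm, Complex.conj_im]
    have e6 : ∀ (q : WaveFn (n + 2)) (qd : Fin 3 → WaveFn (n + 2)), (inner ℂ (antiOp (w τ) q qd) q).im = -(inner ℂ q (antiOp (w τ) q qd)).im :=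
      fun q qd => by rw [← inner_conj_symm, Complex.conj_im]
    have e7 := congrArg Complex.im e4
    rw [Complex.neg_im, e5] at e7
    rw [inner_add_left, inner_sub_right, inner_sub_right, smul_eq_mul]
    simp only [Complex.add_im, Complex.sub_im]
    have e8 : (inner ℂ (antiOp (w τ) (ψ τ) fun k => d τ k) (ψ τ)).im =
      -(inner ℂ (ψ τ) (antiOp (w τ) (ψ τ) (d τ))).im := e6 _ _
    have e9 : (inner ℂ (antiOp (w τ) (ψ t) fun k => d t k) (ψ t)).im =
      -(inner ℂ (ψ t) (antiOp (w τ) (ψ t) (d t))).im := e6 _ _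
    have e10 : (inner ℂ (antiOp (w τ) (ψ t) fun k => d t k) (ψ τ)).im =
      - -(inner ℂ (antiOp (w τ) (ψ τ) (d τ)) (ψ t)).im := e7
    rw [e8, e9, e10]
    ring
  have h4 : HasDerivWithinAt
      (fun τ => ∑ k, ∫ X, w τ k (X 0) * ((starRingEnd ℂ) (ψ t X) * d t k X).im)
      (∑ k, ∫ X, w' k (X 0) * ((starRingEnd ℂ) (ψ t X) * d t k X).im) I t := by
    refine HasDerivWithinAt.fun_sum fun k _ => ?_
    refine hasDerivWithinAt_integral_mul (f := fun τ (X : Config (n + 2)) => w τ k (X 0)) (L := L) ht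
      (integrable_im_conj_mul _ _) (fun τ hτ => ((hw τ hτ).comp k).isBddMeas.lift0.meas) ?_
      (fun τ hτ (X : Config (n + 2)) => hlip τ hτ k (X 0))
      (fun (X : Config (n + 2)) => hder k (X 0))
    intro τ hτ
    exact (integrable_im_conj_mul _ _).bdd_mul
      ((hw τ hτ).comp k).isBddMeas.lift0.meas.aestronglyMeasurable
      (Eventually.of_forall fun X => hC τ hτ k (X 0))
  refine (h1.add h4).congr_of_eventuallyEq (Eventually.of_forall fun τ => ?_) ?_ <;>
  simp

end Momentum

/-! ### The Coulomb potential and its regularization `(|y|² + ε)^{-1/2}`. -/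

section Kernels

lemma pderiv_eq_of_hasDerivAt {a : E3 → ℝ} {k : Fin 3} {y : E3} {c : ℝ} (ha : DifferentiableAt ℝ a y)
    (h : HasDerivAt (fun s : ℝ => a (y + s • unitVec k)) c 0) : pderiv k a y = c := by
  have h2 : HasFDerivAt a (fderiv ℝ a y) (y + (0 : ℝ) • unitVec k) := by
    rw [zero_smul, add_zero]; exact ha.hasFDerivAt
  have h1 : HasDerivAt (fun h : ℝ => y + h • unitVec k) (unitVec k) 0 := by
    simpa using ((hasDerivAt_id (0 : ℝ)).smul_const (unitVec k)).const_add y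
  exact (h2.comp_hasDerivAt 0 h1).unique h

lemma hasDerivAt_coord (k l : Fin 3) (y : E3) :
    HasDerivAt (fun s : ℝ => (y + s • unitVec k) l) (if l = k then 1 else 0) 0 := by
  have : (fun s : ℝ => (y + s • unitVec k) l) = fun s => y l + s * (if l = k then 1 else 0) := by
    ext s
    simp [unitVec]
  rw [this]
  simpa using ((hasDerivAt_id (0 : ℝ)).mul_const (if l = k then (1 : ℝ) else 0)).const_add (y l)

lemma hasDerivAt_norm_sq_line (k : Fin 3) (y : E3) :
    HasDerivAt (fun s : ℝ => ‖y + s • unitVec k‖ ^ 2) (2 * y k) 0 := by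
  have h : (fun s : ℝ => ‖y + s • unitVec k‖ ^ 2) =
      fun s => ∑ l, ((y + s • unitVec k) l) ^ 2 := by
    ext s
    rw [EuclideanSpace.norm_sq_eq]
    simp
  rw [h]
  have h2 := HasDerivAt.fun_sum (u := Finset.univ) fun l _ => (hasDerivAt_coord k l y).pow 2
  refine h2.congr_deriv ?_
  simp

lemma abs_coord_le (y : E3) (k : Fin 3) : |y k| ≤ ‖y‖ := by
  have := PiLp.norm_apply_le y k
  rwa [Real.norm_eq_abs] at this

/-- The regularized distance `(|y|² + ε)^{1/2}`. -/
noncomputable def regNorm (ε : ℝ) (y : E3) : ℝ := √(‖y‖ ^ 2 + ε)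

variable {ε : ℝ}

lemma regNorm_pos (hε : 0 < ε) (y : E3) : 0 < regNorm ε y := Real.sqrt_pos.2 (by positivity)

lemma regNorm_sq (hε : 0 < ε) (y : E3) : regNorm ε y ^ 2 = ‖y‖ ^ 2 + ε :=
  Real.sq_sqrt (by positivity)

lemma norm_le_regNorm (hε : 0 < ε) (y : E3) : ‖y‖ ≤ regNorm ε y :=
  Real.le_sqrt_of_sq_le (by linarith)

lemma sqrt_le_regNorm (y : E3) : √ε ≤ regNorm ε y :=
  Real.sqrt_le_sqrt (by nlinarith [norm_nonneg y])

lemma differentiable_regNorm (hε : 0 < ε) : Differentiable ℝ (regNorm ε) := fun y =>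
  ((differentiable_id.norm_sq ℝ y).add_const ε).sqrt (by
    have : 0 < ‖id y‖ ^ 2 + ε := by positivity
    exact this.ne')

lemma hasDerivAt_regNorm (hε : 0 < ε) (k : Fin 3) (y : E3) :
    HasDerivAt (fun s : ℝ => regNorm ε (y + s • unitVec k)) (y k / regNorm ε y) 0 := by
  have h := ((hasDerivAt_norm_sq_line k y).add_const ε).sqrt (by
    simp only [zero_smul, add_zero]
    positivity)
  refine h.congr_deriv ?_
  simp only [zero_smul, add_zero]
  rw [regNorm]
  have : √(‖y‖ ^ 2 + ε) ≠ 0 := (regNorm_pos hε y).ne'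
  field_simp

/-- The regularized Coulomb potential. -/
noncomputable def regCoulomb (ε : ℝ) (y : E3) : ℝ := (regNorm ε y)⁻¹

lemma differentiable_regCoulomb (hε : 0 < ε) : Differentiable ℝ (regCoulomb ε) := fun y =>
  (differentiable_regNorm hε y).inv (regNorm_pos hε y).ne'

lemma pderiv_regCoulomb (hε : 0 < ε) (k : Fin 3) (y : E3) :
    pderiv k (regCoulomb ε) y = -(y k / regNorm ε y ^ 3) := by
  refine pderiv_eq_of_hasDerivAt (differentiable_regCoulomb hε y) ?_
  have hp := (regNorm_pos hε y).ne'
  have h := (hasDerivAt_regNorm hε k y).fun_inv (by simpa using hp)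
  refine h.congr_deriv ?_
  simp only [zero_smul, add_zero]
  field_simp

lemma abs_pderiv_regCoulomb_le (hε : 0 < ε) (k : Fin 3) (y : E3) :
    |pderiv k (regCoulomb ε) y| ≤ (regNorm ε y ^ 2)⁻¹ := by
  have hp := regNorm_pos hε y
  rw [pderiv_regCoulomb hε, abs_neg, abs_div, abs_of_pos (by positivity : 0 < regNorm ε y ^ 3),
    div_le_iff₀ (by positivity)]
  have : (regNorm ε y ^ 2)⁻¹ * regNorm ε y ^ 3 = regNorm ε y := by field_simp
  rw [this]
  exact (abs_coord_le y k).trans (norm_le_regNorm hε y)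

lemma abs_pderiv_regCoulomb_le_inv_sq (hε : 0 < ε) (k : Fin 3) (y : E3) :
    |pderiv k (regCoulomb ε) y| ≤ (‖y‖ ^ 2)⁻¹ := by
  rcases eq_or_ne y 0 with rfl | hy
  · rw [pderiv_regCoulomb hε]
    simp
  · refine (abs_pderiv_regCoulomb_le hε k y).trans ?_
    have : 0 < ‖y‖ := norm_pos_iff.2 hy
    gcongr
    exact norm_le_regNorm hε y

lemma regCoulomb_nonneg (y : E3) : 0 ≤ regCoulomb ε y := inv_nonneg.2 (Real.sqrt_nonneg _)

lemma regCoulomb_le_coulomb (hε : 0 < ε) {y : E3} (hy : y ≠ 0) : regCoulomb ε y ≤ coulomb y := by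
  have : 0 < ‖y‖ := norm_pos_iff.2 hy
  rw [regCoulomb, coulomb, one_div]
  gcongr
  exact norm_le_regNorm hε y

lemma isC1b_regCoulomb (hε : 0 < ε) : IsC1b (regCoulomb ε) where
  diff := differentiable_regCoulomb hε
  bdd := by
    refine ⟨(√ε)⁻¹, fun y => ?_⟩
    rw [abs_of_nonneg (regCoulomb_nonneg y), regCoulomb]
    have := Real.sqrt_pos.2 hε
    gcongr
    exact sqrt_le_regNorm y
  dbdd k := by
    refine ⟨ε⁻¹, fun y => (abs_pderiv_regCoulomb_le hε k y).trans ?_⟩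
    gcongr
    rw [regNorm_sq hε]
    nlinarith [norm_nonneg y]

/-- A component of the vector field used in the proof of Hardy's inequality. -/
noncomputable def hardyField (ε : ℝ) (l : Fin 3) (y : E3) : ℝ := y l / regNorm ε y ^ 2

lemma differentiable_hardyField (hε : 0 < ε) (l : Fin 3) :
    Differentiable ℝ (hardyField ε l) := fun y => by
  have h1 : DifferentiableAt ℝ (fun y : E3 => y l) y :=
    (EuclideanSpace.proj l : E3 →L[ℝ] ℝ).differentiableAt
  have h2 : DifferentiableAt ℝ (fun y => regNorm ε y ^ 2) y := (differentiable_regNorm hε y).fun_pow 2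
  have h3 := h1.fun_mul (h2.fun_inv (pow_ne_zero 2 (regNorm_pos hε y).ne'))
  have e : hardyField ε l = fun y => y l * (regNorm ε y ^ 2)⁻¹ := by
    ext y
    rw [hardyField, div_eq_mul_inv]
  rw [e]
  exact h3

lemma pderiv_hardyField (hε : 0 < ε) (k l : Fin 3) (y : E3) :
    pderiv k (hardyField ε l) y =
      (if l = k then 1 else 0) / regNorm ε y ^ 2 - 2 * y l * y k / regNorm ε y ^ 4 := by
  refine pderiv_eq_of_hasDerivAt (differentiable_hardyField hε l y) ?_
  have hp := (regNorm_pos hε y).ne'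
  have h := (hasDerivAt_coord k l y).fun_div ((hasDerivAt_regNorm hε k y).fun_pow 2)
    (by simpa using hp)
  refine h.congr_deriv ?_
  simp only [zero_smul, add_zero]
  field_simp
  push_cast
  ring

lemma abs_hardyField_sq_le (hε : 0 < ε) (y : E3) :
    ∑ l, hardyField ε l y ^ 2 ≤ (regNorm ε y ^ 2)⁻¹ := by
  have hp := regNorm_pos hε y
  have h1 : ∑ l, hardyField ε l y ^ 2 = ‖y‖ ^ 2 / regNorm ε y ^ 4 := by
    simp only [hardyField, div_pow]
    rw [← Finset.sum_div, EuclideanSpace.norm_sq_eq]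
    simp only [Real.norm_eq_abs, sq_abs]
    ring
  rw [h1, div_le_iff₀ (by positivity)]
  have : (regNorm ε y ^ 2)⁻¹ * regNorm ε y ^ 4 = regNorm ε y ^ 2 := by field_simp
  rw [this]
  have := norm_le_regNorm hε y
  gcongr

/-- The divergence is `3/(|y|²+ε) - 2|y|²/(|y|²+ε)²`; dimension three leaves the coefficient `3 - 2
= 1`. -/
lemma sum_pderiv_hardyField_ge (hε : 0 < ε) (y : E3) :
    (regNorm ε y ^ 2)⁻¹ ≤ ∑ l, pderiv l (hardyField ε l) y := by
  have hp := regNorm_pos hε y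
  have h1 : ∑ l, pderiv l (hardyField ε l) y =
      3 / regNorm ε y ^ 2 - 2 * ‖y‖ ^ 2 / regNorm ε y ^ 4 := by
    simp only [pderiv_hardyField hε, if_true, EuclideanSpace.norm_sq_eq, Real.norm_eq_abs, sq_abs,
      Fin.sum_univ_three]
    ring
  rw [h1]
  have h2 : 2 * ‖y‖ ^ 2 / regNorm ε y ^ 4 ≤ 2 / regNorm ε y ^ 2 := by
    rw [div_le_div_iff₀ (by positivity) (by positivity)]
    have h3 : ‖y‖ ^ 2 ≤ regNorm ε y ^ 2 := by
      have := norm_le_regNorm hε y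
      gcongr
    nlinarith [mul_le_mul_of_nonneg_right h3 (by positivity : 0 ≤ regNorm ε y ^ 2)]
  have h4 : (3 : ℝ) / regNorm ε y ^ 2 = (regNorm ε y ^ 2)⁻¹ + 2 / regNorm ε y ^ 2 := by
    field_simp; norm_num
  linarith

lemma isC1b_hardyField (hε : 0 < ε) (l : Fin 3) : IsC1b (hardyField ε l) where
  diff := differentiable_hardyField hε l
  bdd := by
    refine ⟨(√ε)⁻¹, fun y => ?_⟩
    have hp := regNorm_pos hε y
    have hs := Real.sqrt_pos.2 hε
    rw [hardyField, abs_div, abs_of_pos (by positivity : 0 < regNorm ε y ^ 2)]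
    calc |y l| / regNorm ε y ^ 2 ≤ regNorm ε y / regNorm ε y ^ 2 := by
          gcongr
          exact (abs_coord_le y l).trans (norm_le_regNorm hε y)
      _ = (regNorm ε y)⁻¹ := by field_simp
      _ ≤ (√ε)⁻¹ := by
          gcongr
          exact sqrt_le_regNorm y
  dbdd k := by
    refine ⟨3 * ε⁻¹, fun y => ?_⟩
    have hp := regNorm_pos hε y
    have h1 : (regNorm ε y ^ 2)⁻¹ ≤ ε⁻¹ := by
      gcongr
      rw [regNorm_sq hε]
      nlinarith [norm_nonneg y]
    rw [pderiv_hardyField hε]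
    refine (abs_sub _ _).trans ?_
    have h2 : |(if l = k then (1 : ℝ) else 0) / regNorm ε y ^ 2| ≤ (regNorm ε y ^ 2)⁻¹ := by
      rw [abs_div, abs_of_pos (by positivity : 0 < regNorm ε y ^ 2), div_eq_mul_inv]
      refine mul_le_of_le_one_left (by positivity) ?_
      split_ifs <;> simp
    have h3 : |2 * y l * y k / regNorm ε y ^ 4| ≤ 2 * (regNorm ε y ^ 2)⁻¹ := by
      rw [abs_div, abs_of_pos (by positivity : 0 < regNorm ε y ^ 4), abs_mul, abs_mul,
        div_le_iff₀ (by positivity)]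
      have e : 2 * (regNorm ε y ^ 2)⁻¹ * regNorm ε y ^ 4 = 2 * regNorm ε y * regNorm ε y := by
        field_simp
      rw [e]
      have := norm_le_regNorm hε y
      have ha := (abs_coord_le y l).trans this
      have hb := (abs_coord_le y k).trans this
      rw [abs_of_pos (by norm_num : (0 : ℝ) < 2)]
      gcongr
    linarith

lemma differentiableAt_coulomb {y : E3} (hy : y ≠ 0) : DifferentiableAt ℝ coulomb y := by
  have : coulomb = fun y : E3 => ‖y‖⁻¹ := by
    ext y
    rw [coulomb, one_div]
  rw [this]
  exact (differentiableAt_id.norm ℝ hy).fun_inv (norm_ne_zero_iff.2 hy)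

lemma pderiv_coulomb {y : E3} (hy : y ≠ 0) (k : Fin 3) :
    pderiv k coulomb y = -(y k / ‖y‖ ^ 3) := by
  refine pderiv_eq_of_hasDerivAt (differentiableAt_coulomb hy) ?_
  have hn : ‖y‖ ≠ 0 := norm_ne_zero_iff.2 hy
  have h1 := (hasDerivAt_norm_sq_line k y).sqrt (by simpa using pow_ne_zero 2 hn)
  have h2 : HasDerivAt (fun s : ℝ => ‖y + s • unitVec k‖⁻¹) (-(y k / ‖y‖ ^ 3)) 0 := by
    simp only [Real.sqrt_sq (norm_nonneg _)] at h1
    refine (h1.fun_inv (by simpa using hn)).congr_deriv ?_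
    simp only [zero_smul, add_zero]
    field_simp
  simpa only [coulomb, one_div] using h2

/-- The potential blows up at the origin, so it is not differentiable there and `fderiv` takes its
default value `0`. Oddness of the gradient and the bound by `(‖y‖ ^ 2)⁻¹`, also `0` at the origin,
therefore hold without exception. -/
lemma pderiv_coulomb_zero (k : Fin 3) : pderiv k coulomb 0 = 0 := by
  have hnd : ¬ DifferentiableAt ℝ coulomb (0 : E3) := by
    intro h
    have h1 : Tendsto (fun s : ℝ => coulomb (s • unitVec 0)) (𝓝[>] 0) (𝓝 (coulomb 0)) := by
      have hc : ContinuousAt (fun s : ℝ => s • unitVec 0) 0 := by fun_prop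
      have h0 : Tendsto (fun s : ℝ => s • unitVec 0) (𝓝[>] 0) (𝓝 (0 : E3)) := by
        have := hc.tendsto.mono_left (nhdsWithin_le_nhds (s := Ioi 0))
        simpa using this
      exact Tendsto.comp (g := coulomb) h.continuousAt.tendsto h0
    have h2 : Tendsto (fun s : ℝ => coulomb (s • unitVec 0)) (𝓝[>] 0) atTop := by
      refine tendsto_inv_nhdsGT_zero.congr' ?_
      filter_upwards [self_mem_nhdsWithin] with s hs
      rw [coulomb, norm_smul, unitVec]
      simp [abs_of_pos (show (0 : ℝ) < s from hs)]
    exact not_tendsto_nhds_of_tendsto_atTop h2 _ h1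
  rw [pderiv, fderiv_zero_of_not_differentiableAt hnd]
  rfl

lemma abs_pderiv_coulomb_le (k : Fin 3) (y : E3) : |pderiv k coulomb y| ≤ (‖y‖ ^ 2)⁻¹ := by
  rcases eq_or_ne y 0 with rfl | hy
  · rw [pderiv_coulomb_zero]
    simp
  · have hn : 0 < ‖y‖ := norm_pos_iff.2 hy
    rw [pderiv_coulomb hy, abs_neg, abs_div, abs_of_pos (by positivity : 0 < ‖y‖ ^ 3),
      div_le_iff₀ (by positivity)]
    have : (‖y‖ ^ 2)⁻¹ * ‖y‖ ^ 3 = ‖y‖ := by field_simp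
    rw [this]
    exact abs_coord_le y k

lemma pderiv_coulomb_neg (k : Fin 3) (y : E3) : pderiv k coulomb (-y) = -pderiv k coulomb y := by
  rcases eq_or_ne y 0 with rfl | hy
  · simp [pderiv_coulomb_zero]
  · rw [pderiv_coulomb hy, pderiv_coulomb (neg_ne_zero.2 hy), norm_neg]
    simp [neg_div]

lemma measurable_coulomb : Measurable coulomb := by
  unfold coulomb
  fun_prop

lemma tendsto_regNorm (y : E3) : Tendsto (fun ε => regNorm ε y) (𝓝[>] 0) (𝓝 ‖y‖) := by
  have h : Continuous fun ε : ℝ => regNorm ε y := by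
    unfold regNorm
    fun_prop
  have h2 := (h.tendsto 0).mono_left (nhdsWithin_le_nhds (s := Ioi 0))
  simpa [regNorm, Real.sqrt_sq (norm_nonneg y)] using h2

lemma tendsto_regCoulomb {y : E3} (hy : y ≠ 0) :
    Tendsto (fun ε => regCoulomb ε y) (𝓝[>] 0) (𝓝 (coulomb y)) := by
  rw [coulomb, one_div]
  exact (tendsto_regNorm y).inv₀ (norm_ne_zero_iff.2 hy)

lemma tendsto_pderiv_regCoulomb (k : Fin 3) (y : E3) :
    Tendsto (fun ε => pderiv k (regCoulomb ε) y) (𝓝[>] 0) (𝓝 (pderiv k coulomb y)) := by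
  have hev : ∀ᶠ ε : ℝ in 𝓝[>] 0, -(y k / regNorm ε y ^ 3) = pderiv k (regCoulomb ε) y := by
    filter_upwards [self_mem_nhdsWithin] with ε hε
    rw [pderiv_regCoulomb hε]
  refine Tendsto.congr' hev ?_
  rcases eq_or_ne y 0 with rfl | hy
  · rw [pderiv_coulomb_zero]
    simp
  · rw [pderiv_coulomb hy]
    exact (tendsto_const_nhds.div ((tendsto_regNorm y).pow 3)
      (pow_ne_zero 3 (norm_ne_zero_iff.2 hy))).neg

end Kernels

/-! ### Hardy's inequality in three of the variables. -/

section Hardy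

variable {E : Type*} [NormedAddCommGroup E] [NormedSpace ℝ E] [FiniteDimensional ℝ E]
  [MeasureSpace E] [BorelSpace E] [(volume : Measure E).IsAddHaarMeasure]

/-- `z` moves with unit speed along the coordinate axes in the directions `e`. -/
structure IsShift (z : E → E3) (e : Fin 3 → E) : Prop where
  meas : Measurable z
  shift : ∀ x (h : ℝ) l, z (x + h • e l) = z x + h • unitVec l
  ne : ∀ᵐ x, z x ≠ 0

variable {z : E → E3} {e : Fin 3 → E}

lemma IsC1b.hasBddLineDeriv_shift {a : E3 → ℝ} (ha : IsC1b a) (hz : IsShift z e) (l : Fin 3) :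
    HasBddLineDeriv (e l) (fun x => a (z x)) (fun x => pderiv l a (z x)) where
  fn := ⟨ha.isBddMeas.meas.comp hz.meas, ha.bdd.imp fun _ hC x => hC _⟩
  deriv := ⟨(ha.isBddMeas_pderiv l).meas.comp hz.meas, (ha.dbdd l).imp fun _ hC x => hC _⟩
  hasDeriv x := by
    simp only [hz.shift]
    exact Differentiable.hasDerivAt_line ha.diff l (z x)

lemma re_inner_mulL_lineDeriv {v : E} {f f' : L2 E} {b b' : E → ℝ} (hb : HasBddLineDeriv v b b')
    (hf : HasL2Deriv v f f') :
    2 * (inner ℂ (mulL b f) f').re = -∫ x, b' x * ‖f x‖ ^ 2 := by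
  have hm : ∀ q : L2 E, MulMem b q := fun q => hb.fn.mulMem q
  have hm' : MulMem b' f := hb.deriv.mulMem f
  have h1 := congrArg Complex.re ((hf.mulL hb).inner_eq_neg hf)
  rw [inner_add_left, Complex.add_re, Complex.neg_re, inner_mulL_comm hm' hm',
    inner_mulL_self hm', Complex.ofReal_re, inner_mulL_comm (hm f') (hm f),
    ← inner_conj_symm, Complex.conj_re] at h1
  linarith

/-- With `g = y/(|y|²+ε)`, integration by parts gives `∫ div g |f|² = -2 Re∫ conj f g·∇f ≤
½∫|g|²|f|² + 2∫|∇f|²`. Since `|g|² ≤ (|y|²+ε)⁻¹ ≤ div g`, half of the left side is absorbed, whence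
the constant `4`. -/
lemma hardy_reg {f : L2 E} {fd : Fin 3 → L2 E} (hz : IsShift z e)
    (hf : ∀ l, HasL2Deriv (e l) f (fd l)) {ε : ℝ} (hε : 0 < ε) :
    Integrable (fun x => (regNorm ε (z x) ^ 2)⁻¹ * ‖f x‖ ^ 2) ∧
    ∫ x, (regNorm ε (z x) ^ 2)⁻¹ * ‖f x‖ ^ 2 ≤ 4 * ∑ l, ‖fd l‖ ^ 2 := by
  have hrm : Measurable (fun x => regNorm ε (z x)) :=
    (differentiable_regNorm hε).continuous.measurable.comp hz.meas
  have hb : IsBddMeas (fun x => (regNorm ε (z x) ^ 2)⁻¹) := by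
    refine ⟨(hrm.pow_const 2).inv, ε⁻¹, fun x => ?_⟩
    rw [abs_of_nonneg (by positivity)]
    gcongr
    rw [regNorm_sq hε]
    nlinarith [norm_nonneg (z x)]
  have hi := integrable_mul_norm_sq (hb.mulMem f)
  refine ⟨hi, ?_⟩
  have hB := fun l => (isC1b_hardyField hε l).hasBddLineDeriv_shift hz l
  have h1 := fun l => re_inner_mulL_lineDeriv (hB l) (hf l)
  have hsq : ∀ l, Integrable (fun x => hardyField ε l (z x) ^ 2 * ‖f x‖ ^ 2) := fun l =>
    (mulMem_iff_integrable (hB l).fn.meas f).1 ((hB l).fn.mulMem f)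
  have hn : ∀ l, ‖mulL (fun x => hardyField ε l (z x)) f‖ ^ 2 =
      ∫ x, hardyField ε l (z x) ^ 2 * ‖f x‖ ^ 2 := by
    intro l
    rw [norm_sq_eq_integral]
    refine integral_congr_ae ?_
    filter_upwards [coeFn_mulL ((hB l).fn.mulMem f)] with x hx
    rw [hx, norm_mul, mul_pow, Complex.norm_real, Real.norm_eq_abs, sq_abs]
  have h2 : ∑ l, ‖mulL (fun x => hardyField ε l (z x)) f‖ ^ 2 ≤
      ∫ x, (regNorm ε (z x) ^ 2)⁻¹ * ‖f x‖ ^ 2 := by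
    simp_rw [hn]
    rw [← integral_finsetSum _ fun l _ => hsq l]
    refine integral_mono (integrable_finsetSum _ fun l _ => hsq l) hi fun x => ?_
    simp only
    rw [← Finset.sum_mul]
    gcongr
    exact abs_hardyField_sq_le hε _
  have h3 : ∫ x, (regNorm ε (z x) ^ 2)⁻¹ * ‖f x‖ ^ 2 ≤
      ∑ l, ∫ x, pderiv l (hardyField ε l) (z x) * ‖f x‖ ^ 2 := by
    rw [← integral_finsetSum _ fun l _ => integrable_mul_norm_sq ((hB l).deriv.mulMem f)]
    refine integral_mono hi
      (integrable_finsetSum _ fun l _ => integrable_mul_norm_sq ((hB l).deriv.mulMem f)) fun x => ?_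
    simp only
    rw [← Finset.sum_mul]
    gcongr
    exact sum_pderiv_hardyField_ge hε _
  have h4 : ∑ l, ∫ x, pderiv l (hardyField ε l) (z x) * ‖f x‖ ^ 2 ≤
      ∑ l, (1 / 2 * ‖mulL (fun x => hardyField ε l (z x)) f‖ ^ 2 + 2 * ‖fd l‖ ^ 2) := by
    refine Finset.sum_le_sum fun l _ => ?_
    have h5 : |(inner ℂ (mulL (fun x => hardyField ε l (z x)) f) (fd l)).re| ≤
        ‖mulL (fun x => hardyField ε l (z x)) f‖ * ‖fd l‖ :=
      (Complex.abs_re_le_norm _).trans (norm_inner_le_norm _ _)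
    have h6 := neg_abs_le (inner ℂ (mulL (fun x => hardyField ε l (z x)) f) (fd l)).re
    have h7 := sq_nonneg (‖mulL (fun x => hardyField ε l (z x)) f‖ - 2 * ‖fd l‖)
    have h8 := h1 l
    nlinarith
  rw [Finset.sum_add_distrib, ← Finset.mul_sum, ← Finset.mul_sum] at h4
  linarith

/-- Hardy's inequality. -/
lemma hardy {f : L2 E} {fd : Fin 3 → L2 E} (hz : IsShift z e)
    (hf : ∀ l, HasL2Deriv (e l) f (fd l)) :
    MulMem (fun x => coulomb (z x)) f ∧
    Integrable (fun x => (‖z x‖ ^ 2)⁻¹ * ‖f x‖ ^ 2) ∧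
    ∫ x, (‖z x‖ ^ 2)⁻¹ * ‖f x‖ ^ 2 ≤ 4 * ∑ l, ‖fd l‖ ^ 2 := by
  set G := 4 * ∑ l, ‖fd l‖ ^ 2 with hG
  have hzm := hz.meas
  have hfm : AEStronglyMeasurable f volume := Lp.aestronglyMeasurable f
  have hmeas : AEStronglyMeasurable (fun x => (‖z x‖ ^ 2)⁻¹ * ‖f x‖ ^ 2) volume :=
    ((hzm.norm.pow_const 2).inv).aestronglyMeasurable.mul (hfm.norm.pow 2)
  set r : ℕ → ℝ := fun m => 1 / ((m : ℝ) + 1) with hr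
  have hrp : ∀ m, 0 < r m := fun m => by positivity
  have hr0 : Tendsto r atTop (𝓝[>] 0) :=
    tendsto_nhdsWithin_iff.2 ⟨tendsto_one_div_add_atTop_nhds_zero_nat, Eventually.of_forall hrp⟩
  -- The regularized bound does not depend on `ε`, so Fatou's lemma along `ε = 1/(m+1)` gives the
  -- singular one.
  have hL : ∫⁻ x, ENNReal.ofReal ((‖z x‖ ^ 2)⁻¹ * ‖f x‖ ^ 2) ≤ ENNReal.ofReal G := by
    have h1 : ∀ᵐ x, ENNReal.ofReal ((‖z x‖ ^ 2)⁻¹ * ‖f x‖ ^ 2) =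
        liminf (fun m => ENNReal.ofReal ((regNorm (r m) (z x) ^ 2)⁻¹ * ‖f x‖ ^ 2)) atTop := by
      filter_upwards [hz.ne] with x hx
      have h2 : Tendsto (fun m => (regNorm (r m) (z x) ^ 2)⁻¹ * ‖f x‖ ^ 2) atTop
          (𝓝 ((‖z x‖ ^ 2)⁻¹ * ‖f x‖ ^ 2)) :=
        (((((tendsto_regNorm (z x)).comp hr0).pow 2)).inv₀
          (pow_ne_zero 2 (norm_ne_zero_iff.2 hx))).mul_const _
      exact ((ENNReal.continuous_ofReal.tendsto _).comp h2).liminf_eq.symm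
    rw [lintegral_congr_ae h1]
    refine (lintegral_liminf_le' fun m => ?_).trans ?_
    · exact (hardy_reg hz hf (hrp m)).1.aestronglyMeasurable.aemeasurable.ennreal_ofReal
    · refine liminf_le_of_le (by isBoundedDefault) fun b hb => ?_
      obtain ⟨m, hm⟩ := hb.exists
      refine hm.trans ?_
      rw [← ofReal_integral_eq_lintegral_ofReal (hardy_reg hz hf (hrp m)).1
        (Eventually.of_forall fun x => by positivity)]
      exact ENNReal.ofReal_le_ofReal (hardy_reg hz hf (hrp m)).2
  have hint : Integrable (fun x => (‖z x‖ ^ 2)⁻¹ * ‖f x‖ ^ 2) := by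
    refine ⟨hmeas, ?_⟩
    rw [hasFiniteIntegral_iff_ofReal (Eventually.of_forall fun x => by positivity)]
    exact hL.trans_lt ENNReal.ofReal_lt_top
  refine ⟨?_, hint, ?_⟩
  · refine (mulMem_iff_integrable (a := fun x => coulomb (z x)) (measurable_coulomb.comp hzm) f).2 ?_
    refine hint.congr (Eventually.of_forall fun x => ?_)
    simp only [coulomb, one_div, inv_pow]
  · rw [← ofReal_integral_eq_lintegral_ofReal hint (Eventually.of_forall fun x => by positivity)] at hL
    exact (ENNReal.ofReal_le_ofReal_iff (by positivity)).1 hL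

lemma norm_mulL_coulomb_sq_le {f : L2 E} {fd : Fin 3 → L2 E} (hz : IsShift z e)
    (hf : ∀ l, HasL2Deriv (e l) f (fd l)) :
    ‖mulL (fun x => coulomb (z x)) f‖ ^ 2 ≤ 4 * ∑ l, ‖fd l‖ ^ 2 := by
  obtain ⟨h1, h2, h3⟩ := hardy hz hf
  rw [norm_sq_eq_integral]
  refine le_trans (le_of_eq (integral_congr_ae ?_)) h3
  filter_upwards [coeFn_mulL h1] with x hx
  rw [hx, norm_mul, mul_pow, Complex.norm_real, Real.norm_eq_abs, sq_abs, coulomb, one_div, inv_pow]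

end Hardy

/-! ### The Coulomb potential between two particles. -/

section Particles

variable {n : ℕ}

/-- The collision set is the kernel of a nonzero linear map, hence a proper subspace and a null set.
-/
lemma ae_apply_ne_apply {i j : Fin (n + 2)} (hij : i ≠ j) :
    ∀ᵐ X : Config (n + 2), X i - X j ≠ 0 := by
  set p : Config (n + 2) →ₗ[ℝ] E3 := 
    (LinearMap.proj i : (Fin (n + 2) → E3) →ₗ[ℝ] E3) -
      (LinearMap.proj j : (Fin (n + 2) → E3) →ₗ[ℝ] E3) with hp
  have hne : LinearMap.ker p ≠ ⊤ := by
    intro h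
    have h1 : (Pi.single i (unitVec 0) : Config (n + 2)) ∈ LinearMap.ker p := by
      rw [h]; trivial
    rw [LinearMap.mem_ker, hp] at h1
    simp only [LinearMap.sub_apply, LinearMap.proj_apply, Pi.single_eq_same,
      Pi.single_eq_of_ne hij.symm, sub_zero] at h1
    have h2 := congrArg (fun y : E3 => y 0) h1
    simp [unitVec] at h2
  have h0 := Measure.addHaar_submodule (volume : Measure (Config (n + 2))) _ hne
  rw [ae_iff]
  convert h0 using 2
  ext X
  simp [hp, LinearMap.mem_ker]

lemma isShift_pair {i j : Fin (n + 2)} (hij : i ≠ j) :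
    IsShift (fun X : Config (n + 2) => X i - X j) (particleDir i) where
  meas := (measurable_pi_apply i).sub (measurable_pi_apply j)
  shift X h l := by
    simp only [particleDir, Pi.add_apply, Pi.smul_apply, Pi.single_eq_same,
      Pi.single_eq_of_ne hij.symm, smul_zero, add_zero]
    abel
  ne := ae_apply_ne_apply hij

/-- The commutator of `w · ∇ + ½ div w` with a Coulomb potential. -/
lemma re_inner_antiOp_coulomb {w : Fin 3 → E3 → ℝ} (hw : IsGoodField w) {ψ : WaveFn (n + 2)}
    {fd : Fin 3 → WaveFn (n + 2)} (hf : ∀ k, HasL2Deriv (particleDir 0 k) ψ (fd k))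
    {z : Config (n + 2) → E3} (hz : IsShift z (particleDir 0)) :
    2 * (inner ℂ (antiOp w ψ fd) (mulL (fun X => coulomb (z X)) ψ)).re =
      -∑ k, ∫ X, w k (X 0) * pderiv k coulomb (z X) * ‖ψ X‖ ^ 2 := by
  have hpos : ∀ᶠ ε : ℝ in 𝓝[>] 0, 0 < ε := self_mem_nhdsWithin
  -- The regularized potentials lie below `V_c`, and `V_c ψ` is in `L²` by Hardy.
  have h1 : Tendsto (fun ε => mulL (fun X => regCoulomb ε (z X)) ψ) (𝓝[>] 0)
      (𝓝 (mulL (fun X => coulomb (z X)) ψ)) := by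
    refine tendsto_mulL_of_dominated (hardy hz hf).1 (measurable_coulomb.comp hz.meas) ?_ ?_ ?_
    · filter_upwards [hpos] with ε hε
      refine ⟨(isC1b_regCoulomb hε).isBddMeas.meas.comp hz.meas, ?_⟩
      filter_upwards [hz.ne] with X hX
      rw [abs_of_nonneg (regCoulomb_nonneg _)]
      exact regCoulomb_le_coulomb hε hX
    · refine Eventually.of_forall fun X => le_of_eq (abs_of_nonneg ?_)
      rw [coulomb]
      positivity
    · filter_upwards [hz.ne] with X hX
      exact tendsto_regCoulomb hX
  have h2 : Tendsto (fun ε => 2 * (inner ℂ (antiOp w ψ fd)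
      (mulL (fun X => regCoulomb ε (z X)) ψ)).re) (𝓝[>] 0)
      (𝓝 (2 * (inner ℂ (antiOp w ψ fd) (mulL (fun X => coulomb (z X)) ψ)).re)) :=
    ((Complex.continuous_re.tendsto _).comp (tendsto_const_nhds.inner h1)).const_mul 2
  -- The regularized gradients are bounded by `|z|⁻²`, and `|z|⁻²|ψ|²` is integrable by Hardy; this
  -- makes the limiting force integral meaningful.
  have h3 : Tendsto (fun ε => -∑ k, ∫ X, w k (X 0) * pderiv k (regCoulomb ε) (z X) * ‖ψ X‖ ^ 2)
      (𝓝[>] 0) (𝓝 (-∑ k, ∫ X, w k (X 0) * pderiv k coulomb (z X) * ‖ψ X‖ ^ 2)) := by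
    refine (tendsto_finsetSum _ fun k _ => ?_).neg
    obtain ⟨C, hC⟩ := (hw.comp k).bdd
    refine tendsto_integral_filter_of_dominated_convergence _ ?_ ?_
      ((hardy hz hf).2.1.const_mul C) ?_
    · filter_upwards [hpos] with ε hε
      exact (((hw.comp k).isBddMeas.lift0.meas).mul
        ((measurable_pderiv k _).comp hz.meas)).aestronglyMeasurable.mul
        ((Lp.aestronglyMeasurable ψ).norm.pow 2)
    · filter_upwards [hpos] with ε hε
      refine Eventually.of_forall fun X => ?_
      rw [Real.norm_eq_abs, abs_mul, abs_mul, abs_of_nonneg (by positivity : 0 ≤ ‖ψ X‖ ^ 2),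
        ← mul_assoc]
      gcongr
      · exact (abs_nonneg _).trans (hC 0)
      · exact hC _
      · exact abs_pderiv_regCoulomb_le_inv_sq hε k _
    · exact Eventually.of_forall fun X =>
        ((tendsto_pderiv_regCoulomb k (z X)).const_mul _).mul_const _
  refine tendsto_nhds_unique h2 (h3.congr' ?_)
  filter_upwards [hpos] with ε hε
  exact (re_inner_antiOp_potential hw hf fun k =>
    (isC1b_regCoulomb hε).hasBddLineDeriv_shift hz k).symm

end Particles

/-! ### Integrals against the one- and two-particle densities. -/

section Densities

/-- Configurations of `m + 1` particles as pairs. -/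
noncomputable def consMeasurableEquiv (m : ℕ) : E3 × Config m ≃ᵐ Config (m + 1) :=
  (MeasurableEquiv.piFinSuccAbove (fun _ : Fin (m + 1) => E3) 0).symm

lemma consMeasurableEquiv_apply {m : ℕ} (p : E3 × Config m) :
    consMeasurableEquiv m p = Fin.cons (α := fun _ => E3) p.1 p.2 := by
  have : consMeasurableEquiv m p = Fin.insertNth (α := fun _ => E3) 0 p.1 p.2 := rfl
  rw [this, Fin.insertNth_zero']

lemma measurePreserving_cons (m : ℕ) : MeasurePreserving (consMeasurableEquiv m) :=
  (volume_preserving_piFinSuccAbove (fun _ : Fin (m + 1) => E3) 0).symm _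

/-- Configurations of `m + 2` particles as pairs of two positions and a configuration. -/
noncomputable def consTwoMeasurableEquiv (m : ℕ) : (E3 × E3) × Config m ≃ᵐ Config (m + 2) :=
  (MeasurableEquiv.prodAssoc.trans
    ((MeasurableEquiv.refl E3).prodCongr (consMeasurableEquiv m))).trans (consMeasurableEquiv (m + 1))

lemma consTwoMeasurableEquiv_apply {m : ℕ} (p : (E3 × E3) × Config m) :
    consTwoMeasurableEquiv m p =
      Fin.cons (α := fun _ => E3) p.1.1 (Fin.cons (α := fun _ => E3) p.1.2 p.2) := by
  have : consTwoMeasurableEquiv m p =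
    consMeasurableEquiv (m + 1) (p.1.1, consMeasurableEquiv m (p.1.2, p.2)) := rfl
  rw [this, consMeasurableEquiv_apply, consMeasurableEquiv_apply]

lemma measurePreserving_consTwo (m : ℕ) : MeasurePreserving (consTwoMeasurableEquiv m) := by
  have h1 : MeasurePreserving (MeasurableEquiv.prodAssoc : (E3 × E3) × Config m ≃ᵐ _) :=
    volume_preserving_prodAssoc
  have h2 : MeasurePreserving ((MeasurableEquiv.refl E3).prodCongr (consMeasurableEquiv m)) :=
    (MeasurePreserving.id volume).prod (measurePreserving_cons m)
  exact (measurePreserving_cons (m + 1)).comp (h2.comp h1)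

variable {n : ℕ} {ψ : WaveFn (n + 2)}

lemma integrable_mul_density1 {a : E3 → ℝ} (ha : Integrable fun X => a (X 0) * ‖ψ X‖ ^ 2) :
    Integrable (fun x => a x * density1 ψ x) ∧
      ∫ x, a x * density1 ψ x = ∫ X, a (X 0) * ‖ψ X‖ ^ 2 := by
  have hm := measurePreserving_cons (n + 1)
  have h1 := (hm.integrable_comp_emb (consMeasurableEquiv (n + 1)).measurableEmbedding).2 ha
  have h2 := (hm.integral_comp' (g := fun X => a (X 0) * ‖ψ X‖ ^ 2))
  -- `integral_const_mul` requires no integrability, so this holds at every `x`, not just almost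
  -- everywhere.
  have e : ∀ x, ∫ Y, a (consMeasurableEquiv (n + 1) (x, Y) 0) *
      ‖ψ (consMeasurableEquiv (n + 1) (x, Y))‖ ^ 2 = a x * density1 ψ x := by
    intro x
    simp only [consMeasurableEquiv_apply, Fin.cons_zero]
    rw [integral_const_mul, density1]
  have h3 := Integrable.integral_prod_left h1
  simp only [Function.comp, e] at h3
  refine ⟨h3, ?_⟩
  have h4 := integral_prod _ h1
  simp only [Function.comp, e] at h4
  rw [← h2]
  exact h4.symm

/-- Only the weighted integral over the configuration space has to converge, so singular weights `b`
are allowed. -/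
lemma integrable_mul_density2 {b : E3 → E3 → ℝ}
    (hb : Integrable fun X => b (X 0) (X 1) * ‖ψ X‖ ^ 2) :
    Integrable (fun p : E3 × E3 => b p.1 p.2 * density2 ψ p.1 p.2) ∧
      ∫ p : E3 × E3, b p.1 p.2 * density2 ψ p.1 p.2 = ∫ X, b (X 0) (X 1) * ‖ψ X‖ ^ 2 := by
  have hm := measurePreserving_consTwo n
  have h1 := (hm.integrable_comp_emb (consTwoMeasurableEquiv n).measurableEmbedding).2 hb
  have h2 := (hm.integral_comp' (g := fun X => b (X 0) (X 1) * ‖ψ X‖ ^ 2))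
  have e : ∀ p : E3 × E3, ∫ Z, b (consTwoMeasurableEquiv n (p, Z) 0)
      (consTwoMeasurableEquiv n (p, Z) 1) * ‖ψ (consTwoMeasurableEquiv n (p, Z))‖ ^ 2 =
      b p.1 p.2 * density2 ψ p.1 p.2 := by
    intro p
    simp only [consTwoMeasurableEquiv_apply, Fin.cons_zero, Fin.cons_one]
    rw [integral_const_mul, density2]
  have h3 := Integrable.integral_prod_left h1
  simp only [Function.comp, e] at h3
  refine ⟨h3, ?_⟩
  have h4 := integral_prod _ h1
  simp only [Function.comp, e] at h4
  rw [← h2]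
  exact h4.symm

lemma integrable_density1 : Integrable (density1 ψ) := by
  have h := integrable_mul_density1 (ψ := ψ) (a := fun _ => 1)
    (by simpa using integrable_norm_sq ψ)
  simpa using h.1

end Densities

/-! ### Permutations of the particles. -/

section Permutations

variable {N : ℕ}

/-- Relabelling of the particles. -/
noncomputable def permConfig (σ : Equiv.Perm (Fin N)) : Config N ≃ᵐ Config N :=
  MeasurableEquiv.piCongrLeft (fun _ => E3) σ.symm

/-- `piCongrLeft` relabels by the inverse permutation, so `σ.symm` in `permConfig` yields `X ∘ σ`.
-/
lemma permConfig_apply (σ : Equiv.Perm (Fin N)) (X : Config N) :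
    permConfig σ X = fun i => X (σ i) := by
  ext1 i
  have h := Equiv.piCongrLeft_apply_apply (fun _ => E3) σ.symm X (σ i)
  rw [Equiv.symm_apply_apply] at h
  exact h

lemma measurePreserving_permConfig (σ : Equiv.Perm (Fin N)) : MeasurePreserving (permConfig σ) :=
  volume_measurePreserving_piCongrLeft (fun _ => E3) σ.symm

/-- Invariance under permutations of the particles. -/
def IsBosonic (ψ : WaveFn N) : Prop :=
  ∀ σ : Equiv.Perm (Fin N), ∀ᵐ X, ψ (fun i => X (σ i)) = ψ X

variable {ψ : WaveFn N}

lemma IsBosonic.integrable_perm (h : IsBosonic ψ) (σ : Equiv.Perm (Fin N)) {F : Config N → ℝ} :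
    Integrable (fun X => F (fun i => X (σ i)) * ‖ψ X‖ ^ 2) ↔ Integrable (fun X => F X * ‖ψ X‖ ^ 2) := by
  have hm := measurePreserving_permConfig σ
  rw [← hm.integrable_comp_emb (permConfig σ).measurableEmbedding (g := fun X => F X * ‖ψ X‖ ^ 2)]
  refine integrable_congr ?_
  filter_upwards [h σ] with X hX
  simp only [Function.comp, permConfig_apply, hX]

lemma IsBosonic.integral_perm (h : IsBosonic ψ) (σ : Equiv.Perm (Fin N)) (F : Config N → ℝ) :
    ∫ X, F (fun i => X (σ i)) * ‖ψ X‖ ^ 2 = ∫ X, F X * ‖ψ X‖ ^ 2 := by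
  have hm := measurePreserving_permConfig σ
  rw [← hm.integral_comp' (g := fun X => F X * ‖ψ X‖ ^ 2)]
  refine integral_congr_ae ?_
  filter_upwards [h σ] with X hX
  simp only [permConfig_apply, hX]

/-- The action of permutations on wave functions. -/
noncomputable def permWave (σ : Equiv.Perm (Fin N)) : WaveFn N →ₗᵢ[ℂ] WaveFn N :=
  Lp.compMeasurePreservingₗᵢ ℂ (permConfig σ) (measurePreserving_permConfig σ)

lemma coeFn_permWave (σ : Equiv.Perm (Fin N)) (f : WaveFn N) :
    ∀ᵐ X, permWave σ f X = f (fun i => X (σ i)) := by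
  filter_upwards [Lp.coeFn_compMeasurePreserving f (measurePreserving_permConfig σ)] with X hX
  rw [← permConfig_apply]
  exact hX

lemma IsBosonic.permWave_eq (h : IsBosonic ψ) (σ : Equiv.Perm (Fin N)) : permWave σ ψ = ψ := by
  apply Lp.ext
  filter_upwards [coeFn_permWave σ ψ, h σ] with X h1 h2
  rw [h1, h2]

lemma translate_permWave (σ : Equiv.Perm (Fin N)) (v : Config N) (f : WaveFn N) :
    translate v (permWave σ f) = permWave σ (translate (fun i => v (σ i)) f) := by
  apply Lp.ext
  have h1 := ae_add_right v (coeFn_permWave σ f)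
  have h2 : ∀ᵐ X, translate (fun i => v (σ i)) f (permConfig σ X) =
      f (permConfig σ X + fun i => v (σ i)) :=
    (measurePreserving_permConfig σ).quasiMeasurePreserving.ae (coeFn_translate _ f)
  filter_upwards [coeFn_translate v (permWave σ f), h1, h2,
    coeFn_permWave σ (translate (fun i => v (σ i)) f)] with X e1 e2 e3 e4
  rw [e1, e2, e4]
  rw [permConfig_apply] at e3
  rw [e3]
  rfl

lemma HasL2Deriv.permWave {v : Config N} {f g : WaveFn N} (σ : Equiv.Perm (Fin N))
    (h : HasL2Deriv (fun i => v (σ i)) f g) :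
    HasL2Deriv v (permWave σ f) (QuantumEuler.permWave σ g) := by
  unfold HasL2Deriv at *
  have e : (fun s : ℝ => translate (s • v) (QuantumEuler.permWave σ f)) =
      fun s => QuantumEuler.permWave σ (translate (s • fun i => v (σ i)) f) := by
    ext1 s
    rw [translate_permWave]
    rfl
  rw [e]
  exact ((QuantumEuler.permWave σ).toContinuousLinearMap.restrictScalars ℝ).hasFDerivAt.comp_hasDerivAt
    (0 : ℝ) h

lemma particleDir_perm (σ : Equiv.Perm (Fin N)) (j : Fin N) (k : Fin 3) :
    (fun i => (particleDir (σ j) k : Config N) (σ i)) = particleDir j k := by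
  ext1 i
  by_cases hi : i = j
  · subst hi
    simp [particleDir]
  · rw [particleDir, particleDir, Pi.single_eq_of_ne hi,
      Pi.single_eq_of_ne (fun h => hi (σ.injective h))]

/-- The transposition of `i` and `j` fixes `ψ` and exchanges the two directions, so one derivative
is the image of the other under an isometry. All particles thus carry equal kinetic energy. -/
lemma IsBosonic.norm_deriv_eq (h : IsBosonic ψ) {d : Fin N → Fin 3 → WaveFn N}
    (hd : ∀ j k, HasL2Deriv (particleDir j k) ψ (d j k)) (i j : Fin N) (k : Fin 3) :
    ‖d i k‖ = ‖d j k‖ := by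
  set σ := Equiv.swap i j with hσ
  have h1 : HasL2Deriv (fun l => (particleDir (σ j) k : Config N) (σ l)) ψ (d j k) := by
    rw [particleDir_perm]; exact hd j k
  have h2 := h1.permWave σ
  rw [h.permWave_eq, hσ, Equiv.swap_apply_right] at h2
  rw [(hd i k).unique h2, LinearIsometry.norm_map]

end Permutations

/-! ### Pair interactions admitted in the Hamiltonian. -/

section Interactions

variable {n : ℕ} {ψ : WaveFn (n + 2)}

/-- A permutation that moves `0, 1` to two given particles. -/
lemma exists_perm_pair {N : ℕ} {i j i' j' : Fin N} (h : i ≠ j) (h' : i' ≠ j') :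
    ∃ σ : Equiv.Perm (Fin N), σ i = i' ∧ σ j = j' := by
  -- First `i` is sent to `i'`; the second swap corrects the image of `j` and leaves `i'` fixed.
  refine ⟨(Equiv.swap i i').trans (Equiv.swap (Equiv.swap i i' j) j'), ?_, ?_⟩
  · simp only [Equiv.trans_apply, Equiv.swap_apply_left]
    refine Equiv.swap_apply_of_ne_of_ne (fun e => h ?_) h'
    have : Equiv.swap i i' i = Equiv.swap i i' j := by rw [Equiv.swap_apply_left]; exact e
    exact (Equiv.swap i i').injective this
  · simp

lemma IsBosonic.integral_pair (h : IsBosonic ψ) {i j i' j' : Fin (n + 2)} (hij : i ≠ j)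
    (hij' : i' ≠ j') (F : E3 → E3 → ℝ) :
    ∫ X, F (X i) (X j) * ‖ψ X‖ ^ 2 = ∫ X, F (X i') (X j') * ‖ψ X‖ ^ 2 := by
  obtain ⟨σ, h1, h2⟩ := exists_perm_pair hij hij'
  rw [← h.integral_perm σ (fun X => F (X i) (X j))]
  simp only [h1, h2]

lemma IsBosonic.integrable_pair (h : IsBosonic ψ) {i j i' j' : Fin (n + 2)} (hij : i ≠ j)
    (hij' : i' ≠ j') {F : E3 → E3 → ℝ} :
    Integrable (fun X => F (X i) (X j) * ‖ψ X‖ ^ 2) ↔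
      Integrable (fun X => F (X i') (X j') * ‖ψ X‖ ^ 2) := by
  obtain ⟨σ, h1, h2⟩ := exists_perm_pair hij hij'
  rw [← h.integrable_perm σ (F := fun X => F (X i) (X j))]
  simp only [h1, h2]

/-- Even potentials with at most Coulomb singularities. -/
structure IsInteraction (W : E3 → ℝ) : Prop where
  meas : Measurable W
  even : ∀ x, W (-x) = W x
  bound : ∃ C, ∀ x, |W x| ≤ C * (1 + coulomb x)
  odd : ∀ k x, pderiv k W (-x) = -pderiv k W x
  dbound : ∃ C, ∀ k x, |pderiv k W x| ≤ C * (1 + (‖x‖ ^ 2)⁻¹)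
  -- The commutator identity is part of the structure because its proof differs for smooth and for
  -- Coulomb potentials, while everything built on it is common to both.
  commutator : ∀ {n : ℕ} {ψ : WaveFn (n + 2)} {w : Fin 3 → E3 → ℝ} {fd : Fin 3 → WaveFn (n + 2)}
    {z : Config (n + 2) → E3}, IsGoodField w → (∀ k, HasL2Deriv (particleDir 0 k) ψ (fd k)) →
    IsShift z (particleDir 0) →
    2 * (inner ℂ (antiOp w ψ fd) (mulL (fun X => W (z X)) ψ)).re =
      -∑ k, ∫ X, w k (X 0) * pderiv k W (z X) * ‖ψ X‖ ^ 2

lemma isInteraction_coulomb : IsInteraction coulomb where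
  meas := measurable_coulomb
  even x := by rw [coulomb, coulomb, norm_neg]
  bound := ⟨1, fun x => by
    have : 0 ≤ coulomb x := by unfold coulomb; positivity
    rw [abs_of_nonneg this]; linarith⟩
  odd := pderiv_coulomb_neg
  dbound := ⟨1, fun k x => by have := abs_pderiv_coulomb_le k x; linarith⟩
  commutator hw hf hz := re_inner_antiOp_coulomb hw hf hz

lemma pderiv_neg_of_even {W : E3 → ℝ} (hW : Differentiable ℝ W) (he : ∀ x, W (-x) = W x) (k : Fin 3)
    (x : E3) : pderiv k W (-x) = -pderiv k W x := by
  have h1 : HasFDerivAt (fun y => W (-y)) ((fderiv ℝ W (-x)).comp (-ContinuousLinearMap.id ℝ E3)) x :=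
    (hW (-x)).hasFDerivAt.comp x (hasFDerivAt_id x).neg
  simp only [he] at h1
  rw [pderiv, pderiv, h1.fderiv]
  simp

lemma IsC1b.isInteraction {W : E3 → ℝ} (hW : IsC1b W) (he : ∀ x, W (-x) = W x) :
    IsInteraction W where
  meas := hW.isBddMeas.meas
  even := he
  bound := by
    obtain ⟨C, hC⟩ := hW.bdd
    refine ⟨C, fun x => ?_⟩
    have h1 : 0 ≤ coulomb x := by unfold coulomb; positivity
    have h2 := (abs_nonneg _).trans (hC x)
    have := hC x
    nlinarith
  odd := pderiv_neg_of_even hW.diff he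
  dbound := by
    choose C hC using hW.dbdd
    refine ⟨∑ k, |C k|, fun k x => (hC k x).trans ?_⟩
    have h1 : |C k| ≤ ∑ k, |C k| :=
      Finset.single_le_sum (f := fun k => |C k|) (fun i _ => abs_nonneg _) (Finset.mem_univ k)
    have h2 : 0 ≤ (‖x‖ ^ 2)⁻¹ := by positivity
    have h3 := abs_nonneg (C k)
    have h4 := le_abs_self (C k)
    nlinarith
  commutator hw hf hz := re_inner_antiOp_potential hw hf fun k => hW.hasBddLineDeriv_shift hz k

lemma isC1b_scaledPotential {V : E3 → ℝ} (hV : IsProfile V) {N : ℕ} (hN : N ≠ 0) (β : ℝ) :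
    IsC1b (scaledPotential N β V) := by
  have hs : ContDiff ℝ ∞ (scaledPotential N β V) := by
    unfold scaledPotential
    exact contDiff_const.mul (hV.smooth.comp (contDiff_const_smul _))
  have hp : (0 : ℝ) < (N : ℝ) ^ β := Real.rpow_pos_of_pos (by positivity) β
  have hc : HasCompactSupport (scaledPotential N β V) := by
    have h1 : HasCompactSupport (fun x => V ((N : ℝ) ^ β • x)) :=
      hV.compactSupport.comp_smul hp.ne'
    exact h1.mul_left
  have hd : ∀ k, ContDiff ℝ ∞ (pderiv k (scaledPotential N β V)) := fun k =>
    (hs.fderiv_right (m := ∞) (by simp)).clm_apply contDiff_const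
  have hcd : ∀ k, HasCompactSupport (pderiv k (scaledPotential N β V)) := fun k =>
    hc.fderiv_apply ℝ (unitVec k)
  refine ⟨hs.differentiable (by simp), ?_, fun k => ?_⟩
  · obtain ⟨C, hC⟩ := hc.exists_bound_of_continuous hs.continuous
    exact ⟨C, fun x => by simpa using hC x⟩
  · obtain ⟨C, hC⟩ := (hcd k).exists_bound_of_continuous (hd k).continuous
    exact ⟨C, fun x => by simpa using hC x⟩

lemma isInteraction_scaledPotential {V : E3 → ℝ} (hV : IsProfile V) {N : ℕ} (hN : N ≠ 0) (β : ℝ) :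
    IsInteraction (scaledPotential N β V) :=
  (isC1b_scaledPotential hV hN β).isInteraction fun x => by
    unfold scaledPotential
    rw [smul_neg, hV.radial (-((N : ℝ) ^ β • x)) ((N : ℝ) ^ β • x) (norm_neg _)]

end Interactions

/-! ### The total pair interaction as an operator on wave functions. -/

section PairSums

variable {n : ℕ} {W : E3 → ℝ}

lemma coulomb_nonneg (x : E3) : 0 ≤ coulomb x := by
  unfold coulomb
  positivity

section

variable {E : Type*} [NormedAddCommGroup E] [NormedSpace ℝ E] [FiniteDimensional ℝ E]
  [MeasureSpace E] [BorelSpace E] [(volume : Measure E).IsAddHaarMeasure]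
  {z : E → E3} {e : Fin 3 → E} {f : L2 E} {fd : Fin 3 → L2 E}

/-- The bound `|W| ≤ C(1 + V_c)` is combined with Hardy for the Coulomb part. The constant does not
depend on `f`, so it also controls differences of states and makes `Wψ` continuous in time. -/
lemma IsInteraction.mulMem_and_norm_le (hW : IsInteraction W) : ∃ C, ∀ {f : L2 E} {fd : Fin 3 → L2 E},
    IsShift z e → (∀ l, HasL2Deriv (e l) f (fd l)) →
    MulMem (fun x => W (z x)) f ∧
      ‖mulL (fun x => W (z x)) f‖ ≤ C * (‖f‖ + 2 * ∑ l, ‖fd l‖) := by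
  obtain ⟨C, hC⟩ := hW.bound
  have hC0 : 0 ≤ C := by
    have := (abs_nonneg _).trans (hC 0)
    have h2 := coulomb_nonneg 0
    by_contra! h
    nlinarith
  refine ⟨C, fun {f fd} hz hf => ?_⟩
  obtain ⟨hc, -, -⟩ := hardy hz hf
  set g := f + mulL (fun x => coulomb (z x)) f with hg
  have hgx : ∀ᵐ x, g x = ((1 + coulomb (z x) : ℝ) : ℂ) * f x := by
    filter_upwards [Lp.coeFn_add f (mulL (fun x => coulomb (z x)) f), coeFn_mulL hc] with x h1 h2
    rw [hg, h1, Pi.add_apply, h2]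
    push_cast
    ring
  have hle : ∀ᵐ x, ‖(W (z x) : ℂ) * f x‖ ≤ C * ‖g x‖ := by
    filter_upwards [hgx] with x hx
    rw [hx, norm_mul, norm_mul, Complex.norm_real, Complex.norm_real, ← mul_assoc,
      Real.norm_eq_abs, Real.norm_of_nonneg (add_nonneg zero_le_one (coulomb_nonneg (z x)))]
    gcongr
    exact hC _
  have hm : MulMem (fun x => W (z x)) f := by
    refine MemLp.of_le_mul (Lp.memLp g) ?_ hle
    exact (Complex.measurable_ofReal.comp (hW.meas.comp hz.meas)).aestronglyMeasurable.mul
      (Lp.aestronglyMeasurable f)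
  refine ⟨hm, ?_⟩
  have h1 : ‖mulL (fun x => W (z x)) f‖ ≤ C * ‖g‖ := by
    refine Lp.norm_le_mul_norm_of_ae_le_mul ?_
    filter_upwards [coeFn_mulL hm, hle] with x h1 h2
    rw [h1]
    exact h2
  have h2 : ‖mulL (fun x => coulomb (z x)) f‖ ≤ 2 * ∑ l, ‖fd l‖ := by
    refine abs_le_of_sq_le_sq' ?_ (by positivity) |>.2
    refine (norm_mulL_coulomb_sq_le hz hf).trans ?_
    have := Finset.sum_sq_le_sq_sum_of_nonneg (s := Finset.univ) (f := fun l => ‖fd l‖)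
      fun l _ => norm_nonneg _
    rw [mul_pow]
    linarith
  calc _ ≤ C * ‖g‖ := h1
    _ ≤ _ := by
      gcongr
      exact (norm_add_le _ _).trans (by linarith)

lemma IsInteraction.mulMem (hW : IsInteraction W) (hz : IsShift z e)
    (hf : ∀ l, HasL2Deriv (e l) f (fd l)) : MulMem (fun x => W (z x)) f := by
  obtain ⟨C, hC⟩ := hW.mulMem_and_norm_le (z := z) (e := e)
  exact (hC hz hf).1

lemma IsInteraction.tendsto_mulL (hW : IsInteraction W) (hz : IsShift z e) {I : Set ℝ} {t : ℝ}
    (ht : t ∈ I) {F : ℝ → L2 E} {D : ℝ → Fin 3 → L2 E}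
    (hF : ∀ τ ∈ I, ∀ l, HasL2Deriv (e l) (F τ) (D τ l)) (hFc : ContinuousWithinAt F I t)
    (hDc : ∀ l, ContinuousWithinAt (fun τ => D τ l) I t) :
    Tendsto (fun τ => mulL (fun x => W (z x)) (F τ)) (𝓝[I] t)
      (𝓝 (mulL (fun x => W (z x)) (F t))) := by
  obtain ⟨C, hC⟩ := hW.mulMem_and_norm_le (z := z) (e := e)
  rw [tendsto_iff_norm_sub_tendsto_zero]
  have h1 : Tendsto (fun τ => C * (‖F τ - F t‖ + 2 * ∑ l, ‖D τ l - D t l‖)) (𝓝[I] t)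
      (𝓝 (C * (‖F t - F t‖ + 2 * ∑ l, ‖D t l - D t l‖))) :=
    ((hFc.sub_const _).norm.add ((tendsto_finsetSum _ fun l _ =>
      ((hDc l).sub_const _).norm).const_mul 2)).const_mul C
  simp only [sub_self, norm_zero, Finset.sum_const_zero, mul_zero, add_zero] at h1
  refine squeeze_zero' (Eventually.of_forall fun _ => norm_nonneg _) ?_ h1
  filter_upwards [self_mem_nhdsWithin] with τ hτ
  rw [← mulL_sub (hC hz (hF τ hτ)).1 (hC hz (hF t ht)).1]
  exact (hC hz fun l => (hF τ hτ l).sub (hF t ht l)).2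

end

/-- `∑_{j<k} W(x_j - x_k) ψ`. -/
noncomputable def pairSum (W : E3 → ℝ) (ψ : WaveFn (n + 2)) : WaveFn (n + 2) :=
  ∑ j, ∑ k ∈ Finset.Ioi j, mulL (fun X => W (X j - X k)) ψ

variable {ψ : WaveFn (n + 2)} {d : Fin (n + 2) → Fin 3 → WaveFn (n + 2)}

lemma IsInteraction.mulMem_pair (hW : IsInteraction W)
    (hd : ∀ j k, HasL2Deriv (particleDir j k) ψ (d j k)) {j k : Fin (n + 2)} (hjk : j ≠ k) :
    MulMem (fun X => W (X j - X k)) ψ :=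
  hW.mulMem (isShift_pair hjk) (hd j)

lemma IsInteraction.coeFn_pairSum (hW : IsInteraction W)
    (hd : ∀ j k, HasL2Deriv (particleDir j k) ψ (d j k)) :
    ∀ᵐ X, pairSum W ψ X = ((∑ j, ∑ k ∈ Finset.Ioi j, W (X j - X k) : ℝ) : ℂ) * ψ X := by
  have h1 : ∀ᵐ X, ∀ j, ∀ k ∈ Finset.Ioi j, mulL (fun X => W (X j - X k)) ψ X =
      (W (X j - X k) : ℂ) * ψ X := by
    rw [ae_all_iff]
    intro j
    refine (ae_ball_iff (Finset.countable_toSet (Finset.Ioi j))).2 fun k hk => ?_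
    exact coeFn_mulL (hW.mulMem_pair hd (Finset.mem_Ioi.1 (Finset.mem_coe.1 hk)).ne)
  have h2 : ∀ᵐ X, pairSum W ψ X = ∑ j, (∑ k ∈ Finset.Ioi j, mulL (fun X => W (X j - X k)) ψ) X := by
    rw [pairSum]
    filter_upwards [Lp.coeFn_finsetSum Finset.univ
      fun j => ∑ k ∈ Finset.Ioi j, mulL (fun X => W (X j - X k)) ψ] with X hX
    rw [hX, Finset.sum_apply]
  have h3 : ∀ᵐ X, ∀ j, (∑ k ∈ Finset.Ioi j, mulL (fun X => W (X j - X k)) ψ) X =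
      ∑ k ∈ Finset.Ioi j, mulL (fun X => W (X j - X k)) ψ X := by
    rw [ae_all_iff]
    intro j
    filter_upwards [Lp.coeFn_finsetSum (Finset.Ioi j)
      fun k => mulL (fun X => W (X j - X k)) ψ] with X hX
    rw [hX, Finset.sum_apply]
  filter_upwards [h1, h2, h3] with X e1 e2 e3
  rw [e2, Complex.ofReal_sum, Finset.sum_mul]
  refine Finset.sum_congr rfl fun j _ => ?_
  rw [e3, Complex.ofReal_sum, Finset.sum_mul]
  exact Finset.sum_congr rfl fun k hk => e1 j k hk

lemma IsInteraction.inner_pairSum_comm (hW : IsInteraction W)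
    (hd : ∀ j k, HasL2Deriv (particleDir j k) ψ (d j k)) {ψ' : WaveFn (n + 2)}
    {d' : Fin (n + 2) → Fin 3 → WaveFn (n + 2)}
    (hd' : ∀ j k, HasL2Deriv (particleDir j k) ψ' (d' j k)) :
    inner ℂ (pairSum W ψ) ψ' = inner ℂ ψ (pairSum W ψ') := by
  simp only [pairSum, sum_inner, inner_sum]
  refine Finset.sum_congr rfl fun j _ => Finset.sum_congr rfl fun k hk => ?_
  have hjk := (Finset.mem_Ioi.1 hk).ne
  exact inner_mulL_comm (hW.mulMem_pair hd hjk) (hW.mulMem_pair hd' hjk)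

lemma IsInteraction.tendsto_pairSum (hW : IsInteraction W) {I : Set ℝ} {t : ℝ} (ht : t ∈ I)
    {ψ : ℝ → WaveFn (n + 2)} {d : ℝ → Fin (n + 2) → Fin 3 → WaveFn (n + 2)}
    (hd : ∀ τ ∈ I, ∀ j k, HasL2Deriv (particleDir j k) (ψ τ) (d τ j k))
    (hψc : ContinuousWithinAt ψ I t) (hdc : ∀ j k, ContinuousWithinAt (fun τ => d τ j k) I t) :
    Tendsto (fun τ => pairSum W (ψ τ)) (𝓝[I] t) (𝓝 (pairSum W (ψ t))) := by
  refine tendsto_finsetSum _ fun j _ => tendsto_finsetSum _ fun k hk => ?_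
  exact hW.tendsto_mulL (isShift_pair (Finset.mem_Ioi.1 hk).ne) ht (fun τ hτ => hd τ hτ j) hψc (hdc j)

lemma im_inner_mulL_mulL {a U : Config (n + 2) → ℝ} (ha : IsBddMeas a) (hU : MulMem U ψ) :
    (inner ℂ (mulL a ψ) (mulL U ψ)).im = 0 := by
  rw [im_inner_mulL hU]
  refine integral_eq_zero_of_ae ?_
  filter_upwards [coeFn_mulL (ha.mulMem ψ)] with X hX
  rw [hX, map_mul, Complex.conj_ofReal, mul_assoc, ← Complex.normSq_eq_conj_mul_self]
  rw [← Complex.ofReal_mul, Complex.ofReal_im, mul_zero]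
  rfl

/-- Real multiplications commute: the interactions contribute nothing to the evolution of a density.
-/
lemma IsInteraction.im_inner_mulL_pairSum (hW : IsInteraction W)
    (hd : ∀ j k, HasL2Deriv (particleDir j k) ψ (d j k)) {a : Config (n + 2) → ℝ}
    (ha : IsBddMeas a) : (inner ℂ (mulL a ψ) (pairSum W ψ)).im = 0 := by
  simp only [pairSum, inner_sum, Complex.im_sum]
  refine Finset.sum_eq_zero fun j _ => Finset.sum_eq_zero fun k hk => ?_
  exact im_inner_mulL_mulL ha (hW.mulMem_pair hd (Finset.mem_Ioi.1 hk).ne)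

/-- Potentials that do not depend on the first particle commute with `antiOp`. -/
lemma re_inner_antiOp_of_invariant {w : Fin 3 → E3 → ℝ} (hw : IsGoodField w)
    {fd : Fin 3 → WaveFn (n + 2)} (hf : ∀ k, HasL2Deriv (particleDir 0 k) ψ (fd k))
    {U : Config (n + 2) → ℝ} (hU : Measurable U) (hUm : MulMem U ψ)
    (hinv : ∀ X (h : ℝ) k, U (X + h • particleDir 0 k) = U X) :
    (inner ℂ (antiOp w ψ fd) (mulL U ψ)).re = 0 := by
  -- `U` may be unbounded, so it is truncated at height `m`. The truncation is still independent of
  -- `x_1`, and the bounded commutator identity with zero derivative applies to it.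
  set V : ℕ → Config (n + 2) → ℝ := fun m X => max (-(m : ℝ)) (min (U X) m) with hV
  have hVm : ∀ m, Measurable (V m) := fun m => measurable_const.max (hU.min measurable_const)
  have hVb : ∀ (m : ℕ) X, |V m X| ≤ m := fun m X => by
    rw [abs_le]
    exact ⟨le_max_left _ _, max_le (by have : (0 : ℝ) ≤ m := m.cast_nonneg; linarith) (min_le_right _ _)⟩
  have hVU : ∀ m X, |V m X| ≤ |U X| := fun m X => by
    have h0 : (0 : ℝ) ≤ m := m.cast_nonneg
    have h1 := neg_abs_le (U X)
    have h2 := le_abs_self (U X)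
    rw [abs_le]
    refine ⟨?_, max_le (by have := abs_nonneg (U X); linarith) ((min_le_left _ _).trans h2)⟩
    refine le_max_of_le_right (le_min h1 ?_)
    have := abs_nonneg (U X)
    linarith
  have hlim : ∀ X, Tendsto (fun m => V m X) atTop (𝓝 (U X)) := fun X => by
    refine tendsto_const_nhds.congr' ?_
    obtain ⟨M, hM⟩ := exists_nat_ge |U X|
    filter_upwards [eventually_ge_atTop M] with m hm
    have h3 : |U X| ≤ m := hM.trans (by exact_mod_cast hm)
    rw [hV]
    simp only
    rw [min_eq_left ((le_abs_self _).trans h3), max_eq_right (by linarith [neg_abs_le (U X)])]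
  have habs : MulMem (fun X => |U X|) ψ :=
    mulMem_of_le hU.abs (Eventually.of_forall fun X => (abs_abs _).le) hUm
  have h1 : Tendsto (fun m => mulL (V m) ψ) atTop (𝓝 (mulL U ψ)) :=
    tendsto_mulL_of_dominated habs hU
      (Eventually.of_forall fun m => ⟨hVm m, Eventually.of_forall fun X => hVU m X⟩)
      (Eventually.of_forall fun X => le_rfl) (Eventually.of_forall hlim)
  have h2 : Tendsto (fun m => (inner ℂ (antiOp w ψ fd) (mulL (V m) ψ)).re) atTop
      (𝓝 (inner ℂ (antiOp w ψ fd) (mulL U ψ)).re) :=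
    (Complex.continuous_re.tendsto _).comp (tendsto_const_nhds.inner h1)
  refine tendsto_nhds_unique h2 (tendsto_const_nhds.congr fun m => ?_)
  have h3 := re_inner_antiOp_potential (U := V m) (U' := fun _ _ => 0) hw hf fun k =>
    ⟨⟨hVm m, m, hVb m⟩, ⟨measurable_const, 0, by simp⟩, fun X => by
      simp only [hV, hinv]
      exact hasDerivAt_const _ _⟩
  simp only [mul_zero, zero_mul, integral_zero, Finset.sum_const_zero, neg_zero] at h3
  linarith

lemma card_Ioi_zero : ((Finset.Ioi (0 : Fin (n + 2))).card : ℝ) = n + 1 := by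
  simp

/-- This is the number `N(N-1)/2` of pairs, with `N = n + 2`. -/
lemma sum_card_Ioi : ∑ j : Fin (n + 2), ((Finset.Ioi j).card : ℝ) = (n + 2) * (n + 1) / 2 := by
  have h : ∀ j : Fin (n + 2), ((Finset.Ioi j).card : ℝ) = (n + 1) - (j : ℕ) := fun j => by
    rw [Fin.card_Ioi, show n + 2 - 1 - (j : ℕ) = n + 1 - j by omega, Nat.cast_sub (by omega)]
    push_cast
    ring
  simp only [h, Finset.sum_sub_distrib, Finset.sum_const, Finset.card_univ, Fintype.card_fin]
  have h2 : ∑ j : Fin (n + 2), ((j : ℕ) : ℝ) = ∑ j ∈ Finset.range (n + 2), (j : ℝ) :=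
    Fin.sum_univ_eq_sum_range (fun i => (i : ℝ)) (n + 2)
  have h3 : (∑ j ∈ Finset.range (n + 2), (j : ℝ)) * 2 = (n + 2) * (n + 1) := by
    have := Finset.sum_range_id_mul_two (n + 2)
    have h4 : ((∑ j ∈ Finset.range (n + 2), j : ℕ) : ℝ) * 2 = ((n + 2) * (n + 2 - 1) : ℕ) := by
      exact_mod_cast this
    push_cast at h4
    exact h4
  rw [h2, nsmul_eq_mul]
  push_cast
  linarith

/-- By symmetry every pair contributes as much as the pair `0, 1`. -/
lemma IsInteraction.re_inner_pairSum (hW : IsInteraction W)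
    (hd : ∀ j k, HasL2Deriv (particleDir j k) ψ (d j k)) (hs : IsBosonic ψ) :
    (inner ℂ ψ (pairSum W ψ)).re = (n + 2) * (n + 1) / 2 * ∫ X, W (X 0 - X 1) * ‖ψ X‖ ^ 2 := by
  have h01 : (0 : Fin (n + 2)) ≠ 1 := by simp
  simp only [pairSum, inner_sum, Complex.re_sum]
  have h : ∀ j, ∀ k ∈ Finset.Ioi j, (inner ℂ ψ (mulL (fun X => W (X j - X k)) ψ)).re =
      ∫ X, W (X 0 - X 1) * ‖ψ X‖ ^ 2 := by
    intro j k hk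
    have hjk := (Finset.mem_Ioi.1 hk).ne
    rw [inner_mulL_self (hW.mulMem_pair hd hjk), Complex.ofReal_re]
    exact hs.integral_pair hjk h01 fun x y => W (x - y)
  rw [Finset.sum_congr rfl fun j _ => Finset.sum_congr rfl (h j)]
  simp only [Finset.sum_const, nsmul_eq_mul]
  rw [← Finset.sum_mul, sum_card_Ioi]

/-- Pairs without particle `0` do not depend on `x_1` and drop out; the `n + 1` pairs that contain
it contribute equally. -/
lemma IsInteraction.re_inner_antiOp_pairSum (hW : IsInteraction W)
    (hd : ∀ j k, HasL2Deriv (particleDir j k) ψ (d j k)) (hs : IsBosonic ψ)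
    {w : Fin 3 → E3 → ℝ} (hw : IsGoodField w) :
    2 * (inner ℂ (antiOp w ψ (d 0)) (pairSum W ψ)).re =
      -(n + 1) * ∑ k, ∫ X, w k (X 0) * pderiv k W (X 0 - X 1) * ‖ψ X‖ ^ 2 := by
  have h01 : (0 : Fin (n + 2)) ≠ 1 := by simp
  simp only [pairSum, inner_sum, Complex.re_sum]
  have h0 : ∀ k ∈ Finset.Ioi (0 : Fin (n + 2)),
      (inner ℂ (antiOp w ψ (d 0)) (mulL (fun X => W (X 0 - X k)) ψ)).re =
      -(1 / 2) * ∑ l, ∫ X, w l (X 0) * pderiv l W (X 0 - X 1) * ‖ψ X‖ ^ 2 := by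
    intro k hk
    have hk0 := (Finset.mem_Ioi.1 hk).ne
    have h1 := hW.commutator hw (hd 0) (isShift_pair hk0)
    have h2 : ∀ l, ∫ X, w l (X 0) * pderiv l W (X 0 - X k) * ‖ψ X‖ ^ 2 =
        ∫ X, w l (X 0) * pderiv l W (X 0 - X 1) * ‖ψ X‖ ^ 2 := fun l =>
      hs.integral_pair hk0 h01 fun x y => w l x * pderiv l W (x - y)
    rw [Finset.sum_congr rfl fun l _ => h2 l] at h1
    linarith
  have hj : ∀ j ∈ Finset.univ, j ≠ (0 : Fin (n + 2)) → (∑ k ∈ Finset.Ioi j,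
      (inner ℂ (antiOp w ψ (d 0)) (mulL (fun X => W (X j - X k)) ψ)).re) = 0 := by
    intro j _ hj
    refine Finset.sum_eq_zero fun k hk => ?_
    have hjk := Finset.mem_Ioi.1 hk
    have hk0 : k ≠ 0 := fun h => by
      rw [h] at hjk
      exact absurd hjk (Fin.not_lt_zero j)
    refine re_inner_antiOp_of_invariant hw (hd 0)
      (hW.meas.comp ((measurable_pi_apply j).sub (measurable_pi_apply k)))
      (hW.mulMem_pair hd hjk.ne) fun X h l => ?_
    simp [particleDir, Pi.single_eq_of_ne hj, Pi.single_eq_of_ne hk0]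
  rw [Finset.sum_eq_single 0 hj (by simp), Finset.sum_congr rfl h0, Finset.sum_const, nsmul_eq_mul,
    card_Ioi_zero]
  ring

end PairSums

/-! ### Consequences of the Schrödinger equation: mass, momentum and energy. -/

section Dynamics

variable {n : ℕ}

/-- The Hamiltonian with two pair interactions, acting on an element of `H²`. -/
noncomputable def pairHamiltonian (ħ a₁ a₂ : ℝ) (W₁ W₂ : E3 → ℝ) (ψ : WaveFn (n + 2))
    (d2 : Fin (n + 2) → Fin 3 → Fin (n + 2) → Fin 3 → WaveFn (n + 2)) : WaveFn (n + 2) :=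
  ((-(ħ ^ 2 / 2) : ℝ) : ℂ) • (∑ j, ∑ k, d2 j k j k) + ((a₁ : ℝ) : ℂ) • pairSum W₁ ψ +
    ((a₂ : ℝ) : ℂ) • pairSum W₂ ψ

variable {ħ a₁ a₂ : ℝ} {W₁ W₂ : E3 → ℝ} {ψ φ : WaveFn (n + 2)}
  {d : Fin (n + 2) → Fin 3 → WaveFn (n + 2)}
  {d2 : Fin (n + 2) → Fin 3 → Fin (n + 2) → Fin 3 → WaveFn (n + 2)}

lemma re_inner_pairHamiltonian (x : WaveFn (n + 2)) :
    (inner ℂ x (pairHamiltonian ħ a₁ a₂ W₁ W₂ ψ d2)).re =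
      -(ħ ^ 2 / 2) * (∑ j, ∑ k, (inner ℂ x (d2 j k j k)).re) +
        a₁ * (inner ℂ x (pairSum W₁ ψ)).re + a₂ * (inner ℂ x (pairSum W₂ ψ)).re := by
  simp only [pairHamiltonian, inner_add_right, inner_smul_right, inner_sum, Complex.add_re,
    Complex.re_ofReal_mul, Complex.re_sum]

lemma im_inner_pairHamiltonian (x : WaveFn (n + 2)) :
    (inner ℂ x (pairHamiltonian ħ a₁ a₂ W₁ W₂ ψ d2)).im =
      -(ħ ^ 2 / 2) * (∑ j, ∑ k, (inner ℂ x (d2 j k j k)).im) +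
        a₁ * (inner ℂ x (pairSum W₁ ψ)).im + a₂ * (inner ℂ x (pairSum W₂ ψ)).im := by
  simp only [pairHamiltonian, inner_add_right, inner_smul_right, inner_sum, Complex.add_im,
    Complex.im_ofReal_mul, Complex.im_sum]

lemma im_inner_of_schroedinger {H : WaveFn (n + 2)} (hφ : (Complex.I * ħ) • φ = H)
    (x : WaveFn (n + 2)) :
    (inner ℂ x H).im = ħ * (inner ℂ x φ).re ∧ (inner ℂ x H).re = -(ħ * (inner ℂ x φ).im) := by
  rw [← hφ, inner_smul_right]
  simp [Complex.mul_re, Complex.mul_im]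

/-- Conservation of mass: the rate of change of a one-particle observable. -/
lemma IsH2.re_inner_observable (h : IsH2 ψ d d2) (hW₁ : IsInteraction W₁) (hW₂ : IsInteraction W₂)
    (hħ : 0 < ħ) (hφ : (Complex.I * ħ) • φ = pairHamiltonian ħ a₁ a₂ W₁ W₂ ψ d2) {a : E3 → ℝ}
    (ha : IsC1b a) :
    2 * (inner ℂ (mulL (lift0 a) ψ) φ).re =
      ħ * ∑ k, ∫ X, pderiv k a (X 0) * ((starRingEnd ℂ) (ψ X) * d 0 k X).im := by
  have h1 := (im_inner_of_schroedinger hφ (mulL (lift0 a) ψ)).1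
  rw [im_inner_pairHamiltonian, hW₁.im_inner_mulL_pairSum h.first ha.isBddMeas.lift0,
    hW₂.im_inner_mulL_pairSum h.first ha.isBddMeas.lift0, Finset.sum_eq_single 0
      (fun j _ hj => Finset.sum_eq_zero fun k _ => h.im_inner_of_ne ha hj k) (by simp),
    Finset.sum_congr rfl fun k _ => h.im_inner_zero ha k] at h1
  have h2 : ∀ k, (inner ℂ (mulL (lift0 (pderiv k a)) ψ) (d 0 k)).im =
      ∫ X, pderiv k a (X 0) * ((starRingEnd ℂ) (ψ X) * d 0 k X).im := fun k => by
    have hm := fun q : WaveFn (n + 2) => (ha.isBddMeas_pderiv k).lift0.mulMem q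
    rw [inner_mulL_comm (hm _) (hm _), im_inner_mulL (hm _)]
    rfl
  simp only [h2, Finset.sum_neg_distrib, mul_zero, add_zero] at h1
  -- The Schrödinger equation yields the identity multiplied by `ħ`, which is cancelled at the end.
  have h3 : ħ * (2 * (inner ℂ (mulL (lift0 a) ψ) φ).re) =
      ħ * (ħ * ∑ k, ∫ X, pderiv k a (X 0) * ((starRingEnd ℂ) (ψ X) * d 0 k X).im) := by
    linear_combination -2 * h1
  exact mul_left_cancel₀ hħ.ne' h3

/-- The rate of change of the momentum along a field. -/
lemma IsH2.im_inner_antiOp_evolution (h : IsH2 ψ d d2) (hW₁ : IsInteraction W₁)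
    (hW₂ : IsInteraction W₂) (hs : IsBosonic ψ)
    (hφ : (Complex.I * ħ) • φ = pairHamiltonian ħ a₁ a₂ W₁ W₂ ψ d2) {w : Fin 3 → E3 → ℝ}
    (hw : IsGoodField w) :
    -2 * ħ * (inner ℂ (antiOp w ψ (d 0)) φ).im =
      ħ ^ 2 * (∑ l, ∑ k, (inner ℂ (mulL (lift0 (pderiv l (w k))) (d 0 k)) (d 0 l)).re) -
        ħ ^ 2 / 4 * (∑ l, ∫ X, pderiv l (pderiv l (fieldDiv w)) (X 0) * ‖ψ X‖ ^ 2) -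
        a₁ * (n + 1) * (∑ k, ∫ X, w k (X 0) * pderiv k W₁ (X 0 - X 1) * ‖ψ X‖ ^ 2) -
        a₂ * (n + 1) * ∑ k, ∫ X, w k (X 0) * pderiv k W₂ (X 0 - X 1) * ‖ψ X‖ ^ 2 := by
  -- The quantity sought is `2 Re⟨Aψ, Hψ⟩`; in it only the Laplacian of the first particle and the
  -- pairs containing that particle survive.
  have h1 := (im_inner_of_schroedinger hφ (antiOp w ψ (d 0))).2
  rw [re_inner_pairHamiltonian, Finset.sum_eq_single 0
      (fun j _ hj => Finset.sum_eq_zero fun k _ => h.re_inner_antiOp_of_ne hw hj k) (by simp),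
    Finset.sum_congr rfl fun k _ => h.re_inner_antiOp_zero hw k, Finset.sum_add_distrib,
    Finset.sum_neg_distrib, ← Finset.mul_sum] at h1
  have h2 := hW₁.re_inner_antiOp_pairSum h.first hs hw
  have h3 := hW₂.re_inner_antiOp_pairSum h.first hs hw
  linear_combination -2 * h1 + a₁ * h2 + a₂ * h3

/-- Two integrations by parts for the Laplacian, and real potentials. Two different states are
needed because polarization pairs the solution at two times. -/
lemma IsH2.inner_pairHamiltonian_comm (h : IsH2 ψ d d2) (hW₁ : IsInteraction W₁)
    (hW₂ : IsInteraction W₂) {ψ' : WaveFn (n + 2)} {d' : Fin (n + 2) → Fin 3 → WaveFn (n + 2)}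
    {d2' : Fin (n + 2) → Fin 3 → Fin (n + 2) → Fin 3 → WaveFn (n + 2)} (h' : IsH2 ψ' d' d2') :
    inner ℂ (pairHamiltonian ħ a₁ a₂ W₁ W₂ ψ d2) ψ' =
      inner ℂ ψ (pairHamiltonian ħ a₁ a₂ W₁ W₂ ψ' d2') := by
  simp only [pairHamiltonian, inner_add_left, inner_add_right, inner_smul_left, inner_smul_right,
    Complex.conj_ofReal, sum_inner, inner_sum, hW₁.inner_pairSum_comm h.first h'.first,
    hW₂.inner_pairSum_comm h.first h'.first]
  congr 3
  refine Finset.sum_congr rfl fun j _ => Finset.sum_congr rfl fun k _ => ?_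
  rw [(h.second j k j k).inner_eq_neg (h'.first j k), (h.first j k).inner_eq_neg (h'.second j k j k),
    neg_neg]

/-- Conservation of energy. -/
lemma hasDerivWithinAt_energy {I : Set ℝ} {t : ℝ} (ht : t ∈ I) {ψ : ℝ → WaveFn (n + 2)}
    {d : ℝ → Fin (n + 2) → Fin 3 → WaveFn (n + 2)}
    {d2 : ℝ → Fin (n + 2) → Fin 3 → Fin (n + 2) → Fin 3 → WaveFn (n + 2)}
    (h : ∀ τ ∈ I, IsH2 (ψ τ) (d τ) (d2 τ)) (hW₁ : IsInteraction W₁) (hW₂ : IsInteraction W₂)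
    (hψ : HasDerivWithinAt ψ φ I t) (hdc : ∀ j k, ContinuousWithinAt (fun τ => d τ j k) I t)
    (hd2c : ∀ j k, ContinuousWithinAt (fun τ => d2 τ j k j k) I t)
    (hφ : (Complex.I * ħ) • φ = pairHamiltonian ħ a₁ a₂ W₁ W₂ (ψ t) (d2 t)) :
    HasDerivWithinAt
      (fun τ => (inner ℂ (ψ τ) (pairHamiltonian ħ a₁ a₂ W₁ W₂ (ψ τ) (d2 τ))).re) 0 I t := by
  have hle : 𝓝[I \ {t}] t ≤ 𝓝[I] t := nhdsWithin_mono _ sdiff_subset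
  have hc := hψ.continuousWithinAt
  set H : ℝ → WaveFn (n + 2) := fun τ => pairHamiltonian ħ a₁ a₂ W₁ W₂ (ψ τ) (d2 τ) with hH
  -- By symmetry of `H` the energy difference is `Re⟨Hψ_τ + Hψ_t, ψ_τ - ψ_t⟩`. Continuity in `H²`
  -- makes `Hψ` continuous in `L²`, and the limit `2 Re⟨Hψ, φ⟩` vanishes since `Hψ = iħφ`.
  have hHc : Tendsto H (𝓝[I \ {t}] t) (𝓝 (H t)) := by
    refine Tendsto.mono_left ?_ hle
    refine (Tendsto.add (Tendsto.const_smul ?_ _) (Tendsto.const_smul ?_ _)).add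
      (Tendsto.const_smul ?_ _)
    · exact tendsto_finsetSum _ fun j _ => tendsto_finsetSum _ fun k _ => hd2c j k
    · exact hW₁.tendsto_pairSum ht (fun τ hτ => (h τ hτ).first) hc hdc
    · exact hW₂.tendsto_pairSum ht (fun τ hτ => (h τ hτ).first) hc hdc
  rw [hasDerivWithinAt_iff_tendsto_slope] at hψ ⊢
  have h1 := (Complex.continuous_re.tendsto _).comp ((hHc.add_const (H t)).inner (𝕜 := ℂ) hψ)
  have e : (inner ℂ (H t + H t) φ).re = 0 := by
    have h2 : H t = (Complex.I * ħ) • φ := hφ.symm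
    rw [h2, inner_add_left, inner_smul_left, inner_self_eq_norm_sq_to_K]
    simp only [map_mul, Complex.conj_I, Complex.conj_ofReal, Complex.add_re]
    have : ((-Complex.I * ħ : ℂ) * ((‖φ‖ : ℝ) : ℂ) ^ 2).re = 0 := by
      rw [← Complex.ofReal_pow, Complex.re_mul_ofReal]
      simp
    have h3 : ((-Complex.I * ħ : ℂ) * (RCLike.ofReal ‖φ‖ : ℂ) ^ 2).re = 0 := this
    rw [h3, add_zero]
  rw [e] at h1
  refine h1.congr' ?_
  filter_upwards [self_mem_nhdsWithin] with τ hτ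
  simp only [Function.comp, slope_def_module, smul_eq_mul]
  rw [inner_smul_right_eq_smul, Complex.real_smul, Complex.re_ofReal_mul, inner_add_left,
    inner_sub_right, inner_sub_right, (h τ hτ.1).inner_pairHamiltonian_comm hW₁ hW₂ (h τ hτ.1),
    (h t ht).inner_pairHamiltonian_comm hW₁ hW₂ (h t ht)]
  have h4 : (inner ℂ (H τ) (ψ t)).re = (inner ℂ (H t) (ψ τ)).re := by
    rw [(h τ hτ.1).inner_pairHamiltonian_comm hW₁ hW₂ (h t ht), ← inner_conj_symm, Complex.conj_re]
  simp only [Complex.add_re, Complex.sub_re]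
  have h5 : (inner ℂ (pairHamiltonian ħ a₁ a₂ W₁ W₂ (ψ τ) (d2 τ)) (ψ t)).re =
    (inner ℂ (pairHamiltonian ħ a₁ a₂ W₁ W₂ (ψ t) (d2 t)) (ψ τ)).re := h4
  rw [h5]
  ring

/-- All `N` particles have equal kinetic energy and all `N(N-1)/2` pairs equal interaction energy.
What multiplies `N/2` is, for the coupling constants of the model, the part of the modulated energy
without fluid variables. -/
lemma IsH2.energy_eq (h : IsH2 ψ d d2) (hW₁ : IsInteraction W₁) (hW₂ : IsInteraction W₂)
    (hs : IsBosonic ψ) :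
    (inner ℂ ψ (pairHamiltonian ħ a₁ a₂ W₁ W₂ ψ d2)).re = (n + 2) / 2 *
      (ħ ^ 2 * (∑ k, ‖d 0 k‖ ^ 2) + a₁ * (n + 1) * (∫ X, W₁ (X 0 - X 1) * ‖ψ X‖ ^ 2) +
        a₂ * (n + 1) * ∫ X, W₂ (X 0 - X 1) * ‖ψ X‖ ^ 2) := by
  have h1 : ∀ j k, (inner ℂ ψ (d2 j k j k)).re = -‖d 0 k‖ ^ 2 := by
    intro j k
    have h2 := (h.first j k).inner_eq_neg (h.second j k j k)
    rw [eq_neg_iff_add_eq_zero, add_comm, ← eq_neg_iff_add_eq_zero] at h2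
    rw [h2, Complex.neg_re, ← hs.norm_deriv_eq h.first j 0 k]
    congr 1
    exact inner_self_eq_norm_sq (𝕜 := ℂ) (d j k)
  rw [re_inner_pairHamiltonian, hW₁.re_inner_pairSum h.first hs, hW₂.re_inner_pairSum h.first hs]
  simp only [h1, Finset.sum_neg_distrib, Finset.sum_const, Finset.card_univ, Fintype.card_fin,
    nsmul_eq_mul]
  push_cast
  ring

end Dynamics

/-! ### Convolutions with singular kernels. -/

section Kernels

open Metric

/-- The convolution of a kernel with a function. -/
noncomputable def kernelConv (k h : E3 → ℝ) (x : E3) : ℝ := ∫ y, k (x - y) * h y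

/-- The integral is split at `|x - y| = 1`: inside, `k` is integrable and `h` bounded; outside, `k`
is bounded and `h` integrable. -/
lemma kernel_estimate {k h : E3 → ℝ} {a M : ℝ} (hk : Measurable k) (ha : 0 ≤ a)
    (hkb : IntegrableOn k (ball 0 1)) (hka : ∀ y ∉ ball (0 : E3) 1, |k y| ≤ a) (hi : Integrable h)
    (hM : ∀ y, |h y| ≤ M) (x : E3) :
    Integrable (fun y => k (x - y) * h y) ∧
      ∫ y, |k (x - y) * h y| ≤ M * (∫ y in ball 0 1, |k y|) + a * ∫ y, |h y| := by
  set g : E3 → ℝ := (ball (0 : E3) 1).indicator fun y => |k y| with hg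
  have hgi : Integrable g := (integrable_indicator_iff measurableSet_ball).2 hkb.abs
  have hgx : Integrable (fun y => g (x - y)) := hgi.comp_sub_left x
  have hG : Integrable (fun y => M * g (x - y) + a * |h y|) :=
    (hgx.const_mul M).add (hi.abs.const_mul a)
  have hle : ∀ y, |k (x - y) * h y| ≤ M * g (x - y) + a * |h y| := by
    intro y
    have h0 := abs_nonneg (h y)
    have h1 := hM y
    rw [abs_mul]
    by_cases hy : x - y ∈ ball (0 : E3) 1
    · rw [hg, indicator_of_mem hy]
      have := abs_nonneg (k (x - y))
      nlinarith
    · rw [hg, indicator_of_notMem hy]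
      have := hka _ hy
      nlinarith
  have hI : Integrable (fun y => k (x - y) * h y) :=
    hG.mono' ((hk.comp (measurable_const.sub measurable_id)).aestronglyMeasurable.mul
      hi.aestronglyMeasurable) (Eventually.of_forall fun y => hle y)
  refine ⟨hI, (integral_mono hI.abs hG hle).trans (le_of_eq ?_)⟩
  rw [integral_add (hgx.const_mul M) (hi.abs.const_mul a), integral_const_mul, integral_const_mul,
    integral_sub_left_eq_self g volume x, hg, integral_indicator measurableSet_ball]

/-- Kernels with at most a singularity of the form `|y|⁻²`. -/
structure IsKernel (C : ℝ) (k : E3 → ℝ) : Prop where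
  nonneg : 0 ≤ C
  meas : Measurable k
  -- At the origin `(‖y‖ ^ 2)⁻¹` has the default value `0`, and the regularized Coulomb kernels with
  -- small `ε` would violate the bound there with a common `C`.
  bound : ∀ y, y ≠ 0 → |k y| ≤ C * (1 + (‖y‖ ^ 2)⁻¹)

lemma integrableOn_kernel : IntegrableOn (fun y : E3 => 1 + (‖y‖ ^ 2)⁻¹) (ball 0 1) := by
  refine IntegrableOn.add (integrableOn_const (by simp)) ?_
  refine integrableOn_ball_of_norm_le_rpow (α := 2) (C := 1) (by simp) (by simp; norm_num)
    (Eventually.of_forall fun x => ?_) (by fun_prop)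
  rw [one_mul, Real.norm_of_nonneg (by positivity), Real.rpow_neg (norm_nonneg _)]
  norm_cast

/-- The constant in the estimate of convolutions with kernels. -/
noncomputable def kernelConst : ℝ := ∫ y in ball (0 : E3) 1, (1 + (‖y‖ ^ 2)⁻¹)

lemma kernelConst_nonneg : 0 ≤ kernelConst :=
  setIntegral_nonneg measurableSet_ball fun y _ => by positivity

lemma ae_ne_zero : ∀ᵐ y : E3, y ≠ 0 := by
  rw [ae_iff]
  simp

variable {C M : ℝ} {k h : E3 → ℝ}

lemma IsKernel.integrableOn (hk : IsKernel C k) : IntegrableOn k (ball 0 1) := by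
  refine Integrable.mono' (integrableOn_kernel.const_mul C) hk.meas.aestronglyMeasurable ?_
  filter_upwards [ae_restrict_of_ae ae_ne_zero] with y hy
  exact hk.bound y hy

lemma IsKernel.abs_le (hk : IsKernel C k) (y : E3) (hy : y ∉ ball (0 : E3) 1) :
    |k y| ≤ 2 * C := by
  have h1 : 1 ≤ ‖y‖ := by simpa using hy
  refine (hk.bound y (norm_pos_iff.1 (by linarith))).trans ?_
  have h2 : (‖y‖ ^ 2)⁻¹ ≤ 1 := inv_le_one_of_one_le₀ (one_le_pow₀ h1)
  nlinarith [hk.nonneg]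

lemma IsKernel.integrable (hk : IsKernel C k) (hi : Integrable h) (hM : ∀ y, |h y| ≤ M) (x : E3) :
    Integrable (fun y => k (x - y) * h y) :=
  (kernel_estimate hk.meas (by have := hk.nonneg; positivity) hk.integrableOn hk.abs_le hi hM x).1

lemma IsKernel.integral_abs_le (hk : IsKernel C k) (hi : Integrable h) (hM : ∀ y, |h y| ≤ M)
    (x : E3) :
    ∫ y, |k (x - y) * h y| ≤ C * (kernelConst * M + 2 * ∫ y, |h y|) := by
  have h1 := (kernel_estimate hk.meas (by have := hk.nonneg; positivity) hk.integrableOn hk.abs_le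
    hi hM x).2
  have h2 : ∫ y in ball 0 1, |k y| ≤ C * kernelConst := by
    rw [kernelConst, ← integral_const_mul]
    refine setIntegral_mono_ae hk.integrableOn.abs (integrableOn_kernel.const_mul C) ?_
    filter_upwards [ae_ne_zero] with y hy
    exact hk.bound y hy
  have h3 : 0 ≤ M := (abs_nonneg _).trans (hM 0)
  nlinarith [mul_le_mul_of_nonneg_left h2 h3]

lemma IsKernel.abs_kernelConv_le (hk : IsKernel C k) (hi : Integrable h) (hM : ∀ y, |h y| ≤ M)
    (x : E3) : |kernelConv k h x| ≤ C * (kernelConst * M + 2 * ∫ y, |h y|) :=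
  (abs_integral_le_integral_abs).trans (hk.integral_abs_le hi hM x)

lemma IsKernel.kernelConv_sub (hk : IsKernel C k) {h₁ h₂ : E3 → ℝ} {M₁ M₂ : ℝ} (hi₁ : Integrable h₁)
    (hM₁ : ∀ y, |h₁ y| ≤ M₁) (hi₂ : Integrable h₂) (hM₂ : ∀ y, |h₂ y| ≤ M₂) (x : E3) :
    kernelConv k (fun y => h₁ y - h₂ y) x = kernelConv k h₁ x - kernelConv k h₂ x := by
  unfold kernelConv
  rw [← integral_sub (hk.integrable hi₁ hM₁ x) (hk.integrable hi₂ hM₂ x)]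
  simp only [mul_sub]

lemma kernelConv_const_mul (c : ℝ) (x : E3) :
    kernelConv k (fun y => c * h y) x = c * kernelConv k h x := by
  unfold kernelConv
  rw [← integral_const_mul]
  congr 1
  ext y
  ring

lemma IsKernel.kernelConv_sum (hk : IsKernel C k) {h : Fin 3 → E3 → ℝ} {M : Fin 3 → ℝ}
    (hi : ∀ j, Integrable (h j)) (hM : ∀ j y, |h j y| ≤ M j) (x : E3) :
    kernelConv k (fun y => ∑ j, h j y) x = ∑ j, kernelConv k (h j) x := by
  unfold kernelConv
  rw [← integral_finsetSum _ fun j _ => hk.integrable (hi j) (hM j) x]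
  simp only [Finset.mul_sum]

lemma measurable_kernelConv (hk : Measurable k) (hh : Measurable h) : Measurable (kernelConv k h) := by
  have : StronglyMeasurable (Function.uncurry fun x y : E3 => k (x - y) * h y) :=
    ((hk.comp (measurable_fst.sub measurable_snd)).mul (hh.comp measurable_snd)).stronglyMeasurable
  exact this.integral_prod_right.measurable

/-- Joint integrability of `k(x - y) a(x) h(y)`. -/
lemma IsKernel.integrable_prod (hk : IsKernel C k) {a : E3 → ℝ} (ha : Integrable a)
    (hi : Integrable h) (hM : ∀ y, |h y| ≤ M) :
    Integrable (fun p : E3 × E3 => k (p.1 - p.2) * (a p.1 * h p.2)) ∧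
      ∫ p : E3 × E3, k (p.1 - p.2) * (a p.1 * h p.2) = ∫ x, kernelConv k h x * a x := by
  have hm : AEStronglyMeasurable (fun p : E3 × E3 => k (p.1 - p.2) * (a p.1 * h p.2))
      (volume.prod volume) :=
    (hk.meas.comp (measurable_fst.sub measurable_snd)).aestronglyMeasurable.mul
      (ha.aestronglyMeasurable.comp_fst.mul hi.aestronglyMeasurable.comp_snd)
  have e : ∀ x y, k (x - y) * (a x * h y) = a x * (k (x - y) * h y) := fun x y => by ring
  have hI : Integrable (fun p : E3 × E3 => k (p.1 - p.2) * (a p.1 * h p.2))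
      (volume.prod volume) := by
    rw [integrable_prod_iff hm]
    refine ⟨Eventually.of_forall fun x => ?_, ?_⟩
    · simp only [e]
      exact (hk.integrable hi hM x).const_mul (a x)
    · refine (ha.abs.mul_const (C * (kernelConst * M + 2 * ∫ y, |h y|))).mono'
        hm.norm.integral_prod_right' (Eventually.of_forall fun x => ?_)
      rw [Real.norm_of_nonneg (integral_nonneg fun y => norm_nonneg _)]
      simp only [e, norm_mul (a x), integral_const_mul]
      rw [Real.norm_eq_abs]
      gcongr
      exact hk.integral_abs_le hi hM x
  refine ⟨hI, ?_⟩
  rw [Measure.volume_eq_prod, integral_prod _ hI]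
  refine integral_congr_ae (Eventually.of_forall fun x => ?_)
  simp only [e]
  rw [integral_const_mul, kernelConv, mul_comm]

lemma isKernel_coulomb : IsKernel 1 coulomb where
  nonneg := zero_le_one
  meas := measurable_coulomb
  bound y hy := by
    have h1 : 0 < ‖y‖ := norm_pos_iff.2 hy
    rw [abs_of_nonneg (coulomb_nonneg y), coulomb, one_div, one_mul, ← inv_pow]
    nlinarith [sq_nonneg (‖y‖⁻¹ - 1), inv_pos.2 h1]

lemma isKernel_regCoulomb {ε : ℝ} (hε : 0 < ε) : IsKernel 1 (regCoulomb ε) where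
  nonneg := zero_le_one
  meas := (isC1b_regCoulomb hε).isBddMeas.meas
  bound y hy := by
    rw [abs_of_nonneg (regCoulomb_nonneg y)]
    refine (regCoulomb_le_coulomb hε hy).trans ?_
    exact (le_abs_self _).trans (isKernel_coulomb.bound y hy)

lemma isKernel_pderiv_coulomb (l : Fin 3) : IsKernel 1 (pderiv l coulomb) where
  nonneg := zero_le_one
  meas := measurable_pderiv l coulomb
  bound y _ := (abs_pderiv_coulomb_le l y).trans (by linarith)

lemma isKernel_pderiv_regCoulomb {ε : ℝ} (hε : 0 < ε) (l : Fin 3) :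
    IsKernel 1 (pderiv l (regCoulomb ε)) where
  nonneg := zero_le_one
  meas := measurable_pderiv l _
  bound y _ := (abs_pderiv_regCoulomb_le_inv_sq hε l y).trans (by linarith)

/-- Convergence of convolutions under dominated convergence of the kernels. -/
lemma tendsto_kernelConv {ι : Type*} {f : Filter ι} [f.IsCountablyGenerated] {K : ι → E3 → ℝ}
    (hK : ∀ᶠ i in f, IsKernel C (K i)) (hk : ∀ y ≠ 0, Tendsto (fun i => K i y) f (𝓝 (k y)))
    (hi : Integrable h) (hM : ∀ y, |h y| ≤ M) (hC : 0 ≤ C) (x : E3) :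
    Tendsto (fun i => kernelConv (K i) h x) f (𝓝 (kernelConv k h x)) := by
  have hne : ∀ᵐ y : E3, x - y ≠ 0 := by
    rw [ae_iff]
    have : {y : E3 | ¬x - y ≠ 0} = {x} := by
      ext y
      simp [sub_eq_zero, eq_comm]
    rw [this]
    exact measure_singleton x
  have hbk : IsKernel C (fun y => C * (1 + (‖y‖ ^ 2)⁻¹)) :=
    ⟨hC, by fun_prop, fun y _ => (abs_of_nonneg (by positivity)).le⟩
  refine tendsto_integral_filter_of_dominated_convergence
    (fun y => C * (1 + (‖x - y‖ ^ 2)⁻¹) * |h y|) ?_ ?_ ?_ ?_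
  · filter_upwards [hK] with i hKi
    exact (hKi.integrable hi hM x).aestronglyMeasurable
  · filter_upwards [hK] with i hKi
    filter_upwards [hne] with y hy
    rw [Real.norm_eq_abs, abs_mul]
    gcongr
    exact hKi.bound _ hy
  · exact hbk.integrable hi.abs (fun y => by rw [abs_abs]; exact hM y) x
  · filter_upwards [hne] with y hy
    exact (hk _ hy).mul_const _

lemma norm_le_sum_unitVec (L : E3 →L[ℝ] ℝ) : ‖L‖ ≤ ∑ l, |L (unitVec l)| := by
  refine L.opNorm_le_bound (Finset.sum_nonneg fun _ _ => abs_nonneg _) fun v => ?_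
  have hv : v = ∑ l, v l • unitVec l := by
    conv_lhs => rw [← (EuclideanSpace.basisFun (Fin 3) ℝ).sum_repr v]
    simp [unitVec]
  conv_lhs => rw [hv]
  rw [map_sum, Finset.sum_mul]
  refine (norm_sum_le _ _).trans (Finset.sum_le_sum fun l _ => ?_)
  rw [map_smul, norm_smul, mul_comm, Real.norm_eq_abs, Real.norm_eq_abs]
  gcongr
  exact abs_coord_le v l

lemma norm_fderiv_le (a : E3 → ℝ) (y : E3) : ‖fderiv ℝ a y‖ ≤ ∑ l, |pderiv l a y| :=
  norm_le_sum_unitVec _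

lemma IsC1b.norm_fderiv_le {a : E3 → ℝ} (ha : IsC1b a) : ∃ C, ∀ y, ‖fderiv ℝ a y‖ ≤ C := by
  choose C hC using ha.dbdd
  exact ⟨∑ l, C l, fun y => (QuantumEuler.norm_fderiv_le a y).trans
    (Finset.sum_le_sum fun l _ => hC l y)⟩

lemma hasFDerivAt_kernelConv_of_isC1b {a : E3 → ℝ} (ha : IsC1b a) (hi : Integrable h) (x : E3) :
    HasFDerivAt (kernelConv a h) (∫ y, h y • fderiv ℝ a (x - y)) x := by
  obtain ⟨B, hB⟩ := ha.norm_fderiv_le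
  obtain ⟨A, hA⟩ := ha.bdd
  have hm : ∀ x, AEStronglyMeasurable (fun y => a (x - y) * h y) volume := fun x =>
    ((ha.diff.continuous.comp (continuous_const.sub continuous_id)).aestronglyMeasurable).mul
      hi.aestronglyMeasurable
  refine hasFDerivAt_integral_of_dominated_of_fderiv_le (F := fun x y => a (x - y) * h y)
    (F' := fun x y => h y • fderiv ℝ a (x - y)) (bound := fun y => |h y| * B) univ_mem
    (Eventually.of_forall hm) ?_ ?_ ?_ (hi.abs.mul_const B) ?_
  · refine (hi.abs.const_mul A).mono' (hm x) (Eventually.of_forall fun y => ?_)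
    rw [norm_mul, Real.norm_eq_abs, Real.norm_eq_abs]
    gcongr
    exact hA _
  · exact hi.aestronglyMeasurable.smul
      ((measurable_fderiv ℝ a).comp (measurable_const.sub measurable_id)).aestronglyMeasurable
  · refine Eventually.of_forall fun y x _ => ?_
    rw [norm_smul, Real.norm_eq_abs]
    gcongr
    exact hB _
  · refine Eventually.of_forall fun y x _ => ?_
    have h1 : HasFDerivAt (fun x => a (x - y)) (fderiv ℝ a (x - y)) x := by
      have h2 := (ha.diff (x - y)).hasFDerivAt.comp x ((hasFDerivAt_id x).sub_const y)
      rw [ContinuousLinearMap.comp_id] at h2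
      exact h2
    simpa using h1.mul_const (h y)

/-- With `r = |y|` and `q = (r²+ε)^{1/2}`, the relations `q² - r² = ε` and `q + r ≥ 2` give `q - r ≤
ε/2`, and `q³ - r³ ≤ 3q²(q - r)`. Away from the singularity the gradients thus converge uniformly.
-/
lemma abs_pderiv_regCoulomb_sub_le {ε : ℝ} (hε : 0 < ε) (l : Fin 3) {y : E3} (hy : 1 ≤ ‖y‖) :
    |pderiv l (regCoulomb ε) y - pderiv l coulomb y| ≤ 3 / 2 * ε := by
  have hr : 0 < ‖y‖ := by linarith
  have hs : 0 < regNorm ε y := regNorm_pos hε y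
  have hrs := norm_le_regNorm hε y
  have hsq := regNorm_sq hε y
  rw [pderiv_regCoulomb hε, pderiv_coulomb (norm_pos_iff.1 hr)]
  set r := ‖y‖
  set q := regNorm ε y
  have e : -(y l / q ^ 3) - -(y l / r ^ 3) = y l * ((q ^ 3 - r ^ 3) / (r ^ 3 * q ^ 3)) := by
    field_simp
    ring
  have h1 : q - r ≤ ε / 2 := by nlinarith
  have h2 : 0 ≤ q ^ 3 - r ^ 3 := by
    have : r ^ 3 ≤ q ^ 3 := by gcongr
    linarith
  have h3 : q ^ 3 - r ^ 3 ≤ 3 / 2 * ε * q ^ 2 := by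
    have h4 : q ^ 3 - r ^ 3 = (q - r) * (q ^ 2 + q * r + r ^ 2) := by ring
    have h5 : q ^ 2 + q * r + r ^ 2 ≤ 3 * q ^ 2 := by nlinarith
    rw [h4]
    calc (q - r) * (q ^ 2 + q * r + r ^ 2) ≤ (ε / 2) * (3 * q ^ 2) := by gcongr
      _ = _ := by ring
  rw [e, abs_mul, abs_of_nonneg (by positivity : 0 ≤ (q ^ 3 - r ^ 3) / (r ^ 3 * q ^ 3))]
  calc |y l| * ((q ^ 3 - r ^ 3) / (r ^ 3 * q ^ 3)) ≤ r * (3 / 2 * ε * q ^ 2 / (r ^ 3 * q ^ 3)) := by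
        gcongr
        exact abs_coord_le y l
    _ = 3 / 2 * ε / (r ^ 2 * q) := by field_simp
    _ ≤ 3 / 2 * ε / 1 := by
        gcongr
        nlinarith [one_le_pow₀ hy (n := 2)]
    _ = _ := by ring

/-- The convolution of the Coulomb potential with a bounded integrable function is differentiable,
and its gradient is the convolution with the gradient of the Coulomb potential. -/
lemma hasFDerivAt_coulombConv (hi : Integrable h) (hM : ∀ y, |h y| ≤ M) (x : E3) :
    HasFDerivAt (kernelConv coulomb h) (∫ y, h y • fderiv ℝ coulomb (x - y)) x := by
  set r : ℕ → ℝ := fun m => 1 / ((m : ℝ) + 1) with hr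
  have hrp : ∀ m, 0 < r m := fun m => by positivity
  have hr0 : Tendsto r atTop (𝓝 0) := tendsto_one_div_add_atTop_nhds_zero_nat
  have hr0' : Tendsto r atTop (𝓝[>] 0) :=
    tendsto_nhdsWithin_iff.2 ⟨hr0, Eventually.of_forall hrp⟩
  set D : ℕ → Fin 3 → E3 → ℝ := fun m l y => pderiv l (regCoulomb (r m)) y - pderiv l coulomb y
    with hD
  have hDk : ∀ m l, IsKernel 2 (D m l) := fun m l =>
    ⟨by norm_num, (measurable_pderiv l _).sub (measurable_pderiv l _), fun y _ => by
      have h1 := abs_pderiv_coulomb_le l y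
      have h2 := abs_pderiv_regCoulomb_le_inv_sq (hrp m) l y
      have h3 := abs_sub (pderiv l (regCoulomb (r m)) y) (pderiv l coulomb y)
      rw [hD]
      simp only
      linarith⟩
  have hM0 : 0 ≤ M := (abs_nonneg _).trans (hM 0)
  have hint : ∀ (a : E3 → ℝ) (x : E3), (∀ l, IsKernel 1 (pderiv l a)) →
      Integrable (fun y => h y • fderiv ℝ a (x - y)) := by
    intro a x ha
    have hb : Integrable (fun y => ∑ l, |pderiv l a (x - y) * h y|) :=
      integrable_finsetSum _ fun l _ => ((ha l).integrable hi hM x).abs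
    refine hb.mono' (hi.aestronglyMeasurable.smul
      ((measurable_fderiv ℝ a).comp (measurable_const.sub measurable_id)).aestronglyMeasurable)
      (Eventually.of_forall fun y => ?_)
    rw [norm_smul, Real.norm_eq_abs]
    simp only [abs_mul, mul_comm _ |h y|, ← Finset.mul_sum]
    gcongr
    exact norm_fderiv_le a _
  -- The gradients of the regularized convolutions converge uniformly in `x`: inside the unit ball
  -- the kernel gradients converge in `L¹` by domination, and outside at the rate `ε`. With
  -- pointwise convergence of the functions, differentiability passes to the limit.
  refine hasFDerivAt_of_tendstoUniformly (l := atTop) (f := fun m => kernelConv (regCoulomb (r m)) h)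
    (f' := fun m x => ∫ y, h y • fderiv ℝ (regCoulomb (r m)) (x - y))
    (g' := fun x => ∫ y, h y • fderiv ℝ coulomb (x - y)) ?_
    (fun m x => hasFDerivAt_kernelConv_of_isC1b (isC1b_regCoulomb (hrp m)) hi x) (fun x => ?_) x
  · have hsup : ∀ m x, ‖(∫ y, h y • fderiv ℝ (regCoulomb (r m)) (x - y)) -
        ∫ y, h y • fderiv ℝ coulomb (x - y)‖ ≤
        ∑ l, (M * (∫ y in ball 0 1, |D m l y|) + 3 / 2 * r m * ∫ y, |h y|) := by
      intro m x
      have e1 : ∀ l, (fderiv ℝ (regCoulomb (r m)) · (unitVec l)) = pderiv l (regCoulomb (r m)) :=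
        fun l => rfl
      have hI1 := hint _ x fun l => isKernel_pderiv_regCoulomb (hrp m) l
      have hI2 := hint _ x fun l => isKernel_pderiv_coulomb l
      rw [← integral_sub hI1 hI2]
      refine (norm_integral_le_integral_norm _).trans ?_
      have hk := fun l => kernel_estimate (hDk m l).meas
        (by have := hrp m; positivity : 0 ≤ 3 / 2 * r m) (hDk m l).integrableOn
        (fun y hy => abs_pderiv_regCoulomb_sub_le (hrp m) l (by simpa using hy)) hi hM x
      refine le_trans ?_ (Finset.sum_le_sum fun l _ => (hk l).2)
      rw [← integral_finsetSum _ fun l _ => (hk l).1.abs]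
      refine integral_mono (hI1.sub hI2).norm
        (integrable_finsetSum _ fun l _ => (hk l).1.abs) fun y => ?_
      simp only [← smul_sub]
      rw [norm_smul, Real.norm_eq_abs]
      simp only [abs_mul, mul_comm _ |h y|, ← Finset.mul_sum]
      gcongr
      exact norm_le_sum_unitVec _
    have hlim : Tendsto (fun m => ∑ l, (M * (∫ y in ball 0 1, |D m l y|) +
        3 / 2 * r m * ∫ y, |h y|)) atTop (𝓝 0) := by
      have h1 : ∀ l, Tendsto (fun m => ∫ y in ball (0 : E3) 1, |D m l y|) atTop (𝓝 0) := by
        intro l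
        have h2 : Tendsto (fun m => ∫ y in ball (0 : E3) 1, |D m l y|) atTop
            (𝓝 (∫ y in ball (0 : E3) 1, (0 : ℝ))) := by
          refine tendsto_integral_of_dominated_convergence
            (fun y => 2 * (1 + (‖y‖ ^ 2)⁻¹)) (fun m => (hDk m l).meas.abs.aestronglyMeasurable)
            (integrableOn_kernel.const_mul 2) (fun m => ?_) (Eventually.of_forall fun y => ?_)
          · filter_upwards [ae_restrict_of_ae ae_ne_zero] with y hy
            rw [Real.norm_eq_abs, abs_abs]
            exact (hDk m l).bound y hy
          · have h3 := ((tendsto_pderiv_regCoulomb l y).comp hr0').sub_const (pderiv l coulomb y)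
            rw [sub_self] at h3
            simpa using h3.abs
        simpa using h2
      have h4 := tendsto_finsetSum (Finset.univ : Finset (Fin 3)) fun l _ =>
        ((h1 l).const_mul M).add ((hr0.const_mul (3 / 2)).mul_const (∫ y, |h y|))
      simpa using h4
    rw [Metric.tendstoUniformly_iff]
    intro δ hδ
    filter_upwards [hlim.eventually (gt_mem_nhds hδ)] with m hm x
    rw [dist_comm, dist_eq_norm]
    exact (hsup m x).trans_lt hm
  · exact tendsto_kernelConv (C := 1) (Eventually.of_forall fun m => isKernel_regCoulomb (hrp m))
      (fun y hy => (tendsto_regCoulomb hy).comp hr0') hi hM zero_le_one x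

lemma pderiv_kernelConv_coulomb (hi : Integrable h) (hM : ∀ y, |h y| ≤ M) (l : Fin 3) (x : E3) :
    pderiv l (kernelConv coulomb h) x = kernelConv (pderiv l coulomb) h x := by
  rw [pderiv, (hasFDerivAt_coulombConv hi hM x).fderiv, ContinuousLinearMap.integral_apply]
  · simp only [kernelConv, smul_apply, smul_eq_mul, mul_comm (h _)]
    rfl
  · have hb : Integrable (fun y => ∑ l, |pderiv l coulomb (x - y) * h y|) :=
      integrable_finsetSum _ fun l _ => ((isKernel_pderiv_coulomb l).integrable hi hM x).abs
    refine hb.mono' (hi.aestronglyMeasurable.smul ((measurable_fderiv ℝ coulomb).comp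
      (measurable_const.sub measurable_id)).aestronglyMeasurable) (Eventually.of_forall fun y => ?_)
    rw [norm_smul, Real.norm_eq_abs]
    simp only [abs_mul, mul_comm _ |h y|, ← Finset.mul_sum]
    gcongr
    exact norm_fderiv_le coulomb _

lemma isC1b_kernelConv_coulomb (hi : Integrable h) (hM : ∀ y, |h y| ≤ M) :
    IsC1b (kernelConv coulomb h) where
  diff x := (hasFDerivAt_coulombConv hi hM x).differentiableAt
  bdd := ⟨_, isKernel_coulomb.abs_kernelConv_le hi hM⟩
  dbdd l := ⟨_, fun x => by
    rw [pderiv_kernelConv_coulomb hi hM]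
    exact (isKernel_pderiv_coulomb l).abs_kernelConv_le hi hM x⟩

/-- Integration by parts in a convolution with the Coulomb potential. -/
lemma kernelConv_coulomb_pderiv {m : E3 → ℝ} {M' : ℝ} {l : Fin 3} (hd : Differentiable ℝ m)
    (hi : Integrable m) (hM : ∀ y, |m y| ≤ M) (hi' : Integrable (pderiv l m))
    (hM' : ∀ y, |pderiv l m y| ≤ M') (x : E3) :
    kernelConv coulomb (pderiv l m) x = kernelConv (pderiv l coulomb) m x := by
  have hpos : ∀ᶠ ε : ℝ in 𝓝[>] 0, 0 < ε := self_mem_nhdsWithin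
  have h1 : Tendsto (fun ε => kernelConv (regCoulomb ε) (pderiv l m) x) (𝓝[>] 0)
      (𝓝 (kernelConv coulomb (pderiv l m) x)) :=
    tendsto_kernelConv (hpos.mono fun ε hε => isKernel_regCoulomb hε)
      (fun y hy => tendsto_regCoulomb hy) hi' hM' zero_le_one x
  have h2 : Tendsto (fun ε => kernelConv (pderiv l (regCoulomb ε)) m x) (𝓝[>] 0)
      (𝓝 (kernelConv (pderiv l coulomb) m x)) :=
    tendsto_kernelConv (hpos.mono fun ε hε => isKernel_pderiv_regCoulomb hε l)
      (fun y _ => tendsto_pderiv_regCoulomb l y) hi hM zero_le_one x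
  -- For `ε > 0` this is ordinary integration by parts; the sign it produces cancels the one from
  -- differentiating `x - y` in `y`.
  refine tendsto_nhds_unique h1 (h2.congr' ?_)
  filter_upwards [hpos] with ε hε
  have hr := differentiable_regCoulomb hε
  have hf : ∀ y, HasFDerivAt (fun y => regCoulomb ε (x - y))
      (-fderiv ℝ (regCoulomb ε) (x - y)) y := fun y => by
    have h3 := (hr (x - y)).hasFDerivAt.comp y ((hasFDerivAt_id y).const_sub x)
    refine h3.congr_fderiv ?_
    ext v
    simp
  have h4 : ∀ y, fderiv ℝ (fun y => regCoulomb ε (x - y)) y (unitVec l) =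
      -pderiv l (regCoulomb ε) (x - y) := fun y => by
    rw [(hf y).fderiv]
    rfl
  have h5 := integral_mul_fderiv_eq_neg_fderiv_mul_of_integrable (μ := volume)
    (f := fun y => regCoulomb ε (x - y)) (g := m) (v := unitVec l) ?_ ?_ ?_
    (fun y _ => (hf y).differentiableAt) (fun y _ => hd y)
  · simp only [h4, neg_mul, integral_neg, neg_neg] at h5
    exact h5.symm
  · simp only [h4, neg_mul]
    exact ((isKernel_pderiv_regCoulomb hε l).integrable hi hM x).neg
  · exact (isKernel_regCoulomb hε).integrable hi' hM' x
  · exact (isKernel_regCoulomb hε).integrable hi hM x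

end Kernels

/-! ### Families of densities differentiable in time uniformly and in `L¹`. -/

section TimeDependence

lemma abs_sub_le_of_hasDerivWithinAt {S : Set ℝ} (hS : Convex ℝ S) {f f' : ℝ → ℝ} {L : ℝ}
    (hder : ∀ τ ∈ S, HasDerivWithinAt f (f' τ) S τ) (hL : ∀ τ ∈ S, |f' τ| ≤ L) {a b : ℝ}
    (ha : a ∈ S) (hb : b ∈ S) : |f b - f a| ≤ L * |b - a| := by
  simpa using hS.norm_image_sub_le_of_norm_hasDerivWithin_le hder (fun τ hτ => hL τ hτ) ha hb

/-- The mean value inequality in `L¹`. -/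
lemma integral_abs_sub_le {S : Set ℝ} (hS : Convex ℝ S) {f f' : ℝ → E3 → ℝ} {L B : ℝ}
    (hf : ∀ τ ∈ S, Measurable (f τ)) (hfi : ∀ τ ∈ S, Integrable (f τ))
    (hder : ∀ τ ∈ S, ∀ x, HasDerivWithinAt (fun τ => f τ x) (f' τ x) S τ)
    (hL : ∀ τ ∈ S, ∀ x, |f' τ x| ≤ L) (hfi' : ∀ τ ∈ S, Integrable (f' τ))
    (hB : ∀ τ ∈ S, ∫ x, |f' τ x| ≤ B) {a b : ℝ} (ha : a ∈ S) (hb : b ∈ S) :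
    ∫ x, |f b x - f a x| ≤ B * |b - a| := by
  -- Testing against the sign of the increment reduces the claim to the scalar mean value
  -- inequality. The sign is cut off to balls because differentiation under the integral, with only
  -- the sup bound `L`, needs an integrable weight.
  set g : E3 → ℝ := fun x => if 0 ≤ f b x - f a x then 1 else -1 with hg
  have hgm : Measurable g :=
    Measurable.ite (measurableSet_le measurable_const ((hf b hb).sub (hf a ha))) measurable_const
      measurable_const
  have hg1 : ∀ x, |g x| ≤ 1 := fun x => by
    rw [hg]
    simp only
    split_ifs <;> simp
  have hgs : ∀ x, (f b x - f a x) * g x = |f b x - f a x| := fun x => by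
    rw [hg]
    simp only
    split_ifs with h
    · rw [mul_one, abs_of_nonneg h]
    · rw [mul_neg, mul_one, abs_of_neg (not_le.1 h)]
  have key : ∀ R : ℕ, ∫ x in Metric.ball 0 (R : ℝ), |f b x - f a x| ≤ B * |b - a| := by
    intro R
    set w : E3 → ℝ := (Metric.ball (0 : E3) R).indicator g with hw
    have hwm : Measurable w := hgm.indicator Metric.isOpen_ball.measurableSet
    have hw1 : ∀ x, |w x| ≤ 1 := fun x => by
      rw [hw]
      by_cases hx : x ∈ Metric.ball (0 : E3) R
      · rw [indicator_of_mem hx]; exact hg1 x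
      · rw [indicator_of_notMem hx]; simp
    have hwi : Integrable w := by
      refine (integrable_indicator_iff Metric.isOpen_ball.measurableSet).2 ?_
      refine Integrable.mono' (integrableOn_const (C := (1 : ℝ)) (by
        exact (Metric.isBounded_ball.measure_lt_top).ne)) hgm.aestronglyMeasurable
        (Eventually.of_forall fun x => hg1 x)
    have hmul : ∀ {q : E3 → ℝ}, Integrable q → Integrable (fun x => q x * w x) := fun {q} hq =>
      (hq.bdd_mul hwm.aestronglyMeasurable (Eventually.of_forall hw1)).congr
        (Eventually.of_forall fun x => mul_comm _ _)
    have h1 : ∀ τ ∈ S, HasDerivWithinAt (fun τ => ∫ x, f τ x * w x) (∫ x, f' τ x * w x) S τ :=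
      fun τ hτ => hasDerivWithinAt_integral_mul (L := L) hτ hwi hf (fun σ hσ => hmul (hfi σ hσ))
        (fun σ hσ x => abs_sub_le_of_hasDerivWithinAt hS (fun τ hτ => hder τ hτ x)
          (fun τ hτ => hL τ hτ x) hτ hσ) (hder τ hτ)
    have h2 := abs_sub_le_of_hasDerivWithinAt hS h1 (L := B) (fun τ hτ => ?_) ha hb
    · rw [← integral_sub (hmul (hfi b hb)) (hmul (hfi a ha))] at h2
      refine le_trans (le_of_eq ?_) ((le_abs_self _).trans h2)
      rw [← integral_indicator Metric.isOpen_ball.measurableSet]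
      refine integral_congr_ae (Eventually.of_forall fun x => ?_)
      simp only
      rw [← sub_mul]
      by_cases hx : x ∈ Metric.ball (0 : E3) R
      · rw [hw, indicator_of_mem hx, indicator_of_mem hx, hgs]
      · rw [hw, indicator_of_notMem hx, indicator_of_notMem hx, mul_zero]
    · refine (abs_integral_le_integral_abs).trans (le_trans ?_ (hB τ hτ))
      refine integral_mono (hmul (hfi' τ hτ)).abs (hfi' τ hτ).abs fun x => ?_
      simp only [abs_mul]
      exact mul_le_of_le_one_right (abs_nonneg _) (hw1 x)
  have hlim := (aecover_ball (μ := (volume : Measure E3)) (x := 0)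
    tendsto_natCast_atTop_atTop).integral_tendsto_of_countably_generated
      ((hfi b hb).sub (hfi a ha)).abs
  exact le_of_tendsto' hlim key

/-- Families that are continuous in time with values in `L¹`. -/
structure IsL1Cont (I : Set ℝ) (r : ℝ → E3 → ℝ) : Prop where
  integrable : ∀ t ∈ I, Integrable (r t)
  cont : ∀ t ∈ I, Tendsto (fun τ => ∫ x, |r τ x - r t x|) (𝓝[I] t) (𝓝 0)

lemma IsL1Cont.add {I : Set ℝ} {r s : ℝ → E3 → ℝ} (hr : IsL1Cont I r) (hs : IsL1Cont I s) :
    IsL1Cont I (fun t x => r t x + s t x) where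
  integrable t ht := (hr.integrable t ht).add (hs.integrable t ht)
  cont t ht := by
    have h := (hr.cont t ht).add (hs.cont t ht)
    rw [add_zero] at h
    refine squeeze_zero' (Eventually.of_forall fun _ => integral_nonneg fun _ => abs_nonneg _) ?_ h
    filter_upwards [self_mem_nhdsWithin] with τ hτ
    have h1 := ((hr.integrable τ hτ).sub (hr.integrable t ht)).abs
    have h2 := ((hs.integrable τ hτ).sub (hs.integrable t ht)).abs
    refine (integral_mono (((hr.integrable τ hτ).add (hs.integrable τ hτ)).sub
      ((hr.integrable t ht).add (hs.integrable t ht))).abs (h1.add h2) fun x => ?_).trans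
      (integral_add h1 h2).le
    simp only [Pi.add_apply, Pi.sub_apply]
    rw [add_sub_add_comm]
    exact abs_add_le _ _

lemma IsL1Cont.neg {I : Set ℝ} {r : ℝ → E3 → ℝ} (hr : IsL1Cont I r) :
    IsL1Cont I (fun t x => -r t x) where
  integrable t ht := (hr.integrable t ht).neg
  cont t ht := by
    refine (hr.cont t ht).congr fun τ => ?_
    refine integral_congr_ae (Eventually.of_forall fun x => ?_)
    simp only
    rw [← neg_sub', abs_neg]

lemma isL1Cont_zero {I : Set ℝ} : IsL1Cont I (fun _ _ => 0) where
  integrable _ _ := integrable_zero _ _ _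
  cont _ _ := by simpa using tendsto_const_nhds

lemma IsL1Cont.sum {I : Set ℝ} {ι : Type*} (s : Finset ι) {r : ι → ℝ → E3 → ℝ}
    (hr : ∀ i, IsL1Cont I (r i)) : IsL1Cont I (fun t x => ∑ i ∈ s, r i t x) := by
  classical
  induction s using Finset.induction_on with
  | empty => simpa using isL1Cont_zero
  | insert i s hi ih =>
    simp only [Finset.sum_insert hi]
    exact (hr i).add ih

lemma IsL1Cont.exists_bound {T : ℝ} {r : ℝ → E3 → ℝ} (hr : IsL1Cont (Icc 0 T) r) :
    ∃ B, ∀ t ∈ Icc 0 T, ∫ x, |r t x| ≤ B := by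
  have hc : ContinuousOn (fun t => ∫ x, |r t x|) (Icc 0 T) := by
    intro t ht
    rw [ContinuousWithinAt, tendsto_iff_norm_sub_tendsto_zero]
    refine squeeze_zero' (Eventually.of_forall fun _ => norm_nonneg _) ?_ (hr.cont t ht)
    filter_upwards [self_mem_nhdsWithin] with τ hτ
    rw [← integral_sub (hr.integrable τ hτ).abs (hr.integrable t ht).abs, Real.norm_eq_abs]
    refine (abs_integral_le_integral_abs).trans (integral_mono
      ((hr.integrable τ hτ).abs.sub (hr.integrable t ht).abs).abs
      ((hr.integrable τ hτ).sub (hr.integrable t ht)).abs fun x => abs_abs_sub_abs_le_abs_sub _ _)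
  obtain ⟨B, hB⟩ := isCompact_Icc.exists_bound_of_continuousOn hc
  exact ⟨B, fun t ht => (le_abs_self _).trans (hB t ht)⟩

lemma integral_abs_mul_le {f g : E3 → ℝ} (hf : MemLp f 2) (hg : MemLp g 2) :
    ∫ x, |f x * g x| ≤ √(∫ x, f x ^ 2) * √(∫ x, g x ^ 2) := by
  have h := integral_mul_norm_le_Lp_mul_Lq (μ := volume) (f := f) (g := g) (p := 2) (q := 2)
    (by rw [Real.holderConjugate_iff]; norm_num) (by simpa using hf) (by simpa using hg)
  simpa [abs_mul, Real.sqrt_eq_rpow] using h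

/-- By Cauchy–Schwarz, `L²` continuity of both factors suffices and neither factor has to be
integrable. This makes `div(ρu)`, a sum of such products, continuous in `L¹`. -/
lemma RealContinuousInSobolev.isL1Cont_mul {I : Set ℝ} {m m' : ℕ} {f g : ℝ → E3 → ℝ}
    (hf : RealContinuousInSobolev I m f) (hg : RealContinuousInSobolev I m' g) :
    IsL1Cont I (fun t x => f t x * g t x) where
  integrable t ht := (hf.memLp ht).integrable_mul (hg.memLp ht)
  cont t ht := by
    have h1 := (hf.tendsto_integral_sq ht).sqrt
    have h2 := (hg.tendsto_integral_sq ht).sqrt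
    rw [Real.sqrt_zero] at h1 h2
    have h3 := ((h1.mul h2).add (h1.mul_const √(∫ x, g t x ^ 2))).add
      (h2.const_mul √(∫ x, f t x ^ 2))
    simp only [mul_zero, zero_mul, add_zero] at h3
    refine squeeze_zero' (Eventually.of_forall fun _ => integral_nonneg fun _ => abs_nonneg _) ?_ h3
    filter_upwards [self_mem_nhdsWithin] with τ hτ
    have df := (hf.memLp hτ).sub (hf.memLp ht)
    have dg := (hg.memLp hτ).sub (hg.memLp ht)
    have i1 := (df.integrable_mul dg).abs
    have i2 := (df.integrable_mul (hg.memLp ht)).abs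
    have i3 := ((hf.memLp ht).integrable_mul dg).abs
    refine le_trans (integral_mono (((hf.memLp hτ).integrable_mul (hg.memLp hτ)).sub
      ((hf.memLp ht).integrable_mul (hg.memLp ht))).abs ((i1.add i2).add i3) fun x => ?_) ?_
    · simp only [Pi.add_apply, Pi.sub_apply, Pi.mul_apply]
      have e : f τ x * g τ x - f t x * g t x = (f τ x - f t x) * (g τ x - g t x) +
          (f τ x - f t x) * g t x + f t x * (g τ x - g t x) := by ring
      rw [e]
      exact (abs_add_le _ _).trans (by gcongr; exact abs_add_le _ _)
    · have e : ∫ x, (((fun x => |((f τ - f t) * (g τ - g t)) x|) +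
          fun x => |((f τ - f t) * g t) x|) + fun x => |(f t * (g τ - g t)) x|) x =
          (∫ x, |((f τ - f t) * (g τ - g t)) x|) + (∫ x, |((f τ - f t) * g t) x|) +
            ∫ x, |(f t * (g τ - g t)) x| := by
        rw [integral_add' (i1.add i2) i3, integral_add' i1 i2]
      refine e.le.trans ?_
      have j1 := integral_abs_mul_le df dg
      have j2 := integral_abs_mul_le df (hg.memLp ht)
      have j3 := integral_abs_mul_le (hf.memLp ht) dg
      exact add_le_add (add_le_add j1 j2) j3

lemma IsTame.add {I : Set ℝ} {f g : ℝ → E3 → ℝ} (hf : IsTame I f) (hg : IsTame I g) :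
    IsTame I (fun t x => f t x + g t x) where
  continuous t ht := (hf.continuous t ht).add (hg.continuous t ht)
  bounded := by
    obtain ⟨A, hA⟩ := hf.bounded
    obtain ⟨B, hB⟩ := hg.bounded
    exact ⟨A + B, fun t ht x => (abs_add_le _ _).trans (add_le_add (hA t ht x) (hB t ht x))⟩
  uniform t ht := (hf.uniform t ht).add (hg.uniform t ht)

lemma IsTame.neg {I : Set ℝ} {f : ℝ → E3 → ℝ} (hf : IsTame I f) : IsTame I (fun t x => -f t x) where
  continuous t ht := (hf.continuous t ht).neg
  bounded := hf.bounded.imp fun C hC t ht x => by rw [abs_neg]; exact hC t ht x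
  uniform t ht := (hf.uniform t ht).neg

lemma isTame_zero {I : Set ℝ} : IsTame I (fun _ _ => 0) where
  continuous _ _ := continuous_const
  bounded := ⟨0, by simp⟩
  uniform _ _ := by
    rw [Metric.tendstoUniformly_iff]
    intro ε hε
    simpa using Eventually.of_forall fun _ => hε

lemma IsTame.sum {I : Set ℝ} {ι : Type*} (s : Finset ι) {f : ι → ℝ → E3 → ℝ}
    (hf : ∀ i, IsTame I (f i)) : IsTame I (fun t x => ∑ i ∈ s, f i t x) := by
  classical
  induction s using Finset.induction_on with
  | empty => simpa using isTame_zero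
  | insert i s hi ih =>
    simp only [Finset.sum_insert hi]
    exact (hf i).add ih

lemma IsTame.mul {I : Set ℝ} {f g : ℝ → E3 → ℝ} (hf : IsTame I f) (hg : IsTame I g) :
    IsTame I (fun t x => f t x * g t x) where
  continuous t ht := (hf.continuous t ht).mul (hg.continuous t ht)
  bounded := by
    obtain ⟨A, hA⟩ := hf.bounded
    obtain ⟨B, hB⟩ := hg.bounded
    refine ⟨A * B, fun t ht x => ?_⟩
    rw [abs_mul]
    exact mul_le_mul (hA t ht x) (hB t ht x) (abs_nonneg _) ((abs_nonneg _).trans (hA t ht x))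
  uniform t ht := by
    obtain ⟨A, hA⟩ := hf.bounded
    obtain ⟨B, hB⟩ := hg.bounded
    have hA0 : 0 ≤ A := (abs_nonneg _).trans (hA t ht 0)
    have hB0 : 0 ≤ B := (abs_nonneg _).trans (hB t ht 0)
    rw [Metric.tendstoUniformly_iff]
    intro ε hε
    have hη : 0 < ε / (A + B + 1) := by positivity
    filter_upwards [Metric.tendstoUniformly_iff.1 (hf.uniform t ht) _ hη,
      Metric.tendstoUniformly_iff.1 (hg.uniform t ht) _ hη, self_mem_nhdsWithin] with τ h1 h2 hτ x
    have h1 := h1 x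
    have h2 := h2 x
    rw [Real.dist_eq] at h1 h2 ⊢
    have e : f t x * g t x - f τ x * g τ x = (f t x - f τ x) * g t x + f τ x * (g t x - g τ x) := by
      ring
    rw [e]
    calc _ ≤ |f t x - f τ x| * |g t x| + |f τ x| * |g t x - g τ x| := by
          refine (abs_add_le _ _).trans ?_
          rw [abs_mul, abs_mul]
      _ ≤ ε / (A + B + 1) * B + A * (ε / (A + B + 1)) := by
          gcongr
          · exact hB t ht x
          · exact hA τ hτ x
      _ = ε * ((A + B) / (A + B + 1)) := by ring
      _ < ε := by
          refine mul_lt_of_lt_one_right hε ?_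
          rw [div_lt_one (by positivity)]
          linarith

/-- Densities with a time derivative that is continuous both uniformly and in `L¹`. -/
structure IsEvolution (T : ℝ) (ρ r : ℝ → E3 → ℝ) : Prop where
  continuous : ∀ t ∈ Icc 0 T, Continuous (ρ t)
  integrable : ∀ t ∈ Icc 0 T, Integrable (ρ t)
  bounded : ∃ M, ∀ t ∈ Icc 0 T, ∀ x, |ρ t x| ≤ M
  deriv : ∀ t ∈ Icc 0 T, ∀ x, HasDerivWithinAt (fun τ => ρ τ x) (r t x) (Icc 0 T) t
  tame : IsTame (Icc 0 T) r
  l1 : IsL1Cont (Icc 0 T) r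

variable {T : ℝ} {ρ r : ℝ → E3 → ℝ}

lemma IsEvolution.exists_lipschitz (h : IsEvolution T ρ r) : ∃ L, ∀ t ∈ Icc 0 T, ∀ τ ∈ Icc 0 T,
    (∀ x, |ρ τ x - ρ t x| ≤ L * |τ - t|) ∧ ∫ x, |ρ τ x - ρ t x| ≤ L * |τ - t| := by
  obtain ⟨A, hA⟩ := h.tame.bounded
  obtain ⟨B, hB⟩ := h.l1.exists_bound
  refine ⟨max A B, fun t ht τ hτ => ⟨fun x => ?_, ?_⟩⟩
  · exact abs_sub_le_of_hasDerivWithinAt (convex_Icc 0 T) (fun s hs => h.deriv s hs x)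
      (fun s hs => (hA s hs x).trans (le_max_left A B)) ht hτ
  · exact integral_abs_sub_le (convex_Icc 0 T) (fun s hs => (h.continuous s hs).measurable)
      h.integrable h.deriv hA h.l1.integrable (fun s hs => (hB s hs).trans (le_max_right A B)) ht hτ

/-- The mean value inequalities are applied to `ρ_τ - τ r_t`, whose time derivative `r_τ - r_t` is
small near `t` in both norms. Hence `ρ` is differentiable in time uniformly and in `L¹`. -/
lemma IsEvolution.eventually_slope (h : IsEvolution T ρ r) {t : ℝ} (ht : t ∈ Icc 0 T) {ε : ℝ}
    (hε : 0 < ε) : ∀ᶠ τ in 𝓝[Icc 0 T] t, (∀ x, |ρ τ x - ρ t x - (τ - t) * r t x| ≤ ε * |τ - t|) ∧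
      ∫ x, |ρ τ x - ρ t x - (τ - t) * r t x| ≤ ε * |τ - t| := by
  have h1 := Metric.tendstoUniformly_iff.1 (h.tame.uniform t ht) ε hε
  have h2 := (h.l1.cont t ht).eventually (gt_mem_nhds hε)
  obtain ⟨δ, hδ, hball⟩ := Metric.mem_nhdsWithin_iff.1 (h1.and h2)
  set S := Metric.ball t δ ∩ Icc 0 T with hS
  have hSc : Convex ℝ S := (convex_ball t δ).inter (convex_Icc 0 T)
  have htS : t ∈ S := ⟨Metric.mem_ball_self hδ, ht⟩
  have hder : ∀ τ ∈ S, ∀ x, HasDerivWithinAt (fun τ => ρ τ x - τ * r t x) (r τ x - r t x) S τ := by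
    intro τ hτ x
    have := ((h.deriv τ hτ.2 x).mono (inter_subset_right (s := Metric.ball t δ))).fun_sub
      ((hasDerivWithinAt_id τ S).mul_const (r t x))
    rwa [one_mul] at this
  have hsup : ∀ τ ∈ S, ∀ x, |r τ x - r t x| ≤ ε := fun τ hτ x => by
    have := (hball hτ).1 x
    rw [Real.dist_eq, abs_sub_comm] at this
    exact this.le
  have e : ∀ τ x, ρ τ x - τ * r t x - (ρ t x - t * r t x) = ρ τ x - ρ t x - (τ - t) * r t x :=
    fun τ x => by ring
  have hev : S ∈ 𝓝[Icc 0 T] t := Metric.mem_nhdsWithin_iff.2 ⟨δ, hδ, subset_rfl⟩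
  filter_upwards [hev] with τ hτ
  constructor
  · intro x
    have := abs_sub_le_of_hasDerivWithinAt hSc (fun s hs => hder s hs x)
      (fun s hs => hsup s hs x) htS hτ
    rwa [e] at this
  · have := integral_abs_sub_le (f := fun τ x => ρ τ x - τ * r t x)
      (f' := fun τ x => r τ x - r t x) (L := ε) (B := ε) hSc
      (fun s hs => (h.continuous s hs.2).measurable.sub
        ((h.tame.continuous t ht).measurable.const_mul s))
      (fun s hs => (h.integrable s hs.2).sub ((h.l1.integrable t ht).const_mul s)) hder hsup
      (fun s hs => (h.l1.integrable s hs.2).sub (h.l1.integrable t ht))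
      (fun s hs => (hball hs).2.le) htS hτ
    simpa only [e] using this

lemma IsEvolution.exists_lipschitz_kernelConv (h : IsEvolution T ρ r) {k : E3 → ℝ} {C : ℝ}
    (hk : IsKernel C k) : ∃ L, ∀ t ∈ Icc 0 T, ∀ τ ∈ Icc 0 T, ∀ x,
      |kernelConv k (ρ τ) x - kernelConv k (ρ t) x| ≤ L * |τ - t| := by
  obtain ⟨L, hL⟩ := h.exists_lipschitz
  obtain ⟨M, hM⟩ := h.bounded
  refine ⟨C * (kernelConst * L + 2 * L), fun t ht τ hτ x => ?_⟩
  rw [← hk.kernelConv_sub (h.integrable τ hτ) (hM τ hτ) (h.integrable t ht) (hM t ht)]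
  refine (hk.abs_kernelConv_le ((h.integrable τ hτ).sub (h.integrable t ht)) (hL t ht τ hτ).1 x).trans ?_
  have h1 := (hL t ht τ hτ).2
  have h2 := hk.nonneg
  calc _ ≤ C * (kernelConst * (L * |τ - t|) + 2 * (L * |τ - t|)) := by
        gcongr
        exact h1
    _ = _ := by ring

/-- Convolution with `k` is bounded from `L¹ ∩ L^∞` to `L^∞`, so the remainder estimate for `ρ` in
both norms is inherited. -/
lemma IsEvolution.hasDerivWithinAt_kernelConv (h : IsEvolution T ρ r) {k : E3 → ℝ} {C : ℝ}
    (hk : IsKernel C k) {t : ℝ} (ht : t ∈ Icc 0 T) (x : E3) :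
    HasDerivWithinAt (fun τ => kernelConv k (ρ τ) x) (kernelConv k (r t) x) (Icc 0 T) t := by
  obtain ⟨M, hM⟩ := h.bounded
  obtain ⟨A, hA⟩ := h.tame.bounded
  rw [hasDerivWithinAt_iff_isLittleO, Asymptotics.isLittleO_iff]
  intro c hc
  have hK : 0 ≤ C * (kernelConst + 2) := mul_nonneg hk.nonneg (by linarith [kernelConst_nonneg])
  -- The added `1` keeps the denominator positive when `C = 0`.
  have hε : 0 < c / (C * (kernelConst + 2) + 1) := by positivity
  filter_upwards [h.eventually_slope ht hε, self_mem_nhdsWithin] with τ h1 hτ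
  have i0 := (h.integrable τ hτ).sub (h.integrable t ht)
  have i1 := (h.l1.integrable t ht).const_mul (τ - t)
  obtain ⟨L, hL⟩ := h.exists_lipschitz
  have e : kernelConv k (ρ τ) x - kernelConv k (ρ t) x - (τ - t) • kernelConv k (r t) x =
      kernelConv k (fun y => ρ τ y - ρ t y - (τ - t) * r t y) x := by
    have h2 := hk.kernelConv_sub (h₁ := fun y => ρ τ y - ρ t y) (h₂ := fun y => (τ - t) * r t y)
      (M₂ := |τ - t| * A) i0 (hL t ht τ hτ).1 i1 (fun y => by
        rw [abs_mul]
        gcongr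
        exact hA t ht y) x
    rw [h2, hk.kernelConv_sub (h.integrable τ hτ) (hM τ hτ) (h.integrable t ht) (hM t ht),
      kernelConv_const_mul, smul_eq_mul]
  rw [e, Real.norm_eq_abs, Real.norm_eq_abs]
  refine (hk.abs_kernelConv_le (i0.sub i1) h1.1 x).trans ?_
  set q := c / (C * (kernelConst + 2) + 1) with hq
  have h3 : C * (kernelConst + 2) * q ≤ c := by
    rw [hq, mul_div_assoc', div_le_iff₀ (by positivity)]
    nlinarith
  have h4 := hk.nonneg
  calc _ ≤ C * (kernelConst * (q * |τ - t|) + 2 * (q * |τ - t|)) := by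
        gcongr
        exact h1.2
    _ = C * (kernelConst + 2) * q * |τ - t| := by ring
    _ ≤ c * |τ - t| := by gcongr

/-- The derivative of a symmetric quadratic functional of the density. -/
lemma IsEvolution.hasDerivWithinAt_quadratic (h : IsEvolution T ρ r) {A : ℝ → E3 → ℝ}
    {A' : E3 → ℝ} {C L : ℝ} {t : ℝ} (ht : t ∈ Icc 0 T) (hAm : ∀ τ ∈ Icc 0 T, Measurable (A τ))
    (hAb : ∀ τ ∈ Icc 0 T, ∀ x, |A τ x| ≤ C)
    (hAl : ∀ τ ∈ Icc 0 T, ∀ x, |A τ x - A t x| ≤ L * |τ - t|)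
    (hA' : ∀ x, HasDerivWithinAt (fun τ => A τ x) (A' x) (Icc 0 T) t)
    (hsymm : ∀ τ ∈ Icc 0 T, ∫ x, A τ x * ρ t x = ∫ x, A t x * ρ τ x) :
    HasDerivWithinAt (fun τ => ∫ x, A τ x * ρ τ x) (2 * ∫ x, A' x * ρ t x) (Icc 0 T) t := by
  have hint : ∀ τ ∈ Icc 0 T, ∀ σ ∈ Icc 0 T, Integrable (fun x => A τ x * ρ σ x) := fun τ hτ σ hσ =>
    (h.integrable σ hσ).bdd_mul (hAm τ hτ).aestronglyMeasurable (Eventually.of_forall (hAb τ hτ))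
  have h1 := (hasDerivWithinAt_integral_mul (f := A) ht (h.integrable t ht) hAm
    (fun τ hτ => hint τ hτ t ht) hAl hA').const_mul 2
  obtain ⟨L', hL'⟩ := h.exists_lipschitz
  -- By symmetry the increment of this combination is `∫(A_τ - A_t)(ρ_τ - ρ_t)`, of second order in
  -- `τ - t`. Only twice the derivative of `∫A_τ ρ_t` remains.
  have h2 : HasDerivWithinAt (fun τ => (∫ x, A τ x * ρ τ x) - 2 * ∫ x, A τ x * ρ t x) 0
      (Icc 0 T) t := by
    rw [hasDerivWithinAt_iff_isLittleO]
    have hbd : ∀ τ ∈ Icc 0 T, |(∫ x, A τ x * ρ τ x) - 2 * (∫ x, A τ x * ρ t x) -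
        ((∫ x, A t x * ρ t x) - 2 * ∫ x, A t x * ρ t x)| ≤ L * |τ - t| * (L' * |τ - t|) := by
      intro τ hτ
      have e : (∫ x, A τ x * ρ τ x) - 2 * (∫ x, A τ x * ρ t x) -
          ((∫ x, A t x * ρ t x) - 2 * ∫ x, A t x * ρ t x) =
          ∫ x, (A τ x - A t x) * (ρ τ x - ρ t x) := by
        have e1 : ∀ x, (A τ x - A t x) * (ρ τ x - ρ t x) =
            (A τ x * ρ τ x - A τ x * ρ t x) - (A t x * ρ τ x - A t x * ρ t x) := fun x => by ring
        simp only [e1]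
        have i1 : Integrable (fun x => A τ x * ρ τ x - A τ x * ρ t x) :=
          (hint τ hτ τ hτ).sub (hint τ hτ t ht)
        have i2 : Integrable (fun x => A t x * ρ τ x - A t x * ρ t x) :=
          (hint t ht τ hτ).sub (hint t ht t ht)
        rw [integral_sub i1 i2, integral_sub (hint τ hτ τ hτ) (hint τ hτ t ht),
          integral_sub (hint t ht τ hτ) (hint t ht t ht), ← hsymm τ hτ]
        ring
      rw [e]
      have i0 := ((h.integrable τ hτ).sub (h.integrable t ht)).abs
      have hL0 : 0 ≤ L * |τ - t| := (abs_nonneg _).trans (hAl τ hτ 0)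
      calc _ ≤ ∫ x, |(A τ x - A t x) * (ρ τ x - ρ t x)| := abs_integral_le_integral_abs
        _ ≤ ∫ x, L * |τ - t| * |ρ τ x - ρ t x| := by
            refine integral_mono_of_nonneg (Eventually.of_forall fun x => abs_nonneg _)
              (i0.const_mul _) (Eventually.of_forall fun x => ?_)
            simp only [abs_mul]
            gcongr
            exact hAl τ hτ x
        _ = L * |τ - t| * ∫ x, |ρ τ x - ρ t x| := integral_const_mul _ _
        _ ≤ _ := by
            gcongr
            exact (hL' t ht τ hτ).2
    rw [Asymptotics.isLittleO_iff]
    intro c hc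
    have h3 : Tendsto (fun τ : ℝ => L * L' * |τ - t|) (𝓝[Icc 0 T] t) (𝓝 (L * L' * |t - t|)) := by
      have : Continuous fun τ : ℝ => L * L' * |τ - t| := by fun_prop
      exact (this.tendsto t).mono_left nhdsWithin_le_nhds
    rw [sub_self, abs_zero, mul_zero] at h3
    filter_upwards [h3.eventually (gt_mem_nhds hc), self_mem_nhdsWithin] with τ h4 hτ
    rw [smul_zero, sub_zero, Real.norm_eq_abs, Real.norm_eq_abs]
    refine (hbd τ hτ).trans ?_
    nlinarith [abs_nonneg (τ - t)]
  have h5 := h2.add h1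
  rw [zero_add] at h5
  refine h5.congr_of_eventuallyEq (Eventually.of_forall fun τ => ?_) ?_ <;> simp

end TimeDependence

/-! ### Calculus of bounded differentiable functions and Sobolev families. -/

section Calculus

lemma pderiv_mul {f g : E3 → ℝ} (hf : Differentiable ℝ f) (hg : Differentiable ℝ g) (k : Fin 3)
    (x : E3) : pderiv k (fun y => f y * g y) x = pderiv k f x * g x + f x * pderiv k g x := by
  rw [pderiv, fderiv_fun_mul (hf x) (hg x)]
  simp only [add_apply, smul_apply, smul_eq_mul, pderiv]
  ring

lemma pderiv_sum {ι : Type*} (s : Finset ι) {f : ι → E3 → ℝ} (hf : ∀ i, Differentiable ℝ (f i))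
    (k : Fin 3) : pderiv k (fun y => ∑ i ∈ s, f i y) = fun x => ∑ i ∈ s, pderiv k (f i) x := by
  ext x
  rw [pderiv, fderiv_fun_sum fun i _ => hf i x]
  simp [pderiv]

lemma IsC1b.sum {ι : Type*} (s : Finset ι) {f : ι → E3 → ℝ} (hf : ∀ i, IsC1b (f i)) :
    IsC1b (fun x => ∑ i ∈ s, f i x) where
  diff := Differentiable.fun_sum fun i _ => (hf i).diff
  bdd := by
    choose C hC using fun i => (hf i).bdd
    exact ⟨∑ i ∈ s, C i, fun x => (Finset.abs_sum_le_sum_abs _ _).trans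
      (Finset.sum_le_sum fun i _ => hC i x)⟩
  dbdd k := by
    choose C hC using fun i => (hf i).dbdd k
    refine ⟨∑ i ∈ s, C i, fun x => ?_⟩
    rw [pderiv_sum s fun i => (hf i).diff]
    exact (Finset.abs_sum_le_sum_abs _ _).trans (Finset.sum_le_sum fun i _ => hC i x)

lemma IsC1b.mul {f g : E3 → ℝ} (hf : IsC1b f) (hg : IsC1b g) : IsC1b (fun x => f x * g x) where
  diff := hf.diff.fun_mul hg.diff
  bdd := by
    obtain ⟨A, hA⟩ := hf.bdd
    obtain ⟨B, hB⟩ := hg.bdd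
    refine ⟨A * B, fun x => ?_⟩
    rw [abs_mul]
    exact mul_le_mul (hA x) (hB x) (abs_nonneg _) ((abs_nonneg _).trans (hA x))
  dbdd k := by
    obtain ⟨A, hA⟩ := hf.bdd
    obtain ⟨B, hB⟩ := hg.bdd
    obtain ⟨A', hA'⟩ := hf.dbdd k
    obtain ⟨B', hB'⟩ := hg.dbdd k
    refine ⟨A' * B + A * B', fun x => ?_⟩
    rw [pderiv_mul hf.diff hg.diff]
    refine (abs_add_le _ _).trans ?_
    rw [abs_mul, abs_mul]
    have h1 := (abs_nonneg _).trans (hA x)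
    have h2 := (abs_nonneg _).trans (hA' x)
    gcongr
    · exact hA' x
    · exact hB x
    · exact hA x
    · exact hB' x

/-- Continuous representatives of a family in `C([0, T]; H^m)`. -/
def IsSobolev (T : ℝ) (m : ℕ) (f : ℝ → E3 → ℝ) : Prop :=
  RealContinuousInSobolev (Icc 0 T) m f ∧ ∀ t ∈ Icc 0 T, Continuous (f t)

variable {T : ℝ} {m : ℕ} {f : ℝ → E3 → ℝ}

lemma IsSobolev.isTame (h : IsSobolev T (m + 2) f) : IsTame (Icc 0 T) f := h.1.isTame h.2

lemma IsSobolev.differentiable (h : IsSobolev T (m + 3) f) {t : ℝ} (ht : t ∈ Icc 0 T) :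
    Differentiable ℝ (f t) := (h.1.pderiv h.2).1 t ht

lemma IsSobolev.pderiv (h : IsSobolev T (m + 3) f) (k : Fin 3) :
    IsSobolev T (m + 2) (fun t => pderiv k (f t)) := (h.1.pderiv h.2).2 k

lemma IsSobolev.isC1b (h : IsSobolev T (m + 3) f) {t : ℝ} (ht : t ∈ Icc 0 T) : IsC1b (f t) where
  diff := h.differentiable ht
  bdd := (IsSobolev.isTame (m := m + 1) h).bounded.imp fun _ hC => hC t ht
  dbdd k := (h.pderiv k).isTame.bounded.imp fun _ hC => hC t ht

end Calculus

/-! ### Regularity and evolution of the fluid variables. -/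

section Fluid

variable {κ b₀ T : ℝ} {m : ℕ} {ρ : ℝ → E3 → ℝ} {u : ℝ → E3 → E3}

/-- The components of a vector field. -/
def components (w : E3 → E3) (k : Fin 3) (x : E3) : ℝ := w x k

/-- The rate of change `-div (ρ u)` of the density. -/
noncomputable def massRate (ρ : E3 → ℝ) (u : E3 → E3) (x : E3) : ℝ :=
  -∑ k, (pderiv k ρ x * u x k + ρ x * pderiv k (components u k) x)

/-- The rate of change of the velocity. -/
noncomputable def velocityRate (κ b₀ : ℝ) (ρ : E3 → ℝ) (u : E3 → E3) (k : Fin 3) (x : E3) : ℝ :=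
  -(∑ j, u x j * pderiv j (components u k) x + b₀ * pderiv k ρ x + κ * kernelConv (pderiv k coulomb) ρ x)

namespace IsEulerPoissonSolution

variable (h : IsEulerPoissonSolution κ b₀ (m + 5) T ρ u)
include h

lemma sobolev_density : IsSobolev T (m + 4) ρ := ⟨h.regular_density, h.continuous_density⟩

lemma sobolev_velocity (k : Fin 3) : IsSobolev T (m + 5) (fun t => components (u t) k) :=
  ⟨h.regular_velocity k, fun t ht =>
    (EuclideanSpace.proj k : E3 →L[ℝ] ℝ).continuous.comp (h.continuous_velocity t ht)⟩

lemma sobolev_gradDensity (k : Fin 3) : IsSobolev T (m + 3) (fun t => pderiv k (ρ t)) :=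
  IsSobolev.pderiv (m := m + 1) h.sobolev_density k

lemma sobolev_gradVelocity (j k : Fin 3) :
    IsSobolev T (m + 4) (fun t => pderiv j (components (u t) k)) :=
  IsSobolev.pderiv (m := m + 2) (h.sobolev_velocity k) j

lemma isC1b_density {t : ℝ} (ht : t ∈ Icc 0 T) : IsC1b (ρ t) :=
  IsSobolev.isC1b (m := m + 1) h.sobolev_density ht

lemma isC1b_velocity {t : ℝ} (ht : t ∈ Icc 0 T) (k : Fin 3) : IsC1b (components (u t) k) :=
  IsSobolev.isC1b (m := m + 2) (h.sobolev_velocity k) ht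

lemma isC1b_gradVelocity {t : ℝ} (ht : t ∈ Icc 0 T) (j k : Fin 3) :
    IsC1b (pderiv j (components (u t) k)) :=
  IsSobolev.isC1b (m := m + 1) (h.sobolev_gradVelocity j k) ht

/-- Three derivatives of `u` must be bounded. For `u ∈ H^{m+5}` they lie in `H^{m+2} ⊂ C_b`. -/
lemma isGoodField {t : ℝ} (ht : t ∈ Icc 0 T) : IsGoodField (components (u t)) where
  comp := h.isC1b_velocity ht
  div := IsC1b.sum _ fun k => h.isC1b_gradVelocity ht k k
  ddiv l := by
    rw [pderiv_sum _ fun k => (h.isC1b_gradVelocity ht k k).diff]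
    exact IsC1b.sum _ fun k => IsSobolev.isC1b (m := m)
      (IsSobolev.pderiv (m := m + 1) (h.sobolev_gradVelocity k k) l) ht

lemma tame_velocity (k : Fin 3) : IsTame (Icc 0 T) (fun t => components (u t) k) :=
  IsSobolev.isTame (m := m + 3) (h.sobolev_velocity k)

lemma tame_gradVelocity (j k : Fin 3) :
    IsTame (Icc 0 T) (fun t => pderiv j (components (u t) k)) :=
  IsSobolev.isTame (m := m + 2) (h.sobolev_gradVelocity j k)

lemma tame_divergence : IsTame (Icc 0 T) (fun t => divergence (u t)) :=
  IsTame.sum Finset.univ fun k => h.tame_gradVelocity k k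

lemma tame_density : IsTame (Icc 0 T) ρ := IsSobolev.isTame (m := m + 2) h.sobolev_density

lemma tame_gradDensity (k : Fin 3) : IsTame (Icc 0 T) (fun t => pderiv k (ρ t)) :=
  IsSobolev.isTame (m := m + 1) (h.sobolev_gradDensity k)

/-- A function that is not integrable has integral `0` by convention, which contradicts the unit
mass. -/
lemma integrable_density {t : ℝ} (ht : t ∈ Icc 0 T) : Integrable (ρ t) := by
  by_contra hn
  have := h.mass t ht
  rw [integral_undef hn] at this
  exact zero_ne_one this

lemma l1_gradDensity_mul (k : Fin 3) :
    IsL1Cont (Icc 0 T) (fun t x => pderiv k (ρ t) x * u t x k) :=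
  (h.sobolev_gradDensity k).1.isL1Cont_mul (h.sobolev_velocity k).1

lemma l1_density_mul (j k : Fin 3) :
    IsL1Cont (Icc 0 T) (fun t x => ρ t x * pderiv j (components (u t) k) x) :=
  h.sobolev_density.1.isL1Cont_mul (h.sobolev_gradVelocity j k).1

/-- The density is continuously differentiable in time, uniformly and in `L¹`. -/
lemma isEvolution : IsEvolution T ρ (fun t => massRate (ρ t) (u t)) where
  continuous := h.continuous_density
  integrable _ := h.integrable_density
  bounded := h.tame_density.bounded
  deriv t ht x := by
    refine (h.continuity_equation t ht x).congr_deriv ?_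
    rw [massRate, divergence]
    congr 1
    refine Finset.sum_congr rfl fun k _ => ?_
    exact pderiv_mul (h.isC1b_density ht).diff (h.isC1b_velocity ht k).diff k x
  tame := (IsTame.sum Finset.univ fun k => ((h.tame_gradDensity k).mul (h.tame_velocity k)).add
    (h.tame_density.mul (h.tame_gradVelocity k k))).neg
  l1 := (IsL1Cont.sum Finset.univ fun k => (h.l1_gradDensity_mul k).add (h.l1_density_mul k k)).neg

lemma hasDerivWithinAt_velocity {t : ℝ} (ht : t ∈ Icc 0 T) (k : Fin 3) (x : E3) :
    HasDerivWithinAt (fun τ => u τ x k) (velocityRate κ b₀ (ρ t) (u t) k x) (Icc 0 T) t := by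
  obtain ⟨M, hM⟩ := h.tame_density.bounded
  refine (h.velocity_equation t ht x k).congr_deriv ?_
  rw [velocityRate, ← pderiv_kernelConv_coulomb (h.integrable_density ht) (hM t ht)]
  rfl

lemma exists_bound_velocityRate : ∃ L, ∀ t ∈ Icc 0 T, ∀ k x,
    |velocityRate κ b₀ (ρ t) (u t) k x| ≤ L := by
  obtain ⟨M, hM⟩ := h.tame_density.bounded
  choose A hA using fun k => (h.tame_velocity k).bounded
  choose B hB using fun j k => (h.tame_gradVelocity j k).bounded
  choose D hD using fun k => (h.tame_gradDensity k).bounded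
  have hk : ∀ t ∈ Icc 0 T, ∀ k x, |kernelConv (pderiv k coulomb) (ρ t) x| ≤
      1 * (kernelConst * M + 2 * 1) := by
    intro t ht k x
    have h1 := (isKernel_pderiv_coulomb k).abs_kernelConv_le (h.integrable_density ht) (hM t ht) x
    have h2 : ∫ y, |ρ t y| = 1 := by
      rw [← h.mass t ht]
      exact integral_congr_ae (Eventually.of_forall fun y => abs_of_nonneg (h.nonneg t ht y))
    rwa [h2] at h1
  have hL : ∀ t ∈ Icc 0 T, ∀ k x, |velocityRate κ b₀ (ρ t) (u t) k x| ≤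
      ∑ j, A j * B j k + |b₀| * D k + |κ| * (1 * (kernelConst * M + 2 * 1)) := by
    intro t ht k x
    rw [velocityRate, abs_neg]
    refine (abs_add_le _ _).trans (add_le_add ((abs_add_le _ _).trans (add_le_add ?_ ?_)) ?_)
    · refine (Finset.abs_sum_le_sum_abs _ _).trans (Finset.sum_le_sum fun j _ => ?_)
      rw [abs_mul]
      exact mul_le_mul (hA j t ht x) (hB j k t ht x) (abs_nonneg _)
        ((abs_nonneg _).trans (hA j t ht x))
    · rw [abs_mul]
      gcongr
      exact hD k t ht x
    · rw [abs_mul]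
      gcongr
      exact hk t ht k x
  refine ⟨∑ k, |∑ j, A j * B j k + |b₀| * D k + |κ| * (1 * (kernelConst * M + 2 * 1))|,
    fun t ht k x => (hL t ht k x).trans ((le_abs_self _).trans ?_)⟩
  exact Finset.single_le_sum (f := fun k => |∑ j, A j * B j k + |b₀| * D k +
    |κ| * (1 * (kernelConst * M + 2 * 1))|) (fun i _ => abs_nonneg _) (Finset.mem_univ k)

lemma exists_lipschitz_velocity : ∃ L, ∀ t ∈ Icc 0 T, ∀ τ ∈ Icc 0 T, ∀ k x,
    |u τ x k - u t x k| ≤ L * |τ - t| := by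
  obtain ⟨L, hL⟩ := h.exists_bound_velocityRate
  exact ⟨L, fun t ht τ hτ k x => abs_sub_le_of_hasDerivWithinAt (convex_Icc 0 T)
    (fun s hs => h.hasDerivWithinAt_velocity hs k x) (fun s hs => hL s hs k x) ht hτ⟩

lemma exists_bound_velocity : ∃ C, ∀ t ∈ Icc 0 T, ∀ k x, |u t x k| ≤ C := by
  choose A hA using fun k => (h.tame_velocity k).bounded
  refine ⟨∑ k, |A k|, fun t ht k x => (hA k t ht x).trans ((le_abs_self _).trans ?_)⟩
  exact Finset.single_le_sum (f := fun k => |A k|) (fun i _ => abs_nonneg _) (Finset.mem_univ k)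

/-- The Coulomb potential of the rate of change of the density, in terms of the momentum. -/
lemma kernelConv_massRate {t : ℝ} (ht : t ∈ Icc 0 T) (x : E3) :
    kernelConv coulomb (massRate (ρ t) (u t)) x =
      -∑ k, kernelConv (pderiv k coulomb) (fun y => ρ t y * u t y k) x := by
  have hc : ∀ k, IsC1b (fun y => ρ t y * u t y k) := fun k =>
    (h.isC1b_density ht).mul (h.isC1b_velocity ht k)
  have hp : ∀ k y, pderiv k (fun y => ρ t y * u t y k) y =
      pderiv k (ρ t) y * u t y k + ρ t y * pderiv k (components (u t) k) y := fun k y =>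
    pderiv_mul (h.isC1b_density ht).diff (h.isC1b_velocity ht k).diff k y
  have hi : ∀ k, Integrable (fun y => ρ t y * u t y k) := fun k => by
    obtain ⟨C, hC⟩ := (h.isC1b_velocity ht k).bdd
    exact ((h.integrable_density ht).bdd_mul
      (h.isC1b_velocity ht k).isBddMeas.meas.aestronglyMeasurable
      (Eventually.of_forall hC)).congr (Eventually.of_forall fun y => mul_comm _ _)
  have hi' : ∀ k, Integrable (pderiv k (fun y => ρ t y * u t y k)) := fun k => by
    refine Integrable.congr (((h.l1_gradDensity_mul k).integrable t ht).add
      ((h.l1_density_mul k k).integrable t ht)) (Eventually.of_forall fun y => ?_)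
    rw [hp]
    rfl
  choose M hM using fun k => (hc k).bdd
  choose M' hM' using fun k => (hc k).dbdd k
  have e : massRate (ρ t) (u t) =
      fun y => (-1) * ∑ k, pderiv k (fun y => ρ t y * u t y k) y := by
    ext y
    simp only [massRate, hp]
    ring
  rw [e, kernelConv_const_mul, isKernel_coulomb.kernelConv_sum hi' hM']
  simp only [fun k => kernelConv_coulomb_pderiv (hc k).diff (hi k) (hM k) (hi' k) (hM' k) x]
  ring

/-- The derivative of `∫ ρ²`. -/
lemma hasDerivWithinAt_integral_sq {t : ℝ} (ht : t ∈ Icc 0 T) :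
    HasDerivWithinAt (fun τ => ∫ x, ρ τ x * ρ τ x) (-∫ x, divergence (u t) x * ρ t x * ρ t x)
      (Icc 0 T) t := by
  obtain ⟨M, hM⟩ := h.tame_density.bounded
  obtain ⟨L, hL⟩ := h.isEvolution.exists_lipschitz
  have h1 := h.isEvolution.hasDerivWithinAt_quadratic (A := ρ) (C := M) (L := L) ht
    (fun τ hτ => (h.continuous_density τ hτ).measurable) hM (fun τ hτ => (hL t ht τ hτ).1)
    (h.isEvolution.deriv t ht)
    (fun τ hτ => integral_congr_ae (Eventually.of_forall fun x => mul_comm _ _))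
  refine h1.congr_deriv ?_
  have hρ := h.isC1b_density ht
  have hb : ∀ {q : E3 → ℝ}, Integrable q → Integrable (fun x => q x * ρ t x) := fun {q} hq =>
    (hq.bdd_mul hρ.isBddMeas.meas.aestronglyMeasurable (Eventually.of_forall (hM t ht))).congr
      (Eventually.of_forall fun x => mul_comm _ _)
  have i1 : ∀ k, Integrable (fun x => pderiv k (ρ t) x * u t x k * ρ t x) := fun k =>
    hb ((h.l1_gradDensity_mul k).integrable t ht)
  have i2 : ∀ k, Integrable (fun x => ρ t x * pderiv k (components (u t) k) x * ρ t x) := fun k =>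
    hb ((h.l1_density_mul k k).integrable t ht)
  -- Integrating `ρ² ∂_k u^k` by parts expresses the transport term through the divergence term;
  -- together they turn `2∫ρ ∂_tρ` into `-∫ρ² div u`.
  have ibp : ∀ k, ∫ x, ρ t x * pderiv k (components (u t) k) x * ρ t x =
      -2 * ∫ x, pderiv k (ρ t) x * u t x k * ρ t x := by
    intro k
    have e1 : ∀ x, fderiv ℝ (fun x => ρ t x * ρ t x) x (unitVec k) * components (u t) k x =
        2 * (pderiv k (ρ t) x * u t x k * ρ t x) := fun x => by
      have := pderiv_mul hρ.diff hρ.diff k x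
      rw [pderiv] at this
      rw [this, components]
      ring
    have e2 : ∀ x, ρ t x * ρ t x * fderiv ℝ (components (u t) k) x (unitVec k) =
        ρ t x * pderiv k (components (u t) k) x * ρ t x := fun x => by
      rw [pderiv]
      ring
    have i3 : Integrable (fun x => ρ t x * ρ t x * components (u t) k x) := by
      obtain ⟨C, hC⟩ := (h.isC1b_velocity ht k).bdd
      exact ((hb (h.integrable_density ht)).bdd_mul
        (h.isC1b_velocity ht k).isBddMeas.meas.aestronglyMeasurable
        (Eventually.of_forall hC)).congr (Eventually.of_forall fun y => mul_comm _ _)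
    have h3 := integral_mul_fderiv_eq_neg_fderiv_mul_of_integrable (μ := volume)
      (f := fun x => ρ t x * ρ t x) (g := components (u t) k) (v := unitVec k)
      (by simp only [e1]; exact (i1 k).const_mul 2) (by simp only [e2]; exact i2 k) i3
      (fun x _ => (hρ.diff x).fun_mul (hρ.diff x)) (fun x _ => (h.isC1b_velocity ht k).diff x)
    simp only [e1, e2, integral_const_mul] at h3
    rw [h3]
    ring
  have e3 : ∫ x, massRate (ρ t) (u t) x * ρ t x =
      -∑ k, ((∫ x, pderiv k (ρ t) x * u t x k * ρ t x) +
        ∫ x, ρ t x * pderiv k (components (u t) k) x * ρ t x) := by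
    have i4 : ∀ k ∈ Finset.univ, Integrable (fun x => pderiv k (ρ t) x * u t x k * ρ t x +
        ρ t x * pderiv k (components (u t) k) x * ρ t x) := fun k _ => (i1 k).add (i2 k)
    rw [Finset.sum_congr rfl fun k _ => (integral_add (i1 k) (i2 k)).symm,
      ← integral_finsetSum _ i4, ← integral_neg]
    refine integral_congr_ae (Eventually.of_forall fun x => ?_)
    simp only [massRate, neg_mul, Finset.sum_mul, add_mul]
  have e4 : ∫ x, divergence (u t) x * ρ t x * ρ t x =
      ∑ k, ∫ x, ρ t x * pderiv k (components (u t) k) x * ρ t x := by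
    rw [← integral_finsetSum _ fun k _ => i2 k]
    refine integral_congr_ae (Eventually.of_forall fun x => ?_)
    simp only [divergence, Finset.sum_mul]
    refine Finset.sum_congr rfl fun k _ => ?_
    rw [mul_comm (ρ t x)]
    rfl
  rw [e3, e4, Finset.sum_congr rfl fun k _ => ibp k, Finset.sum_congr rfl fun k _ => by rw [ibp k],
    ← Finset.mul_sum, Finset.sum_add_distrib, ← Finset.mul_sum]
  ring

/-- The derivative of the Coulomb energy of the density. -/
lemma hasDerivWithinAt_coulombEnergy {t : ℝ} (ht : t ∈ Icc 0 T) :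
    HasDerivWithinAt (fun τ => ∫ x, kernelConv coulomb (ρ τ) x * ρ τ x)
      (2 * ∫ x, kernelConv coulomb (massRate (ρ t) (u t)) x * ρ t x) (Icc 0 T) t := by
  obtain ⟨M, hM⟩ := h.tame_density.bounded
  obtain ⟨L, hL⟩ := h.isEvolution.exists_lipschitz_kernelConv isKernel_coulomb
  refine h.isEvolution.hasDerivWithinAt_quadratic (A := fun τ => kernelConv coulomb (ρ τ))
    (C := 1 * (kernelConst * M + 2 * 1)) (L := L) ht
    (fun τ hτ => measurable_kernelConv measurable_coulomb (h.continuous_density τ hτ).measurable)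
    (fun τ hτ x => ?_) (fun τ hτ => hL t ht τ hτ)
    (h.isEvolution.hasDerivWithinAt_kernelConv isKernel_coulomb ht) (fun τ hτ => ?_)
  · have h1 := isKernel_coulomb.abs_kernelConv_le (h.integrable_density hτ) (hM τ hτ) x
    have h2 : ∫ y, |ρ τ y| = 1 := by
      rw [← h.mass τ hτ]
      exact integral_congr_ae (Eventually.of_forall fun y => abs_of_nonneg (h.nonneg τ hτ y))
    rwa [h2] at h1
  -- The form `∫(V_c*ρ)σ` is symmetric because `V_c` is even.
  · have h1 := (isKernel_coulomb.integrable_prod (h.integrable_density ht)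
      (h.integrable_density hτ) (hM τ hτ)).2
    have h2 := (isKernel_coulomb.integrable_prod (h.integrable_density hτ)
      (h.integrable_density ht) (hM t ht)).2
    rw [← h1, ← h2, Measure.volume_eq_prod, ← integral_prod_swap]
    refine integral_congr_ae (Eventually.of_forall fun p => ?_)
    simp only [Prod.fst_swap, Prod.snd_swap]
    rw [← isInteraction_coulomb.even, neg_sub]
    ring

end IsEulerPoissonSolution

end Fluid

/-! ### Current, stress tensor and the strain term. -/

section Momentum

variable {n : ℕ} {ħ : ℝ} {u : E3 → E3} {ψ : WaveFn (n + 2)}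

/-- The quantum current density in the direction `k` of the first particle. -/
noncomputable def current (ψ : WaveFn (n + 2)) (k : Fin 3) (X : Config (n + 2)) : ℝ :=
  ((starRingEnd ℂ) (ψ X) * weakDeriv (particleDir 0 k) ψ X).im

/-- The real part of the quantum stress tensor of the first particle. -/
noncomputable def stress (ψ : WaveFn (n + 2)) (j k : Fin 3) (X : Config (n + 2)) : ℝ :=
  ((starRingEnd ℂ) (weakDeriv (particleDir 0 k) ψ X) * weakDeriv (particleDir 0 j) ψ X).re

/-- The factor `-i` turns the mixed terms into the current, because `Re(-i z) = Im z`. Both the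
kinetic energy and the strain term are expanded with this identity. -/
lemma re_modMomentum (j k : Fin 3) (X : Config (n + 2)) :
    ((starRingEnd ℂ) (modMomentum ħ u ψ k X) * modMomentum ħ u ψ j X).re =
      ħ ^ 2 * stress ψ j k X + u (X 0) j * u (X 0) k * ‖ψ X‖ ^ 2 -
        ħ * (u (X 0) k * current ψ j X) - ħ * (u (X 0) j * current ψ k X) := by
  simp only [modMomentum, stress, current, ← Complex.normSq_eq_norm_sq, Complex.normSq_apply,
    map_sub, map_mul, map_neg, Complex.conj_I, Complex.conj_ofReal, Complex.mul_re, Complex.mul_im,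
    Complex.sub_re, Complex.sub_im, Complex.neg_re, Complex.neg_im, Complex.I_re, Complex.I_im,
    Complex.ofReal_re, Complex.ofReal_im, Complex.conj_re, Complex.conj_im]
  ring

lemma norm_modMomentum_sq (k : Fin 3) (X : Config (n + 2)) :
    ‖modMomentum ħ u ψ k X‖ ^ 2 =
      ħ ^ 2 * stress ψ k k X + u (X 0) k * u (X 0) k * ‖ψ X‖ ^ 2 -
        ħ * (u (X 0) k * current ψ k X) - ħ * (u (X 0) k * current ψ k X) := by
  rw [← re_modMomentum, ← Complex.normSq_eq_conj_mul_self, Complex.ofReal_re,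
    Complex.normSq_eq_norm_sq]

lemma integrable_current (k : Fin 3) : Integrable (current ψ k) := integrable_im_conj_mul _ _

lemma integrable_stress (j k : Fin 3) : Integrable (stress ψ j k) := by
  refine ((L2.integrable_inner (𝕜 := ℂ) (weakDeriv (particleDir 0 k) ψ)
    (weakDeriv (particleDir 0 j) ψ)).re).congr (Eventually.of_forall fun x => ?_)
  simp [RCLike.inner_apply, stress, mul_comm]

lemma integral_stress_self (k : Fin 3) :
    ∫ X, stress ψ k k X = ‖weakDeriv (particleDir 0 k) ψ‖ ^ 2 := by
  rw [norm_sq_eq_integral]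
  refine integral_congr_ae (Eventually.of_forall fun X => ?_)
  simp only [stress]
  rw [← Complex.normSq_eq_conj_mul_self, Complex.ofReal_re, Complex.normSq_eq_norm_sq]

lemma IsBddMeas.integrable_mul {α : Type*} [MeasureSpace α] {a g : α → ℝ} (ha : IsBddMeas a)
    (hg : Integrable g) : Integrable (fun x => a x * g x) := by
  obtain ⟨C, hC⟩ := ha.bdd
  exact hg.bdd_mul ha.meas.aestronglyMeasurable (Eventually.of_forall hC)

lemma IsBddMeas.mul {α : Type*} [MeasurableSpace α] {a b : α → ℝ} (ha : IsBddMeas a)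
    (hb : IsBddMeas b) : IsBddMeas (fun x => a x * b x) := by
  obtain ⟨A, hA⟩ := ha.bdd
  obtain ⟨B, hB⟩ := hb.bdd
  refine ⟨ha.meas.mul hb.meas, A * B, fun x => ?_⟩
  rw [abs_mul]
  exact mul_le_mul (hA x) (hB x) (abs_nonneg _) ((abs_nonneg _).trans (hA x))

lemma IsBddMeas.sum {α ι : Type*} [MeasurableSpace α] (s : Finset ι) {a : ι → α → ℝ}
    (ha : ∀ i, IsBddMeas (a i)) : IsBddMeas (fun x => ∑ i ∈ s, a i x) := by
  choose C hC using fun i => (ha i).bdd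
  exact ⟨Finset.measurable_fun_sum _ fun i _ => (ha i).meas, ∑ i ∈ s, C i, fun x =>
    (Finset.abs_sum_le_sum_abs _ _).trans (Finset.sum_le_sum fun i _ => hC i x)⟩

lemma IsBddMeas.integrable_lift {a : E3 → ℝ} (ha : IsBddMeas a) {g : Config (n + 2) → ℝ}
    (hg : Integrable g) : Integrable (fun X => a (X 0) * g X) :=
  IsBddMeas.integrable_mul (a := QuantumEuler.lift0 a) ha.lift0 hg

/-- The kinetic part of the modulated energy. -/
lemma kineticEnergy_eq (hu : ∀ k, IsBddMeas (components u k)) :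
    Integrable (kineticIntegrand ħ u ψ) ∧
    kineticEnergy ħ u ψ = ħ ^ 2 * (∑ k, ‖weakDeriv (particleDir 0 k) ψ‖ ^ 2) -
      2 * ħ * (∑ k, ∫ X, u (X 0) k * current ψ k X) +
      ∫ X, (∑ k, u (X 0) k * u (X 0) k) * ‖ψ X‖ ^ 2 := by
  have i1 : ∀ k, Integrable (fun X => ħ ^ 2 * stress ψ k k X) := fun k =>
    (integrable_stress k k).const_mul _
  have i2 : ∀ k, Integrable (fun X => u (X 0) k * u (X 0) k * ‖ψ X‖ ^ 2) := fun k =>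
    ((hu k).mul (hu k)).integrable_lift (integrable_norm_sq ψ)
  have i3 : ∀ k, Integrable (fun X => ħ * (u (X 0) k * current ψ k X)) := fun k =>
    ((hu k).integrable_lift (integrable_current k)).const_mul _
  have i4 : ∀ k, Integrable (fun X => ħ ^ 2 * stress ψ k k X + u (X 0) k * u (X 0) k * ‖ψ X‖ ^ 2 -
        ħ * (u (X 0) k * current ψ k X) - ħ * (u (X 0) k * current ψ k X)) := fun k =>
    (((i1 k).add (i2 k)).sub (i3 k)).sub (i3 k)
  have hI : kineticIntegrand ħ u ψ = fun X => ∑ k, (ħ ^ 2 * stress ψ k k X +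
      u (X 0) k * u (X 0) k * ‖ψ X‖ ^ 2 - ħ * (u (X 0) k * current ψ k X) -
        ħ * (u (X 0) k * current ψ k X)) := by
    ext X
    simp only [kineticIntegrand, norm_modMomentum_sq]
  have hterm : ∀ k, ∫ X, (ħ ^ 2 * stress ψ k k X +
      u (X 0) k * u (X 0) k * ‖ψ X‖ ^ 2 - ħ * (u (X 0) k * current ψ k X) -
        ħ * (u (X 0) k * current ψ k X)) = ħ ^ 2 * ‖weakDeriv (particleDir 0 k) ψ‖ ^ 2 +
        (∫ X, u (X 0) k * u (X 0) k * ‖ψ X‖ ^ 2) - 2 * ħ * ∫ X, u (X 0) k * current ψ k X := by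
    intro k
    have j1 : Integrable (fun X => ħ ^ 2 * stress ψ k k X + u (X 0) k * u (X 0) k * ‖ψ X‖ ^ 2) :=
      (i1 k).add (i2 k)
    have j2 : Integrable (fun X => ħ ^ 2 * stress ψ k k X + u (X 0) k * u (X 0) k * ‖ψ X‖ ^ 2 -
      ħ * (u (X 0) k * current ψ k X)) := j1.sub (i3 k)
    rw [integral_sub j2 (i3 k), integral_sub j1 (i3 k), integral_add (i1 k) (i2 k),
      integral_const_mul, integral_const_mul, integral_stress_self]
    ring
  refine ⟨by rw [hI]; exact integrable_finsetSum _ fun k _ => i4 k, ?_⟩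
  rw [kineticEnergy, hI, integral_finsetSum _ fun k _ => i4 k]
  simp only [hterm, Finset.sum_sub_distrib, Finset.sum_add_distrib, ← Finset.mul_sum,
    Finset.sum_mul]
  rw [integral_finsetSum _ fun k _ => i2 k]
  ring

/-- `(-iħ∂_k - u^k) ψ` as an element of `L²`. -/
lemma exists_modMomentum_L2 (hu : ∀ k, IsBddMeas (components u k)) (k : Fin 3) :
    ∃ P : WaveFn (n + 2), ∀ᵐ X, P X = modMomentum ħ u ψ k X := by
  refine ⟨(-Complex.I * ħ) • weakDeriv (particleDir 0 k) ψ -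
    mulL (lift0 (components u k)) ψ, ?_⟩
  filter_upwards [Lp.coeFn_sub ((-Complex.I * ħ) • weakDeriv (particleDir 0 k) ψ)
    (mulL (lift0 (components u k)) ψ), Lp.coeFn_smul (-Complex.I * ħ)
    (weakDeriv (particleDir 0 k) ψ), coeFn_mulL ((hu k).lift0.mulMem ψ)] with X h1 h2 h3
  rw [h1, Pi.sub_apply, h2, h3, Pi.smul_apply, smul_eq_mul]
  rfl

lemma integrable_modMomentum (hu : ∀ k, IsBddMeas (components u k)) {a : E3 → ℝ}
    (ha : IsBddMeas a) (j k : Fin 3) :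
    Integrable (fun X => (a (X 0) : ℂ) *
      ((starRingEnd ℂ) (modMomentum ħ u ψ k X) * modMomentum ħ u ψ j X)) := by
  obtain ⟨P, hP⟩ := exists_modMomentum_L2 (ħ := ħ) (ψ := ψ) hu j
  obtain ⟨Q, hQ⟩ := exists_modMomentum_L2 (ħ := ħ) (ψ := ψ) hu k
  refine (integrable_inner_mulL (f := Q) (g := P) (ha.lift0.mulMem P)).congr ?_
  filter_upwards [hP, hQ] with X h1 h2
  rw [h1, h2]
  rfl

/-- The strain term of the rate. -/
lemma sum_integral_strain (hu : ∀ k, IsBddMeas (components u k))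
    (hdu : ∀ j k, IsBddMeas (pderiv j (components u k))) :
    (∀ j k, Integrable (strainIntegrand ħ u ψ j k)) ∧
    ∑ j, ∑ k, ∫ X, strainIntegrand ħ u ψ j k X = ((2 * ∑ j, ∑ k,
      (ħ ^ 2 * (∫ X, pderiv j (components u k) (X 0) * stress ψ j k X) +
        (∫ X, pderiv j (components u k) (X 0) * (u (X 0) j * u (X 0) k) * ‖ψ X‖ ^ 2) -
        ħ * (∫ X, pderiv j (components u k) (X 0) * u (X 0) k * current ψ j X) -
        ħ * ∫ X, pderiv j (components u k) (X 0) * u (X 0) j * current ψ k X) : ℝ) : ℂ) := by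
  -- The strain integrand is `q j k` plus the conjugate of `q k j`. Each entry may be complex, but
  -- the sum over `j, k` is twice the real part of `∑ q`.
  set q : Fin 3 → Fin 3 → Config (n + 2) → ℂ := fun j k X =>
    (pderiv j (components u k) (X 0) : ℂ) *
      ((starRingEnd ℂ) (modMomentum ħ u ψ k X) * modMomentum ħ u ψ j X) with hq
  have hqi : ∀ j k, Integrable (q j k) := fun j k => integrable_modMomentum hu (hdu j k) j k
  have hcq : ∀ j k, Integrable (fun X => (starRingEnd ℂ) (q j k X)) := fun j k =>
    (Complex.conjCLE.toContinuousLinearMap.integrable_comp (hqi j k))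
  have he : ∀ j k X, strainIntegrand ħ u ψ j k X = q j k X + (starRingEnd ℂ) (q k j X) := by
    intro j k X
    simp only [strainIntegrand, hq, map_mul, Complex.conj_conj, Complex.conj_ofReal]
    push_cast
    have e1 : (pderiv j (fun y => u y k) (X 0) : ℂ) = (pderiv j (components u k) (X 0) : ℂ) := rfl
    have e2 : (pderiv k (fun y => u y j) (X 0) : ℂ) = (pderiv k (components u j) (X 0) : ℂ) := rfl
    rw [e1, e2]
    ring
  have hre : ∀ j k, (∫ X, q j k X).re = ħ ^ 2 * (∫ X, pderiv j (components u k) (X 0) * stress ψ j k X) +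
        (∫ X, pderiv j (components u k) (X 0) * (u (X 0) j * u (X 0) k) * ‖ψ X‖ ^ 2) -
        ħ * (∫ X, pderiv j (components u k) (X 0) * u (X 0) k * current ψ j X) -
        ħ * ∫ X, pderiv j (components u k) (X 0) * u (X 0) j * current ψ k X := by
    intro j k
    have h1 : (∫ X, q j k X).re = ∫ X, (q j k X).re := (integral_re (hqi j k)).symm
    have h2 : ∀ X, (q j k X).re = ħ ^ 2 * (pderiv j (components u k) (X 0) * stress ψ j k X) +
        pderiv j (components u k) (X 0) * (u (X 0) j * u (X 0) k) * ‖ψ X‖ ^ 2 -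
        ħ * (pderiv j (components u k) (X 0) * u (X 0) k * current ψ j X) -
        ħ * (pderiv j (components u k) (X 0) * u (X 0) j * current ψ k X) := fun X => by
      rw [hq]
      simp only
      rw [Complex.re_ofReal_mul, re_modMomentum]
      ring
    have i1 : Integrable (fun X => ħ ^ 2 * (pderiv j (components u k) (X 0) * stress ψ j k X)) :=
      ((hdu j k).integrable_lift (integrable_stress j k)).const_mul _
    have i2 : Integrable (fun X => pderiv j (components u k) (X 0) * (u (X 0) j * u (X 0) k) *
        ‖ψ X‖ ^ 2) :=
      ((hdu j k).mul ((hu j).mul (hu k))).integrable_lift (integrable_norm_sq ψ)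
    have i3 : Integrable (fun X => ħ * (pderiv j (components u k) (X 0) * u (X 0) k *
        current ψ j X)) :=
      (((hdu j k).mul (hu k)).integrable_lift (integrable_current j)).const_mul _
    have i4 : Integrable (fun X => ħ * (pderiv j (components u k) (X 0) * u (X 0) j *
        current ψ k X)) :=
      (((hdu j k).mul (hu j)).integrable_lift (integrable_current k)).const_mul _
    have j1 : Integrable (fun X => ħ ^ 2 * (pderiv j (components u k) (X 0) * stress ψ j k X) +
        pderiv j (components u k) (X 0) * (u (X 0) j * u (X 0) k) * ‖ψ X‖ ^ 2) := i1.add i2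
    have j2 : Integrable (fun X => ħ ^ 2 * (pderiv j (components u k) (X 0) * stress ψ j k X) +
        pderiv j (components u k) (X 0) * (u (X 0) j * u (X 0) k) * ‖ψ X‖ ^ 2 -
        ħ * (pderiv j (components u k) (X 0) * u (X 0) k * current ψ j X)) := j1.sub i3
    rw [h1]
    simp only [h2]
    rw [integral_sub j2 i4, integral_sub j1 i3, integral_add i1 i2, integral_const_mul,
      integral_const_mul, integral_const_mul]
  have hint : ∀ j k, Integrable (strainIntegrand ħ u ψ j k) := fun j k =>
    ((hqi j k).add (hcq k j)).congr (Eventually.of_forall fun X => (he j k X).symm)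
  refine ⟨hint, ?_⟩
  have hval : ∀ j k, ∫ X, strainIntegrand ħ u ψ j k X =
      (∫ X, q j k X) + (starRingEnd ℂ) (∫ X, q k j X) := fun j k => by
    simp only [he]
    rw [integral_add (hqi j k) (hcq k j), integral_conj]
  simp only [hval, Finset.sum_add_distrib]
  rw [Finset.sum_comm (f := fun j k => (starRingEnd ℂ) (∫ X, q k j X)), ← Finset.sum_add_distrib]
  simp only [← Finset.sum_add_distrib, Complex.add_conj, hre]
  push_cast
  simp only [Finset.mul_sum]

end Momentum

/-! ### Double integrals of pair forces and kernels. -/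

section PairIntegrals

variable {n : ℕ} {ψ : WaveFn (n + 2)} {W : E3 → ℝ}

lemma IsInteraction.integrable_pair (hW : IsInteraction W)
    {d : Fin 3 → WaveFn (n + 2)} (hd : ∀ k, HasL2Deriv (particleDir 0 k) ψ (d k)) :
    Integrable (fun X => W (X 0 - X 1) * ‖ψ X‖ ^ 2) :=
  integrable_mul_norm_sq (a := fun X => W (X 0 - X 1))
    (hW.mulMem (isShift_pair (by simp : (0 : Fin (n + 2)) ≠ 1)) hd)

/-- The force may be as singular as `|x_1-x_2|⁻²`, which Hardy's inequality makes integrable against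
`|ψ|²`. -/
lemma IsInteraction.integrable_deriv_pair (hW : IsInteraction W)
    {d : Fin 3 → WaveFn (n + 2)} (hd : ∀ k, HasL2Deriv (particleDir 0 k) ψ (d k))
    {a : E3 → ℝ} (ha : IsBddMeas a) (k : Fin 3) :
    Integrable (fun X => a (X 0) * pderiv k W (X 0 - X 1) * ‖ψ X‖ ^ 2) := by
  have h01 : (0 : Fin (n + 2)) ≠ 1 := by simp
  obtain ⟨C, hC⟩ := hW.dbound
  obtain ⟨A, hA⟩ := ha.bdd
  have h1 := (((hardy (isShift_pair h01) hd).2.1.add (integrable_norm_sq ψ)).const_mul C).const_mul A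
  refine h1.mono' ?_ (Eventually.of_forall fun X => ?_)
  · exact ((ha.meas.comp (measurable_pi_apply 0)).mul ((measurable_pderiv k W).comp
      ((measurable_pi_apply 0).sub (measurable_pi_apply 1)))).aestronglyMeasurable.mul
      ((Lp.aestronglyMeasurable ψ).norm.pow 2)
  · rw [Real.norm_eq_abs, abs_mul, abs_mul, abs_of_nonneg (by positivity : 0 ≤ ‖ψ X‖ ^ 2), mul_assoc]
    refine mul_le_mul (hA _) ?_ (by positivity) ((abs_nonneg _).trans (hA 0))
    simp only [Pi.add_apply]
    calc _ ≤ C * (1 + (‖X 0 - X 1‖ ^ 2)⁻¹) * ‖ψ X‖ ^ 2 := by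
          gcongr
          exact hC k _
      _ = _ := by ring

/-- The contribution of a pair interaction to the rate, by symmetrization. -/
lemma IsInteraction.integral_rate (hW : IsInteraction W) (hs : IsBosonic ψ)
    {d : Fin 3 → WaveFn (n + 2)} (hd : ∀ k, HasL2Deriv (particleDir 0 k) ψ (d k)) {u : E3 → E3}
    (hu : ∀ k, IsBddMeas (components u k)) :
    Integrable (fun p : E3 × E3 => dotGrad (u p.1 - u p.2) W (p.1 - p.2) * density2 ψ p.1 p.2) ∧
    ∫ p : E3 × E3, dotGrad (u p.1 - u p.2) W (p.1 - p.2) * density2 ψ p.1 p.2 =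
      2 * ∑ k, ∫ X, u (X 0) k * pderiv k W (X 0 - X 1) * ‖ψ X‖ ^ 2 := by
  have h01 : (0 : Fin (n + 2)) ≠ 1 := by simp
  have i1 : ∀ k, Integrable (fun X => u (X 0) k * pderiv k W (X 0 - X 1) * ‖ψ X‖ ^ 2) := fun k =>
    hW.integrable_deriv_pair hd (hu k) k
  have e1 : ∀ (k : Fin 3) (X : Config (n + 2)), u (X 1) k * pderiv k W (X 1 - X 0) * ‖ψ X‖ ^ 2 =
      -(u (X 1) k * pderiv k W (X 0 - X 1) * ‖ψ X‖ ^ 2) := fun k X => by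
    rw [← neg_sub (X 0) (X 1), hW.odd]
    ring
  have i2 : ∀ k, Integrable (fun X => u (X 1) k * pderiv k W (X 0 - X 1) * ‖ψ X‖ ^ 2) := fun k => by
    have := (hs.integrable_pair h01 h01.symm (F := fun x y => u x k * pderiv k W (x - y))).1 (i1 k)
    simp only [e1] at this
    simpa using this.neg
  -- Exchanging the two particles changes the sign of the odd gradient, so both halves of `u(x_1) -
  -- u(x_2)` contribute alike.
  have v2 : ∀ k, ∫ X, u (X 1) k * pderiv k W (X 0 - X 1) * ‖ψ X‖ ^ 2 =
      -∫ X, u (X 0) k * pderiv k W (X 0 - X 1) * ‖ψ X‖ ^ 2 := fun k => by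
    have := hs.integral_pair h01 h01.symm (fun x y => u x k * pderiv k W (x - y))
    simp only [e1] at this
    rw [this, integral_neg, neg_neg]
  have e2 : ∀ X : Config (n + 2), dotGrad (u (X 0) - u (X 1)) W (X 0 - X 1) * ‖ψ X‖ ^ 2 =
      ∑ k, (u (X 0) k * pderiv k W (X 0 - X 1) * ‖ψ X‖ ^ 2 -
        u (X 1) k * pderiv k W (X 0 - X 1) * ‖ψ X‖ ^ 2) := fun X => by
    rw [dotGrad, Finset.sum_mul]
    refine Finset.sum_congr rfl fun k _ => ?_
    rw [PiLp.sub_apply]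
    ring
  have i3 : ∀ k ∈ Finset.univ, Integrable (fun X => u (X 0) k * pderiv k W (X 0 - X 1) * ‖ψ X‖ ^ 2 -
        u (X 1) k * pderiv k W (X 0 - X 1) * ‖ψ X‖ ^ 2) := fun k _ => (i1 k).sub (i2 k)
  have i4 : Integrable (fun X => dotGrad (u (X 0) - u (X 1)) W (X 0 - X 1) * ‖ψ X‖ ^ 2) := by
    simp only [e2]
    exact integrable_finsetSum _ i3
  obtain ⟨h1, h2⟩ := integrable_mul_density2 (ψ := ψ)
    (b := fun x y => dotGrad (u x - u y) W (x - y)) i4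
  refine ⟨h1, h2.trans ?_⟩
  simp only [e2]
  rw [integral_finsetSum _ i3, Finset.mul_sum]
  refine Finset.sum_congr rfl fun k _ => ?_
  rw [integral_sub (i1 k) (i2 k), v2]
  ring

variable {C M : ℝ} {k h a : E3 → ℝ}

/-- Joint integrability of `k(x - y) h(x) a(y)` for even kernels. -/
lemma IsKernel.integrable_prod_even (hk : IsKernel C k) (he : ∀ y, k (-y) = k y) (ha : Integrable a)
    (hi : Integrable h) (hM : ∀ y, |h y| ≤ M) :
    Integrable (fun p : E3 × E3 => k (p.1 - p.2) * (h p.1 * a p.2)) ∧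
      ∫ p : E3 × E3, k (p.1 - p.2) * (h p.1 * a p.2) = ∫ x, kernelConv k h x * a x := by
  -- Swapping the variables puts the convolution on the bounded factor `h`; the factor `a`, later
  -- the one-particle density, is only known to be integrable.
  obtain ⟨h1, h2⟩ := hk.integrable_prod ha hi hM
  have e : ∀ p : E3 × E3, k (p.swap.1 - p.swap.2) * (a p.swap.1 * h p.swap.2) =
      k (p.1 - p.2) * (h p.1 * a p.2) := fun p => by
    rw [Prod.fst_swap, Prod.snd_swap, ← neg_sub, he]
    ring
  constructor
  · exact (Integrable.swap h1).congr (Eventually.of_forall e)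
  · rw [← h2, Measure.volume_eq_prod,
      ← integral_prod_swap (fun p : E3 × E3 => k (p.1 - p.2) * (a p.1 * h p.2))]
    exact integral_congr_ae (Eventually.of_forall fun p => (e p).symm)

lemma IsKernel.integral_kernelConv_antisymm (hk : IsKernel C k) (ho : ∀ y, k (-y) = -k y)
    {M' : ℝ} (ha : Integrable a) (hM' : ∀ y, |a y| ≤ M') (hi : Integrable h) (hM : ∀ y, |h y| ≤ M) :
    ∫ x, kernelConv k h x * a x = -∫ x, kernelConv k a x * h x := by
  rw [← (hk.integrable_prod ha hi hM).2, ← (hk.integrable_prod hi ha hM').2, Measure.volume_eq_prod,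
    ← integral_prod_swap, ← integral_neg]
  refine integral_congr_ae (Eventually.of_forall fun p => ?_)
  simp only [Prod.fst_swap, Prod.snd_swap]
  rw [← neg_sub, ho]
  ring

/-- Integrals of `(w(x) - w(y)) k(x - y) h(x) a(y)` for odd kernels. -/
lemma IsKernel.integrable_prod_sub (hk : IsKernel C k) (ho : ∀ y, k (-y) = -k y) {w : E3 → ℝ}
    (hw : IsBddMeas w) (ha : Integrable a) (hi : Integrable h) (hM : ∀ y, |h y| ≤ M) :
    Integrable (fun p : E3 × E3 => (w p.1 - w p.2) * k (p.1 - p.2) * (h p.1 * a p.2)) ∧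
      ∫ p : E3 × E3, (w p.1 - w p.2) * k (p.1 - p.2) * (h p.1 * a p.2) =
        (∫ x, kernelConv k h x * (w x * a x)) - ∫ x, kernelConv k (fun y => h y * w y) x * a x := by
  obtain ⟨B, hB⟩ := hw.bdd
  have hwi : Integrable (fun y => h y * w y) :=
    (hw.integrable_mul hi).congr (Eventually.of_forall fun y => mul_comm _ _)
  have hwM : ∀ y, |h y * w y| ≤ M * B := fun y => by
    rw [abs_mul]
    exact mul_le_mul (hM y) (hB y) (abs_nonneg _) ((abs_nonneg _).trans (hM y))
  obtain ⟨h1, h2⟩ := hk.integrable_prod (hw.integrable_mul ha) hi hM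
  obtain ⟨h3, h4⟩ := hk.integrable_prod ha hwi hwM
  have e : ∀ p : E3 × E3, k (p.swap.1 - p.swap.2) * (w p.swap.1 * a p.swap.1 * h p.swap.2) -
      k (p.swap.1 - p.swap.2) * (a p.swap.1 * (h p.swap.2 * w p.swap.2)) =
      (w p.1 - w p.2) * k (p.1 - p.2) * (h p.1 * a p.2) := fun p => by
    rw [Prod.fst_swap, Prod.snd_swap, ← neg_sub p.1 p.2, ho]
    ring
  have h5 := h1.sub h3
  constructor
  · exact (Integrable.swap h5).congr (Eventually.of_forall e)
  · rw [← h2, ← h4, ← integral_sub h1 h3, Measure.volume_eq_prod,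
      ← integral_prod_swap (fun p : E3 × E3 => k (p.1 - p.2) * (w p.1 * a p.1 * h p.2) -
        k (p.1 - p.2) * (a p.1 * (h p.2 * w p.2)))]
    exact integral_congr_ae (Eventually.of_forall fun p => (e p).symm)

end PairIntegrals

/-! ### Mixed weak derivatives and the canonical choice of derivative. -/

section WeakDerivatives

variable {E : Type*} [NormedAddCommGroup E] [NormedSpace ℝ E] [FiniteDimensional ℝ E]
  [MeasureSpace E] [BorelSpace E] [(volume : Measure E).IsAddHaarMeasure]

/-- Weak derivatives in two directions commute. -/
lemma IsWeakDeriv.second_comm {v w : E} {f g h a b : L2 E} (hg : IsWeakDeriv v f g)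
    (hh : IsWeakDeriv w f h) (ha : IsWeakDeriv w g a) (hb : IsWeakDeriv v h b) : a = b := by
  refine eq_of_integral_test_eq fun φ hφ hc => ?_
  have hs : ∀ v : E, ContDiff ℝ ∞ (fun x => fderiv ℝ φ x v) := fun v =>
    (hφ.fderiv_right (m := ∞) le_rfl).clm_apply contDiff_const
  have hcs : ∀ v : E, HasCompactSupport (fun x => fderiv ℝ φ x v) := fun v =>
    hc.fderiv_apply (𝕜 := ℝ) v
  have hd : Differentiable ℝ (fderiv ℝ φ) :=
    (hφ.fderiv_right (m := ∞) le_rfl).differentiable (by simp)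
  have hsymm : ∀ x, fderiv ℝ (fun y => fderiv ℝ φ y w) x v =
      fderiv ℝ (fun y => fderiv ℝ φ y v) x w := by
    intro x
    have h1 : IsSymmSndFDerivAt ℝ φ x := hφ.contDiffAt.isSymmSndFDerivAt (by
      rw [minSmoothness_of_isRCLikeNormedField]
      exact WithTop.coe_le_coe.2 (le_top : (2 : ℕ∞) ≤ ⊤))
    have h2 : ∀ a b : E, fderiv ℝ (fun y => fderiv ℝ φ y a) x b = fderiv ℝ (fderiv ℝ φ) x b a :=
      fun a b => by
        rw [fderiv_clm_apply (hd x) (differentiableAt_const a)]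
        simp
    rw [h2, h2]
    exact h1 v w
  have e1 := ha.integral_eq hφ hc
  have e2 := hg.integral_eq (hs w) (hcs w)
  have e3 := hb.integral_eq hφ hc
  have e4 := hh.integral_eq (hs v) (hcs v)
  rw [eq_neg_iff_add_eq_zero, add_comm, ← eq_neg_iff_add_eq_zero] at e1 e3
  rw [e1, e3, neg_inj, ← neg_inj, ← e2, ← e4]
  simp only [hsymm]

lemma ContinuousInSobolev.congr {I : Set ℝ} {m : ℕ} {f g : ℝ → L2 E}
    (h : ContinuousInSobolev I m f) (hfg : ∀ t ∈ I, f t = g t) : ContinuousInSobolev I m g := by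
  cases m with
  | zero => exact ContinuousOn.congr h fun t ht => (hfg t ht).symm
  | succ m =>
    refine ⟨ContinuousOn.congr h.1 fun t ht => (hfg t ht).symm, fun v => ?_⟩
    obtain ⟨d, hd, hS⟩ := h.2 v
    exact ⟨d, fun t ht => hfg t ht ▸ hd t ht, hS⟩

/-- Uniqueness identifies the derivatives supplied by `ContinuousInSobolev` with the chosen
`weakDeriv`, in terms of which the Hamiltonian is written. -/
lemma ContinuousInSobolev.weakDeriv {I : Set ℝ} {m : ℕ} {f : ℝ → L2 E}
    (h : ContinuousInSobolev I (m + 1) f) (v : E) :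
    (∀ t ∈ I, IsWeakDeriv v (f t) (weakDeriv v (f t))) ∧
      ContinuousInSobolev I m (fun t => weakDeriv v (f t)) := by
  obtain ⟨d, hd, hS⟩ := h.2 v
  have e : ∀ t ∈ I, d t = QuantumEuler.weakDeriv v (f t) := fun t ht =>
    (hd t ht).weakDeriv_eq.symm
  exact ⟨fun t ht => e t ht ▸ hd t ht, hS.congr e⟩

end WeakDerivatives

/-! ### Solutions of the many-body equation as elements of `L²`. -/

section Solutions

variable {n : ℕ}

/-- The weak gradient. -/
noncomputable def gradient (ψ : WaveFn (n + 2)) (j : Fin (n + 2)) (k : Fin 3) : WaveFn (n + 2) :=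
  weakDeriv (particleDir j k) ψ

/-- The weak second derivatives. -/
noncomputable def hessian (ψ : WaveFn (n + 2)) (j : Fin (n + 2)) (k : Fin 3) (i : Fin (n + 2))
    (l : Fin 3) : WaveFn (n + 2) :=
  weakDeriv (particleDir j k) (weakDeriv (particleDir i l) ψ)

/-- The pointwise Hamiltonian thereby represents an element of `L²`; for the Coulomb terms this
rests on Hardy's inequality. -/
lemma coeFn_pairHamiltonian {ħ κ β : ℝ} {V : E3 → ℝ} {ψ : WaveFn (n + 2)} (hV : IsProfile V)
    (h : IsH2 ψ (gradient ψ) (hessian ψ)) :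
    ∀ᵐ X, pairHamiltonian ħ (1 / ((n + 2 : ℕ) : ℝ)) (κ / ((n + 2 : ℕ) : ℝ))
      (scaledPotential (n + 2) β V) coulomb ψ (hessian ψ) X = hamiltonian ħ κ β V ψ X := by
  have hW := isInteraction_scaledPotential hV (Nat.succ_ne_zero (n + 1)) β
  set c : ℂ := ((-(ħ ^ 2 / 2) : ℝ) : ℂ) with hc
  set c₁ : ℂ := ((1 / ((n + 2 : ℕ) : ℝ) : ℝ) : ℂ) with hc₁
  set c₂ : ℂ := ((κ / ((n + 2 : ℕ) : ℝ) : ℝ) : ℂ) with hc₂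
  set D : WaveFn (n + 2) := ∑ j, ∑ k, hessian ψ j k j k with hD
  have hDX : ∀ᵐ X, D X = ∑ j, ∑ k, hessian ψ j k j k X := by
    have h1 := Lp.coeFn_finsetSum Finset.univ (fun j => ∑ k, hessian ψ j k j k)
    have h2 : ∀ᵐ X, ∀ j : Fin (n + 2), (∑ k, hessian ψ j k j k : WaveFn (n + 2)) X =
        ∑ k, hessian ψ j k j k X := ae_all_iff.2 fun j => by
      filter_upwards [Lp.coeFn_finsetSum Finset.univ (fun k => hessian ψ j k j k)] with X hX
      rw [hX, Finset.sum_apply]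
    filter_upwards [h1, h2] with X hX hY
    rw [hD, hX, Finset.sum_apply]
    exact Finset.sum_congr rfl fun j _ => hY j
  filter_upwards [hDX, Lp.coeFn_add (c • D + c₁ • pairSum (scaledPotential (n + 2) β V) ψ)
      (c₂ • pairSum coulomb ψ), Lp.coeFn_add (c • D)
      (c₁ • pairSum (scaledPotential (n + 2) β V) ψ), Lp.coeFn_smul c D,
    Lp.coeFn_smul c₁ (pairSum (scaledPotential (n + 2) β V) ψ),
    Lp.coeFn_smul c₂ (pairSum coulomb ψ), hW.coeFn_pairSum h.first,
    isInteraction_coulomb.coeFn_pairSum h.first] with X h1 h2 h3 h4 h5 h6 h7 h8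
  have h0 : pairHamiltonian ħ (1 / ((n + 2 : ℕ) : ℝ)) (κ / ((n + 2 : ℕ) : ℝ))
      (scaledPotential (n + 2) β V) coulomb ψ (hessian ψ) =
      c • D + c₁ • pairSum (scaledPotential (n + 2) β V) ψ + c₂ • pairSum coulomb ψ := rfl
  rw [h0, h2, Pi.add_apply, h3, Pi.add_apply, h4, h5, h6, Pi.smul_apply, Pi.smul_apply,
    Pi.smul_apply, h1, h7, h8, hamiltonian, smul_eq_mul, smul_eq_mul, smul_eq_mul, ← Finset.mul_sum,
    hc, hc₁, hc₂]
  simp only [hessian]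
  push_cast
  ring

namespace IsNBodySolution

variable {ħ κ β T : ℝ} {V : E3 → ℝ} {ψ : ℝ → WaveFn (n + 2)}

lemma isH2 (h : IsNBodySolution ħ κ β V T ψ) {t : ℝ} (ht : t ∈ Icc 0 T) :
    IsH2 (ψ t) (gradient (ψ t)) (hessian (ψ t)) where
  first _ _ := ((h.regular.weakDeriv _).1 t ht).hasL2Deriv
  second _ _ _ _ := (((h.regular.weakDeriv _).2.weakDeriv _).1 t ht).hasL2Deriv
  comm _ _ _ _ := IsWeakDeriv.second_comm ((h.regular.weakDeriv _).1 t ht)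
    ((h.regular.weakDeriv _).1 t ht) (((h.regular.weakDeriv _).2.weakDeriv _).1 t ht)
    (((h.regular.weakDeriv _).2.weakDeriv _).1 t ht)

lemma continuousWithinAt_gradient (h : IsNBodySolution ħ κ β V T ψ) {t : ℝ} (ht : t ∈ Icc 0 T)
    (j : Fin (n + 2)) (k : Fin 3) :
    ContinuousWithinAt (fun τ => gradient (ψ τ) j k) (Icc 0 T) t :=
  (h.regular.weakDeriv _).2.1 t ht

lemma continuousWithinAt_hessian (h : IsNBodySolution ħ κ β V T ψ) {t : ℝ} (ht : t ∈ Icc 0 T)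
    (j : Fin (n + 2)) (k : Fin 3) (i : Fin (n + 2)) (l : Fin 3) :
    ContinuousWithinAt (fun τ => hessian (ψ τ) j k i l) (Icc 0 T) t :=
  (((h.regular.weakDeriv _).2.weakDeriv _).2 : ContinuousOn _ _) t ht

lemma exists_hasDerivWithinAt (h : IsNBodySolution ħ κ β V T ψ) (hV : IsProfile V) {t : ℝ}
    (ht : t ∈ Icc 0 T) : ∃ φ : WaveFn (n + 2), HasDerivWithinAt ψ φ (Icc 0 T) t ∧
      (Complex.I * ħ) • φ = pairHamiltonian ħ (1 / ((n + 2 : ℕ) : ℝ)) (κ / ((n + 2 : ℕ) : ℝ))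
        (scaledPotential (n + 2) β V) coulomb (ψ t) (hessian (ψ t)) := by
  obtain ⟨φ, hφ, he⟩ := h.evolution t ht
  refine ⟨φ, hφ, Lp.ext ?_⟩
  filter_upwards [he, Lp.coeFn_smul (Complex.I * (ħ : ℂ)) φ,
    coeFn_pairHamiltonian (ħ := ħ) (κ := κ) (β := β) hV (h.isH2 ht)] with X h1 h2 h3
  rw [h2, h3, ← h1, Pi.smul_apply, smul_eq_mul]

end IsNBodySolution

end Solutions

lemma IsKernel.isBddMeas_kernelConv {C M : ℝ} {k h : E3 → ℝ} (hk : IsKernel C k) (hm : Measurable h)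
    (hi : Integrable h) (hM : ∀ y, |h y| ≤ M) : IsBddMeas (kernelConv k h) :=
  ⟨measurable_kernelConv hk.meas hm, _, hk.abs_kernelConv_le hi hM⟩

lemma IsBddMeas.integral_density1 {n : ℕ} {a : E3 → ℝ} (ha : IsBddMeas a) (ψ : WaveFn (n + 2)) :
    Integrable (fun x => a x * density1 ψ x) ∧
      ∫ x, a x * density1 ψ x = ∫ X, a (X 0) * ‖ψ X‖ ^ 2 :=
  integrable_mul_density1 (ha.integrable_lift (integrable_norm_sq ψ))

/-! ### Modulated energy and rates at a fixed time. -/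

section Static

variable {n : ℕ} {ħ κ β M : ℝ} {V : E3 → ℝ} {ρ : E3 → ℝ} {u : E3 → E3} {ψ : WaveFn (n + 2)}

/-- The Coulomb part of the modulated energy. -/
lemma coulombEnergy_eq (h : IsH2 ψ (gradient ψ) (hessian ψ)) (hm : Measurable ρ)
    (hi : Integrable ρ) (hM : ∀ x, |ρ x| ≤ M) :
    Integrable (coulombIntegrand ρ ψ) ∧
    coulombEnergy ρ ψ = pairFactor n * (∫ X, coulomb (X 0 - X 1) * ‖ψ X‖ ^ 2) +
      (∫ x, kernelConv coulomb ρ x * ρ x) - 2 * ∫ X, kernelConv coulomb ρ (X 0) * ‖ψ X‖ ^ 2 := by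
  obtain ⟨i1, e1⟩ := integrable_mul_density2 (ψ := ψ) (b := fun x y => coulomb (x - y))
    (isInteraction_coulomb.integrable_pair (h.first 0))
  obtain ⟨i2, e2⟩ := isKernel_coulomb.integrable_prod_even isInteraction_coulomb.even hi hi hM
  obtain ⟨i3, e3⟩ := isKernel_coulomb.integrable_prod_even isInteraction_coulomb.even
    (integrable_density1 (ψ := ψ)) hi hM
  have hI : coulombIntegrand ρ ψ = fun p => pairFactor n * (coulomb (p.1 - p.2) *
      density2 ψ p.1 p.2) + coulomb (p.1 - p.2) * (ρ p.1 * ρ p.2) -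
      2 * (coulomb (p.1 - p.2) * (ρ p.1 * density1 ψ p.2)) := by
    ext p
    rw [coulombIntegrand, correlationBracket]
    ring
  have j1 := (i1.const_mul (pairFactor n)).add i2
  have j2 := j1.sub (i3.const_mul 2)
  rw [coulombEnergy, hI]
  refine ⟨j2, ?_⟩
  refine (integral_sub j1 (i3.const_mul 2)).trans ?_
  simp only [Pi.add_apply]
  rw [integral_add (i1.const_mul _) i2, integral_const_mul, integral_const_mul, e1, e2, e3,
    ((isKernel_coulomb.isBddMeas_kernelConv hm hi hM).integral_density1 ψ).2]

/-- The modulated energy in terms of `L²` quantities. -/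
lemma modulatedEnergy_eq (hV : IsProfile V) (h : IsH2 ψ (gradient ψ) (hessian ψ)) (hm : Measurable ρ)
    (hi : Integrable ρ) (hM : ∀ x, |ρ x| ≤ M) (hu : ∀ k, IsBddMeas (components u k)) :
    EnergyConverges ħ β V ρ u ψ ∧
    modulatedEnergy ħ κ β V ρ u ψ = (ħ ^ 2 * (∑ k, ‖gradient ψ 0 k‖ ^ 2) +
        pairFactor n * (∫ X, scaledPotential (n + 2) β V (X 0 - X 1) * ‖ψ X‖ ^ 2) +
        κ * pairFactor n * (∫ X, coulomb (X 0 - X 1) * ‖ψ X‖ ^ 2)) -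
      2 * ħ * (∑ k, ∫ X, u (X 0) k * current ψ k X) +
      (∫ X, (∑ k, u (X 0) k * u (X 0) k) * ‖ψ X‖ ^ 2) +
      coupling V * (∫ x, ρ x * ρ x) - 2 * coupling V * (∫ X, ρ (X 0) * ‖ψ X‖ ^ 2) +
      κ * (∫ x, kernelConv coulomb ρ x * ρ x) -
      2 * κ * ∫ X, kernelConv coulomb ρ (X 0) * ‖ψ X‖ ^ 2 := by
  have hρ : IsBddMeas ρ := ⟨hm, M, hM⟩
  obtain ⟨i1, e1⟩ := kineticEnergy_eq (ħ := ħ) (ψ := ψ) hu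
  obtain ⟨i2, e2⟩ := integrable_mul_density2 (ψ := ψ)
    (b := fun x y => scaledPotential (n + 2) β V (x - y))
    ((isInteraction_scaledPotential hV (Nat.succ_ne_zero (n + 1)) β).integrable_pair (h.first 0))
  obtain ⟨i3, e3⟩ := hρ.integral_density1 ψ
  obtain ⟨i4, e4⟩ := coulombEnergy_eq h hm hi hM
  refine ⟨⟨i1, i2, hρ.integrable_mul hi, i3, i4⟩, ?_⟩
  have e5 : ∫ p, deltaIntegrand β V ψ p =
      ∫ X, scaledPotential (n + 2) β V (X 0 - X 1) * ‖ψ X‖ ^ 2 := e2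
  rw [modulatedEnergy, e1, deltaEnergy, e5, e3, e4]
  simp only [gradient]
  ring

/-- The contribution of the contact potential to the rate. -/
lemma deltaRate_eq (hV : IsProfile V) (hs : IsBosonic ψ) (h : IsH2 ψ (gradient ψ) (hessian ψ))
    (hm : Measurable ρ) (hi : Integrable ρ) (hM : ∀ x, |ρ x| ≤ M)
    (hu : ∀ k, IsBddMeas (components u k)) (hd : IsBddMeas (divergence u)) :
    Integrable (deltaRateIntegrand β V u ψ) ∧ Integrable (deltaFluidRateIntegrand ρ u ψ) ∧
    deltaRate β V ρ u ψ = 2 * pairFactor n *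
        (∑ k, ∫ X, u (X 0) k * pderiv k (scaledPotential (n + 2) β V) (X 0 - X 1) * ‖ψ X‖ ^ 2) -
      coupling V * ((∫ x, divergence u x * ρ x * ρ x) -
        2 * ∫ X, divergence u (X 0) * ρ (X 0) * ‖ψ X‖ ^ 2) := by
  have hρ : IsBddMeas ρ := ⟨hm, M, hM⟩
  obtain ⟨i1, e1⟩ := (isInteraction_scaledPotential hV (Nat.succ_ne_zero (n + 1)) β).integral_rate
    hs (h.first 0) hu
  have i2 := (hd.mul hρ).integrable_mul hi
  obtain ⟨i3, e3⟩ := (hd.mul hρ).integral_density1 ψ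
  have hI : deltaFluidRateIntegrand ρ u ψ = fun x => divergence u x * ρ x * ρ x -
      2 * (divergence u x * ρ x * density1 ψ x) := by
    ext x
    rw [deltaFluidRateIntegrand]
    ring
  have e5 : ∫ p, deltaRateIntegrand β V u ψ p = _ := e1
  refine ⟨i1, by rw [hI]; exact i2.sub (i3.const_mul 2), ?_⟩
  rw [deltaRate, e5, hI, integral_sub i2 (i3.const_mul 2), integral_const_mul, e3]
  ring

/-- The Coulomb contribution to the rate. -/
lemma coulombRate_eq (hs : IsBosonic ψ) (h : IsH2 ψ (gradient ψ) (hessian ψ))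
    (hm : Measurable ρ) (hi : Integrable ρ) (hM : ∀ x, |ρ x| ≤ M)
    (hu : ∀ k, IsBddMeas (components u k)) {G : E3 → ℝ}
    (hG : ∀ x, G x = -∑ k, kernelConv (pderiv k coulomb) (fun y => ρ y * u y k) x) :
    Integrable (coulombRateIntegrand ρ u ψ) ∧
    coulombRate ρ u ψ = 2 * pairFactor n *
        (∑ k, ∫ X, u (X 0) k * pderiv k coulomb (X 0 - X 1) * ‖ψ X‖ ^ 2) +
      2 * (∫ x, G x * ρ x) -
      2 * (∑ k, ∫ X, u (X 0) k * kernelConv (pderiv k coulomb) ρ (X 0) * ‖ψ X‖ ^ 2) -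
      2 * ∫ X, G (X 0) * ‖ψ X‖ ^ 2 := by
  -- `G` stands for `V_c * ∂_tρ`; written through the momentum `ρu`, it requires no derivative of
  -- `ρ` in this computation.
  have hρ : IsBddMeas ρ := ⟨hm, M, hM⟩
  have hp : ∀ k, IsBddMeas (fun y => ρ y * u y k) := fun k => hρ.mul (hu k)
  have hpi : ∀ k, Integrable (fun y => ρ y * u y k) := fun k =>
    ((hu k).integrable_mul hi).congr (Eventually.of_forall fun y => mul_comm _ _)
  choose B hB using fun k => (hp k).bdd
  have hkb : ∀ k, IsBddMeas (kernelConv (pderiv k coulomb) (fun y => ρ y * u y k)) := fun k =>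
    (isKernel_pderiv_coulomb k).isBddMeas_kernelConv (hp k).meas (hpi k) (hB k)
  have hkρ : ∀ k, IsBddMeas (kernelConv (pderiv k coulomb) ρ) := fun k =>
    (isKernel_pderiv_coulomb k).isBddMeas_kernelConv hm hi hM
  obtain ⟨i1, e1⟩ := isInteraction_coulomb.integral_rate hs (h.first 0) hu
  have h2 := fun k => (isKernel_pderiv_coulomb k).integrable_prod_sub
    (isInteraction_coulomb.odd k) (hu k) hi hi hM
  have h3 := fun k => (isKernel_pderiv_coulomb k).integrable_prod_sub
    (isInteraction_coulomb.odd k) (hu k) (integrable_density1 (ψ := ψ)) hi hM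
  -- Oddness of `∇V_c` makes `∫(∇V_c*ρ)·ρu` the negative of `∫(∇V_c*(ρu))ρ`, so both parts of the
  -- difference `u(x_1) - u(x_2)` coincide.
  have v2 : ∀ k, ∫ p : E3 × E3, (components u k p.1 - components u k p.2) *
      pderiv k coulomb (p.1 - p.2) * (ρ p.1 * ρ p.2) =
      -2 * ∫ x, kernelConv (pderiv k coulomb) (fun y => ρ y * u y k) x * ρ x := fun k => by
    have e : (fun y => components u k y * ρ y) = fun y => ρ y * u y k :=
      funext fun y => mul_comm _ _
    have e' := (isKernel_pderiv_coulomb k).integral_kernelConv_antisymm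
      (isInteraction_coulomb.odd k) (hpi k) (hB k) hi hM
    rw [(h2 k).2]
    have e2 : ∫ x, kernelConv (pderiv k coulomb) ρ x * (components u k x * ρ x) =
        ∫ x, kernelConv (pderiv k coulomb) ρ x * (ρ x * u x k) :=
      integral_congr_ae (Eventually.of_forall fun x => by
        simp only
        rw [mul_comm (components u k x)]
        rfl)
    rw [e2, e']
    simp only [components]
    ring
  -- Here the two parts stay distinct: one tests the fluid force against `u`, the other is the
  -- potential of `∂_tρ`. Only `ρ` and `ρu` are convolved.
  have v3 : ∀ k, ∫ p : E3 × E3, (components u k p.1 - components u k p.2) *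
      pderiv k coulomb (p.1 - p.2) * (ρ p.1 * density1 ψ p.2) =
      (∫ X, u (X 0) k * kernelConv (pderiv k coulomb) ρ (X 0) * ‖ψ X‖ ^ 2) -
      ∫ X, kernelConv (pderiv k coulomb) (fun y => ρ y * u y k) (X 0) * ‖ψ X‖ ^ 2 := fun k => by
    have e2 : ∫ x, kernelConv (pderiv k coulomb) ρ x * (components u k x * density1 ψ x) =
        ∫ x, components u k x * kernelConv (pderiv k coulomb) ρ x * density1 ψ x :=
      integral_congr_ae (Eventually.of_forall fun x => by
        simp only
        ring)
    rw [(h3 k).2, e2, (((hu k).mul (hkρ k)).integral_density1 ψ).2]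
    congr 1
    exact ((hkb k).integral_density1 ψ).2
  have i2 := integrable_finsetSum Finset.univ fun k _ => (h2 k).1
  have i3 := integrable_finsetSum Finset.univ fun k _ => (h3 k).1
  have hI : coulombRateIntegrand ρ u ψ = fun p => pairFactor n *
      (dotGrad (u p.1 - u p.2) coulomb (p.1 - p.2) * density2 ψ p.1 p.2) +
      (∑ k, (components u k p.1 - components u k p.2) *
      pderiv k coulomb (p.1 - p.2) * (ρ p.1 * ρ p.2)) -
      2 * ∑ k, (components u k p.1 - components u k p.2) *
      pderiv k coulomb (p.1 - p.2) * (ρ p.1 * density1 ψ p.2) := by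
    ext p
    have hd : dotGrad (u p.1 - u p.2) coulomb (p.1 - p.2) =
        ∑ k, (components u k p.1 - components u k p.2) * pderiv k coulomb (p.1 - p.2) := by
      simp only [dotGrad, PiLp.sub_apply, components]
    rw [coulombRateIntegrand, correlationBracket, ← Finset.sum_mul, ← Finset.sum_mul, ← hd]
    ring
  have j1 := (i1.const_mul (pairFactor n)).add i2
  have j2 := j1.sub (i3.const_mul 2)
  have w2 : ∫ x, G x * ρ x =
      -∑ k, ∫ x, kernelConv (pderiv k coulomb) (fun y => ρ y * u y k) x * ρ x := by
    rw [← integral_finsetSum _ fun k _ => (hkb k).integrable_mul hi, ← integral_neg]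
    simp only [hG, ← Finset.sum_mul, neg_mul]
  have w3 : ∫ X, G (X 0) * ‖ψ X‖ ^ 2 =
      -∑ k, ∫ X, kernelConv (pderiv k coulomb) (fun y => ρ y * u y k) (X 0) * ‖ψ X‖ ^ 2 := by
    rw [← integral_finsetSum _ fun k _ => (hkb k).integrable_lift (integrable_norm_sq ψ),
      ← integral_neg]
    simp only [hG, ← Finset.sum_mul, neg_mul]
  rw [coulombRate, hI]
  refine ⟨j2, ?_⟩
  refine (integral_sub j1 (i3.const_mul 2)).trans ?_
  simp only [Pi.add_apply]
  rw [integral_add (i1.const_mul _) i2, integral_const_mul, integral_const_mul, e1,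
    integral_finsetSum _ fun k _ => (h2 k).1, integral_finsetSum _ fun k _ => (h3 k).1, w2, w3]
  simp only [v2, v3, Finset.sum_sub_distrib, ← Finset.mul_sum]
  ring

end Static

/-! ### Fluid rates integrated against particle weights. -/

section FluidIntegrals

variable {n : ℕ} {κ b₀ : ℝ} {ρ : E3 → ℝ} {u : E3 → E3} {g : Config (n + 2) → ℝ}

/-- The weight is arbitrary because two are needed: the current for the momentum, and `u^k|ψ|²` for
the square of the velocity. -/
lemma integral_velocityRate_mul (hρ : IsC1b ρ) (hu : ∀ k, IsC1b (components u k))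
    (hf : ∀ k, IsBddMeas (kernelConv (pderiv k coulomb) ρ)) (hg : Integrable g) (k : Fin 3) :
    Integrable (fun X => velocityRate κ b₀ ρ u k (X 0) * g X) ∧
    ∫ X, velocityRate κ b₀ ρ u k (X 0) * g X =
      -((∑ j, ∫ X, pderiv j (components u k) (X 0) * u (X 0) j * g X) +
        b₀ * (∫ X, pderiv k ρ (X 0) * g X) +
        κ * ∫ X, kernelConv (pderiv k coulomb) ρ (X 0) * g X) := by
  have i1 : ∀ j ∈ Finset.univ, Integrable (fun X => pderiv j (components u k) (X 0) *
      u (X 0) j * g X) := fun j _ =>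
    (((hu k).isBddMeas_pderiv j).mul (hu j).isBddMeas).integrable_lift hg
  have i2 := ((hρ.isBddMeas_pderiv k).integrable_lift hg).const_mul b₀
  have i3 := ((hf k).integrable_lift hg).const_mul κ
  have i4 := (integrable_finsetSum _ i1).add i2
  have e : ∀ X, velocityRate κ b₀ ρ u k (X 0) * g X =
      -((∑ j, pderiv j (components u k) (X 0) * u (X 0) j * g X) +
        b₀ * (pderiv k ρ (X 0) * g X) + κ * (kernelConv (pderiv k coulomb) ρ (X 0) * g X)) := by
    intro X
    rw [velocityRate, ← Finset.sum_mul]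
    have : ∑ j, u (X 0) j * pderiv j (components u k) (X 0) =
        ∑ j, pderiv j (components u k) (X 0) * u (X 0) j :=
      Finset.sum_congr rfl fun j _ => mul_comm _ _
    rw [this]
    ring
  simp only [e]
  refine ⟨(i4.add i3).neg, ?_⟩
  rw [integral_neg]
  refine congrArg Neg.neg ((integral_add i4 i3).trans ?_)
  simp only [Pi.add_apply]
  rw [integral_add (integrable_finsetSum _ i1) i2, integral_const_mul, integral_const_mul,
    integral_finsetSum _ i1]

lemma integral_massRate_mul (hρ : IsC1b ρ) (hu : ∀ k, IsC1b (components u k))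
    (hd : IsBddMeas (divergence u)) (hg : Integrable g) :
    ∫ X, massRate ρ u (X 0) * g X = -(∑ k, ∫ X, pderiv k ρ (X 0) * u (X 0) k * g X) -
      ∫ X, divergence u (X 0) * ρ (X 0) * g X := by
  have i1 : ∀ k ∈ Finset.univ, Integrable (fun X => pderiv k ρ (X 0) * u (X 0) k * g X) := fun k _ =>
    ((hρ.isBddMeas_pderiv k).mul (hu k).isBddMeas).integrable_lift hg
  have i2 := (hd.mul hρ.isBddMeas).integrable_lift hg
  have e : ∀ X, massRate ρ u (X 0) * g X = -(∑ k, pderiv k ρ (X 0) * u (X 0) k * g X) -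
      divergence u (X 0) * ρ (X 0) * g X := by
    intro X
    have : divergence u (X 0) = ∑ k, pderiv k (components u k) (X 0) := rfl
    rw [massRate, Finset.sum_add_distrib, ← Finset.mul_sum, ← this, ← Finset.sum_mul]
    ring
  simp only [e]
  refine (integral_sub (integrable_finsetSum _ i1).neg i2).trans ?_
  simp only [Pi.neg_apply]
  rw [integral_neg, integral_finsetSum _ i1]

lemma integral_laplace_divergence (hu : IsGoodField (components u)) (ψ : WaveFn (n + 2)) :
    Integrable (fun x => laplace (divergence u) x * density1 ψ x) ∧
    ∫ x, laplace (divergence u) x * density1 ψ x =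
      ∑ l, ∫ X, pderiv l (pderiv l (fieldDiv (components u))) (X 0) * ‖ψ X‖ ^ 2 := by
  have h1 : ∀ l, IsBddMeas (pderiv l (pderiv l (fieldDiv (components u)))) := fun l =>
    (hu.ddiv l).isBddMeas_pderiv l
  obtain ⟨i, e⟩ := (IsBddMeas.sum Finset.univ h1).integral_density1 ψ
  refine ⟨i, Eq.trans e ?_⟩
  simp only [Finset.sum_mul]
  exact integral_finsetSum _ fun l _ => (h1 l).integrable_lift (integrable_norm_sq ψ)

end FluidIntegrals

lemma re_inner_mulL_gradient {n : ℕ} {a : E3 → ℝ} (ha : IsBddMeas a) (ψ : WaveFn (n + 2))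
    (j k : Fin 3) : (inner ℂ (mulL (lift0 a) (gradient ψ 0 k)) (gradient ψ 0 j)).re =
      ∫ X, a (X 0) * stress ψ j k X := by
  rw [inner_mulL_comm (ha.lift0.mulMem _) (ha.lift0.mulMem _), inner_mulL (ha.lift0.mulMem _)]
  refine (integral_re (integrable_inner_mulL (ha.lift0.mulMem _))).symm.trans ?_
  refine integral_congr_ae (Eventually.of_forall fun X => ?_)
  exact Complex.re_ofReal_mul _ _

/-- The coupling is `1/N`, and `n + 1 = N - 1` pairs contain a given particle. -/
lemma pairFactor_eq (n : ℕ) : 1 / ((n + 2 : ℕ) : ℝ) * (n + 1) = pairFactor n := by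
  rw [pairFactor]
  push_cast
  ring

lemma coulombFactor_eq (κ : ℝ) (n : ℕ) : κ / ((n + 2 : ℕ) : ℝ) * (n + 1) = κ * pairFactor n := by
  rw [← pairFactor_eq]
  ring

namespace IsNBodySolution

variable {n : ℕ} {ħ κ β T : ℝ} {V : E3 → ℝ} {ψ : ℝ → WaveFn (n + 2)}

/-- Conservation of energy, per particle. -/
lemma hasDerivWithinAt_energy (h : IsNBodySolution ħ κ β V T ψ) (hV : IsProfile V) {t : ℝ}
    (ht : t ∈ Icc 0 T) :
    HasDerivWithinAt (fun τ => ħ ^ 2 * (∑ k, ‖gradient (ψ τ) 0 k‖ ^ 2) +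
        pairFactor n * (∫ X, scaledPotential (n + 2) β V (X 0 - X 1) * ‖ψ τ X‖ ^ 2) +
        κ * pairFactor n * (∫ X, coulomb (X 0 - X 1) * ‖ψ τ X‖ ^ 2)) 0 (Icc 0 T) t := by
  obtain ⟨φ, hφ, he⟩ := h.exists_hasDerivWithinAt hV ht
  have hW : IsInteraction (scaledPotential (n + 2) β V) :=
    isInteraction_scaledPotential hV (Nat.succ_ne_zero (n + 1)) β
  have h1 := QuantumEuler.hasDerivWithinAt_energy ht (fun τ hτ => h.isH2 hτ) hW
    isInteraction_coulomb hφ (h.continuousWithinAt_gradient ht)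
    (fun j k => h.continuousWithinAt_hessian ht j k j k) he
  -- Multiplication by `2/N` inverts the factor `N/2` in `IsH2.energy_eq`.
  have h2 := h1.const_mul (2 / ((n : ℝ) + 2))
  rw [mul_zero] at h2
  have e : ∀ τ ∈ Icc 0 T, ħ ^ 2 * (∑ k, ‖gradient (ψ τ) 0 k‖ ^ 2) +
        pairFactor n * (∫ X, scaledPotential (n + 2) β V (X 0 - X 1) * ‖ψ τ X‖ ^ 2) +
        κ * pairFactor n * (∫ X, coulomb (X 0 - X 1) * ‖ψ τ X‖ ^ 2) = 2 / ((n : ℝ) + 2) *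
      (inner ℂ (ψ τ) (pairHamiltonian ħ (1 / ((n + 2 : ℕ) : ℝ)) (κ / ((n + 2 : ℕ) : ℝ))
        (scaledPotential (n + 2) β V) coulomb (ψ τ) (hessian (ψ τ)))).re := fun τ hτ => by
    rw [(h.isH2 hτ).energy_eq hW isInteraction_coulomb (h.symmetric τ hτ), pairFactor_eq,
      coulombFactor_eq]
    have : (n : ℝ) + 2 ≠ 0 := by positivity
    field_simp
  exact h2.congr e (e t ht)

/-- The evolution of the expectation of a function of the position of the first particle. -/
lemma hasDerivWithinAt_observable (h : IsNBodySolution ħ κ β V T ψ) (hħ : 0 < ħ) (hV : IsProfile V)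
    {t : ℝ} (ht : t ∈ Icc 0 T) {f : ℝ → E3 → ℝ} {f' : E3 → ℝ} {C L : ℝ}
    (hf : ∀ τ ∈ Icc 0 T, Measurable (f τ) ∧ ∀ x, |f τ x| ≤ C)
    (hlip : ∀ τ ∈ Icc 0 T, ∀ x, |f τ x - f t x| ≤ L * |τ - t|)
    (hder : ∀ x, HasDerivWithinAt (fun τ => f τ x) (f' x) (Icc 0 T) t) (hft : IsC1b (f t)) :
    HasDerivWithinAt (fun τ => ∫ X, f τ (X 0) * ‖ψ τ X‖ ^ 2)
      (ħ * (∑ k, ∫ X, pderiv k (f t) (X 0) * current (ψ t) k X) +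
        ∫ X, f' (X 0) * ‖ψ t X‖ ^ 2) (Icc 0 T) t := by
  obtain ⟨φ, hφ, he⟩ := h.exists_hasDerivWithinAt hV ht
  have hW : IsInteraction (scaledPotential (n + 2) β V) :=
    isInteraction_scaledPotential hV (Nat.succ_ne_zero (n + 1)) β
  have h1 := hasDerivWithinAt_quadratic hφ (f := fun τ => lift0 (f τ)) (f' := lift0 f') (C := C)
    (L := L) ht (fun τ hτ => ⟨(hf τ hτ).1.comp (measurable_pi_apply 0), fun X => (hf τ hτ).2 _⟩)
    (fun τ hτ X => hlip τ hτ _) (fun X => hder _)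
  rw [(h.isH2 ht).re_inner_observable hW isInteraction_coulomb hħ he hft] at h1
  exact h1

end IsNBodySolution

/-! ### Evolution of the terms that couple particles and fluid. -/

section Coupled

variable {n m : ℕ} {ħ κ b₀ β T : ℝ} {V : E3 → ℝ} {ψ : ℝ → WaveFn (n + 2)} {ρ : ℝ → E3 → ℝ}
  {u : ℝ → E3 → E3}

lemma IsEulerPoissonSolution.isBddMeas_force (h : IsEulerPoissonSolution κ b₀ (m + 5) T ρ u)
    {t : ℝ} (ht : t ∈ Icc 0 T) (k : Fin 3) : IsBddMeas (kernelConv (pderiv k coulomb) (ρ t)) := by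
  obtain ⟨M, hM⟩ := h.tame_density.bounded
  exact (isKernel_pderiv_coulomb k).isBddMeas_kernelConv (h.continuous_density t ht).measurable
    (h.integrable_density ht) (hM t ht)

/-- The evolution of the momentum along the velocity field. -/
lemma hasDerivWithinAt_current (h : IsNBodySolution ħ κ β V T ψ) (hV : IsProfile V)
    (hE : IsEulerPoissonSolution κ b₀ (m + 5) T ρ u) {t : ℝ} (ht : t ∈ Icc 0 T) :
    HasDerivWithinAt (fun τ => 2 * ħ * ∑ k, ∫ X, u τ (X 0) k * current (ψ τ) k X)
      (2 * ħ ^ 2 * (∑ j, ∑ k, ∫ X, pderiv j (components (u t) k) (X 0) * stress (ψ t) j k X) -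
        ħ ^ 2 / 2 * (∫ x, laplace (divergence (u t)) x * density1 (ψ t) x) -
        2 * pairFactor n * (∑ k, ∫ X, u t (X 0) k *
          pderiv k (scaledPotential (n + 2) β V) (X 0 - X 1) * ‖ψ t X‖ ^ 2) -
        2 * κ * pairFactor n * (∑ k, ∫ X, u t (X 0) k * pderiv k coulomb (X 0 - X 1) *
          ‖ψ t X‖ ^ 2) -
        2 * ħ * ((∑ j, ∑ k, ∫ X, pderiv j (components (u t) k) (X 0) * u t (X 0) j *
          current (ψ t) k X) + b₀ * (∑ k, ∫ X, pderiv k (ρ t) (X 0) * current (ψ t) k X) +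
          κ * ∑ k, ∫ X, kernelConv (pderiv k coulomb) (ρ t) (X 0) * current (ψ t) k X))
      (Icc 0 T) t := by
  obtain ⟨φ, hφ, he⟩ := h.exists_hasDerivWithinAt hV ht
  have hW : IsInteraction (scaledPotential (n + 2) β V) :=
    isInteraction_scaledPotential hV (Nat.succ_ne_zero (n + 1)) β
  obtain ⟨C₁, hC₁⟩ := hE.exists_bound_velocity
  obtain ⟨C₂, hC₂⟩ := hE.tame_divergence.bounded
  obtain ⟨L, hL⟩ := hE.exists_lipschitz_velocity
  -- Two effects are separated: the motion of the state, given by the commutator of `A` with `H`,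
  -- and the motion of the field, given by the velocity equation tested on the current.
  have h1 := hasDerivWithinAt_momentum ht hφ (d := fun τ => gradient (ψ τ) 0)
    (fun τ hτ => (h.isH2 hτ).first 0) (h.continuousWithinAt_gradient ht 0)
    (w := fun τ => components (u τ)) (w' := velocityRate κ b₀ (ρ t) (u t))
    (fun τ hτ => hE.isGoodField hτ) (C := max C₁ C₂) (L := L)
    (fun τ hτ k x => (hC₁ τ hτ k x).trans (le_max_left _ _))
    (fun τ hτ x => (hC₂ τ hτ x).trans (le_max_right _ _))
    (fun τ hτ k x => hL t ht τ hτ k x)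
    (fun x => (hE.tame_divergence.uniform t ht).tendsto_at x)
    (fun k x => hE.hasDerivWithinAt_velocity ht k x)
  have h2 := (h.isH2 ht).im_inner_antiOp_evolution hW isInteraction_coulomb (h.symmetric t ht) he
    (hE.isGoodField ht)
  rw [pairFactor_eq, coulombFactor_eq] at h2
  simp only [re_inner_mulL_gradient (hE.isC1b_gradVelocity ht _ _).isBddMeas] at h2
  rw [← (integral_laplace_divergence (hE.isGoodField ht) (ψ t)).2] at h2
  have h3 : ∑ k, ∫ X, velocityRate κ b₀ (ρ t) (u t) k (X 0) * current (ψ t) k X =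
      -((∑ j, ∑ k, ∫ X, pderiv j (components (u t) k) (X 0) * u t (X 0) j * current (ψ t) k X) +
        b₀ * (∑ k, ∫ X, pderiv k (ρ t) (X 0) * current (ψ t) k X) +
        κ * ∑ k, ∫ X, kernelConv (pderiv k coulomb) (ρ t) (X 0) * current (ψ t) k X) := by
    have e := fun k => (integral_velocityRate_mul (κ := κ) (b₀ := b₀) (hE.isC1b_density ht)
      (hE.isC1b_velocity ht) (hE.isBddMeas_force ht) (integrable_current (ψ := ψ t) k) k).2
    rw [Finset.sum_comm (f := fun j k => ∫ X, pderiv j (components (u t) k) (X 0) * u t (X 0) j *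
      current (ψ t) k X)]
    simp only [e, Finset.sum_neg_distrib, Finset.sum_add_distrib, ← Finset.mul_sum]
  refine (h1.const_mul (2 * ħ)).congr_deriv ?_
  have h4 : ∑ k, ∫ X, velocityRate κ b₀ (ρ t) (u t) k (X 0) *
      ((starRingEnd ℂ) (ψ t X) * gradient (ψ t) 0 k X).im = _ := h3
  rw [h4, mul_add]
  have h5 : ∀ a : ℝ, 2 * ħ * (-2 * a) = 2 * (-2 * ħ * a) := fun a => by ring
  rw [h5, h2]
  simp only [components]
  ring

/-- The evolution of the expectation of `|u|²`. -/
lemma hasDerivWithinAt_speed (h : IsNBodySolution ħ κ β V T ψ) (hħ : 0 < ħ) (hV : IsProfile V)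
    (hE : IsEulerPoissonSolution κ b₀ (m + 5) T ρ u) {t : ℝ} (ht : t ∈ Icc 0 T) :
    HasDerivWithinAt (fun τ => ∫ X, (∑ k, u τ (X 0) k * u τ (X 0) k) * ‖ψ τ X‖ ^ 2)
      (2 * ħ * (∑ j, ∑ k, ∫ X, pderiv j (components (u t) k) (X 0) * u t (X 0) k *
          current (ψ t) j X) -
        2 * ((∑ j, ∑ k, ∫ X, pderiv j (components (u t) k) (X 0) * (u t (X 0) j * u t (X 0) k) *
          ‖ψ t X‖ ^ 2) + b₀ * (∑ k, ∫ X, pderiv k (ρ t) (X 0) * u t (X 0) k * ‖ψ t X‖ ^ 2) +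
          κ * ∑ k, ∫ X, u t (X 0) k * kernelConv (pderiv k coulomb) (ρ t) (X 0) * ‖ψ t X‖ ^ 2))
      (Icc 0 T) t := by
  obtain ⟨C, hC⟩ := hE.exists_bound_velocity
  obtain ⟨L, hL⟩ := hE.exists_lipschitz_velocity
  have hC0 : 0 ≤ C := (abs_nonneg _).trans (hC t ht 0 0)
  have hc := hE.isC1b_velocity ht
  have h1 := h.hasDerivWithinAt_observable hħ hV ht
    (f := fun τ x => ∑ k, u τ x k * u τ x k)
    (f' := fun x => ∑ k, (velocityRate κ b₀ (ρ t) (u t) k x * u t x k +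
      u t x k * velocityRate κ b₀ (ρ t) (u t) k x)) (C := ∑ _k : Fin 3, C * C)
    (L := ∑ _k : Fin 3, (L * C + C * L))
    (fun τ hτ => ⟨Finset.measurable_fun_sum _ fun k _ =>
      (hE.isC1b_velocity hτ k).isBddMeas.meas.mul (hE.isC1b_velocity hτ k).isBddMeas.meas,
      fun x => (Finset.abs_sum_le_sum_abs _ _).trans (Finset.sum_le_sum fun k _ => by
        rw [abs_mul]
        exact mul_le_mul (hC τ hτ k x) (hC τ hτ k x) (abs_nonneg _) hC0)⟩)
    (fun τ hτ x => by
      rw [← Finset.sum_sub_distrib, Finset.sum_mul]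
      refine (Finset.abs_sum_le_sum_abs _ _).trans (Finset.sum_le_sum fun k _ => ?_)
      have e : u τ x k * u τ x k - u t x k * u t x k =
        (u τ x k - u t x k) * u τ x k + u t x k * (u τ x k - u t x k) := by ring
      have a1 := hL t ht τ hτ k x
      have hLt : 0 ≤ L * |τ - t| := (abs_nonneg _).trans a1
      rw [e]
      refine (abs_add_le _ _).trans ?_
      rw [abs_mul, abs_mul]
      have b1 := mul_le_mul a1 (hC τ hτ k x) (abs_nonneg _) hLt
      have b2 := mul_le_mul (hC t ht k x) a1 (abs_nonneg _) hC0
      linarith)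
    (fun x => HasDerivWithinAt.fun_sum fun k _ =>
      (hE.hasDerivWithinAt_velocity ht k x).fun_mul (hE.hasDerivWithinAt_velocity ht k x))
    (IsC1b.sum _ fun k => (hc k).mul (hc k))
  refine h1.congr_deriv ?_
  have hp : ∀ j x, pderiv j (fun x => ∑ k, u t x k * u t x k) x =
      ∑ k, 2 * (pderiv j (components (u t) k) x * u t x k) := fun j x => by
    have e := pderiv_sum Finset.univ (f := fun k x => u t x k * u t x k)
      (fun k => ((hc k).mul (hc k)).diff) j
    rw [e]
    refine Finset.sum_congr rfl fun k _ => ?_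
    have e' := pderiv_mul (hc k).diff (hc k).diff j x
    simp only [components] at e' ⊢
    rw [e']
    ring
  have i1 : ∀ j k, Integrable (fun X => 2 * (pderiv j (components (u t) k) (X 0) * u t (X 0) k *
      current (ψ t) j X)) := fun j k =>
    ((((hc k).isBddMeas_pderiv j).mul (hc k).isBddMeas).integrable_lift
      (integrable_current j)).const_mul 2
  have e1 : ∀ j, ∫ X, pderiv j (fun x => ∑ k, u t x k * u t x k) (X 0) * current (ψ t) j X =
      2 * ∑ k, ∫ X, pderiv j (components (u t) k) (X 0) * u t (X 0) k * current (ψ t) j X := by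
    intro j
    simp only [hp, Finset.sum_mul, mul_assoc (2 : ℝ)]
    rw [integral_finsetSum _ fun k _ => i1 j k]
    simp only [integral_const_mul, Finset.mul_sum]
  have i2 : ∀ k, Integrable (fun X => u t (X 0) k * ‖ψ t X‖ ^ 2) := fun k =>
    (hc k).isBddMeas.integrable_lift (integrable_norm_sq (ψ t))
  have h2 := fun k => integral_velocityRate_mul (κ := κ) (b₀ := b₀) (hE.isC1b_density ht) hc
    (hE.isBddMeas_force ht) (i2 k) k
  have e2 : ∫ X, (∑ k, (velocityRate κ b₀ (ρ t) (u t) k (X 0) * u t (X 0) k +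
      u t (X 0) k * velocityRate κ b₀ (ρ t) (u t) k (X 0))) * ‖ψ t X‖ ^ 2 =
      2 * ∑ k, ∫ X, velocityRate κ b₀ (ρ t) (u t) k (X 0) * (u t (X 0) k * ‖ψ t X‖ ^ 2) := by
    rw [← integral_finsetSum _ fun k _ => (h2 k).1, ← integral_const_mul]
    refine integral_congr_ae (Eventually.of_forall fun X => ?_)
    simp only
    rw [Finset.sum_mul, Finset.mul_sum]
    refine Finset.sum_congr rfl fun k _ => ?_
    ring
  have c1 : ∀ j k, ∫ X, pderiv j (components (u t) k) (X 0) * u t (X 0) j *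
      (u t (X 0) k * ‖ψ t X‖ ^ 2) = ∫ X, pderiv j (components (u t) k) (X 0) *
      (u t (X 0) j * u t (X 0) k) * ‖ψ t X‖ ^ 2 := fun j k =>
    integral_congr_ae (Eventually.of_forall fun X => by simp only; ring)
  have c2 : ∀ k, ∫ X, pderiv k (ρ t) (X 0) * (u t (X 0) k * ‖ψ t X‖ ^ 2) =
      ∫ X, pderiv k (ρ t) (X 0) * u t (X 0) k * ‖ψ t X‖ ^ 2 := fun k =>
    integral_congr_ae (Eventually.of_forall fun X => by simp only; ring)
  have c3 : ∀ k, ∫ X, kernelConv (pderiv k coulomb) (ρ t) (X 0) * (u t (X 0) k * ‖ψ t X‖ ^ 2) =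
      ∫ X, u t (X 0) k * kernelConv (pderiv k coulomb) (ρ t) (X 0) * ‖ψ t X‖ ^ 2 := fun k =>
    integral_congr_ae (Eventually.of_forall fun X => by simp only; ring)
  have e3 := fun k => (h2 k).2
  simp only [c1, c2, c3] at e3
  simp only [e1]
  rw [e2]
  simp only [e3]
  rw [Finset.sum_comm (f := fun j k => ∫ X, pderiv j (components (u t) k) (X 0) *
      (u t (X 0) j * u t (X 0) k) * ‖ψ t X‖ ^ 2)]
  simp only [Finset.sum_neg_distrib, Finset.sum_add_distrib, ← Finset.mul_sum]
  ring

/-- The evolution of the expectation of the fluid density. -/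
lemma hasDerivWithinAt_cross (h : IsNBodySolution ħ κ β V T ψ) (hħ : 0 < ħ) (hV : IsProfile V)
    (hE : IsEulerPoissonSolution κ b₀ (m + 5) T ρ u) {t : ℝ} (ht : t ∈ Icc 0 T) :
    HasDerivWithinAt (fun τ => ∫ X, ρ τ (X 0) * ‖ψ τ X‖ ^ 2)
      (ħ * (∑ k, ∫ X, pderiv k (ρ t) (X 0) * current (ψ t) k X) -
        (∑ k, ∫ X, pderiv k (ρ t) (X 0) * u t (X 0) k * ‖ψ t X‖ ^ 2) -
        ∫ X, divergence (u t) (X 0) * ρ t (X 0) * ‖ψ t X‖ ^ 2) (Icc 0 T) t := by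
  obtain ⟨M, hM⟩ := hE.tame_density.bounded
  obtain ⟨L, hL⟩ := hE.isEvolution.exists_lipschitz
  have h1 := h.hasDerivWithinAt_observable hħ hV ht (f := ρ) (C := M) (L := L)
    (fun τ hτ => ⟨(hE.continuous_density τ hτ).measurable, hM τ hτ⟩)
    (fun τ hτ => (hL t ht τ hτ).1) (hE.isEvolution.deriv t ht) (hE.isC1b_density ht)
  refine h1.congr_deriv ?_
  rw [integral_massRate_mul (hE.isC1b_density ht) (hE.isC1b_velocity ht)
    (hE.isGoodField ht).div.isBddMeas (integrable_norm_sq (ψ t))]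
  ring

/-- The evolution of the expectation of the Coulomb potential of the fluid. -/
lemma hasDerivWithinAt_coulombCross (h : IsNBodySolution ħ κ β V T ψ) (hħ : 0 < ħ)
    (hV : IsProfile V) (hE : IsEulerPoissonSolution κ b₀ (m + 5) T ρ u) {t : ℝ}
    (ht : t ∈ Icc 0 T) :
    HasDerivWithinAt (fun τ => ∫ X, kernelConv coulomb (ρ τ) (X 0) * ‖ψ τ X‖ ^ 2)
      (ħ * (∑ k, ∫ X, kernelConv (pderiv k coulomb) (ρ t) (X 0) * current (ψ t) k X) +
        ∫ X, kernelConv coulomb (massRate (ρ t) (u t)) (X 0) * ‖ψ t X‖ ^ 2) (Icc 0 T) t := by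
  obtain ⟨M, hM⟩ := hE.tame_density.bounded
  obtain ⟨L, hL⟩ := hE.isEvolution.exists_lipschitz_kernelConv isKernel_coulomb
  have hmass : ∀ τ ∈ Icc 0 T, ∫ x, |ρ τ x| = 1 := fun τ hτ => by
    simp only [abs_of_nonneg (hE.nonneg τ hτ _), hE.mass τ hτ]
  have h1 := h.hasDerivWithinAt_observable hħ hV ht (f := fun τ => kernelConv coulomb (ρ τ))
    (C := 1 * (kernelConst * M + 2 * 1)) (L := L)
    (fun τ hτ => ⟨measurable_kernelConv isKernel_coulomb.meas (hE.continuous_density τ hτ).measurable,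
      fun x => hmass τ hτ ▸ isKernel_coulomb.abs_kernelConv_le (hE.integrable_density hτ) (hM τ hτ) x⟩)
    (hL t ht) (hE.isEvolution.hasDerivWithinAt_kernelConv isKernel_coulomb ht)
    (isC1b_kernelConv_coulomb (hE.integrable_density ht) (hM t ht))
  simp only [pderiv_kernelConv_coulomb (hE.integrable_density ht) (hM t ht)] at h1
  exact h1

end Coupled

/-! ### The derivative of the modulated energy. -/

section Evolution

variable {n m : ℕ} {ħ κ β T : ℝ} {V : E3 → ℝ} {ψ : ℝ → WaveFn (n + 2)} {ρ : ℝ → E3 → ℝ}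
  {u : ℝ → E3 → E3}

/-- The evolution of the modulated energy, before the reduction to the strain tensor. -/
lemma hasDerivWithinAt_modulatedEnergy (h : IsNBodySolution ħ κ β V T ψ) (hħ : 0 < ħ)
    (hV : IsProfile V) (hE : IsEulerPoissonSolution κ (coupling V) (m + 5) T ρ u) {t : ℝ}
    (ht : t ∈ Icc 0 T) :
    EnergyConverges ħ β V (ρ t) (u t) (ψ t) ∧ RateConverges ħ β V (ρ t) (u t) (ψ t) ∧
    HasDerivWithinAt (fun τ => (modulatedEnergy ħ κ β V (ρ τ) (u τ) (ψ τ) : ℂ))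
      (-(∑ j : Fin 3, ∑ k : Fin 3, ∫ X, strainIntegrand ħ (u t) (ψ t) j k X)
        + ((ħ ^ 2 / 2 * ∫ x, laplace (divergence (u t)) x * density1 (ψ t) x : ℝ) : ℂ)
        + (deltaRate β V (ρ t) (u t) (ψ t) : ℂ)
        + ((κ * coulombRate (ρ t) (u t) (ψ t) : ℝ) : ℂ)) (Icc 0 T) t := by
  obtain ⟨M, hM⟩ := hE.tame_density.bounded
  have hm := fun τ (hτ : τ ∈ Icc 0 T) => (hE.continuous_density τ hτ).measurable
  have hu := fun τ (hτ : τ ∈ Icc 0 T) k => (hE.isC1b_velocity hτ k).isBddMeas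
  have hval := fun τ (hτ : τ ∈ Icc 0 T) => modulatedEnergy_eq (ħ := ħ) (κ := κ) (β := β) hV
    (h.isH2 hτ) (hm τ hτ) (hE.integrable_density hτ) (hM τ hτ) (hu τ hτ)
  obtain ⟨s1, s2⟩ := sum_integral_strain (ħ := ħ) (ψ := ψ t) (hu t ht)
    (fun j k => (hE.isC1b_gradVelocity ht j k).isBddMeas)
  obtain ⟨d1, d2, d3⟩ := deltaRate_eq (β := β) hV (h.symmetric t ht) (h.isH2 ht) (hm t ht)
    (hE.integrable_density ht) (hM t ht) (hu t ht) (hE.isGoodField ht).div.isBddMeas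
  obtain ⟨c1, c2⟩ := coulombRate_eq (h.symmetric t ht) (h.isH2 ht) (hm t ht)
    (hE.integrable_density ht) (hM t ht) (hu t ht) (hE.kernelConv_massRate ht)
  refine ⟨(hval t ht).1,
    ⟨s1, (integral_laplace_divergence (hE.isGoodField ht) (ψ t)).1, d1, d2, c1⟩, ?_⟩
  -- The derivatives are combined with the signs of `modulatedEnergy_eq`, starting from the
  -- conserved energy.
  have h1 := ((((((h.hasDerivWithinAt_energy hV ht).fun_sub
    (hasDerivWithinAt_current h hV hE ht)).fun_add
    (hasDerivWithinAt_speed h hħ hV hE ht)).fun_add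
    ((hE.hasDerivWithinAt_integral_sq ht).const_mul (coupling V))).fun_sub
    ((hasDerivWithinAt_cross h hħ hV hE ht).const_mul (2 * coupling V))).fun_add
    ((hE.hasDerivWithinAt_coulombEnergy ht).const_mul κ)).fun_sub
    ((hasDerivWithinAt_coulombCross h hħ hV hE ht).const_mul (2 * κ))
  have h2 := (h1.congr (fun τ hτ => (hval τ hτ).2) (hval t ht).2).ofReal_comp
  refine h2.congr_deriv ?_
  rw [s2]
  simp only [← Complex.ofReal_neg, ← Complex.ofReal_add]
  rw [Complex.ofReal_inj, d3, c2]
  -- The terms `b₀∇ρ·J` and `κ(∇V_c*ρ)·J` from the velocity equation cancel against the cross terms,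
  -- as does `b₀ u·∇ρ|ψ|²`. Stress, `∂_j u^k u^k J_j`, `∂_j u^k u^j J_k` and `∂_j u^k u^j u^k|ψ|²`
  -- form the expanded strain; the remaining terms are the quantum term and the two rates.
  simp only [Finset.sum_sub_distrib, Finset.sum_add_distrib, ← Finset.mul_sum]
  ring

end Evolution

end QuantumEuler

theorem proposition2p2 (n : ℕ) (ħ : ℝ) (hħ : 0 < ħ) (β : ℝ) (hβ : β ∈ Icc (0 : ℝ) 1)
    (κ : ℝ) (hκ : 0 ≤ κ) (V : E3 → ℝ) (hV : IsProfile V)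
    (s : ℕ) (hs : (9 / 2 : ℝ) < s) (T : ℝ) (hT : 0 < T)
    (ψ : ℝ → WaveFn (n + 2)) (hψ : IsNBodySolution ħ κ β V T ψ)
    (ρ : ℝ → E3 → ℝ) (u : ℝ → E3 → E3)
    (hρu : IsEulerPoissonSolution κ (coupling V) s T ρ u) :
    ∀ t ∈ Icc 0 T,
      EnergyConverges ħ β V (ρ t) (u t) (ψ t) ∧
      RateConverges ħ β V (ρ t) (u t) (ψ t) ∧
      HasDerivWithinAt
        (fun τ => (modulatedEnergy ħ κ β V (ρ τ) (u τ) (ψ τ) : ℂ))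
        (-(∑ j : Fin 3, ∑ k : Fin 3, ∫ X, strainIntegrand ħ (u t) (ψ t) j k X)
          + ((ħ ^ 2 / 2 * ∫ x, laplace (divergence (u t)) x * density1 (ψ t) x : ℝ) : ℂ)
          + (deltaRate β V (ρ t) (u t) (ψ t) : ℂ)
          + ((κ * coulombRate (ρ t) (u t) (ψ t) : ℝ) : ℂ))
        (Icc 0 T) t := by
  intro t ht
  -- For an integer, `s > 9/2` means `s ≥ 5`. This is the order at which three derivatives of `u`
  -- lie in `H² ⊂ C_b`, so that `Δ div u` is bounded.
  have h5 : 5 ≤ s := by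
    by_contra hlt
    have : (s : ℝ) ≤ 4 := by exact_mod_cast Nat.le_of_lt_succ (not_le.1 hlt)
    linarith
  obtain ⟨m, rfl⟩ := Nat.exists_eq_add_of_le' h5
  exact hasDerivWithinAt_modulatedEnergy hψ hħ hV hρu ht
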